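/- **Setting.** Let $M$ be an $n\times p$ real matrix ($n\ge 1$ attributes, $p\ge 2$ observations) given as a turnstile stream: starting from the zero matrix, each update $(\alpha,i,j)$ adds $\alpha\in\mathbb R$ to $M_{i,j}$; the stream has arbitrary finite length and is fixed before the random choices are made. Let $V$ be the sample covariance matrix of the rows of $M$, $\Sigma$ its diagonal part, and $C=\Sigma^{-1/2}V\Sigma^{-1/2}$ the sample correlation matrix. For $0<\varphi\le 1$ let $\mathrm{Large}_\varphi$ be the set of pairs $(i,j)\in[n]^2$ with $i\ne j$ and $|C_{i,j}|\ge\varphi$, and let $C_{-k}$ be $C$ with its diagonal entries and its $k$ off-diagonal entries of largest magnitude replaced by $0$. A *sketching algorithm* consists of three programs for a randomized RAM with unit-cost exact real arithmetic ($+,-,\times,/,\sqrt{\ }$, comparisons, no rounding) on real cells, and unit-cost arithmetic on word cells of $O_{k,R}(\log(n+p+1/\varphi))$ bits: an initialization program, which receives $n,p,k,\varphi,R$ and halts before the stream starts; an update program, run on each update of the stream; and a query program, run on the memory left after the stream, which outputs a list of index pairs. The *sketch* is the content of the memory after the initialization and the updates, and its *size* is the number of cells it occupies. Times count elementary operations and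 are worst case over the random choices. **Statement.** There is a sketching algorithm such that for every integer $k\ge0$ and every real $R\ge 0$ there are constants $K,c$, depending only on $k$ and $R$, such that for all $n\ge1$, $p\ge2$, $0<\varphi\le1$ and every stream: * the sketch has size at most $K(1+\log n)^c\,\varphi^{-2}n^{5/3}$; * every update takes time at most $K(1+\log n)^c$; * the query takes time at most $K(1+\log n)^c\,\varphi^{-2}n^{5/3}$; * if every row of $M$ has positive sample variance, $|\mathrm{Large}_\varphi|\le k$ and $\lVert C_{-k}\rVert_F\le R$, then with probability at least $1-n^{-3}$ the output of the query contains every element of $\mathrm{Large}_\varphi$. That is, for constant $k$ and $R$ one can build a sketch of size $\tilde O(\varphi^{-2}n^{5/3})$ with query time $\tilde O(\varphi^{-2}n^{5/3})$ from which all correlation outliers are recovered with high probability. -/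

import Mathlib

open scoped Matrix

noncomputable section

namespace CorrelationSketch

/-! ### Sample correlation, large entries, residual matrix -/

/-- The sample mean of each row (attribute) of the observation matrix. -/
def sampleMean {n p : ℕ} (M : Matrix (Fin n) (Fin p) ℝ) (i : Fin n) : ℝ :=
  (1 / (p : ℝ)) * ∑ j, M i j

/-- The observation matrix with the mean of each row subtracted. -/
def centered {n p : ℕ} (M : Matrix (Fin n) (Fin p) ℝ) : Matrix (Fin n) (Fin p) ℝ :=
  Matrix.of fun i j => M i j - sampleMean M i

/-- The sample covariance matrix. -/
def sampleCov {n p : ℕ} (M : Matrix (Fin n) (Fin p) ℝ) : Matrix (Fin n) (Fin n) ℝ :=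
  (1 / ((p : ℝ) - 1)) • (centered M * (centered M)ᵀ)

/-- The sample (Pearson) correlation matrix `Σ^(-1/2) V Σ^(-1/2)`, with `V` the sample covariance
and `Σ` its diagonal part. -/
def sampleCorr {n p : ℕ} (M : Matrix (Fin n) (Fin p) ℝ) : Matrix (Fin n) (Fin n) ℝ :=
  Matrix.diagonal (fun i => (sampleCov M i i) ^ (-(1 / 2) : ℝ)) * sampleCov M *
    Matrix.diagonal (fun i => (sampleCov M i i) ^ (-(1 / 2) : ℝ))

/-- The (ordered) index pairs of off-diagonal entries of magnitude at least `φ`. -/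
def largePairs {n : ℕ} (φ : ℝ) (C : Matrix (Fin n) (Fin n) ℝ) : Finset (Fin n × Fin n) :=
  Finset.univ.filter fun e => e.1 ≠ e.2 ∧ φ ≤ |C e.1 e.2|

/-- `S` consists of `k` off-diagonal index pairs of largest magnitude (ties broken in any way; all
off-diagonal pairs if there are fewer than `k` of them). -/
def IsTopPairs {n : ℕ} (C : Matrix (Fin n) (Fin n) ℝ) (k : ℕ) (S : Finset (Fin n × Fin n)) : Prop :=
  S ⊆ (Finset.univ : Finset (Fin n)).offDiag ∧
  S.card = min k (Finset.univ : Finset (Fin n)).offDiag.card ∧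
  ∀ e ∈ S, ∀ f ∈ (Finset.univ : Finset (Fin n)).offDiag \ S, |C f.1 f.2| ≤ |C e.1 e.2|

/-- `B` is obtained from `C` by replacing by `0` all diagonal entries and the `k` off-diagonal
entries of largest magnitude. -/
def IsResidual {n : ℕ} (C : Matrix (Fin n) (Fin n) ℝ) (k : ℕ) (B : Matrix (Fin n) (Fin n) ℝ) :
    Prop :=
  ∃ S : Finset (Fin n × Fin n), IsTopPairs C k S ∧
    B = Matrix.of fun i j => if i = j ∨ (i, j) ∈ S then 0 else C i j

/-- The Frobenius norm. -/
def frobNorm {n : ℕ} (A : Matrix (Fin n) (Fin n) ℝ) : ℝ :=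
  Real.sqrt (∑ i, ∑ j, (A i j) ^ 2)

/-! ### Turnstile streams -/

/-- A turnstile update: increment entry `(row, col)` by `amount`. -/
structure Update (n p : ℕ) where
  row : Fin n
  col : Fin p
  amount : ℝ

/-- The matrix described by a stream of updates, starting from the zero matrix. -/
def streamMatrix {n p : ℕ} (us : List (Update n p)) : Matrix (Fin n) (Fin p) ℝ :=
  (us.map fun u => Matrix.single u.row u.col u.amount).sum

/-! ### A randomized real RAM

The machine has a memory of word cells (natural numbers below a word bound `W`), a memory of real
cells, and a write-only output list of pairs of words. Programs are finite, and are written in a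
structured language. Literals are natural numbers, so no infinite advice can hide in a program;
there is no rounding operation from reals to words. -/

structure State where
  words : ℕ → ℕ
  reals : ℕ → ℝ
  out : List (ℕ × ℕ)

/-- Word expressions. `load e` is the content of the word cell whose address is the value of `e`. -/
inductive WExp where
  | lit (c : ℕ)
  | load (e : WExp)
  | add (e f : WExp)
  | sub (e f : WExp)
  | mul (e f : WExp)
  | div (e f : WExp)
  | mod (e f : WExp)

/-- Real expressions. `load e` is the content of the real cell whose address is the value of `e`. -/
inductive RExp where
  | ofWord (e : WExp)
  | load (e : WExp)
  | add (x y : RExp)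
  | sub (x y : RExp)
  | mul (x y : RExp)
  | div (x y : RExp)
  | sqrt (x : RExp)

/-- Tests: comparisons of two words or of two reals. -/
inductive Test where
  | wordLE (e f : WExp)
  | realLE (x y : RExp)

/-- Programs. -/
inductive Prog where
  | skip
  /-- write the value of `e` into the word cell with address `a` -/
  | setWord (a e : WExp)
  /-- write the value of `x` into the real cell with address `a` -/
  | setReal (a : WExp) (x : RExp)
  /-- write a fresh uniformly random element of `{0, …, m - 1}` into the word cell with address
  `a`, where `m` is the value of `e` -/
  | rand (a e : WExp)
  /-- append the pair of values of `e` and `f` to the output -/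
  | emit (e f : WExp)
  | seq (c d : Prog)
  | cond (t : Test) (c d : Prog)
  | loop (t : Test) (c : Prog)

/-- Values of word expressions: arithmetic modulo the word bound `W`, truncated subtraction,
integer division and remainder. -/
def WExp.val (W : ℕ) (s : State) : WExp → ℕ
  | .lit c => c % W
  | .load e => s.words (e.val W s)
  | .add e f => (e.val W s + f.val W s) % W
  | .sub e f => e.val W s - f.val W s
  | .mul e f => (e.val W s * f.val W s) % W
  | .div e f => e.val W s / f.val W s
  | .mod e f => e.val W s % f.val W s

/-- Values of real expressions: exact real arithmetic (`x / 0` and the square root of a negative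
number evaluate to `0`). -/
def RExp.val (W : ℕ) (s : State) : RExp → ℝ
  | .ofWord e => (e.val W s : ℝ)
  | .load e => s.reals (e.val W s)
  | .add x y => x.val W s + y.val W s
  | .sub x y => x.val W s - y.val W s
  | .mul x y => x.val W s * y.val W s
  | .div x y => x.val W s / y.val W s
  | .sqrt x => Real.sqrt (x.val W s)

def Test.holds (W : ℕ) (s : State) : Test → Prop
  | .wordLE e f => e.val W s ≤ f.val W s
  | .realLE x y => x.val W s ≤ y.val W s

/-- The number of elementary operations in the evaluation of a word expression. -/
def WExp.cost : WExp → ℕ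
  | .lit _ => 1
  | .load e => e.cost + 1
  | .add e f => e.cost + f.cost + 1
  | .sub e f => e.cost + f.cost + 1
  | .mul e f => e.cost + f.cost + 1
  | .div e f => e.cost + f.cost + 1
  | .mod e f => e.cost + f.cost + 1

/-- The number of elementary operations in the evaluation of a real expression. -/
def RExp.cost : RExp → ℕ
  | .ofWord e => e.cost + 1
  | .load e => e.cost + 1
  | .add x y => x.cost + y.cost + 1
  | .sub x y => x.cost + y.cost + 1
  | .mul x y => x.cost + y.cost + 1
  | .div x y => x.cost + y.cost + 1
  | .sqrt x => x.cost + 1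

/-- The number of elementary operations in the evaluation of a test. -/
def Test.cost : Test → ℕ
  | .wordLE e f => e.cost + f.cost + 1
  | .realLE x y => x.cost + y.cost + 1

/-- Write the value `v` into word cell `a`. -/
def State.putWord (s : State) (a v : ℕ) : State :=
  { s with words := Function.update s.words a v }

/-- Write the value `x` into real cell `a`. -/
def State.putReal (s : State) (a : ℕ) (x : ℝ) : State :=
  { s with reals := Function.update s.reals a x }

/-- `Exec W c s t μ`: on a machine with word bound `W`, started in state `s`, the program `c` halts
after at most `t` elementary operations whatever the outcomes of the random choices are, and `μ` is
the distribution of the final state. -/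
inductive Exec (W : ℕ) : Prog → State → ℕ → PMF State → Prop
  | skip (s : State) : Exec W .skip s 1 (PMF.pure s)
  | setWord (s : State) (a e : WExp) :
      Exec W (.setWord a e) s (a.cost + e.cost + 1)
        (PMF.pure (s.putWord (a.val W s) (e.val W s)))
  | setReal (s : State) (a : WExp) (x : RExp) :
      Exec W (.setReal a x) s (a.cost + x.cost + 1)
        (PMF.pure (s.putReal (a.val W s) (x.val W s)))
  | rand (s : State) (a e : WExp) (h : (Finset.range (e.val W s)).Nonempty) :
      Exec W (.rand a e) s (a.cost + e.cost + 1)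
        ((PMF.uniformOfFinset (Finset.range (e.val W s)) h).map
          fun v => s.putWord (a.val W s) v)
  | emit (s : State) (e f : WExp) :
      Exec W (.emit e f) s (e.cost + f.cost + 1)
        (PMF.pure { s with out := s.out ++ [(e.val W s, f.val W s)] })
  | seq (s : State) (c d : Prog) (t₁ t₂ : ℕ) (μ : PMF State) (ν : State → PMF State)
      (hc : Exec W c s t₁ μ) (hd : ∀ s' ∈ μ.support, Exec W d s' t₂ (ν s')) :
      Exec W (.seq c d) s (t₁ + t₂) (μ.bind ν)
  | condTrue (s : State) (b : Test) (c d : Prog) (t : ℕ) (μ : PMF State)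
      (hb : b.holds W s) (hc : Exec W c s t μ) :
      Exec W (.cond b c d) s (b.cost + t) μ
  | condFalse (s : State) (b : Test) (c d : Prog) (t : ℕ) (μ : PMF State)
      (hb : ¬ b.holds W s) (hd : Exec W d s t μ) :
      Exec W (.cond b c d) s (b.cost + t) μ
  | loopStop (s : State) (b : Test) (c : Prog) (hb : ¬ b.holds W s) :
      Exec W (.loop b c) s b.cost (PMF.pure s)
  | loopStep (s : State) (b : Test) (c : Prog) (t : ℕ) (μ : PMF State)
      (hb : b.holds W s) (h : Exec W (.seq c (.loop b c)) s t μ) :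
      Exec W (.loop b c) s (b.cost + t) μ
  | weaken (s : State) (c : Prog) (t t' : ℕ) (μ : PMF State)
      (h : Exec W c s t μ) (ht : t ≤ t') : Exec W c s t' μ

/-! ### Streaming sketches -/

/-- A sketching algorithm: an initialization, an update, and a query program. -/
structure SketchAlgorithm where
  init : Prog
  update : Prog
  query : Prog

/-- Start of the initialization: `n`, `p`, `k` are in word cells 0, 1, 2 and `φ`, `R` in real cells
0, 1; every other cell is `0`. -/
def startState (n p k : ℕ) (φ R : ℝ) : State where
  words := Function.update (Function.update (Function.update (fun _ => 0) 0 n) 1 p) 2 k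
  reals := Function.update (Function.update (fun _ => 0) 0 φ) 1 R
  out := []

/-- Start of the update program: the row and column index are written into word cells 0 and 1, the
increment into real cell 0. -/
def State.feed {n p : ℕ} (s : State) (u : Update n p) : State :=
  ((s.putWord 0 u.row).putWord 1 u.col).putReal 0 u.amount

/-- Start of the query program: the output list is empty. -/
def State.clearOut (s : State) : State := { s with out := [] }

/-- The contents of the memory fit into `size` word cells and `size` real cells. -/
def State.FitsIn (s : State) (size : ℕ) : Prop :=
  ∀ a, size ≤ a → s.words a = 0 ∧ s.reals a = 0

/-- `Digests W c τ us s μ`: starting with memory `s`, the program `c` is run once on each update of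
the stream `us`, always within `τ` operations, and `μ` is the resulting distribution. -/
inductive Digests (W : ℕ) (c : Prog) (τ : ℕ) {n p : ℕ} :
    List (Update n p) → State → PMF State → Prop
  | nil (s : State) : Digests W c τ [] s (PMF.pure s)
  | cons (u : Update n p) (us : List (Update n p)) (s : State) (μ : PMF State)
      (ν : State → PMF State) (hu : Exec W c (s.feed u) τ μ)
      (h : ∀ s' ∈ μ.support, Digests W c τ us s' (ν s')) :
      Digests W c τ (u :: us) s (μ.bind ν)

/-- `A.Sketches W k φ R τ us μ`: `μ` is the distribution of the memory (that is, of the sketch) of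
`A` after the initialization and the stream `us`, each update taking at most `τ` operations. -/
def SketchAlgorithm.Sketches (A : SketchAlgorithm) (W k : ℕ) (φ R : ℝ) (τ : ℕ) {n p : ℕ}
    (us : List (Update n p)) (μ : PMF State) : Prop :=
  ∃ (t : ℕ) (μ₀ : PMF State) (ν : State → PMF State),
    Exec W A.init (startState n p k φ R) t μ₀ ∧
    (∀ s ∈ μ₀.support, Digests W A.update τ us s (ν s)) ∧
    μ = μ₀.bind ν

/-- Words have `O(log (n + p + 1/φ))` bits: they are the natural numbers below this bound. -/
def wordBound (κ n p : ℕ) (φ : ℝ) : ℕ := (n + p + ⌈1 / φ⌉₊ + 2) ^ κ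

end CorrelationSketch

end

/-!
The rows are padded with zero rows to `N = c ^ 6` rows, where `c = ⌈n ^ (1 / 6)⌉` (`cPar`), and
split into `g = c ^ 5` groups of `c` rows. A random trial hashes the `p` columns by two polynomials
of degree at most 3 over `ZMod q`, for a prime `q` above `p`: one gives a sign, the other one of
`m = 131072 c ^ 4` buckets (`mPar`). The sketch of a row is the vector of its signed bucket sums. It
is linear in the row, so that an update changes one number per trial (`wp_updProg`). Keeping also
the row sums and the sketch of the all-ones vector makes it possible to center the rows at query
time (`csA_eq`) and to normalize their sketches. The hash values at four distinct columns are
independent and uniform, so that inner products of sketches estimate inner products of vectors with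
mean squared error `O(1 / m)` (`expect_skD_sub_sq_le`), and correlations are estimated equally well
after normalization (`expect_cosD_sq_le`, `expect_cosD_small_le`).

In each trial the normalized sketches of a group are added with random row signs. The mean square of
the inner product of two group sums is then at most the sum of the mean squares of the inner
products of the rows (`expect_grpD_sq_le`). The hypotheses on the correlation matrix bound the sum
of the squares of its off-diagonal entries by `k + R ^ 2` (`sum_corr_sq_le`), so on average only
`O(φ⁻² (k + R ^ 2 + N ^ 2 / m))` pairs of groups have a large inner product. For a fixed highly
correlated pair of rows in different groups, at least one of the four choices of the signs of the
two rows makes the inner product of the group sums at least as large as that of the two rows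
(`four_mul_cosD_le`, `expect_grpD_lt_le`). Hence a trial fails to find the two groups, or to list
all the pairs of groups with large inner product within the bound `capR`, with probability at most
`7 / 8` (`expect_fail_le`). With `30 ⌈log₂ n⌉` independent trials (`expect_prod_blk`) and a union
bound over at most `n ^ 2` pairs, the probability of failure is at most `n⁻³` (`success_prob`).
Pairs of rows in the same group are always emitted.

All `g ^ 2 = c ^ 10` inner products of group sums are found in time `Õ(n ^ (5 / 3))` by packing
instead of fast matrix multiplication. The group sums are scaled and rounded to integer vectors
`w a`. With a large power `X` of two, every coordinate `b` yields the two real numbers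
`∑ a, w a b * X ^ a` and `∑ a, w a b * X ^ (g * a)`; the sum over `b` of their products is a single
real number, whose base-`X` digits are all the inner products (`packed_product`). The digits are
read from the top by rounding (`floor_top_digit`, `wp_digitsProg`). Packing takes
`Õ(c ^ 6 m) = Õ(c ^ 10)` steps, the number of digits is `c ^ 10`, and each of the `O(φ⁻² c ^ 8)`
listed pairs of groups gives `c ^ 2` pairs of rows (`queryTimeT_le`). For `n φ ^ 6 ≤ 1` the target
`φ⁻² n ^ (5 / 3)` is at least `n ^ 2`, and simply all pairs of rows are emitted.

The programs are verified in a logic `Wp` of deterministic runs with a time bound. All stored words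
are at most `V`, and the machine computes modulo `V ^ 31`, so that expressions of degree at most 30
never wrap around (`WExp.val_eq_ev`). The random choices form a table of independent uniform
residues, and the outcome of a complete run is a function of this table (`run_spec`).
-/

namespace CorrelationSketch

noncomputable section

set_option linter.unusedSectionVars false

section

/-! ### Exact evaluation of expressions -/

/-- The value of a word expression in exact natural number arithmetic, without wrap-around. -/
def WExp.ev (s : State) : WExp → ℕ
  | .lit c => c
  | .load e => s.words (e.ev s)
  | .add e f => e.ev s + f.ev s
  | .sub e f => e.ev s - f.ev s
  | .mul e f => e.ev s * f.ev s
  | .div e f => e.ev s / f.ev s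
  | .mod e f => e.ev s % f.ev s

/-- If all literals and all memory words are at most `V ≥ 2`, the exact value of an expression is
at most `V ^ deg`. -/
def WExp.deg : WExp → ℕ
  | .lit _ => 1
  | .load _ => 1
  | .add e f => max e.deg f.deg + 1
  | .sub e _ => e.deg
  | .mul e f => e.deg + f.deg
  | .div e _ => e.deg
  | .mod e _ => e.deg

/-- All literals are at most `2 ^ 20` and all subexpressions have degree at most `30`; such an
expression never wraps around on a machine with word bound `V ^ 31` and memory words `≤ V`. -/
def WExp.fine : WExp → Bool
  | .lit c => decide (c ≤ 1048576)
  | .load e => e.fine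
  | .add e f => e.fine && f.fine && decide (max e.deg f.deg + 1 ≤ 30)
  | .sub e f => e.fine && f.fine
  | .mul e f => e.fine && f.fine && decide (e.deg + f.deg ≤ 30)
  | .div e f => e.fine && f.fine
  | .mod e f => e.fine && f.fine

/-- The value of a real expression, with exact arithmetic on words. -/
def RExp.ev (s : State) : RExp → ℝ
  | .ofWord e => (e.ev s : ℝ)
  | .load e => s.reals (e.ev s)
  | .add x y => x.ev s + y.ev s
  | .sub x y => x.ev s - y.ev s
  | .mul x y => x.ev s * y.ev s
  | .div x y => x.ev s / y.ev s
  | .sqrt x => Real.sqrt (x.ev s)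

/-- All word subexpressions are fine. -/
def RExp.fine : RExp → Bool
  | .ofWord e => e.fine
  | .load e => e.fine
  | .add x y => x.fine && y.fine
  | .sub x y => x.fine && y.fine
  | .mul x y => x.fine && y.fine
  | .div x y => x.fine && y.fine
  | .sqrt x => x.fine

/-- The truth of a test, with exact arithmetic on words. -/
def Test.ev (s : State) : Test → Prop
  | .wordLE e f => e.ev s ≤ f.ev s
  | .realLE x y => x.ev s ≤ y.ev s

/-- All word subexpressions are fine. -/
def Test.fine : Test → Bool
  | .wordLE e f => e.fine && f.fine
  | .realLE x y => x.fine && y.fine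

/-- Every memory word is at most `V`. -/
def Bd (V : ℕ) (s : State) : Prop := ∀ a, s.words a ≤ V

variable {V : ℕ} [hV : Fact (1048576 ≤ V)]

theorem WExp.ev_le (s : State) (hs : Bd V s) :
    ∀ e : WExp, e.fine = true → e.ev s ≤ V ^ e.deg := by
  have h1 : 1048576 ≤ V := hV.out
  intro e
  induction e with
  | lit c => intro h; simp [WExp.fine, WExp.ev, WExp.deg] at *; omega
  | load e ih => intro h; simpa [WExp.ev, WExp.deg] using hs _
  | add e f ihe ihf =>
    intro h
    simp only [WExp.fine, Bool.and_eq_true, decide_eq_true_eq] at h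
    have a := (ihe h.1.1).trans (Nat.pow_le_pow_right (by omega) (le_max_left e.deg f.deg))
    have b := (ihf h.1.2).trans (Nat.pow_le_pow_right (by omega) (le_max_right e.deg f.deg))
    have : V ^ max e.deg f.deg * 2 ≤ V ^ (max e.deg f.deg + 1) := by
      rw [pow_succ]; exact Nat.mul_le_mul_left _ (by omega)
    simp only [WExp.ev, WExp.deg]; omega
  | sub e f ihe ihf =>
    intro h
    simp only [WExp.fine, Bool.and_eq_true] at h
    exact (Nat.sub_le _ _).trans (ihe h.1)
  | mul e f ihe ihf =>
    intro h
    simp only [WExp.fine, Bool.and_eq_true, decide_eq_true_eq] at h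
    simp only [WExp.ev, WExp.deg, pow_add]
    exact Nat.mul_le_mul (ihe h.1.1) (ihf h.1.2)
  | div e f ihe ihf =>
    intro h
    simp only [WExp.fine, Bool.and_eq_true] at h
    exact (Nat.div_le_self _ _).trans (ihe h.1)
  | mod e f ihe ihf =>
    intro h
    simp only [WExp.fine, Bool.and_eq_true] at h
    exact (Nat.mod_le _ _).trans (ihe h.1)

/-- No wrap-around: a fine expression has degree at most 30, so over words at most `V` all
intermediate values stay below `V ^ 31`. -/
theorem WExp.val_eq_ev (s : State) (hs : Bd V s) :
    ∀ e : WExp, e.fine = true → e.val (V ^ 31) s = e.ev s := by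
  have h1 : 1048576 ≤ V := hV.out
  have hlt : ∀ d, d ≤ 30 → V ^ d < V ^ 31 := fun d hd =>
    Nat.pow_lt_pow_right (by omega) (by omega)
  intro e
  induction e with
  | lit c =>
    intro h
    simp only [WExp.fine, decide_eq_true_eq] at h
    have := hlt 1 (by omega)
    exact Nat.mod_eq_of_lt (by rw [pow_one] at this; omega)
  | load e ih => intro h; simp only [WExp.val, WExp.ev, ih h]
  | add e f ihe ihf =>
    intro h
    have hle := WExp.ev_le s hs _ h
    simp only [WExp.fine, Bool.and_eq_true, decide_eq_true_eq] at h
    simp only [WExp.val, ihe h.1.1, ihf h.1.2]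
    exact Nat.mod_eq_of_lt (hle.trans_lt (hlt _ h.2))
  | sub e f ihe ihf =>
    intro h
    simp only [WExp.fine, Bool.and_eq_true] at h
    simp only [WExp.val, WExp.ev, ihe h.1, ihf h.2]
  | mul e f ihe ihf =>
    intro h
    have hle := WExp.ev_le s hs _ h
    simp only [WExp.fine, Bool.and_eq_true, decide_eq_true_eq] at h
    simp only [WExp.val, ihe h.1.1, ihf h.1.2]
    exact Nat.mod_eq_of_lt (hle.trans_lt (hlt _ h.2))
  | div e f ihe ihf =>
    intro h
    simp only [WExp.fine, Bool.and_eq_true] at h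
    simp only [WExp.val, WExp.ev, ihe h.1, ihf h.2]
  | mod e f ihe ihf =>
    intro h
    simp only [WExp.fine, Bool.and_eq_true] at h
    simp only [WExp.val, WExp.ev, ihe h.1, ihf h.2]

theorem RExp.val_eq_ev (s : State) (hs : Bd V s) :
    ∀ e : RExp, e.fine = true → e.val (V ^ 31) s = e.ev s := by
  intro e
  induction e with
  | ofWord e => intro h; simp only [RExp.val, RExp.ev, WExp.val_eq_ev s hs e h]
  | load e => intro h; simp only [RExp.val, RExp.ev, WExp.val_eq_ev s hs e h]
  | sqrt x ih => intro h; simp only [RExp.val, RExp.ev, ih h]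
  | add x y ihx ihy | sub x y ihx ihy | mul x y ihx ihy | div x y ihx ihy =>
    intro h
    simp only [RExp.fine, Bool.and_eq_true] at h
    simp only [RExp.val, RExp.ev, ihx h.1, ihy h.2]

theorem Test.holds_iff_ev (s : State) (hs : Bd V s) (b : Test) (h : b.fine = true) :
    b.holds (V ^ 31) s ↔ b.ev s := by
  cases b with
  | wordLE e f =>
    simp only [Test.fine, Bool.and_eq_true] at h
    simp only [Test.holds, Test.ev, WExp.val_eq_ev s hs e h.1, WExp.val_eq_ev s hs f h.2]
  | realLE e f =>
    simp only [Test.fine, Bool.and_eq_true] at h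
    simp only [Test.holds, Test.ev, RExp.val_eq_ev s hs e h.1, RExp.val_eq_ev s hs f h.2]

/-! ### A program logic for deterministic runs -/

/-- Total correctness with a time bound: started in a state whose words are at most `V`, the
program `c` makes no random choice that matters, halts within `t` operations on the machine with
word bound `V ^ 31`, keeps all words at most `V`, and ends in a state satisfying `Q`. -/
def Wp (V : ℕ) (c : Prog) (t : ℕ) (s : State) (Q : State → Prop) : Prop :=
  Bd V s → ∃ s', Exec (V ^ 31) c s t (PMF.pure s') ∧ Bd V s' ∧ Q s'

theorem Wp.mono {c : Prog} {t t' : ℕ} {s : State} {Q Q' : State → Prop} (h : Wp V c t s Q)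
    (ht : t ≤ t') (hQ : ∀ s', Q s' → Q' s') : Wp V c t' s Q' := by
  intro hs
  obtain ⟨s', h1, h2, h3⟩ := h hs
  exact ⟨s', Exec.weaken _ _ _ _ _ h1 ht, h2, hQ _ h3⟩

theorem wp_skip {s : State} {Q : State → Prop} (h : Q s) : Wp V .skip 1 s Q :=
  fun hs => ⟨s, Exec.skip s, hs, h⟩

theorem Bd.putWord {s : State} (hs : Bd V s) (a v : ℕ) (hv : v ≤ V) : Bd V (s.putWord a v) := by
  intro b
  by_cases h : b = a
  · subst h; simpa [State.putWord] using hv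
  · simpa [State.putWord, Function.update_of_ne h] using hs b

theorem wp_setWord {s : State} {a e : WExp} {Q : State → Prop} (ha : a.fine = true)
    (he : e.fine = true) (hv : Bd V s → e.ev s ≤ V) (h : Q (s.putWord (a.ev s) (e.ev s))) :
    Wp V (.setWord a e) (a.cost + e.cost + 1) s Q := by
  intro hs
  have := Exec.setWord (W := V ^ 31) s a e
  rw [WExp.val_eq_ev s hs a ha, WExp.val_eq_ev s hs e he] at this
  exact ⟨_, this, hs.putWord _ _ (hv hs), h⟩

theorem wp_setReal {s : State} {a : WExp} {x : RExp} {Q : State → Prop} (ha : a.fine = true)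
    (hx : x.fine = true) (h : Q (s.putReal (a.ev s) (x.ev s))) :
    Wp V (.setReal a x) (a.cost + x.cost + 1) s Q := by
  intro hs
  have := Exec.setReal (W := V ^ 31) s a x
  rw [WExp.val_eq_ev s hs a ha, RExp.val_eq_ev s hs x hx] at this
  exact ⟨_, this, hs, h⟩

/-- Append a pair to the output. -/
def State.putOut (s : State) (e : ℕ × ℕ) : State := { s with out := s.out ++ [e] }

theorem wp_emit {s : State} {e f : WExp} {Q : State → Prop} (he : e.fine = true)
    (hf : f.fine = true) (h : Q (s.putOut (e.ev s, f.ev s))) :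
    Wp V (.emit e f) (e.cost + f.cost + 1) s Q := by
  intro hs
  have := Exec.emit (W := V ^ 31) s e f
  rw [WExp.val_eq_ev s hs e he, WExp.val_eq_ev s hs f hf] at this
  exact ⟨_, this, hs, h⟩

theorem wp_seq {s : State} {c d : Prog} {t₁ t₂ : ℕ} {Q : State → Prop}
    (h : Wp V c t₁ s fun s' => Wp V d t₂ s' Q) : Wp V (.seq c d) (t₁ + t₂) s Q := by
  intro hs
  obtain ⟨s₁, h1, h2, h3⟩ := h hs
  obtain ⟨s₂, h4, h5, h6⟩ := h3 h2
  refine ⟨s₂, ?_, h5, h6⟩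
  have := Exec.seq s c d t₁ t₂ (PMF.pure s₁) (fun _ => PMF.pure s₂) h1 (by
    intro s' hs'
    rw [PMF.support_pure, Set.mem_singleton_iff] at hs'
    subst hs'; exact h4)
  rwa [PMF.pure_bind] at this

theorem wp_cond {s : State} {b : Test} {c d : Prog} {t₁ t₂ : ℕ} {Q : State → Prop}
    (hb : b.fine = true) (hc : b.ev s → Wp V c t₁ s Q) (hd : ¬ b.ev s → Wp V d t₂ s Q) :
    Wp V (.cond b c d) (b.cost + (t₁ + t₂)) s Q := by
  intro hs
  by_cases h : b.ev s
  · obtain ⟨s', h1, h2, h3⟩ := hc h hs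
    refine ⟨s', Exec.weaken _ _ _ _ _ (Exec.condTrue s b c d _ _
      ((Test.holds_iff_ev s hs b hb).2 h) h1) (by omega), h2, h3⟩
  · obtain ⟨s', h1, h2, h3⟩ := hd h hs
    refine ⟨s', Exec.weaken _ _ _ _ _ (Exec.condFalse s b c d _ _
      (fun h' => h ((Test.holds_iff_ev s hs b hb).1 h')) h1) (by omega), h2, h3⟩

theorem wp_ite {s : State} {b : Test} {c d : Prog} {t₁ t₂ : ℕ} {Q : State → Prop} {p : Prop}
    (hb : b.fine = true) (hp : b.ev s ↔ p) (hc : p → Wp V c t₁ s Q) (hd : ¬ p → Wp V d t₂ s Q) :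
    Wp V (.cond b c d) (b.cost + (t₁ + t₂)) s Q :=
  wp_cond hb (fun h => hc (hp.1 h)) (fun h => hd fun h' => h (hp.2 h'))

theorem Wp.setWord {s : State} {a e : WExp} {Q : State → Prop} {t : ℕ} (x v : ℕ)
    (hx : a.ev s = x) (hv : e.ev s = v) (hvV : Bd V s → v ≤ V) (h : Q (s.putWord x v))
    (ha : a.fine = true := by decide) (he : e.fine = true := by decide)
    (ht : a.cost + e.cost + 1 ≤ t := by decide) : Wp V (.setWord a e) t s Q := by
  subst hx hv
  exact (wp_setWord ha he hvV h).mono ht fun _ h => h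

theorem Wp.setWord_seq {s : State} {a e : WExp} {d : Prog} {Q : State → Prop} {t : ℕ} (x v : ℕ)
    (hx : a.ev s = x) (hv : e.ev s = v) (hvV : Bd V s → v ≤ V)
    (h : Wp V d (t - (a.cost + e.cost + 1)) (s.putWord x v) Q)
    (ha : a.fine = true := by decide) (he : e.fine = true := by decide)
    (ht : a.cost + e.cost + 1 ≤ t := by decide) : Wp V (.seq (.setWord a e) d) t s Q := by
  subst hx hv
  exact (wp_seq (wp_setWord ha he hvV h)).mono (by omega) fun _ h => h

theorem Wp.setReal {s : State} {a : WExp} {e : RExp} {Q : State → Prop} {t : ℕ} (x : ℕ) (v : ℝ)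
    (hx : a.ev s = x) (hv : e.ev s = v) (h : Q (s.putReal x v))
    (ha : a.fine = true := by decide) (he : e.fine = true := by decide)
    (ht : a.cost + e.cost + 1 ≤ t := by decide) : Wp V (.setReal a e) t s Q := by
  subst hx hv
  exact (wp_setReal ha he h).mono ht fun _ h => h

theorem Wp.setReal_seq {s : State} {a : WExp} {e : RExp} {d : Prog} {Q : State → Prop} {t : ℕ}
    (x : ℕ) (v : ℝ) (hx : a.ev s = x) (hv : e.ev s = v)
    (h : Wp V d (t - (a.cost + e.cost + 1)) (s.putReal x v) Q)
    (ha : a.fine = true := by decide) (he : e.fine = true := by decide)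
    (ht : a.cost + e.cost + 1 ≤ t := by decide) : Wp V (.seq (.setReal a e) d) t s Q := by
  subst hx hv
  exact (wp_seq (wp_setReal ha he h)).mono (by omega) fun _ h => h

theorem Wp.ite {s : State} {b : Test} {c d : Prog} {t : ℕ} {Q : State → Prop} {p : Prop}
    (t₁ t₂ : ℕ) (hp : b.ev s ↔ p) (hc : p → Wp V c t₁ s Q) (hd : ¬ p → Wp V d t₂ s Q)
    (hb : b.fine = true := by decide) (ht : b.cost + (t₁ + t₂) ≤ t := by decide) :
    Wp V (.cond b c d) t s Q :=
  (wp_ite hb hp hc hd).mono ht fun _ h => h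

theorem Wp.seq {s : State} {c d : Prog} {t : ℕ} {Q : State → Prop} (t₁ t₂ : ℕ)
    (h : Wp V c t₁ s fun s' => Wp V d t₂ s' Q) (ht : t₁ + t₂ ≤ t) : Wp V (.seq c d) t s Q :=
  (wp_seq h).mono ht fun _ h => h

/-- A loop that is known to make exactly `N` iterations. -/
theorem wp_loop {b : Test} {c : Prog} {t : ℕ} {Q : State → Prop} (Inv : ℕ → State → Prop) (N : ℕ)
    (hb : b.fine = true)
    (hstep : ∀ j s, j < N → Inv j s → b.ev s ∧ Wp V c t s (Inv (j + 1)))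
    (hend : ∀ s, Inv N s → ¬ b.ev s ∧ Q s) {s : State} (h0 : Inv 0 s) :
    Wp V (.loop b c) (N * (t + b.cost) + b.cost) s Q := by
  suffices H : ∀ r j s, j + r = N → Inv j s → Wp V (.loop b c) (r * (t + b.cost) + b.cost) s Q from
    H N 0 s (by omega) h0
  intro r
  induction r with
  | zero =>
    intro j s hj hI hs
    obtain rfl : j = N := by omega
    refine ⟨s, ?_, hs, (hend s hI).2⟩
    simpa using Exec.loopStop s b c fun h => (hend s hI).1 ((Test.holds_iff_ev s hs b hb).1 h)
  | succ r ih =>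
    intro j s hj hI hs
    obtain ⟨h1, h2⟩ := hstep j s (by omega) hI
    have h3 : Wp V (.seq c (.loop b c)) (t + (r * (t + b.cost) + b.cost)) s Q :=
      wp_seq (h2.mono le_rfl fun s' hs' => ih (j + 1) s' (by omega) hs')
    obtain ⟨s', h4, h5, h6⟩ := h3 hs
    refine ⟨s', Exec.weaken _ _ _ _ _ (Exec.loopStep s b c _ _
      ((Test.holds_iff_ev s hs b hb).2 h1) h4) (le_of_eq (by ring)), h5, h6⟩

/-! ### Memory layout -/

/-- The content of a scalar word cell. -/
abbrev wc (i : ℕ) : WExp := .load (.lit i)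

/-- The content of a scalar real cell. -/
abbrev rc (i : ℕ) : RExp := .load (.lit i)

/-- The address of entry `x` of array number `r < 32`. Addresses below `32` are scalars, and the
arrays are interleaved above them. -/
def A (r x : ℕ) : ℕ := 32 * (x + 1) + r

/-- The expression for the address of entry `e` of array number `r`. -/
def arr (r : ℕ) (e : WExp) : WExp := .add (.mul (.lit 32) (.add e (.lit 1))) (.lit r)

@[simp] theorem arr_ev (r : ℕ) (e : WExp) (s : State) : (arr r e).ev s = A r (e.ev s) := rfl

@[simp] theorem A_eq_A_self {r x y : ℕ} : A r x = A r y ↔ x = y := by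
  unfold A; omega

theorem le_A (r x : ℕ) : 32 ≤ A r x := by unfold A; omega

@[simp] theorem A_ne_small {r x c : ℕ} (h : c < 32) : A r x ≠ c := by unfold A; omega

@[simp] theorem small_ne_A {r x c : ℕ} (h : c < 32) : c ≠ A r x := by unfold A; omega

@[simp] theorem not_A_lt {r x c : ℕ} (h : c ≤ 32) : ¬ A r x < c := by unfold A; omega

@[simp] theorem le_A' {r x c : ℕ} (h : c ≤ 32) : c ≤ A r x := by unfold A; omega

@[simp] theorem A_ne_A {r r' x y : ℕ} (h : r < 32) (h' : r' < 32) (hne : r ≠ r') :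
    A r x ≠ A r' y := by
  unfold A; omega

@[simp] theorem putWord_words (s : State) (a v b : ℕ) :
    (s.putWord a v).words b = if b = a then v else s.words b := by
  simp [State.putWord, Function.update_apply]
@[simp] theorem putWord_reals (s : State) (a v : ℕ) : (s.putWord a v).reals = s.reals := rfl
@[simp] theorem putWord_out (s : State) (a v : ℕ) : (s.putWord a v).out = s.out := rfl
@[simp] theorem putReal_words (s : State) (a : ℕ) (x : ℝ) : (s.putReal a x).words = s.words := rfl
@[simp] theorem putReal_reals (s : State) (a : ℕ) (x : ℝ) (b : ℕ) :
    (s.putReal a x).reals b = if b = a then x else s.reals b := by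
  simp [State.putReal, Function.update_apply]
@[simp] theorem putReal_out (s : State) (a : ℕ) (x : ℝ) : (s.putReal a x).out = s.out := rfl
@[simp] theorem putOut_words (s : State) (e : ℕ × ℕ) : (s.putOut e).words = s.words := rfl
@[simp] theorem putOut_reals (s : State) (e : ℕ × ℕ) : (s.putOut e).reals = s.reals := rfl
@[simp] theorem putOut_out (s : State) (e : ℕ × ℕ) : (s.putOut e).out = s.out ++ [e] := rfl

@[simp] theorem ev_lit (s : State) (c : ℕ) : (WExp.lit c).ev s = c := rfl
@[simp] theorem ev_load (s : State) (e : WExp) : (WExp.load e).ev s = s.words (e.ev s) := rfl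
@[simp] theorem ev_add (s : State) (e f : WExp) : (WExp.add e f).ev s = e.ev s + f.ev s := rfl
@[simp] theorem ev_sub (s : State) (e f : WExp) : (WExp.sub e f).ev s = e.ev s - f.ev s := rfl
@[simp] theorem ev_mul (s : State) (e f : WExp) : (WExp.mul e f).ev s = e.ev s * f.ev s := rfl
@[simp] theorem ev_div (s : State) (e f : WExp) : (WExp.div e f).ev s = e.ev s / f.ev s := rfl
@[simp] theorem ev_mod (s : State) (e f : WExp) : (WExp.mod e f).ev s = e.ev s % f.ev s := rfl
@[simp] theorem rev_ofWord (s : State) (e : WExp) : (RExp.ofWord e).ev s = (e.ev s : ℝ) := rfl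
@[simp] theorem rev_load (s : State) (e : WExp) : (RExp.load e).ev s = s.reals (e.ev s) := rfl
@[simp] theorem rev_add (s : State) (e f : RExp) : (RExp.add e f).ev s = e.ev s + f.ev s := rfl
@[simp] theorem rev_sub (s : State) (e f : RExp) : (RExp.sub e f).ev s = e.ev s - f.ev s := rfl
@[simp] theorem rev_mul (s : State) (e f : RExp) : (RExp.mul e f).ev s = e.ev s * f.ev s := rfl
@[simp] theorem rev_div (s : State) (e f : RExp) : (RExp.div e f).ev s = e.ev s / f.ev s := rfl
@[simp] theorem rev_sqrt (s : State) (e : RExp) : (RExp.sqrt e).ev s = Real.sqrt (e.ev s) := rfl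
@[simp] theorem tev_wordLE (s : State) (e f : WExp) :
    (Test.wordLE e f).ev s ↔ e.ev s ≤ f.ev s := Iff.rfl
@[simp] theorem tev_realLE (s : State) (e f : RExp) :
    (Test.realLE e f).ev s ↔ e.ev s ≤ f.ev s := Iff.rfl

theorem putReal_eq_self (s : State) {a : ℕ} {v : ℝ} (h : v = s.reals a) : s.putReal a v = s := by
  subst h; simp [State.putReal]

/-! ### Counting loops -/

/-- `for i in 0, …, (bound − 1)`, with counter in word cell `i` and bound in word cell `b`. -/
def forTo (i b : ℕ) (body : Prog) : Prog :=
  .seq (.setWord (.lit i) (.lit 0))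
    (.loop (.wordLE (.add (wc i) (.lit 1)) (wc b))
      (.seq body (.setWord (.lit i) (.add (wc i) (.lit 1)))))

/-- Rule for counting loops: the invariant is about the state at the start of an iteration. -/
theorem wp_forTo {i b : ℕ} {body : Prog} {T : ℕ} {s : State} {Q : State → Prop}
    (Inv : ℕ → State → Prop) (N : ℕ) (hi : i < 32) (hb : b < 32)
    (h0 : Inv 0 (s.putWord i 0))
    (hI : ∀ j s, j ≤ N → Inv j s → s.words i = j ∧ s.words b = N)
    (hstep : ∀ j s, j < N → Inv j s → s.words i = j → s.words b = N →
      Wp V body T s fun s' => s'.words i = j ∧ Inv (j + 1) (s'.putWord i (j + 1)))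
    (hQ : ∀ s, Inv N s → Q s) :
    Wp V (forTo i b body) (N * (T + 13) + 10) s Q := by
  have hi' : (WExp.lit i).fine = true := by simp [WExp.fine]; omega
  have hb' : (WExp.lit b).fine = true := by simp [WExp.fine]; omega
  have hV' := hV.out
  have hN : ∀ s, Inv N s → Bd V s → N ≤ V := fun s hs hB => (hI N s le_rfl hs).2 ▸ hB b
  have hfi : (WExp.add (wc i) (.lit 1)).fine = true := by
    simp [WExp.fine, WExp.deg]; omega
  have hft : (Test.wordLE (.add (wc i) (.lit 1)) (wc b)).fine = true := by
    rw [Test.fine, hfi, Bool.true_and]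
    exact hb'
  refine Wp.mono (t := (1 + 1 + 1) + (N * ((T + 6) + 7) + 7)) ?_ (by ring_nf; omega)
    (fun _ h => h)
  refine wp_seq (wp_setWord hi' rfl (by simp) ?_)
  have key := wp_loop (V := V) (b := .wordLE (.add (wc i) (.lit 1)) (wc b))
    (c := .seq body (.setWord (.lit i) (.add (wc i) (.lit 1)))) (t := T + 6) (Q := Q) Inv N hft
    (by
      intro j s hj hIj
      obtain ⟨h1, h2⟩ := hI j s hj.le hIj
      refine ⟨by simp [h1, h2]; omega, ?_⟩
      intro hBs
      have hNV : N ≤ V := h2 ▸ hBs b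
      refine wp_seq ((hstep j s hj hIj h1 h2).mono le_rfl ?_) hBs
      rintro s' ⟨h3, h4⟩
      refine Wp.mono (wp_setWord hi' hfi (by simp [h3]; omega) ?_) le_rfl (fun _ h => h)
      simpa [h3] using h4)
    (by
      intro s hs
      obtain ⟨h1, h2⟩ := hI N s le_rfl hs
      exact ⟨by simp [h1, h2], hQ s hs⟩)
    (s := s.putWord i 0) h0
  refine key.mono ?_ (fun _ h => h)
  exact le_rfl

/-- `s'` differs from `s` only in word cells satisfying `ws`, real cells satisfying `rs`; the output
is the same. -/
structure Frame (ws rs : ℕ → Prop) (s s' : State) : Prop where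
  words : ∀ a, ¬ ws a → s'.words a = s.words a
  reals : ∀ a, ¬ rs a → s'.reals a = s.reals a
  out : s'.out = s.out

theorem Frame.refl (ws rs : ℕ → Prop) (s : State) : Frame ws rs s s :=
  ⟨fun _ _ => rfl, fun _ _ => rfl, rfl⟩

theorem Frame.trans {ws rs ws' rs' : ℕ → Prop} {s s' s'' : State} (h : Frame ws rs s s')
    (h' : Frame ws' rs' s' s'') (hw : ∀ a, ws' a → ws a) (hr : ∀ a, rs' a → rs a) :
    Frame ws rs s s'' :=
  ⟨fun a ha => (h'.words a fun h => ha (hw a h)).trans (h.words a ha),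
   fun a ha => (h'.reals a fun h => ha (hr a h)).trans (h.reals a ha), h'.out.trans h.out⟩

theorem Frame.putWord {ws rs : ℕ → Prop} {s s' : State} (h : Frame ws rs s s') {a v : ℕ}
    (ha : ws a) : Frame ws rs s (s'.putWord a v) :=
  ⟨fun b hb => by
    rw [putWord_words, if_neg (fun (e : b = a) => hb (e ▸ ha)), h.words b hb], h.reals, h.out⟩

theorem Frame.putReal {ws rs : ℕ → Prop} {s s' : State} (h : Frame ws rs s s') {a : ℕ} {v : ℝ}
    (ha : rs a) : Frame ws rs s (s'.putReal a v) :=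
  ⟨h.words, fun b hb => by
    rw [putReal_reals, if_neg (fun (e : b = a) => hb (e ▸ ha)), h.reals b hb], h.out⟩

/-- `s'` differs from `s` only in word cells satisfying `ws`, real cells satisfying `rs`, and the
output, which has not lost any entry. -/
structure FrameO (ws rs : ℕ → Prop) (s s' : State) : Prop where
  words : ∀ a, ¬ ws a → s'.words a = s.words a
  reals : ∀ a, ¬ rs a → s'.reals a = s.reals a
  out : ∀ e ∈ s.out, e ∈ s'.out

theorem Frame.toO {ws rs : ℕ → Prop} {s s' : State} (h : Frame ws rs s s') : FrameO ws rs s s' :=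
  ⟨h.words, h.reals, fun _ he => h.out ▸ he⟩

theorem FrameO.refl (ws rs : ℕ → Prop) (s : State) : FrameO ws rs s s := (Frame.refl ws rs s).toO

theorem FrameO.trans {ws rs ws' rs' : ℕ → Prop} {s s' s'' : State} (h : FrameO ws rs s s')
    (h' : FrameO ws' rs' s' s'') (hw : ∀ a, ws' a → ws a) (hr : ∀ a, rs' a → rs a) :
    FrameO ws rs s s'' :=
  ⟨fun a ha => (h'.words a fun h => ha (hw a h)).trans (h.words a ha),
   fun a ha => (h'.reals a fun h => ha (hr a h)).trans (h.reals a ha),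
   fun e he => h'.out e (h.out e he)⟩

theorem FrameO.putWord {ws rs : ℕ → Prop} {s s' : State} (h : FrameO ws rs s s') {a v : ℕ}
    (ha : ws a) : FrameO ws rs s (s'.putWord a v) :=
  ⟨fun b hb => by
    rw [putWord_words, if_neg (fun (e : b = a) => hb (e ▸ ha)), h.words b hb], h.reals, h.out⟩

theorem FrameO.putOut {ws rs : ℕ → Prop} {s s' : State} (h : FrameO ws rs s s') (e : ℕ × ℕ) :
    FrameO ws rs s (s'.putOut e) :=
  ⟨h.words, h.reals, fun f hf => by simp [h.out f hf]⟩

theorem Wp.emit {s : State} {e f : WExp} {Q : State → Prop} {t : ℕ} (x v : ℕ) (hx : e.ev s = x)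
    (hv : f.ev s = v) (h : Q (s.putOut (x, v))) (he : e.fine = true := by decide)
    (hf : f.fine = true := by decide) (ht : e.cost + f.cost + 1 ≤ t := by decide) :
    Wp V (.emit e f) t s Q := by
  subst hx hv
  exact (wp_emit he hf h).mono ht fun _ h => h

end

section

variable {V : ℕ} [hV : Fact (1048576 ≤ V)]

/-! ### The update program -/

/-- The polynomial `a₃ j³ + a₂ j² + a₁ j + a₀` modulo `q`. -/
def horner (q a₀ a₁ a₂ a₃ j : ℕ) : ℕ :=
  ((((((a₃ * j + a₂) % q) * j + a₁) % q) * j) + a₀) % q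

/-- The sign of a residue `v < q`: `0` for `0`, and `1` or `-1` on the two halves of the nonzero
residues, so that it is an odd function modulo an odd `q`. -/
def sgnN (q v : ℕ) : ℝ := if v ≤ q / 2 then if 1 ≤ v then 1 else 0 else -1

/-- The sign hash of column `j` in a trial whose random table starts at `x` in `T`. -/
def sgnH (q : ℕ) (T : ℕ → ℕ) (x j : ℕ) : ℝ :=
  sgnN q (horner q (T x) (T (x + 1)) (T (x + 2)) (T (x + 3)) j)

/-- The bucket of column `j` in a trial whose random table starts at `x` in `T`. -/
def bktH (q m : ℕ) (T : ℕ → ℕ) (x j : ℕ) : ℕ :=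
  horner q (T (x + 4)) (T (x + 5)) (T (x + 6)) (T (x + 7)) j % m

/-- Entry `r` of the current trial's part of the random table. -/
def wt (r : ℕ) : WExp := .load (arr 0 (.add (wc 11) (.lit r)))

/-- The hash polynomial with coefficients at the entries `o, …, o + 3` of the current trial's table,
evaluated by Horner's rule at the column in word cell 1, modulo the prime in word cell 8. -/
def hashE (o : ℕ) : WExp :=
  .mod (.add (.mul (.mod (.add (.mul (.mod (.add (.mul (wt (o + 3)) (wc 1)) (wt (o + 2))) (wc 8))
    (wc 1)) (wt (o + 1))) (wc 8)) (wc 1)) (wt o)) (wc 8)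

/-- The update of one trial: the entry at `o = 0` decides on the sign, the entry at `o = 4` on the
bucket. Residues up to half of the prime have sign `1`, except for the residue `0`, which has sign
`0`. -/
def updBody : Prog :=
  .seq (.setWord (.lit 11) (.mul (wc 10) (.add (wc 6) (.lit 8)))) <|
  .seq (.setWord (.lit 12) (hashE 0)) <|
  .seq (.setWord (.lit 13) (.mod (hashE 4) (wc 5))) <|
  .seq (.setWord (.lit 14)
    (.add (.mul (.add (.mul (wc 10) (.add (wc 6) (.lit 1))) (wc 0)) (wc 5)) (wc 13))) <|
  .cond (.wordLE (wc 12) (.div (wc 8) (.lit 2)))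
    (.cond (.wordLE (.lit 1) (wc 12))
      (.setReal (arr 0 (wc 14)) (.add (.load (arr 0 (wc 14))) (rc 0))) .skip)
    (.setReal (arr 0 (wc 14)) (.sub (.load (arr 0 (wc 14))) (rc 0)))

/-- The update program: for each trial, add the signed increment to one bucket of the row's sketch,
and add the increment to the row sum. -/
def updProg : Prog :=
  .seq (.setReal (arr 1 (wc 0)) (.add (.load (arr 1 (wc 0))) (rc 0)))
    (forTo 10 7 updBody)

/-- The effect of an update on the sketch array and on the row sums, within time linear in the
number of trials. -/
theorem wp_updProg {s : State} {m N L q i j : ℕ} {α : ℝ} {T : ℕ → ℕ}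
    (h0 : s.words 0 = i) (h1 : s.words 1 = j) (h5 : s.words 5 = m) (h6 : s.words 6 = N)
    (h7 : s.words 7 = L) (h8 : s.words 8 = q) (hr : s.reals 0 = α)
    (hT : ∀ x, s.words (A 0 x) = T x) (hi : i ≤ N) (hm : 0 < m) (hq : 0 < q) (hqV : q ≤ V)
    (hLN : L * (N + 8) ≤ V) (hLm : L * (N + 1) * m ≤ V) :
    Wp V updProg (L * 400 + 50) s fun s' =>
      Frame (fun a => 10 ≤ a ∧ a < 15) (fun a => ∃ x, a = A 0 x ∨ a = A 1 x) s s' ∧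
      (∀ x, s'.reals (A 0 x) = s.reals (A 0 x) + ∑ t ∈ Finset.range L,
        if x = (t * (N + 1) + i) * m + bktH q m T (t * (N + 8)) j then
          sgnH q T (t * (N + 8)) j * α else 0) ∧
      (∀ x, s'.reals (A 1 x) = s.reals (A 1 x) + if x = i then α else 0) := by
  refine Wp.seq 30 (L * 313 + 10) (Wp.setReal (A 1 i) (s.reals (A 1 i) + α) (by simp [h0])
    (by simp [h0, hr]) ?_) (by omega)
  refine wp_forTo (T := 300) (fun t s' =>
    Frame (fun a => 10 ≤ a ∧ a < 15) (fun a => ∃ x, a = A 0 x ∨ a = A 1 x) s s' ∧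
    s'.words 10 = t ∧
    (∀ x, s'.reals (A 0 x) = s.reals (A 0 x) + ∑ t ∈ Finset.range t,
      if x = (t * (N + 1) + i) * m + bktH q m T (t * (N + 8)) j then
        sgnH q T (t * (N + 8)) j * α else 0) ∧
    (∀ x, s'.reals (A 1 x) = s.reals (A 1 x) + if x = i then α else 0)) L (by norm_num)
    (by norm_num) ?_ ?_ ?_ ?_
  · refine ⟨((Frame.refl _ _ s).putReal ⟨_, Or.inr rfl⟩).putWord (by norm_num), ?_, ?_, ?_⟩
    · simp
    · simp
    · intro x
      simp only [putWord_reals, putReal_reals, A_eq_A_self]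
      split_ifs with h <;> simp [h]
  · rintro t s' - ⟨hF, h10, -⟩
    refine ⟨h10, ?_⟩
    rw [hF.words 7 (by norm_num), h7]
  · rintro t s' ht ⟨hF, h10, hA, hA1⟩ - -
    have e0 : s'.words 0 = i := by rw [hF.words 0 (by norm_num), h0]
    have e1 : s'.words 1 = j := by rw [hF.words 1 (by norm_num), h1]
    have e5 : s'.words 5 = m := by rw [hF.words 5 (by norm_num), h5]
    have e6 : s'.words 6 = N := by rw [hF.words 6 (by norm_num), h6]
    have e8 : s'.words 8 = q := by rw [hF.words 8 (by norm_num), h8]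
    have er : s'.reals 0 = α := by rw [hF.reals 0 (by simp), hr]
    have eT : ∀ x, s'.words (A 0 x) = T x := fun x => by
      rw [hF.words _ (by simp), hT]
    have ht1 : t * (N + 8) + (N + 8) ≤ L * (N + 8) := by
      have := Nat.mul_le_mul_right (N + 8) (Nat.succ_le_of_lt ht)
      rwa [Nat.succ_mul] at this
    have ht2 : (t * (N + 1) + i) * m + m ≤ L * (N + 1) * m := by
      have h2 := Nat.mul_le_mul_right (N + 1) (Nat.succ_le_of_lt ht)
      rw [Nat.succ_mul] at h2
      have := Nat.mul_le_mul_right m (show t * (N + 1) + i + 1 ≤ L * (N + 1) by omega)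
      rwa [add_mul _ 1, one_mul] at this
    have hb : bktH q m T (t * (N + 8)) j < m := Nat.mod_lt _ hm
    have hb' : bktH q m T (t * (N + 8)) j ≤ q := (Nat.mod_le _ _).trans (Nat.mod_lt _ hq).le
    have hh : ∀ a b c d, horner q a b c d j < q := fun _ _ _ _ => Nat.mod_lt _ hq
    set x := (t * (N + 1) + i) * m + bktH q m T (t * (N + 8)) j with hx
    set v := horner q (T (t * (N + 8))) (T (t * (N + 8) + 1)) (T (t * (N + 8) + 2))
      (T (t * (N + 8) + 3)) j with hv
    refine Wp.setWord_seq 11 (t * (N + 8)) rfl (by simp [h10, e6]) (by omega) ?_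
    refine Wp.setWord_seq 12 v rfl (by simp [hashE, wt, e1, e8, eT, hv, horner])
      (fun _ => (hh _ _ _ _).le.trans hqV) ?_
    refine Wp.setWord_seq 13 (bktH q m T (t * (N + 8)) j) rfl
      (by simp [hashE, wt, e1, e5, e8, eT, bktH, horner]) (fun _ => hb'.trans hqV) ?_
    refine Wp.setWord_seq 14 x rfl (by simp [h10, e0, e5, e6, hx]) (by omega) ?_
    have fin : ∀ s'' : State, (∃ r : ℝ, r = sgnN q v * α ∧ s'' =
        ((((s'.putWord 11 (t * (N + 8))).putWord 12 v).putWord 13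
          (bktH q m T (t * (N + 8)) j)).putWord 14 x).putReal (A 0 x) (s'.reals (A 0 x) + r)) →
        (s''.words 10 = t ∧ (Frame (fun a => 10 ≤ a ∧ a < 15)
          (fun a => ∃ x, a = A 0 x ∨ a = A 1 x) s (s''.putWord 10 (t + 1)) ∧
        (s''.putWord 10 (t + 1)).words 10 = t + 1 ∧
        (∀ x, (s''.putWord 10 (t + 1)).reals (A 0 x) = s.reals (A 0 x) +
          ∑ t ∈ Finset.range (t + 1),
          if x = (t * (N + 1) + i) * m + bktH q m T (t * (N + 8)) j then
          sgnH q T (t * (N + 8)) j * α else 0) ∧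
        (∀ x, (s''.putWord 10 (t + 1)).reals (A 1 x) =
          s.reals (A 1 x) + if x = i then α else 0))) := by
      rintro s'' ⟨r, hr', rfl⟩
      refine ⟨by simp [h10], ((((((hF.putWord (by norm_num)).putWord (by norm_num)).putWord
        (by norm_num)).putWord (by norm_num)).putReal ⟨_, Or.inl rfl⟩).putWord (by norm_num)),
        by simp, ?_, ?_⟩
      · intro y
        rw [Finset.sum_range_succ, ← add_assoc, ← hA]
        simp only [putWord_reals, putReal_reals, A_eq_A_self, ← hx]
        split_ifs with h
        · rw [h, hr', sgnH]
        · simp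
      · intro y
        simp [hA1]
    refine Wp.ite (p := v ≤ q / 2) 50 40 (by simp [e8]) (fun h1 => ?_) (fun h1 => ?_)
    · refine Wp.ite (p := 1 ≤ v) 30 2 (by simp) (fun h2 => ?_) (fun h2 => ?_)
      · exact Wp.setReal (A 0 x) (s'.reals (A 0 x) + α) (by simp) (by simp [er])
          (fin _ ⟨α, by simp [sgnN, h1, h2], rfl⟩)
      · refine (wp_skip ?_).mono (by norm_num) fun _ h => h
        have := fin _ ⟨0, by simp [sgnN, h1, h2], rfl⟩
        rwa [putReal_eq_self] at this
        simp
    · exact Wp.setReal (A 0 x) (s'.reals (A 0 x) - α) (by simp) (by simp [er])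
        (fin _ ⟨-α, by simp [sgnN, h1], rfl⟩)
  · rintro s' ⟨h1, h2, h3, h4⟩
    exact ⟨h1, h3, h4⟩

end

section

variable {V : ℕ} [hV : Fact (1048576 ≤ V)]

/-! ### Rounding down by binary search -/

/-- Puts the integer part of real cell 8 into real cell 9, by a binary search that starts with the
power of two in real cell 3. -/
def floorProg : Prog :=
  .seq (.setReal (.lit 9) (.ofWord (.lit 0))) <|
  .seq (.setReal (.lit 10) (rc 3)) <|
  .loop (.realLE (.ofWord (.lit 1)) (rc 10)) <|
    .seq (.cond (.realLE (.add (rc 9) (rc 10)) (rc 8)) (.setReal (.lit 9) (.add (rc 9) (rc 10)))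
      .skip) (.setReal (.lit 10) (.div (rc 10) (.ofWord (.lit 2))))

theorem wp_floorProg {s : State} {B : ℕ} {v : ℝ} (h3 : s.reals 3 = 2 ^ B) (h8 : s.reals 8 = v)
    (hv0 : 0 ≤ v) (hv : v < 2 ^ (B + 1)) :
    Wp V floorProg (B * 40 + 80) s fun s' =>
      Frame (fun _ => False) (fun a => a = 9 ∨ a = 10) s s' ∧ s'.reals 9 = (⌊v⌋₊ : ℝ) := by
  refine Wp.seq 5 (B * 40 + 75) (Wp.setReal 9 0 rfl (by simp) ?_) (by omega)
  refine Wp.seq 5 (B * 40 + 70) (Wp.setReal 10 (2 ^ B) rfl (by simp [h3]) ?_) (by omega)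
  refine Wp.mono (wp_loop (t := 30) (fun j s' =>
    Frame (fun _ => False) (fun a => a = 9 ∨ a = 10) s s' ∧
    s'.reals 10 = 2 ^ (B + 1 - j) / 2 ∧
    ∃ x : ℕ, s'.reals 9 = x ∧ (x : ℝ) ≤ v ∧ v < x + 2 ^ (B + 1 - j)) (B + 1) (by decide)
    ?_ ?_ ?_) ?_ (fun _ h => h)
  · rintro j s' hj ⟨hF, h10, x, h9, hx1, hx2⟩
    obtain ⟨d, hd⟩ : ∃ d, B + 1 - j = d + 1 := ⟨B - j, by omega⟩
    have hd' : B + 1 - (j + 1) = d := by omega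
    have e8 : s'.reals 8 = v := by rw [hF.reals 8 (by norm_num), h8]
    rw [hd] at h10 hx2
    have h10' : s'.reals 10 = 2 ^ d := by rw [h10, pow_succ]; ring
    refine ⟨by simp [h10', one_le_pow₀], ?_⟩
    rw [hd']
    refine Wp.seq 20 10 (Wp.ite (p := (x : ℝ) + 2 ^ d ≤ v) 7 1 (by simp [h9, h10', e8])
      (fun h => ?_) (fun h => ?_)) (by norm_num)
    · refine Wp.setReal 9 ((x : ℝ) + 2 ^ d) rfl (by simp [h9, h10']) ?_
      refine Wp.setReal 10 (2 ^ d / 2) rfl (by simp [h10']) ?_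
      refine ⟨(hF.putReal (by simp)).putReal (by simp), by simp, x + 2 ^ d, by simp, ?_, ?_⟩
      · push_cast; exact h
      · push_cast; rw [pow_succ] at hx2; linarith
    · refine wp_skip ?_
      refine Wp.setReal 10 (2 ^ d / 2) rfl (by simp [h10']) ?_
      exact ⟨hF.putReal (by simp), by simp, x, by simp [h9], hx1, not_le.1 h⟩
  · rintro s' ⟨hF, h10, x, h9, hx1, hx2⟩
    refine ⟨by simp [h10]; norm_num, hF, ?_⟩
    rw [h9]
    congr 1
    symm
    rw [Nat.floor_eq_iff hv0]
    exact ⟨hx1, by simpa using hx2⟩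
  · refine ⟨((Frame.refl _ _ s).putReal (by simp)).putReal (by simp), ?_, 0, by simp,
      by simpa using hv0, by simpa using hv⟩
    simp [pow_succ]
  · have : (Test.realLE (.ofWord (.lit 1)) (rc 10)).cost = 5 := rfl
    rw [this]; omega

/-! ### The query context -/

/-- The centered sketch of row `i` in trial `t`, read off from the sketch array `F` and the row
sums `G`; row `N` is the sketch of the all-ones vector. -/
def csA (F G : ℕ → ℝ) (m N t i b : ℕ) : ℝ :=
  F ((t * (N + 1) + i) * m + b) - G i / G N * F ((t * (N + 1) + N) * m + b)

/-- The norm of the centered sketch of row `i` in trial `t`. -/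
def nrmA (F G : ℕ → ℝ) (m N t i : ℕ) : ℝ :=
  Real.sqrt (∑ b ∈ Finset.range m, csA F G m N t i b * csA F G m N t i b)

/-- The random sign of row `i` in trial `t`. -/
def rsgn (q : ℕ) (T : ℕ → ℕ) (N t i : ℕ) : ℝ := sgnN q (T (t * (N + 8) + (8 + i)))

/-- The signed sum of the normalized sketches of the `c` rows of group `a`. -/
def zA (F G : ℕ → ℝ) (T : ℕ → ℕ) (q c m N t a b : ℕ) : ℝ :=
  ∑ u ∈ Finset.range c,
    rsgn q T N t (a * c + u) * csA F G m N t (a * c + u) b / nrmA F G m N t (a * c + u)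

/-- The rounding of `m ^ 2 * z` to an integer, for `|m ^ 2 * z| ≤ m ^ 8`. -/
def rnd (m : ℕ) (z : ℝ) : ℝ := (⌊(m : ℝ) ^ 2 * z + (m : ℝ) ^ 8⌋₊ : ℝ) - (m : ℝ) ^ 8

/-- The constants of the query that stay fixed during a trial. -/
structure Env (F G : ℕ → ℝ) (T : ℕ → ℕ) (q c m N t B : ℕ) (τ cap : ℝ)
    (s : State) : Prop where
  w4 : s.words 4 = c
  w5 : s.words 5 = m
  w6 : s.words 6 = N
  w8 : s.words 8 = q
  w9 : s.words 9 = (t * (N + 1) + N) * m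
  w10 : s.words 10 = t
  w11 : s.words 11 = t * (N + 8)
  w0 : s.words 0 = c ^ 5
  w1 : s.words 1 = c ^ 5 * c ^ 5
  r0 : s.reals 0 = τ
  r7 : s.reals 7 = cap
  r3 : s.reals 3 = 2 ^ B
  r4 : s.reals 4 = (m : ℝ) ^ 2
  r5 : s.reals 5 = (m : ℝ) ^ 8
  r6 : s.reals 6 = (2 ^ B) ^ (c ^ 5)
  hF : ∀ x, s.reals (A 0 x) = F x
  hG : ∀ x, s.reals (A 1 x) = G x
  hT : ∀ x, s.words (A 0 x) = T x

variable {F G : ℕ → ℝ} {T : ℕ → ℕ} {q c m N t B : ℕ} {τ cap : ℝ}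

theorem Env.frameO {s s' : State} {ws rs : ℕ → Prop} (h : Env F G T q c m N t B τ cap s)
    (hf : FrameO ws rs s s') (hw : ∀ a, ws a → (12 ≤ a ∧ a < 32) ∨ ∃ x, a = A 1 x)
    (hr : ∀ a, rs a → (8 ≤ a ∧ a < 32) ∨ ∃ x, a = A 2 x ∨ a = A 3 x ∨ a = A 4 x) :
    Env F G T q c m N t B τ cap s' := by
  have hw' : ∀ a, a < 12 → ¬ ws a := fun a ha h' => by
    rcases hw a h' with h1 | ⟨x, rfl⟩
    · omega
    · have := le_A 1 x; omega
  have hr' : ∀ a, a < 8 → ¬ rs a := fun a ha h' => by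
    rcases hr a h' with h1 | ⟨x, rfl | rfl | rfl⟩
    · omega
    · have := le_A 2 x; omega
    · have := le_A 3 x; omega
    · have := le_A 4 x; omega
  have hT' : ∀ x, ¬ ws (A 0 x) := fun x h' => by
    rcases hw _ h' with h1 | ⟨y, h1⟩
    · have := le_A 0 x; omega
    · simp at h1
  have hA : ∀ r x, r < 2 → ¬ rs (A r x) := fun r x hr2 h' => by
    rcases hr _ h' with h1 | ⟨y, h1⟩
    · have := le_A r x; omega
    · unfold A at h1; omega
  have W : ∀ a, a < 12 → s'.words a = s.words a := fun a ha => hf.words a (hw' a ha)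
  have R : ∀ a, a < 8 → s'.reals a = s.reals a := fun a ha => hf.reals a (hr' a ha)
  exact ⟨(W 4 (by norm_num)).trans h.w4, (W 5 (by norm_num)).trans h.w5,
    (W 6 (by norm_num)).trans h.w6, (W 8 (by norm_num)).trans h.w8,
    (W 9 (by norm_num)).trans h.w9, (W 10 (by norm_num)).trans h.w10,
    (W 11 (by norm_num)).trans h.w11, (W 0 (by norm_num)).trans h.w0,
    (W 1 (by norm_num)).trans h.w1, (R 0 (by norm_num)).trans h.r0,
    (R 7 (by norm_num)).trans h.r7, (R 3 (by norm_num)).trans h.r3,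
    (R 4 (by norm_num)).trans h.r4, (R 5 (by norm_num)).trans h.r5,
    (R 6 (by norm_num)).trans h.r6,
    fun x => (hf.reals _ (hA 0 x (by norm_num))).trans (h.hF x),
    fun x => (hf.reals _ (hA 1 x (by norm_num))).trans (h.hG x),
    fun x => (hf.words _ (hT' x)).trans (h.hT x)⟩

theorem Env.frame {s s' : State} {ws rs : ℕ → Prop} (h : Env F G T q c m N t B τ cap s)
    (hf : Frame ws rs s s') (hw : ∀ a, ws a → (12 ≤ a ∧ a < 32) ∨ ∃ x, a = A 1 x)
    (hr : ∀ a, rs a → (8 ≤ a ∧ a < 32) ∨ ∃ x, a = A 2 x ∨ a = A 3 x ∨ a = A 4 x) :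
    Env F G T q c m N t B τ cap s' :=
  h.frameO hf.toO hw hr

/-! ### Signed sums of normalized sketches -/

/-- Entry `b` (word cell 16) of the centered sketch of the current row. -/
def csE : RExp :=
  .sub (.load (arr 0 (.add (wc 20) (wc 16)))) (.mul (rc 11) (.load (arr 0 (.add (wc 9) (wc 16)))))

/-- Puts the squared norm of the current row's centered sketch into real cell 12. -/
def rowNorm : Prog :=
  .seq (.setReal (.lit 12) (.ofWord (.lit 0)))
    (forTo 16 5 (.setReal (.lit 12) (.add (rc 12) (.mul csE csE))))

theorem wp_rowNorm {s : State} {i : ℕ} (hE : Env F G T q c m N t B τ cap s)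
    (h20 : s.words 20 = (t * (N + 1) + i) * m) (h11 : s.reals 11 = G i / G N) :
    Wp V rowNorm (m * 113 + 20) s fun s' =>
      Frame (fun a => a = 16) (fun a => a = 12) s s' ∧
      s'.reals 12 = ∑ b ∈ Finset.range m, csA F G m N t i b * csA F G m N t i b := by
  refine Wp.seq 5 (m * 113 + 10) (Wp.setReal 12 0 rfl (by simp) ?_) (by omega)
  refine wp_forTo (T := 100) (fun b s' => Frame (fun a => a = 16) (fun a => a = 12) s s' ∧
    s'.words 16 = b ∧
    s'.reals 12 = ∑ b ∈ Finset.range b, csA F G m N t i b * csA F G m N t i b) m (by norm_num)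
    (by norm_num) ?_ ?_ ?_ ?_
  · exact ⟨((Frame.refl _ _ s).putReal (by simp)).putWord (by simp), by simp, by simp⟩
  · rintro b s' - ⟨hf, h16, -⟩
    exact ⟨h16, by rw [hf.words 5 (by norm_num), hE.w5]⟩
  · rintro b s' hb ⟨hf, h16, h12⟩ - -
    have hE' := hE.frame hf (by simp) (by simp)
    have e20 := (hf.words 20 (by norm_num)).trans h20
    have e11 := (hf.reals 11 (by norm_num)).trans h11
    refine Wp.setReal 12 _ rfl rfl ?_
    refine ⟨by simp [h16], (hf.putReal rfl).putWord rfl, by simp, ?_⟩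
    rw [Finset.sum_range_succ, ← h12]
    simp [csE, csA, e20, h16, e11, hE'.hF, hE'.w9]
  · rintro s' ⟨hf, -, h12⟩
    exact ⟨hf, h12⟩

/-- Adds the current row's centered sketch, multiplied by the sign in real cell 13 and divided by
the norm in real cell 12, to real array 2. -/
def addRow : Prog :=
  forTo 16 5 (.setReal (arr 2 (wc 16))
    (.add (.load (arr 2 (wc 16))) (.div (.mul (rc 13) csE) (rc 12))))

theorem wp_addRow {s : State} {i : ℕ} (hE : Env F G T q c m N t B τ cap s)
    (h20 : s.words 20 = (t * (N + 1) + i) * m) (h11 : s.reals 11 = G i / G N) {σ ν : ℝ}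
    (h13 : s.reals 13 = σ) (h12 : s.reals 12 = ν) :
    Wp V addRow (m * 113 + 10) s fun s' =>
      Frame (fun a => a = 16) (fun a => ∃ x, a = A 2 x) s s' ∧
      ∀ b < m, s'.reals (A 2 b) = s.reals (A 2 b) + σ * csA F G m N t i b / ν := by
  refine wp_forTo (T := 100) (fun j s' =>
    Frame (fun a => a = 16) (fun a => ∃ x, a = A 2 x) s s' ∧ s'.words 16 = j ∧
    (∀ b < m, s'.reals (A 2 b) = s.reals (A 2 b) +
      if b < j then σ * csA F G m N t i b / ν else 0)) m (by norm_num)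
    (by norm_num) ?_ ?_ ?_ ?_
  · exact ⟨(Frame.refl _ _ s).putWord rfl, by simp, by simp⟩
  · rintro b s' - ⟨hf, h16, -⟩
    exact ⟨h16, by rw [hf.words 5 (by norm_num), hE.w5]⟩
  · rintro j s' hj ⟨hf, h16, hZ⟩ - -
    have hE' := hE.frame hf (by simp) (by rintro a ⟨x, h⟩; exact Or.inr ⟨x, Or.inl h⟩)
    have e20 := (hf.words 20 (by norm_num)).trans h20
    have e11 := (hf.reals 11 (by simp)).trans h11
    have e12 := (hf.reals 12 (by simp)).trans h12
    have e13 := (hf.reals 13 (by simp)).trans h13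
    refine Wp.setReal (A 2 j) (s'.reals (A 2 j) + σ * csA F G m N t i j / ν) (by simp [h16])
      (by simp [csE, csA, h16, e20, e11, e12, e13, hE'.w9, hE'.hF]) ?_
    refine ⟨by simp [h16], (hf.putReal ⟨_, rfl⟩).putWord rfl, by simp, fun b hb => ?_⟩
    simp only [putWord_reals, putReal_reals, A_eq_A_self, hZ b hb, hZ j hj]
    by_cases h : b = j
    · subst h; simp
    · have : b < j + 1 ↔ b < j := by omega
      simp [h, this]
  · rintro s' ⟨hf, -, hZ⟩
    exact ⟨hf, fun b hb => by rw [hZ b hb, if_pos hb]⟩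

/-- Sets the first `m` entries of real array `r` to zero. -/
def zeroArr (r : ℕ) : Prog := forTo 16 5 (.setReal (arr r (wc 16)) (.ofWord (.lit 0)))

theorem wp_zeroArr {s : State} {r : ℕ} (h5 : s.words 5 = m) (hr : r < 32) :
    Wp V (zeroArr r) (m * 25 + 10) s fun s' =>
      Frame (fun a => a = 16) (fun a => ∃ x, a = A r x) s s' ∧
      ∀ b < m, s'.reals (A r b) = 0 := by
  refine wp_forTo (T := 12) (fun j s' =>
    Frame (fun a => a = 16) (fun a => ∃ x, a = A r x) s s' ∧ s'.words 16 = j ∧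
    ∀ b < j, s'.reals (A r b) = 0) m (by norm_num) (by norm_num) ?_ ?_ ?_ ?_
  · exact ⟨(Frame.refl _ _ s).putWord rfl, by simp, by simp⟩
  · rintro b s' - ⟨hf, h16, -⟩
    exact ⟨h16, by rw [hf.words 5 (by norm_num), h5]⟩
  · rintro j s' hj ⟨hf, h16, hZ⟩ - -
    have hfine : (arr r (wc 16)).fine = true := by
      simp [arr, WExp.fine, WExp.deg]; omega
    refine Wp.setReal (A r j) 0 (by simp [h16]) (by simp) ?_ (ha := hfine) (ht := show (11 : ℕ) ≤ 12 by norm_num)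
    · refine ⟨by simp [h16], (hf.putReal ⟨_, rfl⟩).putWord rfl, by simp, fun b hb => ?_⟩
      simp only [putWord_reals, putReal_reals, A_eq_A_self]
      split_ifs with h
      · rfl
      · exact hZ b (by omega)
  · rintro s' ⟨hf, -, hZ⟩
    exact ⟨hf, hZ⟩

/-- Puts the random sign of the current row into real cell 13. -/
def sgnProg : Prog :=
  .seq (.setWord (.lit 12) (.load (arr 0 (.add (wc 11) (.add (.lit 8) (wc 19)))))) <|
  .cond (.wordLE (wc 12) (.div (wc 8) (.lit 2)))
    (.cond (.wordLE (.lit 1) (wc 12)) (.setReal (.lit 13) (.ofWord (.lit 1)))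
      (.setReal (.lit 13) (.ofWord (.lit 0))))
    (.setReal (.lit 13) (.sub (.ofWord (.lit 0)) (.ofWord (.lit 1))))

theorem wp_sgnProg {s : State} {i : ℕ} (hE : Env F G T q c m N t B τ cap s) (h19 : s.words 19 = i) :
    Wp V sgnProg 70 s fun s' =>
      Frame (fun a => a = 12) (fun a => a = 13) s s' ∧ s'.reals 13 = rsgn q T N t i := by
  refine Wp.setWord_seq 12 (T (t * (N + 8) + (8 + i))) rfl (by simp [hE.w11, h19, hE.hT])
    (fun h => hE.hT (t * (N + 8) + (8 + i)) ▸ h _) ?_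
  refine Wp.ite (p := T (t * (N + 8) + (8 + i)) ≤ q / 2) 25 10 (by simp [hE.w8])
    (fun h1 => ?_) (fun h1 => ?_)
  · refine Wp.ite (p := 1 ≤ T (t * (N + 8) + (8 + i))) 8 8 (by simp)
      (fun h2 => ?_) (fun h2 => ?_)
    · refine Wp.setReal 13 1 rfl (by simp) ⟨((Frame.refl _ _ s).putWord (by simp)).putReal (by simp), ?_⟩
      simp [rsgn, sgnN, h1, h2]
    · refine Wp.setReal 13 0 rfl (by simp) ⟨((Frame.refl _ _ s).putWord (by simp)).putReal (by simp), ?_⟩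
      simp [rsgn, sgnN, h1, h2]
  · refine Wp.setReal 13 (-1) rfl (by simp) ⟨((Frame.refl _ _ s).putWord (by simp)).putReal (by simp), ?_⟩
    simp [rsgn, sgnN, h1]

/-- Adds the signed normalized sketch of row `a * c + u` to the group sum. -/
def rowStep : Prog :=
  .seq (.setWord (.lit 19) (.add (.mul (wc 17) (wc 4)) (wc 18))) <|
  .seq (.setWord (.lit 20) (.mul (.add (.mul (wc 10) (.add (wc 6) (.lit 1))) (wc 19)) (wc 5))) <|
  .seq (.setReal (.lit 11) (.div (.load (arr 1 (wc 19))) (.load (arr 1 (wc 6))))) <|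
  .seq rowNorm <|
  .seq (.setReal (.lit 12) (.sqrt (rc 12))) <|
  .seq sgnProg addRow

theorem wp_rowStep {s : State} {a u : ℕ} (hE : Env F G T q c m N t B τ cap s) (h17 : s.words 17 = a)
    (h18 : s.words 18 = u) (hi : a * c + u ≤ V) (hx : (t * (N + 1) + (a * c + u)) * m ≤ V) :
    Wp V rowStep (m * 226 + 200) s fun s' =>
      Frame (fun a => a = 12 ∨ a = 16 ∨ a = 19 ∨ a = 20)
        (fun a => a = 11 ∨ a = 12 ∨ a = 13 ∨ ∃ x, a = A 2 x) s s' ∧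
      ∀ b < m, s'.reals (A 2 b) = s.reals (A 2 b) +
        rsgn q T N t (a * c + u) * csA F G m N t (a * c + u) b / nrmA F G m N t (a * c + u) := by
  set i := a * c + u with hidef
  refine Wp.seq 10 (m * 226 + 190) (Wp.setWord 19 i rfl (by simp [h17, h18, hE.w4, hidef])
    (fun _ => hi) ?_) (by omega)
  refine Wp.seq 20 (m * 226 + 170) (Wp.setWord 20 ((t * (N + 1) + i) * m) rfl
    (by simp [hE.w10, hE.w6, hE.w5]) (fun _ => hx) ?_) (by omega)
  refine Wp.seq 25 (m * 226 + 145) (Wp.setReal 11 (G i / G N) rfl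
    (by simp [hE.w6, hE.hG]) ?_) (by omega)
  set s₁ := (((s.putWord 19 i).putWord 20 ((t * (N + 1) + i) * m)).putReal 11 (G i / G N)) with hs₁
  have hf₁ : Frame (fun a => a = 12 ∨ a = 16 ∨ a = 19 ∨ a = 20)
        (fun a => a = 11 ∨ a = 12 ∨ a = 13 ∨ ∃ x, a = A 2 x) s s₁ :=
    (((Frame.refl _ _ s).putWord (by simp)).putWord (by simp)).putReal (by simp)
  have hsub : ∀ a, (a = 12 ∨ a = 16 ∨ a = 19 ∨ a = 20) → (12 ≤ a ∧ a < 32) ∨ ∃ x, a = A 1 x := by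
    intro a h; left; omega
  have hsub' : ∀ a, (a = 11 ∨ a = 12 ∨ a = 13 ∨ ∃ x, a = A 2 x) →
      (8 ≤ a ∧ a < 32) ∨ ∃ x, a = A 2 x ∨ a = A 3 x ∨ a = A 4 x := by
    rintro a (h | h | h | ⟨x, h⟩)
    · left; omega
    · left; omega
    · left; omega
    · exact Or.inr ⟨x, Or.inl h⟩
  have hE₁ := hE.frame hf₁ hsub hsub'
  refine Wp.seq (m * 113 + 20) (m * 113 + 125) ((wp_rowNorm (i := i) hE₁ (by simp [hs₁])
    (by simp [hs₁])).mono le_rfl ?_) (by omega)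
  rintro s₂ ⟨hf₂, h12⟩
  have hf₂' := hf₁.trans hf₂ (by simp) (by simp)
  refine Wp.seq 10 (m * 113 + 115) (Wp.setReal 12 (nrmA F G m N t i) rfl
    (by simp [h12, nrmA]) ?_) (by omega)
  have hf₃ := hf₂'.putReal (a := 12) (v := nrmA F G m N t i) (by simp)
  have hE₃ := hE.frame hf₃ hsub hsub'
  refine Wp.seq 70 (m * 113 + 10) ((wp_sgnProg (i := i) hE₃ ?_).mono le_rfl ?_) (by omega)
  · simp [hf₂.words 19, hs₁]
  rintro s₄ ⟨hf₄, h13⟩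
  have hf₄' := hf₃.trans hf₄ (by simp) (by simp)
  have hE₄ := hE.frame hf₄' hsub hsub'
  refine (wp_addRow (i := i) hE₄ ?_ ?_ h13 (ν := nrmA F G m N t i) ?_).mono le_rfl ?_
  · rw [hf₄.words 20 (by norm_num)]; simp [hf₂.words 20, hs₁]
  · rw [hf₄.reals 11 (by norm_num)]; simp [hf₂.reals 11, hs₁]
  · rw [hf₄.reals 12 (by norm_num)]; simp
  rintro s₅ ⟨hf₅, hZ⟩
  refine ⟨hf₄'.trans hf₅ (by simp) (by rintro a h; exact Or.inr (Or.inr (Or.inr h))), ?_⟩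
  intro b hb
  rw [hZ b hb, hf₄.reals _ (by simp)]
  simp [hf₂.reals, hs₁]

/-- Computes the sum of group `a` (word cell 17) in real array 2. -/
def groupSum : Prog := .seq (zeroArr 2) (forTo 18 4 rowStep)

theorem wp_groupSum {s : State} {a : ℕ} (hE : Env F G T q c m N t B τ cap s) (h17 : s.words 17 = a)
    (hi : a * c + c ≤ V) (hx : (t * (N + 1) + (a * c + c)) * m ≤ V) :
    Wp V groupSum (c * (m * 226 + 213) + m * 25 + 20) s fun s' =>
      Frame (fun a => a = 12 ∨ a = 16 ∨ a = 18 ∨ a = 19 ∨ a = 20)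
        (fun a => a = 11 ∨ a = 12 ∨ a = 13 ∨ ∃ x, a = A 2 x) s s' ∧
      ∀ b < m, s'.reals (A 2 b) = zA F G T q c m N t a b := by
  refine Wp.seq (m * 25 + 10) (c * (m * 226 + 200 + 13) + 10)
    ((wp_zeroArr hE.w5 (by norm_num)).mono le_rfl ?_) (by ring_nf; omega)
  rintro s₁ ⟨hf₁, hZ₁⟩
  have hsub : ∀ a, (a = 12 ∨ a = 16 ∨ a = 18 ∨ a = 19 ∨ a = 20) →
      (12 ≤ a ∧ a < 32) ∨ ∃ x, a = A 1 x := by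
    intro a h; left; omega
  have hsub' : ∀ a, (a = 11 ∨ a = 12 ∨ a = 13 ∨ ∃ x, a = A 2 x) →
      (8 ≤ a ∧ a < 32) ∨ ∃ x, a = A 2 x ∨ a = A 3 x ∨ a = A 4 x := by
    rintro a (h | h | h | ⟨x, h⟩)
    · left; omega
    · left; omega
    · left; omega
    · exact Or.inr ⟨x, Or.inl h⟩
  refine wp_forTo (fun u s' =>
    Frame (fun a => a = 12 ∨ a = 16 ∨ a = 18 ∨ a = 19 ∨ a = 20)
        (fun a => a = 11 ∨ a = 12 ∨ a = 13 ∨ ∃ x, a = A 2 x) s s' ∧ s'.words 18 = u ∧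
    ∀ b < m, s'.reals (A 2 b) = ∑ u ∈ Finset.range u,
      rsgn q T N t (a * c + u) * csA F G m N t (a * c + u) b / nrmA F G m N t (a * c + u)) c
    (by norm_num) (by norm_num) ?_ ?_ ?_ ?_
  · refine ⟨((Frame.refl _ _ s).trans hf₁ (by simp) ?_).putWord (by simp), by simp, ?_⟩
    · rintro a h; exact Or.inr (Or.inr (Or.inr h))
    · simpa using hZ₁
  · rintro u s' - ⟨hf, h18, -⟩
    exact ⟨h18, by rw [hf.words 4 (by norm_num), hE.w4]⟩
  · rintro u s' hu ⟨hf, h18, hZ⟩ - -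
    have hE' := hE.frame hf hsub hsub'
    refine (wp_rowStep hE' ((hf.words 17 (by norm_num)).trans h17) h18 (by omega)
      (le_trans (Nat.mul_le_mul_right _ (by omega)) hx)).mono le_rfl ?_
    rintro s'' ⟨hf', hZ'⟩
    refine ⟨by rw [hf'.words 18 (by norm_num), h18],
      (hf.trans hf' (by intro a h; omega) (fun a h => h)).putWord (by simp), by simp, ?_⟩
    intro b hb
    rw [Finset.sum_range_succ, ← hZ b hb]
    simpa using hZ' b hb
  · rintro s' ⟨hf, -, hZ⟩
    exact ⟨hf, hZ⟩

end

section

variable {V : ℕ} [hV : Fact (1048576 ≤ V)]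

variable {F G : ℕ → ℝ} {T : ℕ → ℕ} {q c m N t B : ℕ} {τ cap : ℝ}

/-! ### Rounded group sums -/

theorem abs_sgnN_le (q v : ℕ) : |sgnN q v| ≤ 1 := by
  unfold sgnN; split_ifs <;> simp

theorem abs_csA_le (F G : ℕ → ℝ) (m N t i : ℕ) {b : ℕ} (hb : b < m) :
    |csA F G m N t i b| ≤ nrmA F G m N t i := by
  rw [nrmA]
  apply Real.abs_le_sqrt
  rw [sq]
  exact Finset.single_le_sum (f := fun b => csA F G m N t i b * csA F G m N t i b)
    (fun _ _ => mul_self_nonneg _) (Finset.mem_range.2 hb)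

theorem abs_zA_le (F G : ℕ → ℝ) (T : ℕ → ℕ) (q c m N t a : ℕ) {b : ℕ} (hb : b < m) :
    |zA F G T q c m N t a b| ≤ c := by
  refine (Finset.abs_sum_le_sum_abs _ _).trans ?_
  refine (Finset.sum_le_card_nsmul _ _ 1 fun u _ => ?_).trans (by simp)
  rw [mul_div_assoc, abs_mul, abs_div]
  have h1 := abs_csA_le F G m N t (a * c + u) hb
  have h0 : 0 ≤ nrmA F G m N t (a * c + u) := Real.sqrt_nonneg _
  rw [abs_of_nonneg h0]
  exact mul_le_one₀ (abs_sgnN_le _ _) (by positivity) (div_le_one_of_le₀ h1 h0)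

/-- The rounded group sums. -/
def wA (F G : ℕ → ℝ) (T : ℕ → ℕ) (q c m N t a b : ℕ) : ℝ := rnd m (zA F G T q c m N t a b)

theorem rnd_arg_bounds {m : ℕ} (hm : 1 ≤ m) {z : ℝ} (hz : |z| ≤ m) :
    0 ≤ (m : ℝ) ^ 2 * z + (m : ℝ) ^ 8 ∧ (m : ℝ) ^ 2 * z + (m : ℝ) ^ 8 ≤ 2 * (m : ℝ) ^ 8 := by
  have hm' : (1 : ℝ) ≤ m := by exact_mod_cast hm
  have h1 : |(m : ℝ) ^ 2 * z| ≤ (m : ℝ) ^ 8 := by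
    rw [abs_mul, abs_of_nonneg (by positivity)]
    calc (m : ℝ) ^ 2 * |z| ≤ (m : ℝ) ^ 2 * m := by gcongr
      _ = (m : ℝ) ^ 3 := by ring
      _ ≤ (m : ℝ) ^ 8 := pow_le_pow_right₀ hm' (by norm_num)
  obtain ⟨h2, h3⟩ := abs_le.1 h1
  constructor <;> linarith

theorem rnd_le {m : ℕ} (hm : 1 ≤ m) {z : ℝ} (hz : |z| ≤ m) :
    rnd m z ≤ (m : ℝ) ^ 2 * z ∧ (m : ℝ) ^ 2 * z < rnd m z + 1 := by
  have h := rnd_arg_bounds hm hz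
  have h1 := Nat.floor_le h.1
  have h2 := Nat.lt_floor_add_one ((m : ℝ) ^ 2 * z + (m : ℝ) ^ 8)
  constructor <;> unfold rnd <;> linarith

theorem exists_int_rnd (m : ℕ) (z : ℝ) : ∃ k : ℤ, rnd m z = k :=
  ⟨(⌊(m : ℝ) ^ 2 * z + (m : ℝ) ^ 8⌋₊ : ℤ) - (m : ℤ) ^ 8, by simp [rnd]⟩

theorem abs_rnd_le {m : ℕ} (hm : 1 ≤ m) {z : ℝ} (hz : |z| ≤ m) : |rnd m z| ≤ (m : ℝ) ^ 3 := by
  have hm' : (1 : ℝ) ≤ m := by exact_mod_cast hm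
  obtain ⟨h1, h2⟩ := rnd_le hm hz
  have h3 : |(m : ℝ) ^ 2 * z| ≤ (m : ℝ) ^ 3 := by
    rw [abs_mul, abs_of_nonneg (by positivity)]
    calc (m : ℝ) ^ 2 * |z| ≤ (m : ℝ) ^ 2 * m := by gcongr
      _ = (m : ℝ) ^ 3 := by ring
  obtain ⟨h4, h5⟩ := abs_le.1 h3
  obtain ⟨k, hk⟩ := exists_int_rnd m z
  refine abs_le.2 ⟨?_, h1.trans h5⟩
  rw [hk] at h2 ⊢
  have : (-(m : ℝ) ^ 3) < k + 1 := by linarith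
  have h6 : (-(m : ℤ) ^ 3) < k + 1 := by exact_mod_cast this
  have h7 : (-(m : ℤ) ^ 3) ≤ k := by omega
  exact_mod_cast h7

/-! ### Packing -/

/-- Rounds coordinate `b` of the group sum in real array 2, and adds it at the current place to
entry `b` of real arrays 3 and 4. -/
def packBody : Prog :=
  .seq (.setReal (.lit 8) (.add (.mul (rc 4) (.load (arr 2 (wc 16)))) (rc 5))) <|
  .seq floorProg <|
  .seq (.setReal (arr 3 (wc 16))
    (.add (.load (arr 3 (wc 16))) (.mul (.sub (rc 9) (rc 5)) (rc 14))))
  (.setReal (arr 4 (wc 16))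
    (.add (.load (arr 4 (wc 16))) (.mul (.sub (rc 9) (rc 5)) (rc 15))))

/-- Adds the rounded group sum, multiplied by the current powers, to the packed vectors in real
arrays 3 and 4. -/
def packProg : Prog := forTo 16 5 packBody

theorem wp_packProg {s : State} {a : ℕ} {X Y : ℝ} (hE : Env F G T q c m N t B τ cap s)
    (hm : 1 ≤ m) (hcm : c ≤ m) (hB : 4 * (m : ℝ) ^ 8 ≤ 2 ^ B) (h14 : s.reals 14 = X)
    (h15 : s.reals 15 = Y) (hZ : ∀ b < m, s.reals (A 2 b) = zA F G T q c m N t a b) :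
    Wp V packProg (m * (B * 40 + 193) + 10) s fun s' =>
      Frame (fun a => a = 16)
        (fun a => a = 8 ∨ a = 9 ∨ a = 10 ∨ ∃ x, a = A 3 x ∨ a = A 4 x) s s' ∧
      (∀ b < m, s'.reals (A 3 b) = s.reals (A 3 b) + wA F G T q c m N t a b * X) ∧
      (∀ b < m, s'.reals (A 4 b) = s.reals (A 4 b) + wA F G T q c m N t a b * Y) := by
  have hsub' : ∀ a, (a = 8 ∨ a = 9 ∨ a = 10 ∨ ∃ x, a = A 3 x ∨ a = A 4 x) →
      (8 ≤ a ∧ a < 32) ∨ ∃ x, a = A 2 x ∨ a = A 3 x ∨ a = A 4 x := by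
    rintro a (h | h | h | ⟨x, h | h⟩)
    · left; omega
    · left; omega
    · left; omega
    · exact Or.inr ⟨x, Or.inr (Or.inl h)⟩
    · exact Or.inr ⟨x, Or.inr (Or.inr h)⟩
  refine wp_forTo (T := B * 40 + 180) (fun j s' =>
    Frame (fun a => a = 16)
      (fun a => a = 8 ∨ a = 9 ∨ a = 10 ∨ ∃ x, a = A 3 x ∨ a = A 4 x) s s' ∧
    s'.words 16 = j ∧
    (∀ b < m, s'.reals (A 3 b) = s.reals (A 3 b) +
      if b < j then wA F G T q c m N t a b * X else 0) ∧
    (∀ b < m, s'.reals (A 4 b) = s.reals (A 4 b) +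
      if b < j then wA F G T q c m N t a b * Y else 0)) m (by norm_num)
    (by norm_num) ?_ ?_ ?_ ?_
  · exact ⟨(Frame.refl _ _ s).putWord (by simp), by simp, by simp, by simp⟩
  · rintro b s' - ⟨hf, h16, -⟩
    exact ⟨h16, by rw [hf.words 5 (by norm_num), hE.w5]⟩
  · rintro j s' hj ⟨hf, h16, hP, hP'⟩ - -
    have hE' := hE.frame hf (by simp) hsub'
    have hz := abs_zA_le F G T q c m N t a hj
    have hz' : |zA F G T q c m N t a j| ≤ m := hz.trans (by exact_mod_cast hcm)
    have e2 : s'.reals (A 2 j) = zA F G T q c m N t a j :=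
      (hf.reals _ (by simp)).trans (hZ j hj)
    have e14 := (hf.reals 14 (by simp)).trans h14
    have e15 := (hf.reals 15 (by simp)).trans h15
    obtain ⟨hv0, hv1⟩ := rnd_arg_bounds hm hz'
    refine Wp.seq 20 (B * 40 + 160) (Wp.setReal 8 ((m : ℝ) ^ 2 * zA F G T q c m N t a j +
      (m : ℝ) ^ 8) rfl (by simp [hE'.r4, hE'.r5, h16, e2]) ?_) (by omega)
    refine Wp.seq (B * 40 + 80) 80 ((wp_floorProg (B := B) (by simp [hE'.r3])
      (by simp) hv0 ?_).mono le_rfl ?_) (by omega)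
    · have : (0 : ℝ) < 2 ^ B := by positivity
      rw [pow_succ (2 : ℝ) B]; linarith
    rintro s₂ ⟨hf₂, h9⟩
    have hf₂' := (hf.putReal (a := 8) (v := ((m : ℝ) ^ 2 * zA F G T q c m N t a j +
      (m : ℝ) ^ 8)) (by simp)).trans hf₂ (by simp) (by rintro a (h | h) <;> simp [h])
    have hE₂ := hE.frame hf₂' (by simp) hsub'
    have f16 : s₂.words 16 = j := by rw [hf₂.words 16 (by simp)]; simp [h16]
    have f14 := (hf₂'.reals 14 (by simp)).trans h14
    have f15 := (hf₂'.reals 15 (by simp)).trans h15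
    have f3 : ∀ b, s₂.reals (A 3 b) = s'.reals (A 3 b) := fun b => by
      rw [hf₂.reals _ (by simp)]; simp
    have f4 : ∀ b, s₂.reals (A 4 b) = s'.reals (A 4 b) := fun b => by
      rw [hf₂.reals _ (by simp)]; simp
    refine Wp.setReal_seq (A 3 j) (s'.reals (A 3 j) + wA F G T q c m N t a j * X)
      (by simp [f16]) (by simp [f16, f3, h9, f14, hE₂.r5, wA, rnd]) ?_
    refine Wp.setReal (A 4 j) (s'.reals (A 4 j) + wA F G T q c m N t a j * Y)
      (by simp [f16]) (by simp [f16, f4, h9, f15, hE₂.r5, wA, rnd]) ?_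
    refine ⟨by simp [f16], ((hf₂'.putReal (Or.inr (Or.inr (Or.inr ⟨j, Or.inl rfl⟩)))).putReal
      (Or.inr (Or.inr (Or.inr ⟨j, Or.inr rfl⟩)))).putWord (by simp), by simp, ?_, ?_⟩
    · intro b hb
      have h2 : b < j + 1 ↔ b < j ∨ b = j := by omega
      by_cases h : b = j
      · subst h; simp [hP b hb]
      · simp [h, h2, f3, hP b hb]
    · intro b hb
      have h2 : b < j + 1 ↔ b < j ∨ b = j := by omega
      by_cases h : b = j
      · subst h; simp [hP' b hb]
      · simp [h, h2, f4, hP' b hb]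
  · rintro s' ⟨hf, -, hP, hP'⟩
    exact ⟨hf, fun b hb => by rw [hP b hb, if_pos hb], fun b hb => by rw [hP' b hb, if_pos hb]⟩

/-- Packs the sum of one group, and moves on to the next places. -/
def packStep : Prog :=
  .seq groupSum <|
  .seq packProg <|
  .seq (.setReal (.lit 14) (.mul (rc 14) (rc 3))) (.setReal (.lit 15) (.mul (rc 15) (rc 6)))

/-- Packs the coordinates of all rounded group sums: coordinate `b` of the `g = c ^ 5` groups `a`
becomes the base-`2 ^ B` number with digit `a` at place `a` in real array 3, and at place `g * a` in
real array 4. -/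
def packAll : Prog :=
  .seq (zeroArr 3) <|
  .seq (zeroArr 4) <|
  .seq (.setReal (.lit 14) (.ofWord (.lit 1))) <|
  .seq (.setReal (.lit 15) (.ofWord (.lit 1))) (forTo 17 0 packStep)

theorem wp_packAll {s : State} (hE : Env F G T q c m N t B τ cap s)
    (hm : 1 ≤ m) (hcm : c ≤ m) (hB : 4 * (m : ℝ) ^ 8 ≤ 2 ^ B)
    (hNV : c ^ 5 * c ≤ V) (hxV : (t * (N + 1) + c ^ 5 * c) * m ≤ V) :
    Wp V packAll (c ^ 5 * (c * (m * 226 + 213) + m * (B * 40 + 218) + 63) + m * 50 + 50) s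
      fun s' =>
      Frame (fun a => a = 12 ∨ (16 ≤ a ∧ a ≤ 20))
        (fun a => (8 ≤ a ∧ a ≤ 15) ∨ ∃ x, a = A 2 x ∨ a = A 3 x ∨ a = A 4 x) s s' ∧
      (∀ b < m, s'.reals (A 3 b) =
        ∑ a ∈ Finset.range (c ^ 5), wA F G T q c m N t a b * ((2 : ℝ) ^ B) ^ a) ∧
      (∀ b < m, s'.reals (A 4 b) =
        ∑ a ∈ Finset.range (c ^ 5), wA F G T q c m N t a b * (((2 : ℝ) ^ B) ^ c ^ 5) ^ a) ∧
      s'.reals 15 = (((2 : ℝ) ^ B) ^ c ^ 5) ^ c ^ 5 := by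
  have hsub : ∀ a, (a = 12 ∨ (16 ≤ a ∧ a ≤ 20)) → (12 ≤ a ∧ a < 32) ∨ ∃ x, a = A 1 x := by
    intro a h; left; omega
  have hsub' : ∀ a, ((8 ≤ a ∧ a ≤ 15) ∨ ∃ x, a = A 2 x ∨ a = A 3 x ∨ a = A 4 x) →
      (8 ≤ a ∧ a < 32) ∨ ∃ x, a = A 2 x ∨ a = A 3 x ∨ a = A 4 x := by
    rintro a (h | h)
    · left; omega
    · exact Or.inr h
  have s3 : ∀ a, (∃ x, a = A 3 x) →
      ((8 ≤ a ∧ a ≤ 15) ∨ ∃ x, a = A 2 x ∨ a = A 3 x ∨ a = A 4 x) :=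
    fun a ⟨x, h⟩ => Or.inr ⟨x, Or.inr (Or.inl h)⟩
  have s4 : ∀ a, (∃ x, a = A 4 x) →
      ((8 ≤ a ∧ a ≤ 15) ∨ ∃ x, a = A 2 x ∨ a = A 3 x ∨ a = A 4 x) :=
    fun a ⟨x, h⟩ => Or.inr ⟨x, Or.inr (Or.inr h)⟩
  refine Wp.seq (m * 25 + 10) (c ^ 5 * (c * (m * 226 + 213) + m * (B * 40 + 218) + 63) +
    m * 25 + 40) ((wp_zeroArr hE.w5 (by norm_num)).mono le_rfl ?_) (by omega)
  rintro s₁ ⟨hf₁, hz₁⟩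
  have hf₁' := (Frame.refl (fun a => a = 12 ∨ (16 ≤ a ∧ a ≤ 20)) (fun a => (8 ≤ a ∧ a ≤ 15) ∨
    ∃ x, a = A 2 x ∨ a = A 3 x ∨ a = A 4 x) s).trans hf₁ (by simp) s3
  refine Wp.seq (m * 25 + 10) (c ^ 5 * (c * (m * 226 + 213) + m * (B * 40 + 218) + 63) +
    30) ((wp_zeroArr (hE.frame hf₁' hsub hsub').w5 (by norm_num)).mono le_rfl ?_) (by omega)
  rintro s₂ ⟨hf₂, hz₂⟩
  have hf₂' := hf₁'.trans hf₂ (by simp) s4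
  refine Wp.seq 10 (c ^ 5 * (c * (m * 226 + 213) + m * (B * 40 + 218) + 63) + 20)
    (Wp.setReal 14 1 rfl (by simp) ?_) (by omega)
  refine Wp.seq 10 (c ^ 5 * (c * (m * 226 + 213) + m * (B * 40 + 218) + 63) + 10)
    (Wp.setReal 15 1 rfl (by simp) ?_) (by omega)
  refine Wp.mono (wp_forTo (T := c * (m * 226 + 213) + m * (B * 40 + 218) + 50) (fun a s' =>
    Frame (fun a => a = 12 ∨ (16 ≤ a ∧ a ≤ 20))
        (fun a => (8 ≤ a ∧ a ≤ 15) ∨ ∃ x, a = A 2 x ∨ a = A 3 x ∨ a = A 4 x) s s' ∧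
    s'.words 17 = a ∧ s'.reals 14 = ((2 : ℝ) ^ B) ^ a ∧
    s'.reals 15 = (((2 : ℝ) ^ B) ^ c ^ 5) ^ a ∧
    (∀ b < m, s'.reals (A 3 b) =
        ∑ a ∈ Finset.range a, wA F G T q c m N t a b * ((2 : ℝ) ^ B) ^ a) ∧
    (∀ b < m, s'.reals (A 4 b) =
        ∑ a ∈ Finset.range a, wA F G T q c m N t a b * (((2 : ℝ) ^ B) ^ c ^ 5) ^ a))
    (c ^ 5) (by norm_num) (by norm_num) ?_ ?_ ?_ ?_) le_rfl (fun _ h => h)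
  · refine ⟨((hf₂'.putReal (by simp)).putReal (by simp)).putWord (by simp), by simp, by simp,
      by simp, ?_, ?_⟩
    · intro b hb
      simp [hf₂.reals, hz₁ b hb]
    · intro b hb
      simp [hz₂ b hb]
  · rintro a s' - ⟨hf, h17, -⟩
    exact ⟨h17, by rw [hf.words 0 (by norm_num), hE.w0]⟩
  · rintro a s' ha ⟨hf, h17, h14, h15, hP, hP'⟩ - -
    have hac : a * c + c ≤ c ^ 5 * c := by
      have := Nat.mul_le_mul_right c (Nat.succ_le_of_lt ha)
      rwa [Nat.succ_mul] at this
    have hE' := hE.frame hf hsub hsub'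
    refine Wp.seq (c * (m * 226 + 213) + m * 25 + 20) (m * (B * 40 + 193) + 30)
      ((wp_groupSum hE' h17 (by omega)
        (le_trans (Nat.mul_le_mul_right _ (by omega)) hxV)).mono le_rfl ?_) (by ring_nf; omega)
    rintro s₃ ⟨hf₃, hZ⟩
    have hf₃' := hf.trans hf₃ (by intro a h; omega) (by
      rintro a (h | h | h | ⟨x, h⟩)
      · left; omega
      · left; omega
      · left; omega
      · exact Or.inr ⟨x, Or.inl h⟩)
    have hE₃ := hE.frame hf₃' hsub hsub'
    refine Wp.seq (m * (B * 40 + 193) + 10) 20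
      ((wp_packProg (a := a) hE₃ hm hcm hB ((hf₃.reals 14 (by simp)).trans h14)
        ((hf₃.reals 15 (by simp)).trans h15) hZ).mono le_rfl ?_) (by omega)
    rintro s₄ ⟨hf₄, hQ, hQ'⟩
    have hf₄' := hf₃'.trans hf₄ (by intro a h; omega) (by
      rintro a (h | h | h | ⟨x, h⟩)
      · left; omega
      · left; omega
      · left; omega
      · exact Or.inr ⟨x, Or.inr h⟩)
    have hE₄ := hE.frame hf₄' hsub hsub'
    have g14 : s₄.reals 14 = ((2 : ℝ) ^ B) ^ a := by
      rw [hf₄.reals 14 (by simp), hf₃.reals 14 (by simp), h14]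
    have g15 : s₄.reals 15 = (((2 : ℝ) ^ B) ^ c ^ 5) ^ a := by
      rw [hf₄.reals 15 (by simp), hf₃.reals 15 (by simp), h15]
    refine Wp.setReal_seq 14 (((2 : ℝ) ^ B) ^ (a + 1)) rfl
      (by simp [g14, hE₄.r3, pow_succ]) ?_
    refine Wp.setReal 15 ((((2 : ℝ) ^ B) ^ c ^ 5) ^ (a + 1)) rfl
      (by simp [g15, hE₄.r6, pow_succ]) ?_
    refine ⟨?_, ((hf₄'.putReal (by simp)).putReal (by simp)).putWord (by simp), by simp,
      by simp, by simp, ?_, ?_⟩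
    · simp [hf₄.words 17, hf₃.words 17, h17]
    · intro b hb
      rw [Finset.sum_range_succ, ← hP b hb]
      simp [hQ b hb, hf₃.reals]
    · intro b hb
      rw [Finset.sum_range_succ, ← hP' b hb]
      simp [hQ' b hb, hf₃.reals]
  · rintro s' ⟨hf, -, -, h15, hP, hP'⟩
    exact ⟨hf, hP, hP', h15⟩

end

section

variable {V : ℕ} [hV : Fact (1048576 ≤ V)]

variable {F G : ℕ → ℝ} {T : ℕ → ℕ} {q c m N t B : ℕ} {τ cap : ℝ}

/-! ### Digits of the packed product -/

/-- Digit `e = a + g a'` (where `g = c ^ 5`) of the packed product: the inner product of the rounded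
sums of the groups `a` and `a'`. -/
def dA (F G : ℕ → ℝ) (T : ℕ → ℕ) (q c m N t e : ℕ) : ℝ :=
  ∑ b ∈ Finset.range m, wA F G T q c m N t (e % c ^ 5) b * wA F G T q c m N t (e / c ^ 5) b

theorem exists_int_dA (F G : ℕ → ℝ) (T : ℕ → ℕ) (q c m N t e : ℕ) :
    ∃ k : ℤ, dA F G T q c m N t e = k := by
  choose f hf using exists_int_rnd m
  refine ⟨∑ b ∈ Finset.range m, f (zA F G T q c m N t (e % c ^ 5) b) *
    f (zA F G T q c m N t (e / c ^ 5) b), ?_⟩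
  push_cast
  exact Finset.sum_congr rfl fun b _ => by rw [wA, wA, hf, hf]

theorem abs_dA_le (F G : ℕ → ℝ) (T : ℕ → ℕ) (q c N t e : ℕ) {m : ℕ} (hm : 1 ≤ m) (hcm : c ≤ m) :
    |dA F G T q c m N t e| ≤ (m : ℝ) ^ 8 := by
  have hm' : (1 : ℝ) ≤ m := by exact_mod_cast hm
  have hcm' : (c : ℝ) ≤ m := by exact_mod_cast hcm
  refine (Finset.abs_sum_le_sum_abs _ _).trans ?_
  refine (Finset.sum_le_card_nsmul _ _ ((m : ℝ) ^ 3 * (m : ℝ) ^ 3) fun b hb => ?_).trans ?_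
  · rw [abs_mul]
    have hb' := Finset.mem_range.1 hb
    gcongr
    · exact abs_rnd_le hm ((abs_zA_le F G T q c m N t _ hb').trans hcm')
    · exact abs_rnd_le hm ((abs_zA_le F G T q c m N t _ hb').trans hcm')
  · rw [Finset.card_range, nsmul_eq_mul]
    calc (m : ℝ) * ((m : ℝ) ^ 3 * (m : ℝ) ^ 3) = (m : ℝ) ^ 7 := by ring
      _ ≤ (m : ℝ) ^ 8 := pow_le_pow_right₀ hm' (by norm_num)

/-- A place `e < g * h` stands for the pair `(e % g, e / g)`. -/
theorem sum_range_mul_digits {M : Type*} [AddCommMonoid M] (g h : ℕ) (f : ℕ → ℕ → M) :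
    ∑ e ∈ Finset.range (g * h), f (e % g) (e / g) =
      ∑ a' ∈ Finset.range h, ∑ a ∈ Finset.range g, f a a' := by
  induction h with
  | zero => simp
  | succ h ih =>
    rw [Nat.mul_succ, Finset.sum_range_add, ih, Finset.sum_range_succ]
    congr 1
    refine Finset.sum_congr rfl fun a ha => ?_
    have ha' := Finset.mem_range.1 ha
    rw [Nat.mul_add_mod, Nat.mod_eq_of_lt ha', Nat.mul_add_div (by omega),
      Nat.div_eq_of_lt ha', add_zero]

/-- The digits of the sum of products of packed coordinates are the inner products of all pairs of
rounded group sums. -/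
theorem packed_product (F G : ℕ → ℝ) (T : ℕ → ℕ) (q c m N t : ℕ) (X : ℝ) :
    ∑ b ∈ Finset.range m,
      (∑ a ∈ Finset.range (c ^ 5), wA F G T q c m N t a b * X ^ a) *
      (∑ a ∈ Finset.range (c ^ 5), wA F G T q c m N t a b * (X ^ c ^ 5) ^ a) =
    ∑ e ∈ Finset.range (c ^ 5 * c ^ 5), dA F G T q c m N t e * X ^ e := by
  have h := sum_range_mul_digits (c ^ 5) (c ^ 5) (fun a a' =>
    (∑ b ∈ Finset.range m, wA F G T q c m N t a b * wA F G T q c m N t a' b) *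
      X ^ (a + c ^ 5 * a'))
  simp only [Nat.mod_add_div] at h
  unfold dA
  rw [h, Finset.sum_comm' (t' := Finset.range (c ^ 5)) (s' := fun _ => Finset.range (c ^ 5))
    (by simp)]
  simp_rw [Finset.sum_mul, Finset.mul_sum]
  rw [Finset.sum_comm]
  refine Finset.sum_congr rfl fun a _ => ?_
  rw [Finset.sum_comm]
  refine Finset.sum_congr rfl fun a' _ => Finset.sum_congr rfl fun b _ => ?_
  rw [pow_add, pow_mul]; ring

/-- All lower digits together amount to less than half a unit of the next place. -/
theorem abs_sum_digits_le {d : ℕ → ℝ} {H X : ℝ} (hd : ∀ e, |d e| ≤ H) (hX : 2 * H + 1 ≤ X)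
    (E : ℕ) : |∑ e ∈ Finset.range E, d e * X ^ e| ≤ (X ^ E - 1) / 2 := by
  have hH : 0 ≤ H := (abs_nonneg _).trans (hd 0)
  have hX0 : 0 ≤ X := by linarith
  induction E with
  | zero => simp
  | succ E ih =>
    rw [Finset.sum_range_succ]
    refine (abs_add_le _ _).trans ?_
    have h1 : |d E * X ^ E| ≤ (X - 1) / 2 * X ^ E := by
      rw [abs_mul, abs_of_nonneg (pow_nonneg hX0 E)]
      have := hd E
      gcongr
      linarith
    have : X ^ (E + 1) = X * X ^ E := by ring
    rw [this]; linarith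

/-- The top digit of a number with small integer digits in a large base is found by rounding. -/
theorem floor_top_digit {d : ℕ → ℝ} {H : ℕ} {X : ℝ} (hd : ∀ e, |d e| ≤ H)
    (hint : ∀ e, ∃ k : ℤ, d e = k) (hX : 2 * (H : ℝ) + 1 ≤ X) (E : ℕ) :
    (⌊(∑ e ∈ Finset.range (E + 1), d e * X ^ e) / X ^ E + 1 / 2 + H⌋₊ : ℝ) = d E + H ∧
    0 ≤ (∑ e ∈ Finset.range (E + 1), d e * X ^ e) / X ^ E + 1 / 2 + H ∧
    (∑ e ∈ Finset.range (E + 1), d e * X ^ e) / X ^ E + 1 / 2 + H < 2 * H + 1 := by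
  have hX0 : 0 < X := by have : (0 : ℝ) ≤ H := by positivity
                         linarith
  have hXE : 0 < X ^ E := pow_pos hX0 E
  have h1 := abs_sum_digits_le hd hX E
  rw [Finset.sum_range_succ, add_div, mul_div_assoc, div_self hXE.ne', mul_one]
  set r := (∑ e ∈ Finset.range E, d e * X ^ e) / X ^ E with hr
  have hr' : |r| < 1 / 2 := by
    rw [hr, abs_div, abs_of_pos hXE, div_lt_iff₀ hXE]; linarith
  obtain ⟨h2, h3⟩ := abs_lt.1 hr'
  obtain ⟨k, hk⟩ := hint E
  obtain ⟨h4, h5⟩ := abs_le.1 (hd E)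
  have hkH : (0 : ℤ) ≤ k + H := by
    rw [hk] at h4
    have : (-(H : ℤ)) ≤ k := by exact_mod_cast h4
    omega
  obtain ⟨j, hj⟩ := Int.eq_ofNat_of_zero_le hkH
  have hj' : d E + H = (j : ℝ) := by rw [hk]; exact_mod_cast hj
  refine ⟨?_, by linarith, by linarith⟩
  have : ⌊r + d E + 1 / 2 + (H : ℝ)⌋₊ = j := by
    rw [Nat.floor_eq_iff (by linarith)]
    constructor <;> linarith
  rw [this, hj']

/-- Puts the inner product of real arrays 3 and 4 into real cell 16. -/
def dotProg : Prog :=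
  .seq (.setReal (.lit 16) (.ofWord (.lit 0)))
    (forTo 16 5 (.setReal (.lit 16)
      (.add (rc 16) (.mul (.load (arr 3 (wc 16))) (.load (arr 4 (wc 16)))))))

theorem wp_dotProg {s : State} {P P' : ℕ → ℝ} (h5 : s.words 5 = m)
    (hP : ∀ b < m, s.reals (A 3 b) = P b) (hP' : ∀ b < m, s.reals (A 4 b) = P' b) :
    Wp V dotProg (m * 53 + 20) s fun s' =>
      Frame (fun a => a = 16) (fun a => a = 16) s s' ∧
      s'.reals 16 = ∑ b ∈ Finset.range m, P b * P' b := by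
  refine Wp.seq 5 (m * 53 + 10) (Wp.setReal 16 0 rfl (by simp) ?_) (by omega)
  refine wp_forTo (T := 40) (fun b s' => Frame (fun a => a = 16) (fun a => a = 16) s s' ∧
    s'.words 16 = b ∧ s'.reals 16 = ∑ b ∈ Finset.range b, P b * P' b) m (by norm_num)
    (by norm_num) ?_ ?_ ?_ ?_
  · exact ⟨((Frame.refl _ _ s).putReal (by simp)).putWord (by simp), by simp, by simp⟩
  · rintro b s' - ⟨hf, h16, -⟩
    exact ⟨h16, by rw [hf.words 5 (by norm_num), h5]⟩
  · rintro b s' hb ⟨hf, h16, h12⟩ - -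
    refine Wp.setReal 16 _ rfl rfl ?_
    refine ⟨by simp [h16], (hf.putReal rfl).putWord rfl, by simp, ?_⟩
    rw [Finset.sum_range_succ, ← h12, ← hP b hb, ← hP' b hb]
    simp [h16, hf.reals]
  · rintro s' ⟨hf, -, h12⟩
    exact ⟨hf, h12⟩

/-! ### Extraction of the large digits -/

/-- Appends the place of the current digit to the list in word array 1 if the square of the digit
reaches the threshold and the list is not yet full. -/
def recordProg : Prog :=
  .cond (.realLE (rc 0) (.mul (rc 8) (rc 8)))
    (.cond (.realLE (rc 7) (.ofWord (wc 23))) .skip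
      (.seq (.setWord (arr 1 (wc 23)) (.sub (wc 1) (.add (wc 22) (.lit 1))))
        (.setWord (.lit 23) (.add (wc 23) (.lit 1)))))
    .skip

/-- Splits the top digit off real cell 16, and records its place if it is large. Real cell 5 is
added before rounding because `floorProg` expects a nonnegative number. -/
def digitStep : Prog :=
  .seq (.setReal (.lit 17) (.div (rc 17) (rc 3))) <|
  .seq (.setReal (.lit 8) (.add (.add (.div (rc 16) (rc 17))
    (.div (.ofWord (.lit 1)) (.ofWord (.lit 2)))) (rc 5))) <|
  .seq floorProg <|
  .seq (.setReal (.lit 8) (.sub (rc 9) (rc 5))) <|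
  .seq (.setReal (.lit 16) (.sub (rc 16) (.mul (rc 8) (rc 17)))) recordProg

/-- Reads the digits of real cell 16 from the top and lists the places of those whose square is at
least real cell 0, until the list has reached the length given by real cell 7. -/
def digitsProg : Prog :=
  .seq (.setReal (.lit 17) (rc 15)) <|
  .seq (.setWord (.lit 23) (.lit 0)) (forTo 22 1 digitStep)

open Classical in
/-- The number of places in `S` whose digit has a square of at least `τ`. -/
def bigCount (d : ℕ → ℝ) (τ : ℝ) (S : Finset ℕ) : ℕ := (S.filter fun e => τ ≤ d e * d e).card

/-- Word array 1 holds a list of `K` places below `M`, which contains all large digits in `S`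
unless there are more than `cap` of them. -/
structure Listed (d : ℕ → ℝ) (τ cap : ℝ) (M : ℕ) (S : Finset ℕ) (K : ℕ) (s : State) : Prop where
  le_count : K ≤ bigCount d τ S
  lt_cap : (K : ℝ) < max cap 0 + 1
  mem : ∀ f < K, s.words (A 1 f) < M
  complete : (bigCount d τ S : ℝ) ≤ cap → ∀ e ∈ S, τ ≤ d e * d e → ∃ f < K, s.words (A 1 f) = e

/-- The invariant: after `j` steps, real cell 16 holds the number formed by the digits that are
still to be read, and the list contains the large digits among the top `j` places. -/
theorem wp_digitsProg {s : State} (hE : Env F G T q c m N t B τ cap s)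
    (hm : 1 ≤ m) (hcm : c ≤ m) (hB : 4 * (m : ℝ) ^ 8 ≤ 2 ^ B) (hV1 : c ^ 5 * c ^ 5 ≤ V)
    (h15 : s.reals 15 = (((2 : ℝ) ^ B) ^ c ^ 5) ^ c ^ 5)
    (h16 : s.reals 16 = ∑ e ∈ Finset.range (c ^ 5 * c ^ 5),
      dA F G T q c m N t e * ((2 : ℝ) ^ B) ^ e) :
    Wp V digitsProg (c ^ 5 * c ^ 5 * (B * 40 + 233) + 20) s fun s' =>
      Frame (fun a => a = 22 ∨ a = 23 ∨ ∃ x, a = A 1 x)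
        (fun a => a = 8 ∨ a = 9 ∨ a = 10 ∨ a = 16 ∨ a = 17) s s' ∧
      ∃ K, s'.words 23 = K ∧
        Listed (dA F G T q c m N t) τ cap (c ^ 5 * c ^ 5) (Finset.range (c ^ 5 * c ^ 5)) K s' := by
  classical
  set M := c ^ 5 * c ^ 5 with hM
  set X : ℝ := 2 ^ B with hX
  set d := dA F G T q c m N t with hdd
  have hm' : (1 : ℝ) ≤ m := by exact_mod_cast hm
  have hm8 : (1 : ℝ) ≤ (m : ℝ) ^ 8 := one_le_pow₀ hm'
  have hX0 : 0 < X := by positivity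
  have hsub : ∀ a, (a = 22 ∨ a = 23 ∨ ∃ x, a = A 1 x) →
      (12 ≤ a ∧ a < 32) ∨ ∃ x, a = A 1 x := by
    rintro a (h | h | h)
    · left; omega
    · left; omega
    · exact Or.inr h
  have hsub' : ∀ a, (a = 8 ∨ a = 9 ∨ a = 10 ∨ a = 16 ∨ a = 17) →
      (8 ≤ a ∧ a < 32) ∨ ∃ x, a = A 2 x ∨ a = A 3 x ∨ a = A 4 x := by
    rintro a h; left; omega
  refine Wp.seq 5 (M * (B * 40 + 233) + 15) (Wp.setReal 17 (X ^ M) rfl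
    (by simp [h15, hM, pow_mul]) ?_) (by omega)
  refine Wp.seq 5 (M * (B * 40 + 233) + 10) (Wp.setWord 23 0 rfl (by simp) (by simp) ?_) (by omega)
  refine wp_forTo (T := B * 40 + 220) (fun j s' =>
    Frame (fun a => a = 22 ∨ a = 23 ∨ ∃ x, a = A 1 x)
        (fun a => a = 8 ∨ a = 9 ∨ a = 10 ∨ a = 16 ∨ a = 17) s s' ∧
    s'.words 22 = j ∧ s'.reals 17 = X ^ (M - j) ∧
    s'.reals 16 = ∑ e ∈ Finset.range (M - j), d e * X ^ e ∧
    ∃ K, s'.words 23 = K ∧ Listed d τ cap M (Finset.Ico (M - j) M) K s') M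
    (by norm_num) (by norm_num) ?_ ?_ ?_ ?_
  · refine ⟨(((Frame.refl _ _ s).putReal (by simp)).putWord (by simp)).putWord (by simp), by simp,
      by simp, by simpa using h16, 0, by simp, by simp, ?_, by simp, by simp⟩
    have : 0 ≤ max cap 0 := le_max_right _ _
    push_cast; linarith
  · rintro a s' - ⟨hf, h22, -⟩
    exact ⟨h22, by rw [hf.words 1 (by simp), hE.w1]⟩
  · rintro j s' hj ⟨hf, h22, h17, h16, K, h23, hL⟩ - -
    have hE' := hE.frame hf hsub hsub'
    obtain ⟨E, hEj⟩ : ∃ E, M - j = E + 1 := ⟨M - j - 1, by omega⟩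
    have hEj' : M - (j + 1) = E := by omega
    rw [hEj] at h17 h16 hL
    rw [hEj']
    obtain ⟨t1, t2, t3⟩ := floor_top_digit (d := d) (H := m ^ 8) (X := X)
      (fun e => by
        have := abs_dA_le F G T q c N t e hm hcm
        push_cast; exact this)
      (fun e => exists_int_dA F G T q c m N t e) (by push_cast; linarith) E
    push_cast at t1 t2 t3
    have hXE : X ^ (E + 1) / X = X ^ E := by rw [pow_succ]; field_simp
    refine Wp.seq 10 (B * 40 + 210) (Wp.setReal 17 (X ^ E) rfl
      (by simp [h17, hE'.r3, ← hX, hXE]) ?_) (by omega)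
    refine Wp.seq 20 (B * 40 + 190) (Wp.setReal 8 _ rfl
      (by simp only [rev_add, rev_div, rev_load, ev_lit, putReal_reals]
          norm_num
          rw [h16, hE'.r5]) ?_) (by omega)
    refine Wp.seq (B * 40 + 80) 110 ((wp_floorProg (B := B) (by simp [hE'.r3])
      (by simp) t2 ?_).mono le_rfl ?_) (by omega)
    · rw [pow_succ (2 : ℝ) B]; linarith
    rintro s₂ ⟨hf₂, h9⟩
    rw [t1] at h9
    have hf₂' := ((hf.putReal (a := 17) (v := X ^ E) (by simp)).putReal (a := 8) (v := _)
      (by simp)).trans hf₂ (by simp) (by rintro a (h | h) <;> simp [h])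
    have hE₂ := hE.frame hf₂' hsub hsub'
    have g17 : s₂.reals 17 = X ^ E := by rw [hf₂.reals 17 (by simp)]; simp
    have g16 : s₂.reals 16 = ∑ e ∈ Finset.range (E + 1), d e * X ^ e := by
      rw [hf₂.reals 16 (by simp)]; simp [h16]
    refine Wp.setReal_seq 8 (d E) rfl (by simp [h9, hE₂.r5]) ?_
    refine Wp.setReal_seq 16 (∑ e ∈ Finset.range E, d e * X ^ e) rfl
      (by simp [g17, g16, Finset.sum_range_succ]) ?_
    set s₃ := ((s₂.putReal 8 (d E)).putReal 16 (∑ e ∈ Finset.range E, d e * X ^ e)) with hs₃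
    have hf₃ : Frame (fun a => a = 22 ∨ a = 23 ∨ ∃ x, a = A 1 x)
        (fun a => a = 8 ∨ a = 9 ∨ a = 10 ∨ a = 16 ∨ a = 17) s s₃ := (hf₂'.putReal (a := 8) (v := d E) (by simp)).putReal (a := 16)
      (v := ∑ e ∈ Finset.range E, d e * X ^ e) (by simp)
    have hE₃ : Env F G T q c m N t B τ cap s₃ := hE.frame hf₃ hsub hsub'
    have w22 : s₃.words 22 = j := by simp [hs₃, hf₂.words, h22]
    have w23 : s₃.words 23 = K := by simp [hs₃, hf₂.words, h23]
    have wA : ∀ f, s₃.words (A 1 f) = s'.words (A 1 f) := fun f => by simp [hs₃, hf₂.words]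
    have r17 : s₃.reals 17 = X ^ E := by simp [hs₃, g17]
    have r16 : s₃.reals 16 = ∑ e ∈ Finset.range E, d e * X ^ e := by simp [hs₃]
    have r8 : s₃.reals 8 = d E := by simp [hs₃]
    have hIco : Finset.Ico E M = insert E (Finset.Ico (E + 1) M) := by
      ext x; simp only [Finset.mem_Ico, Finset.mem_insert]; omega
    have hKM : K < M := by
      refine (hL.le_count.trans (Finset.card_filter_le _ _)).trans_lt ?_
      simp; omega
    have hcnt : bigCount d τ (Finset.Ico E M) =
        bigCount d τ (Finset.Ico (E + 1) M) + if τ ≤ d E * d E then 1 else 0 := by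
      unfold bigCount
      rw [hIco, Finset.filter_insert]
      split_ifs with h
      · rw [Finset.card_insert_of_notMem (by simp)]
      · rfl
    refine Wp.ite (p := τ ≤ d E * d E) 60 5 (by simp [hE₃.r0, r8]) (fun hbig => ?_)
      (fun hbig => ?_)
    · rw [if_pos hbig] at hcnt
      refine Wp.ite (p := cap ≤ (K : ℝ)) 1 50 (by simp [hE₃.r7, w23]) (fun hc => ?_)
        (fun hc => ?_)
      · refine wp_skip ⟨w22, hf₃.putWord (by simp), by simp, by simp [r17], by simp [r16], K,
          by simp [w23], ?_, hL.lt_cap, fun f hf => by simpa [wA] using hL.mem f hf, ?_⟩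
        · rw [hcnt]; exact hL.le_count.trans (Nat.le_succ _)
        · intro h
          exfalso
          rw [hcnt] at h
          have : (K : ℝ) ≤ bigCount d τ (Finset.Ico (E + 1) M) := by exact_mod_cast hL.le_count
          push_cast at h
          linarith
      · refine Wp.setWord_seq (A 1 K) E (by simp [w23])
          (by simp [hE₃.w1, w22]; omega) (fun _ => by omega) ?_
        refine Wp.setWord 23 (K + 1) rfl (by simp [w23]) (fun _ => by omega) ?_
        refine ⟨by simp [w22], ((hf₃.putWord (by simp)).putWord (by simp)).putWord (by simp),
          by simp, by simp [r17], by simp [r16], K + 1, by simp, ?_, ?_, ?_, ?_⟩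
        · rw [hcnt]; exact Nat.succ_le_succ hL.le_count
        · have : cap ≤ max cap 0 := le_max_left _ _
          push_cast; push Not at hc; linarith
        · intro f hf'
          simp only [putWord_words, A_eq_A_self]
          by_cases h : f = K
          · simp [h]; omega
          · simpa [h, wA] using hL.mem f (by omega)
        · intro h e he hτ
          by_cases heE : e = E
          · exact ⟨K, by omega, by simp [heE]⟩
          · rw [hIco, Finset.mem_insert] at he
            obtain ⟨f, hf1, hf2⟩ := hL.complete (by
              rw [hcnt] at h; push_cast at h; linarith) e (he.resolve_left heE) hτ
            refine ⟨f, by omega, ?_⟩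
            simp [wA, hf2, show f ≠ K by omega]
    · rw [if_neg hbig, add_zero] at hcnt
      refine (wp_skip ⟨w22, hf₃.putWord (by simp), by simp, by simp [r17], by simp [r16], K,
        by simp [w23], by rw [hcnt]; exact hL.le_count, hL.lt_cap,
        fun f hf => by simpa [wA] using hL.mem f hf, ?_⟩).mono (by norm_num) (fun _ h => h)
      intro h e he hτ
      rw [hIco, Finset.mem_insert] at he
      rw [hcnt] at h
      rcases he with rfl | he
      · exact absurd hτ hbig
      obtain ⟨f, hf1, hf2⟩ := hL.complete h e he hτ
      exact ⟨f, hf1, by simp [wA, hf2]⟩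
  · rintro s' ⟨hf, -, -, -, K, h23, hL⟩
    refine ⟨hf, K, h23, ?_⟩
    rwa [Nat.sub_self, Nat.Ico_zero_eq_range] at hL

end

section

variable {V : ℕ} [hV : Fact (1048576 ≤ V)]

variable {F G : ℕ → ℝ} {T : ℕ → ℕ} {q c m N t B : ℕ} {τ cap : ℝ}

/-! ### The query program -/

/-- Emits the pairs in a square block of side given by word cell `b`, with corner in word cells 25
and 26. -/
def emitBlock (b : ℕ) : Prog :=
  forTo 18 b (forTo 16 b (.emit (.add (wc 25) (wc 18)) (.add (wc 26) (wc 16))))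

theorem wp_emitBlock {s : State} {b C x y : ℕ} (hb : b < 12) (hC : s.words b = C)
    (hx : s.words 25 = x) (hy : s.words 26 = y) :
    Wp V (emitBlock b) (C * (C * 24 + 23) + 10) s fun s' =>
      FrameO (fun a => a = 16 ∨ a = 18) (fun _ => False) s s' ∧
      ∀ u < C, ∀ u' < C, (x + u, y + u') ∈ s'.out := by
  refine wp_forTo (T := C * 24 + 10) (fun j s' =>
    FrameO (fun a => a = 16 ∨ a = 18) (fun _ => False) s s' ∧ s'.words 18 = j ∧
    ∀ u < j, ∀ u' < C, (x + u, y + u') ∈ s'.out) C (by norm_num) (by omega) ?_ ?_ ?_ ?_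
  · exact ⟨(FrameO.refl _ _ s).putWord (by simp), by simp, by simp⟩
  · rintro j s' - ⟨hf, h18, -⟩
    exact ⟨h18, by rw [hf.words b (by omega), hC]⟩
  · rintro j s' hj ⟨hf, h18, ho⟩ - -
    refine wp_forTo (T := 11) (fun i s'' =>
      FrameO (fun a => a = 16 ∨ a = 18) (fun _ => False) s s'' ∧ s''.words 18 = j ∧
      s''.words 16 = i ∧ (∀ u < j, ∀ u' < C, (x + u, y + u') ∈ s''.out) ∧
      ∀ u' < i, (x + j, y + u') ∈ s''.out) C (by norm_num) (by omega) ?_ ?_ ?_ ?_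
    · exact ⟨hf.putWord (by simp), by simp [h18], by simp, by simpa using ho, by simp⟩
    · rintro i s'' - ⟨hf'', -, h16, -⟩
      exact ⟨h16, by rw [hf''.words b (by omega), hC]⟩
    · rintro i s'' hi ⟨hf'', g18, g16, h1, h2⟩ - -
      have e25 := (hf''.words 25 (by simp)).trans hx
      have e26 := (hf''.words 26 (by simp)).trans hy
      refine Wp.emit (x + j) (y + i) (by simp [e25, g18]) (by simp [e26, g16]) ?_
      refine ⟨by simp [g16], (hf''.putOut _).putWord (by simp), by simp [g18], by simp, ?_, ?_⟩
      · intro u hu u' hu'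
        simp [h1 u hu u' hu']
      · intro u' hu'
        by_cases h : u' = i
        · simp [h]
        · simp [h2 u' (by omega)]
    · rintro s'' ⟨hf'', g18, g16, h1, h2⟩
      refine ⟨g18, hf''.putWord (by simp), by simp, fun u hu u' hu' => ?_⟩
      by_cases h : u = j
      · subst h; simpa using h2 u' hu'
      · simpa using h1 u (by omega) u' hu'
  · rintro s' ⟨hf, -, ho⟩
    exact ⟨hf, ho⟩

/-- Emits, for each place on the list, all pairs of rows in the two groups concerned. -/
def emitList : Prog :=
  forTo 22 23 <|
    .seq (.setWord (.lit 24) (.load (arr 1 (wc 22)))) <|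
    .seq (.setWord (.lit 25) (.mul (.mod (wc 24) (wc 0)) (wc 4))) <|
    .seq (.setWord (.lit 26) (.mul (.div (wc 24) (wc 0)) (wc 4))) (emitBlock 4)

theorem wp_emitList {s : State} {K : ℕ} (hE : Env F G T q c m N t B τ cap s)
    (h23 : s.words 23 = K) (hmem : ∀ f < K, s.words (A 1 f) < c ^ 5 * c ^ 5)
    (hcV : c ^ 5 * c ^ 5 ≤ V) (hcV' : c ^ 5 * c ≤ V) :
    Wp V emitList (K * (c * (c * 24 + 23) + 63) + 10) s fun s' =>
      FrameO (fun a => a = 16 ∨ a = 18 ∨ a = 22 ∨ a = 24 ∨ a = 25 ∨ a = 26)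
        (fun _ => False) s s' ∧
      ∀ f < K, ∀ u < c, ∀ u' < c,
        (s.words (A 1 f) % c ^ 5 * c + u, s.words (A 1 f) / c ^ 5 * c + u') ∈ s'.out := by
  refine wp_forTo (T := c * (c * 24 + 23) + 50) (fun j s' =>
    FrameO (fun a => a = 16 ∨ a = 18 ∨ a = 22 ∨ a = 24 ∨ a = 25 ∨ a = 26)
        (fun _ => False) s s' ∧ s'.words 22 = j ∧
    ∀ f < j, ∀ u < c, ∀ u' < c,
      (s.words (A 1 f) % c ^ 5 * c + u, s.words (A 1 f) / c ^ 5 * c + u') ∈ s'.out) K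
    (by norm_num) (by omega) ?_ ?_ ?_ ?_
  · exact ⟨(FrameO.refl _ _ s).putWord (by simp), by simp, by simp⟩
  · rintro j s' - ⟨hf, h22, -⟩
    exact ⟨h22, by rw [hf.words 23 (by simp), h23]⟩
  · rintro j s' hj ⟨hf, h22, ho⟩ - -
    have hE' := hE.frameO hf (by intro a h; left; omega) (by simp)
    have hA : s'.words (A 1 j) = s.words (A 1 j) := hf.words _ (by simp)
    set e := s.words (A 1 j) with he
    have hlt := hmem j hj
    have hdiv : e / c ^ 5 < c ^ 5 := Nat.div_lt_of_lt_mul hlt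
    have hmod : e % c ^ 5 < c ^ 5 := Nat.mod_lt _ (by
      rcases Nat.eq_zero_or_pos (c ^ 5) with h | h
      · rw [h] at hlt; omega
      · exact h)
    have b1 := Nat.mul_le_mul_right c hdiv.le
    have b2 := Nat.mul_le_mul_right c hmod.le
    refine Wp.seq 12 (c * (c * 24 + 23) + 38) (Wp.setWord 24 e rfl (by simp [h22, hA])
      (fun _ => by omega) ?_) (by omega)
    refine Wp.seq 12 (c * (c * 24 + 23) + 26) (Wp.setWord 25 (e % c ^ 5 * c) rfl
      (by simp [hE'.w0, hE'.w4]) (fun _ => by omega) ?_) (by omega)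
    refine Wp.seq 12 (c * (c * 24 + 23) + 14) (Wp.setWord 26 (e / c ^ 5 * c) rfl
      (by simp [hE'.w0, hE'.w4]) (fun _ => by omega) ?_) (by omega)
    refine (wp_emitBlock (C := c) (x := e % c ^ 5 * c) (y := e / c ^ 5 * c) (by norm_num)
      (by simp [hE'.w4]) (by simp) (by simp)).mono (by omega) ?_
    rintro s'' ⟨hf'', ho''⟩
    have hf3 := (((hf.putWord (a := 24) (v := e) (by simp)).putWord (a := 25)
      (v := e % c ^ 5 * c) (by simp)).putWord (a := 26) (v := e / c ^ 5 * c) (by simp)).trans hf''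
      (by rintro a (h | h) <;> simp [h]) (by simp)
    refine ⟨by simp [hf''.words, h22], hf3.putWord (by simp), by simp, fun f hf' u hu u' hu' => ?_⟩
    by_cases h : f = j
    · subst h; exact ho'' u hu u' hu'
    · exact hf''.out _ (ho f (by omega) u hu u' hu')
  · rintro s' ⟨hf, -, ho⟩
    exact ⟨hf, ho⟩

/-- The query for one trial: pack the group sums, multiply, read the digits, and emit the pairs of
rows from the listed pairs of groups. -/
def trialProg : Prog :=
  .seq (.setWord (.lit 9) (.mul (.add (.mul (wc 10) (.add (wc 6) (.lit 1))) (wc 6)) (wc 5))) <|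
  .seq (.setWord (.lit 11) (.mul (wc 10) (.add (wc 6) (.lit 8)))) <|
  .seq packAll <|
  .seq dotProg <|
  .seq digitsProg emitList

/-- Running time of one trial of the query, for a list of `K` places. -/
def trialTime (c m B K : ℕ) : ℕ :=
  c ^ 5 * (c * (m * 226 + 213) + m * (B * 40 + 218) + 63) + m * 103 +
    c ^ 5 * c ^ 5 * (B * 40 + 233) + K * (c * (c * 24 + 23) + 63) + 200

/-- What one trial of the query achieves: if not too many inner products of group sums are large,
then all pairs of rows from pairs of groups with a large inner product are emitted. -/
def TrialOut (F G : ℕ → ℝ) (T : ℕ → ℕ) (q c m N t : ℕ) (τ cap : ℝ) (o : List (ℕ × ℕ)) : Prop :=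
  (bigCount (dA F G T q c m N t) τ (Finset.range (c ^ 5 * c ^ 5)) : ℝ) ≤ cap →
    ∀ e < c ^ 5 * c ^ 5, τ ≤ dA F G T q c m N t e * dA F G T q c m N t e →
      ∀ u < c, ∀ u' < c, (e % c ^ 5 * c + u, e / c ^ 5 * c + u') ∈ o

/-- The word cells changed by a trial. -/
def TWords (a : ℕ) : Prop := a = 9 ∨ a = 11 ∨ (12 ≤ a ∧ a < 32) ∨ ∃ x, a = A 1 x

/-- The real cells changed by a trial. -/
def TReals (a : ℕ) : Prop := (8 ≤ a ∧ a < 32) ∨ ∃ x, a = A 2 x ∨ a = A 3 x ∨ a = A 4 x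

/-- The constants of the query that do not depend on the trial. -/
structure QEnv (F G : ℕ → ℝ) (T : ℕ → ℕ) (q c m N L B : ℕ) (τ cap : ℝ) (s : State) : Prop where
  w4 : s.words 4 = c
  w5 : s.words 5 = m
  w6 : s.words 6 = N
  w7 : s.words 7 = L
  w8 : s.words 8 = q
  w0 : s.words 0 = c ^ 5
  w1 : s.words 1 = c ^ 5 * c ^ 5
  r0 : s.reals 0 = τ
  r7 : s.reals 7 = cap
  r3 : s.reals 3 = 2 ^ B
  r4 : s.reals 4 = (m : ℝ) ^ 2
  r5 : s.reals 5 = (m : ℝ) ^ 8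
  r6 : s.reals 6 = (2 ^ B) ^ (c ^ 5)
  hF : ∀ x, s.reals (A 0 x) = F x
  hG : ∀ x, s.reals (A 1 x) = G x
  hT : ∀ x, s.words (A 0 x) = T x

theorem QEnv.frame {s s' : State} {ws rs : ℕ → Prop} {L : ℕ}
    (h : QEnv F G T q c m N L B τ cap s) (hf : FrameO ws rs s s')
    (hw : ∀ a, ws a → a = 10 ∨ TWords a) (hr : ∀ a, rs a → TReals a) :
    QEnv F G T q c m N L B τ cap s' := by
  have hw' : ∀ a, a < 9 → ¬ ws a := fun a ha h' => by
    rcases hw a h' with h1 | h1 | h1 | h1 | ⟨x, rfl⟩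
    any_goals omega
    have := le_A 1 x; omega
  have hr' : ∀ a, a < 8 → ¬ rs a := fun a ha h' => by
    rcases hr a h' with h1 | ⟨x, rfl | rfl | rfl⟩
    · omega
    · have := le_A 2 x; omega
    · have := le_A 3 x; omega
    · have := le_A 4 x; omega
  have hT' : ∀ x, ¬ ws (A 0 x) := fun x h' => by
    have := le_A 0 x
    rcases hw _ h' with h1 | h1 | h1 | h1 | ⟨y, h1⟩
    any_goals omega
    unfold A at h1; omega
  have hA : ∀ r x, r < 2 → ¬ rs (A r x) := fun r x hr2 h' => by
    rcases hr _ h' with h1 | ⟨y, h1⟩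
    · have := le_A r x; omega
    · unfold A at h1; omega
  have W : ∀ a, a < 9 → s'.words a = s.words a := fun a ha => hf.words a (hw' a ha)
  have R : ∀ a, a < 8 → s'.reals a = s.reals a := fun a ha => hf.reals a (hr' a ha)
  exact ⟨(W 4 (by norm_num)).trans h.w4, (W 5 (by norm_num)).trans h.w5,
    (W 6 (by norm_num)).trans h.w6, (W 7 (by norm_num)).trans h.w7,
    (W 8 (by norm_num)).trans h.w8, (W 0 (by norm_num)).trans h.w0,
    (W 1 (by norm_num)).trans h.w1, (R 0 (by norm_num)).trans h.r0,
    (R 7 (by norm_num)).trans h.r7, (R 3 (by norm_num)).trans h.r3,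
    (R 4 (by norm_num)).trans h.r4, (R 5 (by norm_num)).trans h.r5,
    (R 6 (by norm_num)).trans h.r6,
    fun x => (hf.reals _ (hA 0 x (by norm_num))).trans (h.hF x),
    fun x => (hf.reals _ (hA 1 x (by norm_num))).trans (h.hG x),
    fun x => (hf.words _ (hT' x)).trans (h.hT x)⟩

theorem wp_trialProg {s : State} {L : ℕ} (hQ : QEnv F G T q c m N L B τ cap s)
    (h10 : s.words 10 = t)
    (hm : 1 ≤ m) (hcm : c ≤ m) (hB : 4 * (m : ℝ) ^ 8 ≤ 2 ^ B) (hN : c ^ 5 * c = N)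
    (htL : t < L) (hLV : L * (N + 8) ≤ V) (hxV : L * (N + 1) * m ≤ V)
    (hV1 : c ^ 5 * c ^ 5 ≤ V) :
    Wp V trialProg (trialTime c m B ⌈max cap 0⌉₊) s fun s' =>
      FrameO TWords TReals s s' ∧ TrialOut F G T q c m N t τ cap s'.out := by
  have hLV' : t * (N + 8) + (N + 8) ≤ V := by
    have := Nat.mul_le_mul_right (N + 8) (Nat.succ_le_of_lt htL)
    rw [Nat.succ_mul] at this; omega
  have hxV' : (t * (N + 1) + N) * m ≤ V := by
    have h2 := Nat.mul_le_mul_right (N + 1) (Nat.succ_le_of_lt htL)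
    rw [Nat.succ_mul] at h2
    exact (Nat.mul_le_mul_right m (by omega)).trans hxV
  have hF0 := FrameO.refl TWords TReals s
  unfold trialTime
  refine Wp.seq 20 (c ^ 5 * (c * (m * 226 + 213) + m * (B * 40 + 218) + 63) + m * 103 +
    c ^ 5 * c ^ 5 * (B * 40 + 233) + ⌈max cap 0⌉₊ * (c * (c * 24 + 23) + 63) + 180)
    (Wp.setWord 9 ((t * (N + 1) + N) * m) rfl
    (by simp [h10, hQ.w6, hQ.w5]) (fun _ => hxV') ?_) (by omega)
  refine Wp.seq 20 (c ^ 5 * (c * (m * 226 + 213) + m * (B * 40 + 218) + 63) + m * 103 +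
    c ^ 5 * c ^ 5 * (B * 40 + 233) + ⌈max cap 0⌉₊ * (c * (c * 24 + 23) + 63) + 160)
    (Wp.setWord 11 (t * (N + 8)) rfl
    (by simp [h10, hQ.w6]) (fun _ => by omega) ?_) (by omega)
  have hF1 := (hF0.putWord (a := 9) (v := (t * (N + 1) + N) * m) (Or.inl rfl)).putWord (a := 11)
    (v := t * (N + 8)) (Or.inr (Or.inl rfl))
  have hQ1 := hQ.frame hF1 (fun a h => Or.inr h) (fun a h => h)
  set s₁ := (s.putWord 9 ((t * (N + 1) + N) * m)).putWord 11 (t * (N + 8)) with hs₁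
  have hE : Env F G T q c m N t B τ cap s₁ :=
    ⟨hQ1.w4, hQ1.w5, hQ1.w6, hQ1.w8, by simp [hs₁], by simp [hs₁, h10], by simp [hs₁], hQ1.w0,
      hQ1.w1, hQ1.r0, hQ1.r7, hQ1.r3, hQ1.r4, hQ1.r5, hQ1.r6, hQ1.hF, hQ1.hG, hQ1.hT⟩
  refine Wp.seq (c ^ 5 * (c * (m * 226 + 213) + m * (B * 40 + 218) + 63) + m * 50 + 50)
    (m * 53 + c ^ 5 * c ^ 5 * (B * 40 + 233) + ⌈max cap 0⌉₊ * (c * (c * 24 + 23) + 63) + 110)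
    ((wp_packAll hE hm hcm hB (by omega) (by rw [hN]; exact hxV')).mono le_rfl ?_) (by omega)
  rintro s₂ ⟨hf₂, hP, hP', h15⟩
  have hE₂ := hE.frame hf₂ (by intro a h; left; omega) (by
    rintro a (h | h)
    · left; omega
    · exact Or.inr h)
  refine Wp.seq (m * 53 + 20)
    (c ^ 5 * c ^ 5 * (B * 40 + 233) + ⌈max cap 0⌉₊ * (c * (c * 24 + 23) + 63) + 90)
    ((wp_dotProg hE₂.w5 hP hP').mono le_rfl ?_) (by omega)
  rintro s₃ ⟨hf₃, h16⟩
  rw [packed_product] at h16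
  have hE₃ := hE₂.frame hf₃ (by intro a h; left; omega) (by intro a h; left; omega)
  refine Wp.seq (c ^ 5 * c ^ 5 * (B * 40 + 233) + 20)
    (⌈max cap 0⌉₊ * (c * (c * 24 + 23) + 63) + 70)
    ((wp_digitsProg hE₃ hm hcm hB hV1 (by rw [hf₃.reals 15 (by simp), h15]) h16).mono le_rfl ?_)
    (by omega)
  rintro s₄ ⟨hf₄, K, h23, hL⟩
  have hE₄ := hE₃.frame hf₄ (by
    rintro a (h | h | h)
    · left; omega
    · left; omega
    · exact Or.inr h) (by intro a h; left; omega)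
  have hK : K ≤ ⌈max cap 0⌉₊ := by
    have h1 := hL.lt_cap
    have h2 := Nat.le_ceil (max cap 0)
    have h3 : (K : ℝ) < (⌈max cap 0⌉₊ : ℝ) + 1 := by linarith
    have h4 : K < ⌈max cap 0⌉₊ + 1 := by exact_mod_cast h3
    omega
  have hK' := Nat.mul_le_mul_right (c * (c * 24 + 23) + 63) hK
  refine (wp_emitList hE₄ h23 hL.mem hV1 (by omega)).mono (by omega) ?_
  rintro s₅ ⟨hf₅, ho⟩
  constructor
  · refine (((hF1.trans hf₂.toO ?_ ?_).trans hf₃.toO ?_ ?_).trans hf₄.toO ?_ ?_).trans hf₅ ?_ ?_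
    · intro a h; exact Or.inr (Or.inr (Or.inl (by omega)))
    · rintro a (h | h)
      · exact Or.inl (by omega)
      · exact Or.inr h
    · intro a h; exact Or.inr (Or.inr (Or.inl (by omega)))
    · intro a h; exact Or.inl (by omega)
    · rintro a (h | h | h)
      · exact Or.inr (Or.inr (Or.inl (by omega)))
      · exact Or.inr (Or.inr (Or.inl (by omega)))
      · exact Or.inr (Or.inr (Or.inr h))
    · intro a h; exact Or.inl (by omega)
    · intro a h; exact Or.inr (Or.inr (Or.inl (by omega)))
    · intro a h; exact h.elim
  · intro hcount e he hτ u hu u' hu'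
    obtain ⟨f, hf, rfl⟩ := hL.complete hcount e (Finset.mem_range.2 he) hτ
    exact ho f hf u hu u' hu'

/-- Emits all pairs of rows of the same group. -/
def sameGroup : Prog :=
  forTo 17 0 <|
    .seq (.setWord (.lit 25) (.mul (wc 17) (wc 4))) <|
    .seq (.setWord (.lit 26) (.mul (wc 17) (wc 4))) (emitBlock 4)

theorem wp_sameGroup {s : State} {g : ℕ} (h4 : s.words 4 = c) (h0 : s.words 0 = g)
    (hV1 : g * c ≤ V) :
    Wp V sameGroup (g * (c * (c * 24 + 23) + 43) + 10) s fun s' =>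
      FrameO (fun a => 16 ≤ a ∧ a ≤ 26) (fun _ => False) s s' ∧
      ∀ a < g, ∀ u < c, ∀ u' < c, (a * c + u, a * c + u') ∈ s'.out := by
  refine wp_forTo (T := c * (c * 24 + 23) + 30) (fun j s' =>
    FrameO (fun a => 16 ≤ a ∧ a ≤ 26) (fun _ => False) s s' ∧ s'.words 17 = j ∧
      ∀ a < j, ∀ u < c, ∀ u' < c, (a * c + u, a * c + u') ∈ s'.out) g
    (by norm_num) (by omega) ?_ ?_ ?_ ?_
  · exact ⟨(FrameO.refl _ _ s).putWord (by simp), by simp, by simp⟩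
  · rintro j s' - ⟨hf, h17, -⟩
    exact ⟨h17, by rw [hf.words 0 (by simp), h0]⟩
  · rintro j s' hj ⟨hf, h17, ho⟩ - -
    have e4 := (hf.words 4 (by simp)).trans h4
    have b1 := Nat.mul_le_mul_right c hj.le
    refine Wp.seq 10 (c * (c * 24 + 23) + 20) (Wp.setWord 25 (j * c) rfl (by simp [h17, e4])
      (fun _ => by omega) ?_) (by omega)
    refine Wp.seq 10 (c * (c * 24 + 23) + 10) (Wp.setWord 26 (j * c) rfl (by simp [h17, e4])
      (fun _ => by omega) ?_) (by omega)
    refine (wp_emitBlock (C := c) (x := j * c) (y := j * c) (by norm_num)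
      (by simp [e4]) (by simp) (by simp)).mono (by omega) ?_
    rintro s'' ⟨hf'', ho''⟩
    have hf3 := ((hf.putWord (a := 25) (v := j * c) (by simp)).putWord (a := 26)
      (v := j * c) (by simp)).trans hf'' (by intro a h; omega) (by simp)
    refine ⟨by simp [hf''.words, h17], hf3.putWord (by simp), by simp, fun a ha u hu u' hu' => ?_⟩
    by_cases h : a = j
    · subst h; exact ho'' u hu u' hu'
    · exact hf''.out _ (ho a (by omega) u hu u' hu')
  · rintro s' ⟨hf, -, ho⟩
    exact ⟨hf, ho⟩

/-- The fifth power of word cell `i`. -/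
def wpow5 (i : ℕ) : WExp := .mul (.mul (.mul (.mul (wc i) (wc i)) (wc i)) (wc i)) (wc i)

/-- The threshold for squares of inner products of rounded group sums. -/
def thr (φ : ℝ) (m : ℕ) : ℝ := (φ / 2 * (m : ℝ) ^ 4) * (φ / 2 * (m : ℝ) ^ 4)

/-- The bound on the number of listed pairs of groups. -/
def capR (k : ℕ) (R φ : ℝ) (c : ℕ) : ℝ :=
  2048 * (1 + (k + R * R)) * (c ^ 5 * c ^ 3 : ℕ) / (φ * φ)

/-- The base-two logarithm of the base used for packing. -/
def baseLog (m : ℕ) : ℕ := Nat.log 2 (4 * m ^ 8) + 1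

/-- Computes the constants of the query: the numbers `c ^ 5` and `c ^ 10`, the scaling factors
`m ^ 2` and `m ^ 8`, the threshold, the bound for the length of the list, and the bases `2 ^ B` and
`2 ^ (B * c ^ 5)` for packing. -/
def setupProg : Prog :=
  .seq (.setWord (.lit 0) (wpow5 4)) <|
  .seq (.setWord (.lit 1) (.mul (wc 0) (wc 0))) <|
  .seq (.setReal (.lit 4) (.ofWord (.mul (wc 5) (wc 5)))) <|
  .seq (.setReal (.lit 5) (.mul (.mul (rc 4) (rc 4)) (.mul (rc 4) (rc 4)))) <|
  .seq (.setReal (.lit 0) (.mul (.mul (.div (rc 2) (.ofWord (.lit 2))) (.mul (rc 4) (rc 4)))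
    (.mul (.div (rc 2) (.ofWord (.lit 2))) (.mul (rc 4) (rc 4))))) <|
  .seq (.setReal (.lit 7) (.div (.mul (.mul (.ofWord (.lit 2048)) (.add (.ofWord (.lit 1))
    (.add (.ofWord (wc 2)) (.mul (rc 1) (rc 1)))))
    (.ofWord (.mul (wpow5 4) (.mul (.mul (wc 4) (wc 4)) (wc 4))))) (.mul (rc 2) (rc 2)))) <|
  .seq (.setReal (.lit 3) (.ofWord (.lit 1))) <|
  .seq (.loop (.realLE (rc 3) (.mul (.ofWord (.lit 4)) (rc 5)))
    (.setReal (.lit 3) (.mul (rc 3) (.ofWord (.lit 2))))) <|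
  .seq (.setReal (.lit 6) (.ofWord (.lit 1)))
    (forTo 17 0 (.setReal (.lit 6) (.mul (rc 6) (rc 3))))

theorem wp_setupProg {s : State} {L k : ℕ} {R φ : ℝ} (h4 : s.words 4 = c) (h5 : s.words 5 = m)
    (h6 : s.words 6 = N) (h7 : s.words 7 = L) (h8 : s.words 8 = q) (h2 : s.words 2 = k)
    (r1 : s.reals 1 = R) (r2 : s.reals 2 = φ) (hF : ∀ x, s.reals (A 0 x) = F x)
    (hG : ∀ x, s.reals (A 1 x) = G x) (hT : ∀ x, s.words (A 0 x) = T x)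
    (hV1 : c ^ 5 * c ^ 5 ≤ V) (hc : 1 ≤ c) (hm : 1 ≤ m) :
    Wp V setupProg (baseLog m * 20 + c ^ 5 * 30 + 300) s
      (QEnv F G T q c m N L (baseLog m) (thr φ m) (capR k R φ c)) := by
  have hV2 : c ^ 5 ≤ V := (Nat.le_mul_of_pos_left _ (by positivity)).trans hV1
  refine Wp.seq 20 (baseLog m * 20 + c ^ 5 * 30 + 280) (Wp.setWord 0 (c ^ 5) rfl
    (by simp [wpow5, h4]; ring) (fun _ => hV2) ?_) (by omega)
  refine Wp.seq 10 (baseLog m * 20 + c ^ 5 * 30 + 270) (Wp.setWord 1 (c ^ 5 * c ^ 5) rfl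
    (by simp) (fun _ => hV1) ?_) (by omega)
  refine Wp.seq 10 (baseLog m * 20 + c ^ 5 * 30 + 260) (Wp.setReal 4 ((m : ℝ) ^ 2) rfl
    (by simp [h5, sq]) ?_) (by omega)
  refine Wp.seq 15 (baseLog m * 20 + c ^ 5 * 30 + 240) (Wp.setReal 5 ((m : ℝ) ^ 8) rfl
    (by simp; ring) ?_) (by omega)
  refine Wp.seq 30 (baseLog m * 20 + c ^ 5 * 30 + 210) (Wp.setReal 0 (thr φ m) rfl
    (by simp [r2, thr]; ring) ?_) (by omega)
  refine Wp.seq 70 (baseLog m * 20 + c ^ 5 * 30 + 140) (Wp.setReal 7 (capR k R φ c) rfl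
    ?_ ?_) (by omega)
  · simp [wpow5, h4, h2, r1, r2, capR]
    ring
  refine Wp.seq 5 (baseLog m * 20 + c ^ 5 * 30 + 130) (Wp.setReal 3 1 rfl
    (by simp) ?_) (by omega)
  set s₁ := (((((((s.putWord 0 (c ^ 5)).putWord 1 (c ^ 5 * c ^ 5)).putReal 4
    ((m : ℝ) ^ 2)).putReal 5 ((m : ℝ) ^ 8)).putReal 0 (thr φ m)).putReal 7
    (capR k R φ c)).putReal 3 1) with hs₁
  refine Wp.seq (baseLog m * 20 + 10) (c ^ 5 * 30 + 120) ((wp_loop (t := 7) (fun j s' =>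
    Frame (fun _ => False) (fun a => a = 3) s₁ s' ∧ s'.reals 3 = 2 ^ j) (baseLog m) (by decide)
    (Q := fun s' => Frame (fun _ => False) (fun a => a = 3) s₁ s' ∧ s'.reals 3 = 2 ^ baseLog m)
    ?_ ?_ ?_).mono ?_ ?_) (by omega)
  · rintro j s' hj ⟨hf, h3⟩
    have e5 : s'.reals 5 = (m : ℝ) ^ 8 := by rw [hf.reals 5 (by simp)]; simp [hs₁]
    refine ⟨?_, Wp.setReal 3 (2 ^ (j + 1)) rfl (by simp [h3, pow_succ]) ?_⟩
    · simp only [tev_realLE, rev_load, ev_lit, h3, rev_mul, rev_ofWord, e5]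
      have : 2 ^ j ≤ 4 * m ^ 8 :=
        Nat.pow_le_of_le_log (by positivity) (by unfold baseLog at hj; omega)
      exact_mod_cast this
    · exact ⟨hf.putReal rfl, by simp⟩
  · rintro s' ⟨hf, h3⟩
    have e5 : s'.reals 5 = (m : ℝ) ^ 8 := by rw [hf.reals 5 (by simp)]; simp [hs₁]
    refine ⟨?_, hf, h3⟩
    simp only [tev_realLE, rev_load, ev_lit, h3, rev_mul, rev_ofWord, e5, not_le]
    have : 4 * m ^ 8 < 2 ^ baseLog m := Nat.lt_pow_succ_log_self (by norm_num) _
    exact_mod_cast this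
  · exact ⟨Frame.refl _ _ _, by simp [hs₁]⟩
  · have : (Test.realLE (rc 3) (.mul (.ofWord (.lit 4)) (rc 5))).cost = 8 := rfl
    rw [this]; omega
  rintro s₂ ⟨hf₂, h3⟩
  refine Wp.seq 5 (c ^ 5 * 30 + 110) (Wp.setReal 6 1 rfl (by simp) ?_) (by omega)
  refine Wp.mono (wp_forTo (T := 10) (fun j s' =>
    Frame (fun a => a = 17) (fun a => a = 3 ∨ a = 6) s₁ s' ∧ s'.reals 3 = 2 ^ baseLog m ∧
    s'.words 17 = j ∧ s'.reals 6 = (2 ^ baseLog m) ^ j) (c ^ 5)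
    (by norm_num) (by omega) ?_ ?_ ?_ ?_) (by omega : c ^ 5 * (10 + 13) + 10 ≤ _) (fun _ h => h)
  · refine ⟨(((Frame.refl _ _ s₁).trans hf₂ (by simp) (by simp +contextual)).putReal
      (by simp)).putWord (by simp), by simp [h3], by simp, by simp⟩
  · rintro j s' - ⟨hf, h3, h17, h6⟩
    exact ⟨h17, by rw [hf.words 0 (by simp)]; simp [hs₁]⟩
  · rintro j s' hj ⟨hf, h3, h17, h6⟩ - -
    refine Wp.setReal 6 ((2 ^ baseLog m) ^ (j + 1)) rfl (by simp [h6, h3, pow_succ]) ?_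
    exact ⟨by simp [h17], (hf.putReal (by simp)).putWord (by simp), by simp [h3], by simp, by simp⟩
  · rintro s' ⟨hf, h3, h17, h6'⟩
    exact ⟨by simp [hf.words, hs₁, h4], by simp [hf.words, hs₁, h5], by simp [hf.words, hs₁, h6],
      by simp [hf.words, hs₁, h7], by simp [hf.words, hs₁, h8], by simp [hf.words, hs₁],
      by simp [hf.words, hs₁], by simp [hf.reals, hs₁], by simp [hf.reals, hs₁], h3,
      by simp [hf.reals, hs₁], by simp [hf.reals, hs₁], h6',
      fun x => by simp [hf.reals, hs₁, hF], fun x => by simp [hf.reals, hs₁, hG],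
      fun x => by simp [hf.words, hs₁, hT]⟩

/-- The query program: all pairs of rows if `n * φ ^ 6 ≤ 1`, and otherwise all pairs of rows within
a group and the pairs found in the trials. -/
def queryProg : Prog :=
  .cond (.realLE (.mul (.ofWord (wc 3)) (.mul (.mul (.mul (rc 2) (rc 2)) (.mul (rc 2) (rc 2)))
      (.mul (rc 2) (rc 2)))) (.ofWord (.lit 1)))
    (.seq (.setWord (.lit 25) (.lit 0)) <|
     .seq (.setWord (.lit 26) (.lit 0)) (emitBlock 3))
    (.seq setupProg (.seq sameGroup (forTo 10 7 trialProg)))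

/-- Running time of the query when it does not emit all pairs. -/
def mainTime (k : ℕ) (R φ : ℝ) (c m L : ℕ) : ℕ :=
  baseLog m * 20 + c ^ 5 * 30 + c ^ 5 * (c * (c * 24 + 23) + 43) +
    L * (trialTime c m (baseLog m) ⌈max (capR k R φ c) 0⌉₊ + 13) + 500

/-- What the query achieves, in the case of small `φ` and in the main case. -/
def QueryOut (F G : ℕ → ℝ) (T : ℕ → ℕ) (q c m N L n k : ℕ) (R φ : ℝ) (o : List (ℕ × ℕ)) : Prop :=
  (n * φ ^ 6 ≤ 1 → ∀ i < n, ∀ j < n, (i, j) ∈ o) ∧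
  (¬ n * φ ^ 6 ≤ 1 → (∀ a < c ^ 5, ∀ u < c, ∀ u' < c, (a * c + u, a * c + u') ∈ o) ∧
    ∀ t < L, TrialOut F G T q c m N t (thr φ m) (capR k R φ c) o)

open Classical in
/-- The query program runs in the stated time and emits what `QueryOut` asks for. -/
theorem wp_queryProg {s : State} {L k n : ℕ} {R φ : ℝ} (h3 : s.words 3 = n) (h4 : s.words 4 = c)
    (h5 : s.words 5 = m)
    (h6 : s.words 6 = N) (h7 : s.words 7 = L) (h8 : s.words 8 = q) (h2 : s.words 2 = k)
    (r1 : s.reals 1 = R) (r2 : s.reals 2 = φ) (hF : ∀ x, s.reals (A 0 x) = F x)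
    (hG : ∀ x, s.reals (A 1 x) = G x) (hT : ∀ x, s.words (A 0 x) = T x)
    (hV1 : c ^ 5 * c ^ 5 ≤ V) (hc : 1 ≤ c) (hm : 1 ≤ m) (hcm : c ≤ m) (hN : c ^ 5 * c = N)
    (hLV : L * (N + 8) ≤ V) (hxV : L * (N + 1) * m ≤ V) (hNV : N ≤ V) :
    Wp V queryProg (50 + if n * φ ^ 6 ≤ 1 then n * (n * 24 + 23) + 30 else mainTime k R φ c m L) s
      (fun s' => QueryOut F G T q c m N L n k R φ s'.out) := by
  have hiff : (Test.realLE (.mul (.ofWord (wc 3)) (.mul (.mul (.mul (rc 2) (rc 2))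
      (.mul (rc 2) (rc 2))) (.mul (rc 2) (rc 2)))) (.ofWord (.lit 1))).ev s ↔ n * φ ^ 6 ≤ 1 := by
    simp [h3, r2]
    ring_nf
  by_cases hreg : n * φ ^ 6 ≤ 1
  · rw [if_pos hreg]
    refine (wp_cond (t₁ := n * (n * 24 + 23) + 30) (t₂ := 0) (by decide) (fun _ => ?_)
      (fun h => absurd (hiff.2 hreg) h)).mono ?_ (fun _ h => h)
    · refine Wp.seq 5 (n * (n * 24 + 23) + 20) (Wp.setWord 25 0 rfl (by simp) (by simp) ?_)
        (by omega)
      refine Wp.seq 5 (n * (n * 24 + 23) + 10) (Wp.setWord 26 0 rfl (by simp) (by simp) ?_)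
        (by omega)
      refine (wp_emitBlock (C := n) (x := 0) (y := 0) (by norm_num) (by simp [h3]) (by simp)
        (by simp)).mono le_rfl ?_
      rintro s' ⟨-, ho⟩
      refine ⟨fun _ i hi j hj => by simpa using ho i hi j hj, fun h => absurd hreg h⟩
    · exact Nat.add_le_add (by decide) (by omega)
  · rw [if_neg hreg]
    refine (wp_cond (t₁ := 0) (t₂ := mainTime k R φ c m L) (by decide)
      (fun h => absurd (hiff.1 h) hreg) (fun _ => ?_)).mono ?_ (fun _ h => h)
    · refine Wp.seq (baseLog m * 20 + c ^ 5 * 30 + 300) (c ^ 5 * (c * (c * 24 + 23) + 43) +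
        L * (trialTime c m (baseLog m) ⌈max (capR k R φ c) 0⌉₊ + 13) + 200)
        ((wp_setupProg h4 h5 h6 h7 h8 h2 r1 r2 hF hG hT hV1 hc hm).mono le_rfl ?_)
        (by unfold mainTime; omega)
      intro s₁ hQ
      refine Wp.seq (c ^ 5 * (c * (c * 24 + 23) + 43) + 10)
        (L * (trialTime c m (baseLog m) ⌈max (capR k R φ c) 0⌉₊ + 13) + 190)
        ((wp_sameGroup hQ.w4 hQ.w0 (by omega)).mono le_rfl ?_) (by omega)
      rintro s₂ ⟨hf₂, ho₂⟩
      have hQ₂ := hQ.frame hf₂ (fun a h => Or.inr (Or.inr (Or.inr (Or.inl (by omega)))))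
        (fun a h => h.elim)
      have hB : 4 * (m : ℝ) ^ 8 ≤ 2 ^ baseLog m := by
        have : 4 * m ^ 8 < 2 ^ baseLog m := Nat.lt_pow_succ_log_self (by norm_num) _
        exact_mod_cast this.le
      refine Wp.mono (wp_forTo (T := trialTime c m (baseLog m) ⌈max (capR k R φ c) 0⌉₊)
        (fun j s' => QEnv F G T q c m N L (baseLog m) (thr φ m) (capR k R φ c) s' ∧
        s'.words 10 = j ∧ (∀ e ∈ s₂.out, e ∈ s'.out) ∧
        ∀ t < j, TrialOut F G T q c m N t (thr φ m) (capR k R φ c) s'.out) L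
        (by norm_num) (by norm_num) ?_ ?_ ?_ ?_) (by omega) (fun _ h => h)
      · refine ⟨hQ₂.frame ((FrameO.refl (fun a => a = 10) (fun _ => False) s₂).putWord rfl)
          (fun a h => Or.inl h) (fun a h => h.elim), by simp, by simp, by simp⟩
      · rintro j s' - ⟨hQ', h10, -⟩
        exact ⟨h10, hQ'.w7⟩
      · rintro j s' hj ⟨hQ', h10, ho, hall⟩ - -
        refine (wp_trialProg hQ' h10 hm hcm hB hN hj hLV hxV hV1).mono le_rfl ?_
        rintro s'' ⟨hf'', ho''⟩
        have h10' : s''.words 10 = j := by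
          rw [hf''.words 10, h10]
          rintro (h | h | h | ⟨x, h⟩)
          any_goals omega
          have := le_A 1 x; omega
        have hQ'' := (hQ'.frame hf'' (fun a h => Or.inr h) (fun a h => h))
        refine ⟨h10', hQ''.frame ((FrameO.refl (fun a => a = 10) (fun _ => False) s'').putWord rfl)
          (fun a h => Or.inl h) (fun a h => h.elim), by simp, fun e he => hf''.out e (ho e he), ?_⟩
        intro t ht
        by_cases h : t = j
        · subst h; exact ho''
        · exact fun a e b cc u hu u' hu' => hf''.out _ (hall t (by omega) a e b cc u hu u' hu')
      · rintro s' ⟨-, -, ho, hall⟩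
        exact ⟨fun h => absurd h hreg,
          fun _ => ⟨fun a ha u hu u' hu' => ho _ (ho₂ a ha u hu u' hu'), hall⟩⟩
    · exact Nat.add_le_add (by decide) (by omega)

end

section

variable {V : ℕ} [hV : Fact (1048576 ≤ V)]

/-! ### Parameters -/

theorem exists_sixth_root (n : ℕ) : ∃ c, n ≤ c ^ 6 := ⟨n, Nat.le_self_pow (by norm_num) n⟩

open Classical in
/-- The number of rows per group: the sixth root of the number of rows, rounded up. -/
def cPar (n : ℕ) : ℕ := Nat.find (exists_sixth_root n)

theorem le_cPar_pow (n : ℕ) : n ≤ cPar n ^ 6 := by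
  classical exact Nat.find_spec (exists_sixth_root n)

theorem pow_lt_of_lt_cPar {n j : ℕ} (h : j < cPar n) : j ^ 6 < n := by
  classical exact not_le.1 (Nat.find_min (exists_sixth_root n) h)

/-- The number of buckets of each row sketch. -/
def mPar (n : ℕ) : ℕ := 131072 * cPar n ^ 4

/-- The number of trials. -/
def LPar (n : ℕ) : ℕ := 30 * Nat.clog 2 n

theorem exists_prime_gt (x : ℕ) : ∃ q, x < q ∧ q.Prime :=
  ⟨_, (Nat.exists_infinite_primes (x + 1)).choose_spec⟩

open Classical in
/-- The smallest prime above `x`. -/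
def nextPrime (x : ℕ) : ℕ := Nat.find (exists_prime_gt x)

theorem nextPrime_spec (x : ℕ) : x < nextPrime x ∧ (nextPrime x).Prime := by
  classical exact Nat.find_spec (exists_prime_gt x)

theorem not_prime_of_lt_nextPrime {x y : ℕ} (h : x < y) (h' : y < nextPrime x) : ¬ y.Prime := by
  classical exact fun hp => Nat.find_min (exists_prime_gt x) h' ⟨h, hp⟩

theorem nextPrime_le (x : ℕ) (hx : x ≠ 0) : nextPrime x ≤ 2 * x := by
  classical
  obtain ⟨p, hp, h1, h2⟩ := Nat.exists_prime_lt_and_le_two_mul x hx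
  exact (Nat.find_min' (exists_prime_gt x) ⟨h1, hp⟩).trans h2

/-! ### The deterministic part of the initialization -/

/-- The sixth power of word cell `i`. -/
def wpow6 (i : ℕ) : WExp := .mul (wpow5 i) (wc i)

/-- Finds `cPar n` by linear search. -/
def rootProg : Prog :=
  .seq (.setWord (.lit 4) (.lit 0)) <|
  .loop (.wordLE (.add (wpow6 4) (.lit 1)) (wc 3)) (.setWord (.lit 4) (.add (wc 4) (.lit 1)))

theorem wp_rootProg {s : State} {n : ℕ} (h3 : s.words 3 = n) (hcV : cPar n ≤ V) :
    Wp V rootProg (cPar n * 30 + 30) s fun s' =>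
      Frame (fun a => a = 4) (fun _ => False) s s' ∧ s'.words 4 = cPar n := by
  refine Wp.seq 5 (cPar n * 30 + 25) (Wp.setWord 4 0 rfl (by simp) (by simp) ?_) (by omega)
  refine (wp_loop (t := 6) (fun j s' => Frame (fun a => a = 4) (fun _ => False) s s' ∧
    s'.words 4 = j) (cPar n) (by decide) ?_ ?_ ?_).mono ?_ (fun _ h => h)
  · rintro j s' hj ⟨hf, h4⟩
    have e3 := (hf.words 3 (by simp)).trans h3
    have := pow_lt_of_lt_cPar hj
    refine ⟨?_, Wp.setWord 4 (j + 1) rfl (by simp [h4]) (fun _ => by omega)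
      ⟨hf.putWord rfl, by simp⟩⟩
    simp only [tev_wordLE, ev_add, wpow6, wpow5, ev_mul, ev_load, ev_lit, h4, e3]
    ring_nf at this ⊢
    omega
  · rintro s' ⟨hf, h4⟩
    have e3 := (hf.words 3 (by simp)).trans h3
    have := le_cPar_pow n
    refine ⟨?_, hf, h4⟩
    simp only [tev_wordLE, ev_add, wpow6, wpow5, ev_mul, ev_load, ev_lit, h4, e3]
    ring_nf at this ⊢
    omega
  · exact ⟨(Frame.refl _ _ s).putWord rfl, by simp⟩
  · have : (Test.wordLE (.add (wpow6 4) (.lit 1)) (wc 3)).cost = 22 := rfl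
    rw [this]; omega

/-- Finds `Nat.clog 2 n` by repeated doubling. -/
def logProg : Prog :=
  .seq (.setWord (.lit 7) (.lit 0)) <|
  .seq (.setWord (.lit 10) (.lit 1)) <|
  .loop (.wordLE (.add (wc 10) (.lit 1)) (wc 3))
    (.seq (.setWord (.lit 10) (.mul (wc 10) (.lit 2))) (.setWord (.lit 7) (.add (wc 7) (.lit 1))))

theorem wp_logProg {s : State} {n : ℕ} (h3 : s.words 3 = n) (hcV : 2 * n + 2 ≤ V) :
    Wp V logProg (Nat.clog 2 n * 30 + 30) s fun s' =>
      Frame (fun a => a = 7 ∨ a = 10) (fun _ => False) s s' ∧ s'.words 7 = Nat.clog 2 n := by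
  refine Wp.seq 5 (Nat.clog 2 n * 30 + 25) (Wp.setWord 7 0 rfl (by simp) (by simp) ?_) (by omega)
  refine Wp.seq 5 (Nat.clog 2 n * 30 + 20) (Wp.setWord 10 1 rfl (by simp) (by omega) ?_) (by omega)
  refine (wp_loop (t := 20) (fun j s' => Frame (fun a => a = 7 ∨ a = 10) (fun _ => False) s s' ∧
    s'.words 7 = j ∧ s'.words 10 = 2 ^ j) (Nat.clog 2 n) (by decide) ?_ ?_ ?_).mono ?_ (fun _ h => h)
  · rintro j s' hj ⟨hf, h7, h10⟩
    have e3 := (hf.words 3 (by simp)).trans h3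
    have h2j : 2 ^ j < n := (Nat.lt_clog_iff_pow_lt (by norm_num)).1 hj
    have : j < 2 ^ j := Nat.lt_two_pow_self
    refine ⟨by simp [h10, e3]; omega, ?_⟩
    refine Wp.setWord_seq 10 (2 ^ (j + 1)) rfl (by simp [h10, pow_succ])
      (fun _ => by rw [pow_succ]; omega) ?_
    exact Wp.setWord 7 (j + 1) rfl (by simp [h7]) (fun _ => by omega)
      ⟨(hf.putWord (by simp)).putWord (by simp), by simp, by simp⟩
  · rintro s' ⟨hf, h7, h10⟩
    have e3 := (hf.words 3 (by simp)).trans h3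
    have : n ≤ 2 ^ Nat.clog 2 n := Nat.le_pow_clog (by norm_num) n
    exact ⟨by simp [h10, e3]; omega, hf, h7⟩
  · exact ⟨((Frame.refl _ _ s).putWord (by simp)).putWord (by simp), by simp, by simp⟩
  · have : (Test.wordLE (.add (wc 10) (.lit 1)) (wc 3)).cost = 7 := rfl
    rw [this]; omega

/-- Trial division of word cell 8; word cell 11 ends as 1 if it is prime, and 0 otherwise. -/
def trialDiv : Prog :=
  .seq (.setWord (.lit 11) (.lit 1)) <|
  .seq (.setWord (.lit 12) (.lit 2)) <|
  .loop (.wordLE (.add (wc 12) (.lit 1)) (wc 8))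
    (.seq (.cond (.wordLE (.mod (wc 8) (wc 12)) (.lit 0)) (.setWord (.lit 11) (.lit 0)) .skip)
      (.setWord (.lit 12) (.add (wc 12) (.lit 1))))

open Classical in
theorem wp_trialDiv {s : State} {x : ℕ} (h8 : s.words 8 = x) (hx : 2 ≤ x) (hxV : x ≤ V) :
    Wp V trialDiv (x * 40 + 30) s fun s' =>
      Frame (fun a => a = 11 ∨ a = 12) (fun _ => False) s s' ∧
      s'.words 11 = if x.Prime then 1 else 0 := by
  refine Wp.seq 5 (x * 40 + 25) (Wp.setWord 11 1 rfl (by simp) (by omega) ?_) (by omega)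
  refine Wp.seq 5 (x * 40 + 20) (Wp.setWord 12 2 rfl (by simp) (by omega) ?_) (by omega)
  refine (wp_loop (t := 30) (fun j s' => Frame (fun a => a = 11 ∨ a = 12) (fun _ => False) s s' ∧
    s'.words 12 = j + 2 ∧ s'.words 11 = if ∀ d, 2 ≤ d → d < j + 2 → ¬ d ∣ x then 1 else 0) (x - 2)
    (by decide) ?_ ?_ ?_).mono ?_ (fun _ h => h)
  · rintro j s' hj ⟨hf, h12, h11⟩
    have e8 := (hf.words 8 (by simp)).trans h8
    refine ⟨by simp [h12, e8]; omega, ?_⟩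
    refine Wp.seq 20 10 (Wp.ite (p := (j + 2) ∣ x) 5 1 (by simp [e8, h12, Nat.dvd_iff_mod_eq_zero])
      (fun hd => ?_) (fun hd => ?_)) (by norm_num)
    · refine Wp.setWord 11 0 rfl (by simp) (by simp) ?_
      refine Wp.setWord 12 (j + 3) rfl (by simp [h12]) (fun _ => by omega)
        ⟨(hf.putWord (by simp)).putWord (by simp), by simp, ?_⟩
      have : ¬ ∀ d, 2 ≤ d → d < j + 1 + 2 → ¬ d ∣ x :=
        fun h => h (j + 2) (by omega) (by omega) hd
      rw [if_neg this]; simp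
    · refine wp_skip ?_
      refine Wp.setWord 12 (j + 3) rfl (by simp [h12]) (fun _ => by omega)
        ⟨hf.putWord (by simp), by simp, ?_⟩
      have : (∀ d, 2 ≤ d → d < j + 1 + 2 → ¬ d ∣ x) ↔ ∀ d, 2 ≤ d → d < j + 2 → ¬ d ∣ x := by
        refine ⟨fun h d h1 h2 => h d h1 (by omega), fun h d h1 h2 => ?_⟩
        by_cases hdj : d = j + 2
        · subst hdj; exact hd
        · exact h d h1 (by omega)
      rw [putWord_words, if_neg (by norm_num), h11]
      split_ifs <;> tauto
  · rintro s' ⟨hf, h12, h11⟩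
    have e8 := (hf.words 8 (by simp)).trans h8
    refine ⟨by simp [h12, e8]; omega, hf, ?_⟩
    rw [h11]
    congr 1
    rw [Nat.prime_def_lt']
    apply propext
    rw [show x - 2 + 2 = x by omega]
    exact ⟨fun h => ⟨hx, h⟩, fun h => h.2⟩
  · refine ⟨((Frame.refl _ _ s).putWord (by simp)).putWord (by simp), by simp, ?_⟩
    rw [if_pos (fun d h1 h2 => by omega)]; simp
  · have : (Test.wordLE (.add (wc 12) (.lit 1)) (wc 8)).cost = 7 := rfl
    rw [this]; omega

/-- Finds the smallest prime above `p + m` by trial division. -/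
def primeProg : Prog :=
  .seq (.setWord (.lit 8) (.add (wc 9) (wc 5))) <|
  .seq (.setWord (.lit 11) (.lit 0)) <|
  .loop (.wordLE (wc 11) (.lit 0))
    (.seq (.setWord (.lit 8) (.add (wc 8) (.lit 1))) trialDiv)

/-- A bound for the time taken by the search for a prime. -/
def primeTime (x : ℕ) : ℕ := (nextPrime x - x) * (10 + (nextPrime x * 40 + 30) + 4) + 4

open Classical in
theorem wp_primeProg {s : State} {p m : ℕ} (h9 : s.words 9 = p) (h5 : s.words 5 = m) (hm : 1 ≤ m)
    (hV2 : 2 * (p + m) ≤ V) :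
    Wp V primeProg (10 + (10 + primeTime (p + m))) s fun s' =>
      Frame (fun a => a = 8 ∨ a = 11 ∨ a = 12) (fun _ => False) s s' ∧
      s'.words 8 = nextPrime (p + m) := by
  obtain ⟨hq1, hq2⟩ := nextPrime_spec (p + m)
  have hq3 := nextPrime_le (p + m) (by omega)
  unfold primeTime
  set q := nextPrime (p + m) with hq
  refine Wp.seq 10 _ (Wp.setWord 8 (p + m) rfl (by simp [h9, h5]) (by omega) ?_) le_rfl
  refine Wp.seq 10 _ (Wp.setWord 11 0 rfl (by simp) (by omega) ?_) le_rfl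
  refine (wp_loop (t := 10 + (q * 40 + 30)) (fun j s' =>
    Frame (fun a => a = 8 ∨ a = 11 ∨ a = 12) (fun _ => False) s s' ∧ s'.words 8 = p + m + j ∧
    s'.words 11 = if p + m + j = q then 1 else 0) (q - (p + m)) (by decide) ?_ ?_ ?_).mono le_rfl
      (fun _ h => h)
  · rintro j s' hj ⟨hf, h8, h11⟩
    rw [if_neg (by omega)] at h11
    refine ⟨by simp [h11], ?_⟩
    refine Wp.seq 10 (q * 40 + 30) (Wp.setWord 8 (p + m + (j + 1)) rfl (by simp [h8]; omega)
      (by omega) ?_) le_rfl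
    refine (wp_trialDiv (x := p + m + (j + 1)) (by simp) (by omega) (by omega)).mono (by omega) ?_
    rintro s'' ⟨hf'', h11'⟩
    have hf3 := (hf.putWord (a := 8) (v := p + m + (j + 1)) (by simp)).trans hf''
      (by intro a h; omega) (by simp)
    refine ⟨hf3, by simp [hf''.words], ?_⟩
    refine h11'.trans (if_congr ?_ rfl rfl)
    constructor
    · intro hp
      by_contra hne
      exact not_prime_of_lt_nextPrime (x := p + m) (y := p + m + (j + 1)) (by omega) (by omega) hp
    · intro h; rw [h]; exact hq2
  · rintro s' ⟨hf, h8, h11⟩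
    rw [if_pos (by omega)] at h11
    exact ⟨by simp [h11], hf, by rw [h8]; omega⟩
  · refine ⟨((Frame.refl _ _ s).putWord (by simp)).putWord (by simp), by simp, ?_⟩
    rw [if_neg (by omega)]; simp

/-- The part of the initialization that precedes the random choices. -/
def preProg : Prog :=
  .seq (.setReal (.lit 2) (rc 0)) <|
  .seq (.setWord (.lit 3) (wc 0)) <|
  .seq (.setWord (.lit 9) (wc 1)) <|
  .seq rootProg <|
  .seq (.setWord (.lit 5) (.mul (.lit 131072) (.mul (.mul (.mul (wc 4) (wc 4)) (wc 4)) (wc 4)))) <|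
  .seq (.setWord (.lit 6) (wpow6 4)) <|
  .seq logProg <|
  .seq (.setWord (.lit 7) (.mul (.lit 30) (wc 7))) <|
  .seq primeProg (.setWord (.lit 12) (.mul (wc 7) (.add (wc 6) (.lit 8))))

/-- The parameters held by the scalar cells. -/
structure Params (n p k : ℕ) (φ R : ℝ) (s : State) : Prop where
  w2 : s.words 2 = k
  w3 : s.words 3 = n
  w4 : s.words 4 = cPar n
  w5 : s.words 5 = mPar n
  w6 : s.words 6 = cPar n ^ 6
  w7 : s.words 7 = LPar n
  w8 : s.words 8 = nextPrime (p + mPar n)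
  r1 : s.reals 1 = R
  r2 : s.reals 2 = φ

theorem Params.frame {n p k : ℕ} {φ R : ℝ} {s s' : State} {ws rs : ℕ → Prop}
    (h : Params n p k φ R s) (hf : Frame ws rs s s') (hw : ∀ a, ws a → a < 2 ∨ 9 ≤ a)
    (hr : ∀ a, rs a → a = 0 ∨ 3 ≤ a) : Params n p k φ R s' := by
  have W : ∀ a, 2 ≤ a → a < 9 → s'.words a = s.words a := fun a h1 h2 =>
    hf.words a fun h3 => by have := hw a h3; omega
  have Rr : ∀ a, 1 ≤ a → a < 3 → s'.reals a = s.reals a := fun a h1 h2 =>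
    hf.reals a fun h3 => by have := hr a h3; omega
  exact ⟨(W 2 (by norm_num) (by norm_num)).trans h.w2, (W 3 (by norm_num) (by norm_num)).trans h.w3,
    (W 4 (by norm_num) (by norm_num)).trans h.w4, (W 5 (by norm_num) (by norm_num)).trans h.w5,
    (W 6 (by norm_num) (by norm_num)).trans h.w6, (W 7 (by norm_num) (by norm_num)).trans h.w7,
    (W 8 (by norm_num) (by norm_num)).trans h.w8, (Rr 1 (by norm_num) (by norm_num)).trans h.r1,
    (Rr 2 (by norm_num) (by norm_num)).trans h.r2⟩

/-- Size conditions which exclude overflow. -/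
structure Sizes (V n p : ℕ) : Prop where
  one_le : 1 ≤ n
  root : 1 ≤ cPar n
  a1 : 2 * n + 2 ≤ V
  a2 : 2 * (p + mPar n) ≤ V
  a3 : LPar n * (cPar n ^ 6 + 8) ≤ V
  a4 : LPar n * (cPar n ^ 6 + 1) * mPar n ≤ V
  a5 : cPar n ^ 5 * cPar n ^ 5 ≤ V
  a6 : cPar n ^ 6 ≤ V
  a7 : cPar n ≤ V
  a8 : LPar n ≤ V

theorem Sizes.one_le_mPar {V n p : ℕ} (h : Sizes V n p) : 1 ≤ mPar n := by
  have : 1 ≤ cPar n ^ 4 := Nat.one_le_pow _ _ h.root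
  unfold mPar; omega

/-- A bound for the time taken by the deterministic part of the initialization. -/
def preTime (n p : ℕ) : ℕ :=
  10 + (10 + (10 + ((cPar n * 30 + 30) + (20 + (20 + ((Nat.clog 2 n * 30 + 30) +
    (10 + ((10 + (10 + primeTime (p + mPar n))) + 10))))))))

theorem wp_preProg {n p k : ℕ} {φ R : ℝ} (hS : Sizes V n p) :
    Wp V preProg (preTime n p) (startState n p k φ R) fun s' =>
      Params n p k φ R s' ∧ s'.words 9 = p ∧
      s'.words 12 = LPar n * (cPar n ^ 6 + 8) ∧
      (∀ a, 32 ≤ a → s'.words a = 0) ∧ (∀ a, 32 ≤ a → s'.reals a = 0) := by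
  set s := startState n p k φ R with hs
  have e0 : s.words 0 = n := by simp [hs, startState, Function.update]
  have e1 : s.words 1 = p := by simp [hs, startState, Function.update]
  have e2 : s.words 2 = k := by simp [hs, startState, Function.update]
  have f0 : s.reals 0 = φ := by simp [hs, startState, Function.update]
  have f1 : s.reals 1 = R := by simp [hs, startState, Function.update]
  have ew : ∀ a, 32 ≤ a → s.words a = 0 := fun a ha => by
    simp [hs, startState, Function.update, show a ≠ 0 by omega, show a ≠ 1 by omega,
      show a ≠ 2 by omega]
  have er : ∀ a, 32 ≤ a → s.reals a = 0 := fun a ha => by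
    simp [hs, startState, Function.update, show a ≠ 0 by omega, show a ≠ 1 by omega]
  have hm := hS.one_le_mPar
  obtain ⟨h1, h2, h3, h4, h5, h6, h7, h8, h9, h10⟩ := hS
  refine Wp.seq 10 _ (Wp.setReal 2 φ rfl (by simp [f0]) ?_) le_rfl
  refine Wp.seq 10 _ (Wp.setWord 3 n rfl (by simp [e0]) (fun _ => by omega) ?_) le_rfl
  refine Wp.seq 10 _ (Wp.setWord 9 p rfl (by simp [e1]) (fun _ => by omega) ?_) le_rfl
  refine Wp.seq _ _ ((wp_rootProg (n := n) (by simp) h9).mono le_rfl ?_) le_rfl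
  rintro sa ⟨hfa, ha4⟩
  have hf1 := ((((Frame.refl (fun a => 3 ≤ a ∧ a < 32) (fun a => a = 2) s).putReal (a := 2)
    (v := φ) rfl).putWord (a := 3) (v := n) (by simp)).putWord (a := 9) (v := p) (by simp)).trans hfa
    (by intro a h; omega) (by simp)
  have ha3 : sa.words 3 = n := by simp [hfa.words]
  have ha9 : sa.words 9 = p := by simp [hfa.words]
  have har : sa.reals 2 = φ := by simp [hfa.reals]
  refine Wp.seq 20 _ (Wp.setWord 5 (mPar n) rfl (by simp [ha4, mPar]; ring) (fun _ => by omega) ?_)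
    le_rfl
  refine Wp.seq 20 _ (Wp.setWord 6 (cPar n ^ 6) rfl (by simp [wpow6, wpow5, ha4]; ring)
    (fun _ => by omega) ?_) le_rfl
  refine Wp.seq _ _ ((wp_logProg (n := n) (by simp [ha3]) h3).mono le_rfl ?_) le_rfl
  rintro sb ⟨hfb, hb7⟩
  have hf2 := ((hf1.putWord (a := 5) (v := mPar n) (by simp)).putWord (a := 6) (v := cPar n ^ 6)
    (by simp)).trans hfb (by intro a h; omega) (by simp)
  refine Wp.seq 10 _ (Wp.setWord 7 (LPar n) rfl (by simp [hb7, LPar]) (fun _ => by omega) ?_) le_rfl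
  refine Wp.seq _ _ ((wp_primeProg (p := p) (m := mPar n) (by simp [hfb.words, ha9])
    (by simp [hfb.words]) hm h4).mono le_rfl ?_) le_rfl
  rintro sc ⟨hfc, hc8⟩
  have hf3 := (hf2.putWord (a := 7) (v := LPar n) (by simp)).trans hfc (by intro a h; omega)
    (by simp)
  have c3 : sc.words 3 = n := by simp [hfc.words, hfb.words, ha3]
  have c4 : sc.words 4 = cPar n := by simp [hfc.words, hfb.words, ha4]
  have c5 : sc.words 5 = mPar n := by simp [hfc.words, hfb.words]
  have c6 : sc.words 6 = cPar n ^ 6 := by simp [hfc.words, hfb.words]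
  have c7 : sc.words 7 = LPar n := by simp [hfc.words]
  have c9 : sc.words 9 = p := by simp [hfc.words, hfb.words, ha9]
  have cr : sc.reals 2 = φ := by simp [hfc.reals, hfb.reals, har]
  refine Wp.setWord 12 (LPar n * (cPar n ^ 6 + 8)) rfl (by simp [c6, c7]) (fun _ => by omega) ?_
  have hf4 := hf3.putWord (a := 12) (v := LPar n * (cPar n ^ 6 + 8)) (by simp)
  refine ⟨⟨?_, ?_, ?_, ?_, ?_, ?_, ?_, ?_, ?_⟩, ?_, ?_, ?_, ?_⟩
  · exact (hf4.words 2 (by simp)).trans e2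
  · simpa using c3
  · simpa using c4
  · simpa using c5
  · simpa using c6
  · simpa using c7
  · simpa using hc8
  · exact (hf4.reals 1 (by simp)).trans f1
  · simpa using cr
  · simpa using c9
  · simp
  · exact fun a ha => (hf4.words a (by omega)).trans (ew a ha)
  · exact fun a ha => (hf4.reals a (by omega)).trans (er a ha)

end

section

variable {V : ℕ} [hV : Fact (1048576 ≤ V)]

/-! ### Random tables -/

theorem uniformOfFinset_range_eq_map (q : ℕ) [NeZero q] (h : (Finset.range q).Nonempty) :
    PMF.uniformOfFinset (Finset.range q) h = (PMF.uniformOfFintype (ZMod q)).map ZMod.val := by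
  ext v
  rw [PMF.uniformOfFinset_apply, PMF.map_apply, tsum_fintype]
  simp only [PMF.uniformOfFintype_apply, ZMod.card, Finset.card_range, Finset.mem_range]
  split_ifs with hv
  · rw [Finset.sum_eq_single (v : ZMod q)]
    · rw [if_pos (ZMod.val_cast_of_lt hv).symm]
    · rintro b - hb
      rw [if_neg]
      rintro rfl
      exact hb (by simp)
    · simp
  · symm
    refine Finset.sum_eq_zero fun b _ => if_neg ?_
    rintro rfl
    exact hv (ZMod.val_lt b)

theorem uniform_cons (q r : ℕ) [NeZero q] :
    (PMF.uniformOfFintype (ZMod q)).bind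
      (fun v => (PMF.uniformOfFintype (Fin r → ZMod q)).map (Fin.cons v : _ → Fin (r + 1) → ZMod q)) =
    PMF.uniformOfFintype (Fin (r + 1) → ZMod q) := by
  ext ω
  rw [PMF.bind_apply, tsum_fintype]
  rw [Finset.sum_eq_single (ω 0)]
  · rw [PMF.map_apply, tsum_fintype, Finset.sum_eq_single (Fin.tail ω)]
    · rw [if_pos (Fin.cons_self_tail ω).symm]
      simp only [PMF.uniformOfFintype_apply, ZMod.card, Fintype.card_pi, Finset.prod_const,
        Finset.card_univ, Fintype.card_fin, Nat.cast_pow]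
      rw [← ENNReal.mul_inv (by simp) (by simp), pow_succ, mul_comm]
    · rintro b - hb
      rw [if_neg fun h => hb (by simpa using (congrArg Fin.tail h).symm)]
    · simp
  · rintro b - hb
    rw [PMF.map_apply, tsum_fintype, Finset.sum_eq_zero, mul_zero]
    rintro c -
    rw [if_neg]
    rintro rfl
    exact hb (by simp)
  · simp

/-- A deterministic program run after a program with random outcome. -/
theorem Exec.seq_wp {Ω : Type*} {c d : Prog} {s : State} {t₁ t₂ : ℕ} {μ : PMF Ω} {F : Ω → State}
    {Q : State → State → Prop} (hc : Exec (V ^ 31) c s t₁ (μ.map F)) (hB : ∀ ω, Bd V (F ω))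
    (hd : ∀ ω, Wp V d t₂ (F ω) (Q (F ω))) :
    ∃ F' : Ω → State, Exec (V ^ 31) (.seq c d) s (t₁ + t₂) (μ.map F') ∧
      ∀ ω, Bd V (F' ω) ∧ Q (F ω) (F' ω) := by
  have h : ∀ s' : State, ∃ s'', (∃ ω, F ω = s') →
      Exec (V ^ 31) d s' t₂ (PMF.pure s'') ∧ Bd V s'' ∧ Q s' s'' := by
    intro s'
    by_cases hs : ∃ ω, F ω = s'
    · obtain ⟨ω, rfl⟩ := hs
      obtain ⟨s'', h⟩ := hd ω (hB ω)
      exact ⟨s'', fun _ => h⟩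
    · exact ⟨s', fun h => absurd h hs⟩
  choose G hG using h
  refine ⟨G ∘ F, ?_, fun ω => (hG _ ⟨ω, rfl⟩).2⟩
  have := Exec.seq s c d t₁ t₂ (μ.map F) (fun s' => PMF.pure (G s')) hc (by
    intro s' hs'
    rw [PMF.support_map] at hs'
    obtain ⟨ω, -, hω⟩ := hs'
    exact (hG _ ⟨ω, hω⟩).1)
  rw [← PMF.map_comp]
  exact this

/-- A program with random outcome run after a deterministic one. -/
theorem Exec.wp_seq {Ω : Type*} {c d : Prog} {s : State} {t₁ t₂ : ℕ} {μ : PMF Ω}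
    {P : State → Prop} {Q : (Ω → State) → Prop} (hs : Bd V s) (hc : Wp V c t₁ s P)
    (hd : ∀ s', Bd V s' → P s' → ∃ F, Exec (V ^ 31) d s' t₂ (μ.map F) ∧ Q F) :
    ∃ F : Ω → State, Exec (V ^ 31) (.seq c d) s (t₁ + t₂) (μ.map F) ∧ Q F := by
  obtain ⟨s', h1, h2, h3⟩ := hc hs
  obtain ⟨F, h4, h5⟩ := hd s' h2 h3
  refine ⟨F, ?_, h5⟩
  have := Exec.seq s c d t₁ t₂ (PMF.pure s') (fun _ => μ.map F) h1 (by
    intro s'' hs''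
    rw [PMF.support_pure, Set.mem_singleton_iff] at hs''
    subst hs''; exact h4)
  rwa [PMF.pure_bind] at this

/-- Fills one entry of the random table with a uniform residue. -/
def fillBody : Prog :=
  .seq (.rand (arr 0 (wc 13)) (wc 8)) (.setWord (.lit 13) (.add (wc 13) (.lit 1)))

/-- Fills the random table. -/
def fillLoop : Prog := .loop (.wordLE (.add (wc 13) (.lit 1)) (wc 12)) fillBody

/-- The random table: `q`-residues in the first `D` entries, `0` elsewhere. -/
def tbl {q D : ℕ} (ω : Fin D → ZMod q) (x : ℕ) : ℕ := if h : x < D then (ω ⟨x, h⟩).val else 0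

theorem exec_fillLoop (q : ℕ) [NeZero q] (hqV : q ≤ V) (r : ℕ) :
    ∀ (j : ℕ) (s : State), Bd V s → s.words 8 = q → s.words 13 = j → s.words 12 = j + r →
    ∃ F : (Fin r → ZMod q) → State,
      Exec (V ^ 31) fillLoop s (r * 30 + 7) ((PMF.uniformOfFintype (Fin r → ZMod q)).map F) ∧
      ∀ ω, Bd V (F ω) ∧ Frame (fun a => a = 13 ∨ ∃ x, j ≤ x ∧ x < j + r ∧ a = A 0 x)
        (fun _ => False) s (F ω) ∧ ∀ x, x < r → (F ω).words (A 0 (j + x)) = tbl ω x := by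
  have hf : (Test.wordLE (.add (wc 13) (.lit 1)) (wc 12)).fine = true := by decide
  induction r with
  | zero =>
    intro j s hB h8 h13 h12
    refine ⟨fun _ => s, ?_, fun ω => ⟨hB, Frame.refl _ _ _, by simp⟩⟩
    have : Exec (V ^ 31) fillLoop s _ (PMF.pure s) :=
      Exec.loopStop s _ fillBody (by
        rw [Test.holds_iff_ev s hB _ hf]; simp [h12, h13])
    have hp : (PMF.uniformOfFintype (Fin 0 → ZMod q)).map (fun _ => s) = PMF.pure s :=
      PMF.map_const _ _
    rw [hp]
    exact this
  | succ r ih =>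
    intro j s hB h8 h13 h12
    have hq0 : 0 < q := Nat.pos_of_ne_zero (NeZero.ne q)
    have hjV : j + 1 ≤ V := by have := hB 12; omega
    have h8' : (wc 8).val (V ^ 31) s = q := by
      rw [WExp.val_eq_ev s hB _ (by decide)]; simp [h8]
    have ha : (arr 0 (wc 13)).val (V ^ 31) s = A 0 j := by
      rw [WExp.val_eq_ev s hB _ (by decide)]; simp [h13]
    -- one iteration
    have h1 : Exec (V ^ 31) (.rand (arr 0 (wc 13)) (wc 8)) s 12
        ((PMF.uniformOfFintype (ZMod q)).map fun v => s.putWord (A 0 j) v.val) := by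
      have h := Exec.rand (W := V ^ 31) s (arr 0 (wc 13)) (wc 8)
        (by rw [h8']; exact ⟨0, by simpa using hq0⟩)
      rw [ha] at h
      have e : ∀ (x : ℕ) (hx : x = q) (hne : (Finset.range x).Nonempty),
          (PMF.uniformOfFinset (Finset.range x) hne).map (fun v => s.putWord (A 0 j) v) =
          (PMF.uniformOfFintype (ZMod q)).map fun v => s.putWord (A 0 j) v.val := by
        rintro x rfl hne
        rw [uniformOfFinset_range_eq_map, PMF.map_comp]; rfl
      rw [e _ h8'] at h
      exact Exec.weaken _ _ _ _ _ h (by decide)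
    have hB1 : ∀ v : ZMod q, Bd V (s.putWord (A 0 j) v.val) := fun v =>
      hB.putWord _ _ ((ZMod.val_lt v).le.trans hqV)
    set G : ZMod q → State := fun v => (s.putWord (A 0 j) v.val).putWord 13 (j + 1) with hG
    have hBG : ∀ v, Bd V (G v) := fun v => (hB1 v).putWord _ _ hjV
    have h2 : Exec (V ^ 31) fillBody s (12 + 6) ((PMF.uniformOfFintype (ZMod q)).map G) := by
      obtain ⟨F', hF', hF''⟩ := Exec.seq_wp (V := V) (t₂ := 6) (d := .setWord (.lit 13) (.add (wc 13) (.lit 1)))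
        (Q := fun s₁ s₂ => s₁.words 13 = j → s₂ = s₁.putWord 13 (j + 1)) h1 hB1
        (fun v => Wp.setWord 13 (j + 1) rfl (by simp [h13]) (fun _ => hjV) fun _ => rfl)
      have : F' = G := funext fun v => (hF'' v).2 (by simp [h13])
      rw [← this]; exact hF'
    have ih' : ∀ s' : State, ∃ F : (Fin r → ZMod q) → State, (∃ v, G v = s') →
        Exec (V ^ 31) fillLoop s' (r * 30 + 7) ((PMF.uniformOfFintype (Fin r → ZMod q)).map F) ∧
        ∀ ω, Bd V (F ω) ∧ Frame (fun a => a = 13 ∨ ∃ x, j + 1 ≤ x ∧ x < j + 1 + r ∧ a = A 0 x)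
          (fun _ => False) s' (F ω) ∧ ∀ x, x < r → (F ω).words (A 0 (j + 1 + x)) = tbl ω x := by
      intro s'
      by_cases hs : ∃ v, G v = s'
      · obtain ⟨v, rfl⟩ := hs
        obtain ⟨F, hF⟩ := ih (j + 1) (G v) (hBG v) (by simp [hG, h8]) (by simp [hG])
          (by simp [hG, h12]; omega)
        exact ⟨F, fun _ => hF⟩
      · exact ⟨fun _ => s, fun h => absurd h hs⟩
    choose F hF using ih'
    refine ⟨fun ω => F (G (ω 0)) (Fin.tail ω), ?_, fun ω => ?_⟩
    · have h3 := Exec.seq s fillBody fillLoop _ _ _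
        (fun s' => (PMF.uniformOfFintype (Fin r → ZMod q)).map (F s')) h2 (by
          intro s' hs'
          rw [PMF.support_map] at hs'
          obtain ⟨v, -, hv⟩ := hs'
          exact (hF _ ⟨v, hv⟩).1)
      have h4 := Exec.loopStep s _ fillBody _ _ (by
        rw [Test.holds_iff_ev s hB _ hf]; simp [h12, h13]) h3
      have e : ((PMF.uniformOfFintype (ZMod q)).map G).bind
          (fun s' => (PMF.uniformOfFintype (Fin r → ZMod q)).map (F s')) =
          (PMF.uniformOfFintype (Fin (r + 1) → ZMod q)).map
            (fun ω => F (G (ω 0)) (Fin.tail ω)) := by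
        rw [← uniform_cons, PMF.map_bind, PMF.bind_map]
        congr 1
        funext v
        rw [PMF.map_comp]
        rfl
      rw [e] at h4
      refine Exec.weaken _ _ _ _ _ h4 ?_
      have : (Test.wordLE (.add (wc 13) (.lit 1)) (wc 12)).cost = 7 := rfl
      rw [this]; omega
    · obtain ⟨-, h⟩ := hF (G (ω 0)) ⟨_, rfl⟩
      obtain ⟨h5, h6, h7⟩ := h (Fin.tail ω)
      refine ⟨h5, ?_, ?_⟩
      · refine (((Frame.refl _ _ s).putWord (a := A 0 j) (v := (ω 0).val)
          (Or.inr ⟨j, le_rfl, by omega, rfl⟩)).putWord (a := 13) (v := j + 1) (Or.inl rfl)).trans h6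
          ?_ (fun _ h => h)
        rintro a (h | ⟨x, h1, h2, h3⟩)
        · exact Or.inl h
        · exact Or.inr ⟨x, by omega, by omega, h3⟩
      · intro x hx
        rcases x with _ | x
        · rw [h6.words (A 0 (j + 0)) (by
            rintro (h | ⟨x, h1, h2, h3⟩)
            · simp at h
            · simp at h3; omega)]
          simp [hG, tbl]
        · rw [show j + (x + 1) = j + 1 + x by ring, h7 x (by omega)]
          simp [tbl, hx, show x < r by omega, Fin.tail]

end

section

variable {V : ℕ} [hV : Fact (1048576 ≤ V)]

/-! ### The sketch after the initialization and the stream -/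

/-- The coefficient of entry `(i, j)` of the data in entry `x` of the sketch array. -/
def skA (q m N L : ℕ) (T : ℕ → ℕ) (i j x : ℕ) : ℝ :=
  ∑ t ∈ Finset.range L, if x = (t * (N + 1) + i) * m + bktH q m T (t * (N + 8)) j then
    sgnH q T (t * (N + 8)) j else 0

/-- The part of the memory that the stream does not change. -/
structure Fixed (n p k : ℕ) (φ R : ℝ) (T : ℕ → ℕ) (s : State) : Prop where
  params : Params n p k φ R s
  table : ∀ x, s.words (A 0 x) = T x
  words : ∀ a, 32 ≤ a → (∀ x, a ≠ A 0 x) → s.words a = 0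
  reals : ∀ a, 32 ≤ a → (∀ x, a ≠ A 0 x ∧ a ≠ A 1 x) → s.reals a = 0

theorem Fixed.frame {n p k : ℕ} {φ R : ℝ} {T : ℕ → ℕ} {s s' : State}
    (h : Fixed n p k φ R T s)
    (hf : Frame (fun a => a = 0 ∨ a = 1 ∨ (10 ≤ a ∧ a < 32))
      (fun a => a = 0 ∨ ∃ x, a = A 0 x ∨ a = A 1 x) s s') : Fixed n p k φ R T s' := by
  refine ⟨h.params.frame hf (fun a ha => by omega) ?_, fun x => ?_, fun a ha hx => ?_,
    fun a ha hx => ?_⟩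
  · rintro a (h | ⟨x, h | h⟩)
    · exact Or.inl h
    · exact Or.inr (h ▸ (by have := le_A 0 x; omega))
    · exact Or.inr (h ▸ (by have := le_A 1 x; omega))
  · rw [hf.words _ (by have := le_A 0 x; omega), h.table]
  · rw [hf.words _ (by omega), h.words a ha hx]
  · rw [hf.reals _ (by
      rintro (h | ⟨x, h | h⟩)
      · omega
      · exact (hx x).1 h
      · exact (hx x).2 h), h.reals a ha hx]

/-- One update, in terms of the sketch. -/
theorem Fixed.update {n p k i j : ℕ} {φ R α : ℝ} {T : ℕ → ℕ} {s : State} (hS : Sizes V n p)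
    (h : Fixed n p k φ R T s) (h0 : s.words 0 = i) (h1 : s.words 1 = j) (hr : s.reals 0 = α)
    (hi : i ≤ cPar n ^ 6) :
    Wp V updProg (LPar n * 400 + 50) s fun s' =>
      Frame (fun a => a = 0 ∨ a = 1 ∨ (10 ≤ a ∧ a < 15))
        (fun a => a = 0 ∨ ∃ x, a = A 0 x ∨ a = A 1 x) s s' ∧
      Fixed n p k φ R T s' ∧
      (∀ x, s'.reals (A 0 x) = s.reals (A 0 x) + α *
        skA (nextPrime (p + mPar n)) (mPar n) (cPar n ^ 6) (LPar n) T i j x) ∧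
      (∀ x, s'.reals (A 1 x) = s.reals (A 1 x) + if x = i then α else 0) := by
  have hm := hS.one_le_mPar
  have hq := nextPrime_spec (p + mPar n)
  have hq' := nextPrime_le (p + mPar n) (by omega)
  refine (wp_updProg h0 h1 h.params.w5 h.params.w6 h.params.w7 h.params.w8 hr h.table hi hm
    (by omega) (hq'.trans hS.a2) hS.a3 hS.a4).mono le_rfl ?_
  rintro s' ⟨hf, h3, h4⟩
  have hf' : Frame (fun a => a = 0 ∨ a = 1 ∨ (10 ≤ a ∧ a < 15))
        (fun a => a = 0 ∨ ∃ x, a = A 0 x ∨ a = A 1 x) s s' :=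
    (Frame.refl _ _ s).trans hf (fun a ha => Or.inr (Or.inr ha)) (fun a ha => Or.inr ha)
  refine ⟨hf', h.frame ((Frame.refl _ _ s).trans hf' (fun a ha => by omega) (fun a ha => ha)), ?_, h4⟩
  intro x
  rw [h3, skA, Finset.mul_sum]
  congr 1
  refine Finset.sum_congr rfl fun t _ => ?_
  split_ifs <;> ring

/-- Feeds the all-ones row, as row `N`, through the update program. -/
def onesProg : Prog :=
  forTo 15 9 <|
    .seq (.setWord (.lit 0) (wc 6)) <|
    .seq (.setWord (.lit 1) (wc 15)) <|
    .seq (.setReal (.lit 0) (.ofWord (.lit 1))) updProg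

theorem wp_onesProg {n p k : ℕ} {φ R : ℝ} {T : ℕ → ℕ} {s : State} (hS : Sizes V n p)
    (h : Fixed n p k φ R T s) (h9 : s.words 9 = p) (h0 : ∀ a, 32 ≤ a → s.reals a = 0) :
    Wp V onesProg (p * (30 + (LPar n * 400 + 50) + 13) + 10) s fun s' =>
      Fixed n p k φ R T s' ∧
      (∀ x, s'.reals (A 0 x) = ∑ j ∈ Finset.range p,
        skA (nextPrime (p + mPar n)) (mPar n) (cPar n ^ 6) (LPar n) T (cPar n ^ 6) j x) ∧
      (∀ x, s'.reals (A 1 x) = if x = cPar n ^ 6 then (p : ℝ) else 0) := by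
  refine wp_forTo (fun y s' => Fixed n p k φ R T s' ∧ s'.words 9 = p ∧ s'.words 15 = y ∧
      (∀ x, s'.reals (A 0 x) = ∑ j ∈ Finset.range y,
        skA (nextPrime (p + mPar n)) (mPar n) (cPar n ^ 6) (LPar n) T (cPar n ^ 6) j x) ∧
      (∀ x, s'.reals (A 1 x) = if x = cPar n ^ 6 then (y : ℝ) else 0)) p (by norm_num) (by norm_num)
    ?_ ?_ ?_ ?_
  · refine ⟨h.frame ((Frame.refl _ _ s).putWord (by norm_num)), by simp [h9], by simp, ?_, ?_⟩
    · intro x; simp [h0]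
    · intro x; simp [h0]
  · rintro j s' - ⟨-, h1, h2, -⟩
    exact ⟨h2, h1⟩
  · rintro j s' hj ⟨hF, h9', h15, hA, hB⟩ - -
    have := hS.a2
    refine Wp.seq 10 _ (Wp.setWord 0 (cPar n ^ 6) rfl (by simp [hF.params.w6])
      (fun _ => hS.a6) ?_) (show 10 + (20 + (LPar n * 400 + 50)) ≤ _ by omega)
    refine Wp.seq 10 _ (Wp.setWord 1 j rfl (by simp [h15]) (fun _ => by omega) ?_)
      (show 10 + (10 + (LPar n * 400 + 50)) ≤ _ by omega)
    refine Wp.seq 10 _ (Wp.setReal 0 1 rfl (by simp) ?_) le_rfl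
    have hf := (((Frame.refl (fun a => a = 0 ∨ a = 1 ∨ (10 ≤ a ∧ a < 32))
      (fun a => a = 0 ∨ ∃ x, a = A 0 x ∨ a = A 1 x) s').putWord (a := 0) (v := cPar n ^ 6)
      (by norm_num)).putWord (a := 1) (v := j) (by norm_num)).putReal (a := 0) (v := 1) (by norm_num)
    refine (Fixed.update (i := cPar n ^ 6) (j := j) (α := 1) hS (hF.frame hf) (by simp) (by simp)
      (by simp) le_rfl).mono le_rfl ?_
    rintro s'' ⟨hf2, hF2, hA2, hB2⟩
    refine ⟨by simp [hf2.words, h15], hF2.frame ((Frame.refl _ _ _).putWord (by norm_num)),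
      by simp [hf2.words, h9'], by simp, ?_, ?_⟩
    · intro x
      simp [hA2, hA, Finset.sum_range_succ]
    · intro x
      simp only [putWord_reals, hB2, putReal_reals, A_ne_small (show 0 < 32 by norm_num), if_false,
        hB]
      split_ifs <;> simp
  · rintro s' ⟨hF, -, -, hA, hB⟩
    exact ⟨hF, hA, hB⟩

/-- The initialization: compute the parameters, draw the random table, and sketch the all-ones
row. -/
def initProg : Prog :=
  .seq preProg <| .seq (.setWord (.lit 13) (.lit 0)) <| .seq fillLoop onesProg

/-- The random table has `LPar n * (cPar n ^ 6 + 8)` entries. -/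
abbrev tlen (n : ℕ) : ℕ := LPar n * (cPar n ^ 6 + 8)

theorem exec_initProg {n p k : ℕ} {φ R : ℝ} (hS : Sizes V n p) (hk : k ≤ V)
    [NeZero (nextPrime (p + mPar n))] :
    ∃ (t : ℕ) (F : (Fin (tlen n) → ZMod (nextPrime (p + mPar n))) → State),
      Exec (V ^ 31) initProg (startState n p k φ R) t ((PMF.uniformOfFintype _).map F) ∧
      ∀ ω, Bd V (F ω) ∧ Fixed n p k φ R (tbl ω) (F ω) ∧
      (∀ x, (F ω).reals (A 0 x) = ∑ j ∈ Finset.range p,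
        skA (nextPrime (p + mPar n)) (mPar n) (cPar n ^ 6) (LPar n) (tbl ω) (cPar n ^ 6) j x) ∧
      (∀ x, (F ω).reals (A 1 x) = if x = cPar n ^ 6 then (p : ℝ) else 0) := by
  have hm := hS.one_le_mPar
  have hq' := (nextPrime_le (p + mPar n) (by omega)).trans hS.a2
  have hB0 : Bd V (startState n p k φ R) := by
    intro a
    have := hS.a1
    have := hS.a2
    simp only [startState, Function.update_apply]
    split_ifs <;> omega
  obtain ⟨F, h1, h2⟩ := Exec.wp_seq (V := V) (d := .seq (.setWord (.lit 13) (.lit 0))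
      (.seq fillLoop onesProg)) (μ := PMF.uniformOfFintype (Fin (tlen n) → ZMod (nextPrime (p + mPar n))))
    (t₂ := 10 + ((tlen n * 30 + 7) + (p * (30 + (LPar n * 400 + 50) + 13) + 10)))
    (Q := fun F => ∀ ω, Bd V (F ω) ∧ Fixed n p k φ R (tbl ω) (F ω) ∧
      (∀ x, (F ω).reals (A 0 x) = ∑ j ∈ Finset.range p,
        skA (nextPrime (p + mPar n)) (mPar n) (cPar n ^ 6) (LPar n) (tbl ω) (cPar n ^ 6) j x) ∧
      (∀ x, (F ω).reals (A 1 x) = if x = cPar n ^ 6 then (p : ℝ) else 0)) hB0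
    (wp_preProg (k := k) (φ := φ) (R := R) hS) (by
      rintro s hBs ⟨hP, h9, h12, hw, hr⟩
      refine Exec.wp_seq (P := fun s' => s' = s.putWord 13 0) hBs
        (Wp.setWord 13 0 rfl (by simp) (by simp) rfl) ?_
      rintro _ hBs' rfl
      obtain ⟨F, hF1, hF2⟩ := exec_fillLoop _ hq' (tlen n) 0 (s.putWord 13 0) hBs'
        (by simp [hP.w8]) (by simp) (by simp [h12, tlen])
      have hFix : ∀ ω, Fixed n p k φ R (tbl ω) (F ω) := by
        intro ω
        obtain ⟨-, hf, ht⟩ := hF2 ω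
        have hf' := ((Frame.refl (fun a => a = 13 ∨ ∃ x, x < tlen n ∧ a = A 0 x)
          (fun _ => False) s).putWord (a := 13) (v := 0) (Or.inl rfl)).trans hf (by
            rintro a (h | ⟨x, h1, h2, h3⟩)
            · exact Or.inl h
            · exact Or.inr ⟨x, by omega, h3⟩) (fun _ h => h)
        refine ⟨hP.frame hf' ?_ (fun _ h => h.elim), ?_, ?_, ?_⟩
        · rintro a (h | ⟨x, -, h⟩)
          · omega
          · have := le_A 0 x; omega
        · intro x
          by_cases hx : x < tlen n
          · simpa using ht x hx
          · rw [hf'.words _ (by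
              rintro (h | ⟨y, hy, h⟩)
              · simp at h
              · simp at h; omega), hw _ (le_A 0 x), tbl, dif_neg hx]
        · intro a ha hx
          rw [hf'.words _ (by
            rintro (h | ⟨y, hy, h⟩)
            · omega
            · exact hx y h), hw a ha]
        · intro a ha hx
          rw [hf'.reals _ (fun h => h), hr a ha]
      obtain ⟨F', hF'1, hF'2⟩ := Exec.seq_wp (V := V) (d := onesProg)
        (t₂ := p * (30 + (LPar n * 400 + 50) + 13) + 10)
        (Q := fun s₁ s₂ => ∀ T, Fixed n p k φ R T s₁ → Fixed n p k φ R T s₂ ∧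
          (∀ x, s₂.reals (A 0 x) = ∑ j ∈ Finset.range p,
            skA (nextPrime (p + mPar n)) (mPar n) (cPar n ^ 6) (LPar n) T (cPar n ^ 6) j x) ∧
          (∀ x, s₂.reals (A 1 x) = if x = cPar n ^ 6 then (p : ℝ) else 0)) hF1
        (fun ω => (hF2 ω).1) (fun ω => by
          obtain ⟨hb, hf, ht⟩ := hF2 ω
          refine (wp_onesProg hS (hFix ω) ?_ ?_).mono le_rfl ?_
          · rw [hf.words 9 (by
              rintro (h | ⟨y, -, -, h⟩)
              · simp at h
              · simp at h)]
            simp [h9]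
          · intro a ha
            rw [hf.reals a (fun h => h)]
            exact hr a ha
          · rintro s₂ ⟨hF3, hA, hB⟩ T hT
            have : T = tbl ω := funext fun x => by rw [← hT.table, (hFix ω).table]
            subst this
            exact ⟨hF3, hA, hB⟩)
      exact ⟨F', hF'1, fun ω => ⟨(hF'2 ω).1, (hF'2 ω).2 _ (hFix ω)⟩⟩)
  exact ⟨_, F, h1, h2⟩

theorem sum_single_mul {n p : ℕ} (i : Fin n) (j : Fin p) (α : ℝ) (f : ℕ → ℕ → ℝ) :
    ∑ i', ∑ j', Matrix.single i j α i' j' * f i' j' = α * f i j := by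
  rw [Finset.sum_eq_single i, Finset.sum_eq_single j]
  · simp
  · intro b _ hb; rw [Matrix.single_apply_of_col_ne _ _ hb.symm]; simp
  · simp
  · intro b _ hb
    refine Finset.sum_eq_zero fun c _ => ?_
    rw [Matrix.single_apply_of_row_ne hb.symm]; simp
  · simp

/-- The memory after the stream is a function of the memory before it; in the sketch array and the
array of row sums, every entry of the data matrix enters linearly. -/
theorem digests_updProg {n p k : ℕ} {φ R : ℝ} (hS : Sizes V n p) (us : List (Update n p)) :
    ∃ G : State → State, ∀ s, Bd V s → (∃ T, Fixed n p k φ R T s) →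
      Digests (V ^ 31) updProg (LPar n * 400 + 50) us s (PMF.pure (G s)) ∧ Bd V (G s) ∧
      ∀ T, Fixed n p k φ R T s → Fixed n p k φ R T (G s) ∧
      (∀ x, (G s).reals (A 0 x) = s.reals (A 0 x) + ∑ i : Fin n, ∑ j : Fin p,
        streamMatrix us i j *
          skA (nextPrime (p + mPar n)) (mPar n) (cPar n ^ 6) (LPar n) T i j x) ∧
      (∀ x, (G s).reals (A 1 x) = s.reals (A 1 x) + ∑ i : Fin n, ∑ j : Fin p,
        streamMatrix us i j * if x = (i : ℕ) then 1 else 0) := by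
  induction us with
  | nil =>
    refine ⟨id, fun s hB hT => ⟨Digests.nil s, hB, fun T hT => ⟨hT, ?_, ?_⟩⟩⟩ <;>
      simp [streamMatrix]
  | cons u us ih =>
    obtain ⟨G, hG⟩ := ih
    have step : ∀ s, ∃ s', Bd V s → (∃ T, Fixed n p k φ R T s) →
        Exec (V ^ 31) updProg (s.feed u) (LPar n * 400 + 50) (PMF.pure s') ∧ Bd V s' ∧
        ∀ T, Fixed n p k φ R T s → Fixed n p k φ R T s' ∧
        (∀ x, s'.reals (A 0 x) = s.reals (A 0 x) + u.amount *
          skA (nextPrime (p + mPar n)) (mPar n) (cPar n ^ 6) (LPar n) T u.row u.col x) ∧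
        (∀ x, s'.reals (A 1 x) = s.reals (A 1 x) + if x = (u.row : ℕ) then u.amount else 0) := by
      intro s
      by_cases h : Bd V s ∧ ∃ T, Fixed n p k φ R T s
      · obtain ⟨hB, T, hT⟩ := h
        have hrow := u.row.2
        have hcol := u.col.2
        have := le_cPar_pow n
        have := hS.a1
        have := hS.a2
        have hB' : Bd V (s.feed u) := ((hB.putWord 0 u.row (by omega)).putWord 1 u.col (by omega))
        have hf : Frame (fun a => a = 0 ∨ a = 1 ∨ (10 ≤ a ∧ a < 32))
            (fun a => a = 0 ∨ ∃ x, a = A 0 x ∨ a = A 1 x) s (s.feed u) :=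
          (((Frame.refl _ _ s).putWord (by norm_num)).putWord (by norm_num)).putReal (by norm_num)
        obtain ⟨s', h1, h2, h3, h4, h5, h6⟩ := (hT.frame hf).update (i := u.row) (j := u.col)
          (α := u.amount) hS (by simp [State.feed]) (by simp [State.feed]) (by simp [State.feed])
          (by omega) hB'
        refine ⟨s', fun _ _ => ⟨h1, h2, fun T' hT' => ?_⟩⟩
        have : T' = T := funext fun x => by rw [← hT'.table, hT.table]
        subst this
        exact ⟨h4, fun x => by rw [h5]; simp [State.feed], fun x => by rw [h6]; simp [State.feed]⟩
      · exact ⟨s, fun h1 h2 => absurd ⟨h1, h2⟩ h⟩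
    choose H hH using step
    have hM : ∀ i j, streamMatrix (u :: us) i j =
        Matrix.single u.row u.col u.amount i j + streamMatrix us i j := by
      intro i j; simp [streamMatrix]
    refine ⟨fun s => G (H s), fun s hB hT => ?_⟩
    obtain ⟨h1, h2, h3⟩ := hH s hB hT
    have hT' : ∃ T, Fixed n p k φ R T (H s) := hT.imp fun T h => (h3 T h).1
    obtain ⟨h4, h5, h6⟩ := hG (H s) h2 hT'
    refine ⟨?_, h5, fun T hT => ?_⟩
    · have := Digests.cons u us s (PMF.pure (H s)) (fun _ => PMF.pure (G (H s))) h1 (by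
        intro s' hs'
        rw [PMF.support_pure, Set.mem_singleton_iff] at hs'
        subst hs'; exact h4)
      rwa [PMF.pure_bind] at this
    · obtain ⟨h7, h8, h9⟩ := h3 T hT
      obtain ⟨h10, h11, h12⟩ := h6 T h7
      refine ⟨h10, fun x => ?_, fun x => ?_⟩
      · rw [h11, h8]
        simp only [hM, add_mul, Finset.sum_add_distrib]
        rw [sum_single_mul u.row u.col u.amount (fun i j =>
          skA (nextPrime (p + mPar n)) (mPar n) (cPar n ^ 6) (LPar n) T i j x)]
        ring
      · rw [h12, h9]
        simp only [hM, add_mul, Finset.sum_add_distrib]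
        rw [sum_single_mul u.row u.col u.amount (fun i j => if x = i then 1 else 0)]
        simp; ring

end

section

variable {V : ℕ} [hV : Fact (1048576 ≤ V)]

/-! ### The complete run -/

theorem tbl_eq_zero {q D : ℕ} (ω : Fin D → ZMod q) {x : ℕ} (h : D ≤ x) : tbl ω x = 0 :=
  dif_neg (by omega)

theorem skA_eq_zero {q m N L : ℕ} {T : ℕ → ℕ} {i j x : ℕ} (hi : i ≤ N) (hm : 1 ≤ m)
    (hx : L * (N + 1) * m ≤ x) : skA q m N L T i j x = 0 := by
  refine Finset.sum_eq_zero fun t ht => if_neg ?_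
  rintro rfl
  have ht := Finset.mem_range.1 ht
  have hb : bktH q m T (t * (N + 8)) j < m := Nat.mod_lt _ hm
  have h1 : (t * (N + 1) + i + 1) * m ≤ L * (N + 1) * m := by
    refine Nat.mul_le_mul_right _ ?_
    calc t * (N + 1) + i + 1 ≤ (t + 1) * (N + 1) := by ring_nf; omega
      _ ≤ L * (N + 1) := Nat.mul_le_mul_right _ ht
  rw [add_mul] at h1
  omega

/-- The contribution of an update to one bucket of the sketch of one row in one trial. -/
theorem skA_apply {q m N L : ℕ} {T : ℕ → ℕ} {i i' j t b : ℕ} (hi : i ≤ N) (hi' : i' ≤ N)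
    (ht : t < L) (hm : 1 ≤ m) (hb : b < m) :
    skA q m N L T i' j ((t * (N + 1) + i) * m + b) =
      if i' = i ∧ bktH q m T (t * (N + 8)) j = b then sgnH q T (t * (N + 8)) j else 0 := by
  have hbk : ∀ t, bktH q m T (t * (N + 8)) j < m := fun t => Nat.mod_lt _ hm
  have key : ∀ t', (t * (N + 1) + i) * m + b = (t' * (N + 1) + i') * m + bktH q m T (t' * (N + 8)) j ↔
      t' = t ∧ i' = i ∧ bktH q m T (t' * (N + 8)) j = b := by
    intro t'
    constructor
    · intro h
      have h1 := congrArg (· / m) h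
      have h2 := congrArg (· % m) h
      simp only [mul_comm _ m, Nat.mul_add_div hm, Nat.div_eq_of_lt hb, Nat.div_eq_of_lt (hbk _),
        Nat.mul_add_mod, Nat.mod_eq_of_lt hb, Nat.mod_eq_of_lt (hbk _), add_zero] at h1 h2
      have h3 := congrArg (· / (N + 1)) h1
      have h4 := congrArg (· % (N + 1)) h1
      simp only [mul_comm _ (N + 1), Nat.mul_add_div (Nat.succ_pos N), Nat.mul_add_mod,
        Nat.div_eq_of_lt (show i < N + 1 by omega), Nat.div_eq_of_lt (show i' < N + 1 by omega),
        Nat.mod_eq_of_lt (show i < N + 1 by omega),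
        Nat.mod_eq_of_lt (show i' < N + 1 by omega), add_zero] at h3 h4
      exact ⟨h3.symm, h4.symm, h2.symm⟩
    · rintro ⟨rfl, rfl, h⟩; rw [h]
  unfold skA
  simp only [key]
  rw [Finset.sum_eq_single t]
  · simp
  · intro t' _ h; rw [if_neg (fun h' => h h'.1)]
  · intro h; exact absurd (Finset.mem_range.2 ht) h

/-- The sketch array at the end of the stream. -/
def finF (n p : ℕ) (us : List (Update n p)) (T : ℕ → ℕ) (x : ℕ) : ℝ :=
  ∑ j ∈ Finset.range p,
    skA (nextPrime (p + mPar n)) (mPar n) (cPar n ^ 6) (LPar n) T (cPar n ^ 6) j x +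
  ∑ i : Fin n, ∑ j : Fin p, streamMatrix us i j *
    skA (nextPrime (p + mPar n)) (mPar n) (cPar n ^ 6) (LPar n) T i j x

/-- The array of row sums at the end of the stream. -/
def finG (n p : ℕ) (us : List (Update n p)) (x : ℕ) : ℝ :=
  (if x = cPar n ^ 6 then (p : ℝ) else 0) +
  ∑ i : Fin n, ∑ j : Fin p, streamMatrix us i j * if x = (i : ℕ) then 1 else 0

/-- The size of the sketch. -/
def sizeT (n : ℕ) : ℕ :=
  32 * (LPar n * (cPar n ^ 6 + 8) + LPar n * (cPar n ^ 6 + 1) * mPar n + cPar n ^ 6 + 4)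

open Classical in
/-- The running time of the query. -/
def queryTimeT (n k : ℕ) (R φ : ℝ) : ℕ :=
  50 + if n * φ ^ 6 ≤ 1 then n * (n * 24 + 23) + 30 else
    mainTime k R φ (cPar n) (mPar n) (LPar n)

theorem Fixed.fitsIn {n p k : ℕ} {φ R : ℝ} {us : List (Update n p)}
    {ω : Fin (tlen n) → ZMod (nextPrime (p + mPar n))} {s : State} (hS : Sizes V n p)
    (h : Fixed n p k φ R (tbl ω) s) (hF : ∀ x, s.reals (A 0 x) = finF n p us (tbl ω) x)
    (hG : ∀ x, s.reals (A 1 x) = finG n p us x) : s.FitsIn (sizeT n) := by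
  intro a ha
  have hm := hS.one_le_mPar
  have hn := le_cPar_pow n
  unfold sizeT at ha
  constructor
  · by_cases hx : ∃ x, a = A 0 x
    · obtain ⟨x, rfl⟩ := hx
      rw [h.table, tbl_eq_zero]
      unfold tlen
      unfold A at ha
      omega
    · exact h.words a (by omega) fun x hx' => hx ⟨x, hx'⟩
  · by_cases hx : ∃ x, a = A 0 x
    · obtain ⟨x, rfl⟩ := hx
      have hx : LPar n * (cPar n ^ 6 + 1) * mPar n ≤ x := by
        unfold A at ha; omega
      rw [hF, finF, Finset.sum_eq_zero (fun j _ => skA_eq_zero le_rfl hm hx), zero_add]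
      refine Finset.sum_eq_zero fun i _ => Finset.sum_eq_zero fun j _ => ?_
      rw [skA_eq_zero (by have := i.2; omega) hm hx, mul_zero]
    · by_cases hy : ∃ x, a = A 1 x
      · obtain ⟨x, rfl⟩ := hy
        have hx : cPar n ^ 6 < x := by unfold A at ha; omega
        rw [hG, finG, if_neg (by omega), zero_add]
        refine Finset.sum_eq_zero fun i _ => Finset.sum_eq_zero fun j _ => ?_
        rw [if_neg (by have := i.2; omega), mul_zero]
      · exact h.reals a (by omega) fun x => ⟨fun h => hx ⟨x, h⟩, fun h => hy ⟨x, h⟩⟩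

/-- The outcome of the complete run is a function of a uniform random table, and its output
satisfies `QueryOut` for the sketch that belongs to that table. -/
theorem run_spec {n p k : ℕ} {φ R : ℝ} (hS : Sizes V n p) (hk : k ≤ V)
    [NeZero (nextPrime (p + mPar n))] (us : List (Update n p)) :
    ∃ (μ : PMF State) (ν : State → PMF State)
      (F : (Fin (tlen n) → ZMod (nextPrime (p + mPar n))) → State),
      SketchAlgorithm.Sketches ⟨initProg, updProg, queryProg⟩ (V ^ 31) k φ R (LPar n * 400 + 50)
        us μ ∧
      (∀ s ∈ μ.support, s.FitsIn (sizeT n)) ∧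
      (∀ s ∈ μ.support, Exec (V ^ 31) queryProg s.clearOut (queryTimeT n k R φ) (ν s)) ∧
      μ.bind ν = (PMF.uniformOfFintype _).map F ∧
      ∀ ω, QueryOut (finF n p us (tbl ω)) (finG n p us) (tbl ω) (nextPrime (p + mPar n)) (cPar n)
        (mPar n) (cPar n ^ 6) (LPar n) n k R φ (F ω).out := by
  classical
  have hm := hS.one_le_mPar
  obtain ⟨t, F, hF1, hF2⟩ := exec_initProg (k := k) (φ := φ) (R := R) hS hk
  obtain ⟨G, hG⟩ := digests_updProg (k := k) (φ := φ) (R := R) hS us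
  have hF3 : ∀ ω, ∃ T, Fixed n p k φ R T (F ω) := fun ω => ⟨_, (hF2 ω).2.1⟩
  have hGF : ∀ ω, Fixed n p k φ R (tbl ω) (G (F ω)) ∧
      (∀ x, (G (F ω)).reals (A 0 x) = finF n p us (tbl ω) x) ∧
      (∀ x, (G (F ω)).reals (A 1 x) = finG n p us x) := by
    intro ω
    obtain ⟨-, h1, h2, h3⟩ := hF2 ω
    obtain ⟨-, -, h4⟩ := hG _ (hF2 ω).1 (hF3 ω)
    obtain ⟨h5, h6, h7⟩ := h4 _ h1
    exact ⟨h5, fun x => by rw [h6, h2, finF], fun x => by rw [h7, h3, finG]⟩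
  have hBG : ∀ ω, Bd V (G (F ω)) := fun ω => (hG _ (hF2 ω).1 (hF3 ω)).2.1
  have hQ : ∀ s, ∃ s', (∃ ω, G (F ω) = s) →
      Exec (V ^ 31) queryProg s.clearOut (queryTimeT n k R φ) (PMF.pure s') ∧
      ∀ ω, G (F ω) = s → QueryOut (finF n p us (tbl ω)) (finG n p us) (tbl ω)
        (nextPrime (p + mPar n)) (cPar n) (mPar n) (cPar n ^ 6) (LPar n) n k R φ s'.out := by
    intro s
    by_cases h : ∃ ω, G (F ω) = s
    · obtain ⟨ω, hω⟩ := h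
      have hB := hBG ω
      obtain ⟨h1, h2, h3⟩ := hGF ω
      rw [hω] at hB h1 h2 h3
      have hcm : cPar n ≤ mPar n := by
        have : cPar n ≤ cPar n ^ 4 := Nat.le_self_pow (by norm_num) _
        unfold mPar; omega
      obtain ⟨s', h4, -, h5⟩ := wp_queryProg (V := V) (s := s.clearOut) (k := k) (n := n) (R := R)
        (φ := φ) h1.params.w3 h1.params.w4 h1.params.w5 h1.params.w6 h1.params.w7 h1.params.w8
        h1.params.w2 h1.params.r1 h1.params.r2 h2 h3 h1.table hS.a5 hS.root hm hcm (by ring)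
        hS.a3 hS.a4 hS.a6 hB
      refine ⟨s', fun _ => ⟨by exact h4, fun ω' hω' => ?_⟩⟩
      have e : tbl ω' = tbl ω := funext fun x => by
        rw [← h1.table, ← hω', (hGF ω').1.table]
      rw [e]
      exact h5
    · exact ⟨s, fun h' => absurd h' h⟩
  choose H hH using hQ
  refine ⟨(PMF.uniformOfFintype _).map (G ∘ F), fun s => PMF.pure (H s), H ∘ G ∘ F, ?_, ?_, ?_, ?_,
    ?_⟩
  · refine ⟨t, _, fun s => PMF.pure (G s), hF1, ?_, ?_⟩
    · intro s hs
      rw [PMF.support_map] at hs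
      obtain ⟨ω, -, rfl⟩ := hs
      exact (hG _ (hF2 ω).1 (hF3 ω)).1
    · rw [← PMF.map_comp]; rfl
  · intro s hs
    rw [PMF.support_map] at hs
    obtain ⟨ω, -, rfl⟩ := hs
    exact (hGF ω).1.fitsIn hS (hGF ω).2.1 (hGF ω).2.2
  · intro s hs
    rw [PMF.support_map] at hs
    obtain ⟨ω, -, rfl⟩ := hs
    exact (hH _ ⟨ω, rfl⟩).1
  · rw [← PMF.map_comp (p := PMF.uniformOfFintype _) (G ∘ F) H]; rfl
  · intro ω
    exact (hH _ ⟨ω, rfl⟩).2 ω rfl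

/-! ### Centered rows -/

/-- The contribution of column `j` to bucket `b` in trial `t`. -/
def hsh (q m N : ℕ) (T : ℕ → ℕ) (t j b : ℕ) : ℝ :=
  if bktH q m T (t * (N + 8)) j = b then sgnH q T (t * (N + 8)) j else 0

/-- The centered sketch of a row is the sketch of the centered row. -/
theorem csA_eq {n p : ℕ} (hS : Sizes V n p) (us : List (Update n p)) (T : ℕ → ℕ)
    {t b : ℕ} (ht : t < LPar n) (hb : b < mPar n) (i : Fin n) :
    csA (finF n p us T) (finG n p us) (mPar n) (cPar n ^ 6) t i b =
      ∑ j : Fin p, centered (streamMatrix us) i j *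
        hsh (nextPrime (p + mPar n)) (mPar n) (cPar n ^ 6) T t j b := by
  have hm := hS.one_le_mPar
  have hn := le_cPar_pow n
  have hi := i.2
  have hF : ∀ i : Fin n, finF n p us T ((t * (cPar n ^ 6 + 1) + i) * mPar n + b) =
      ∑ j : Fin p, streamMatrix us i j *
        hsh (nextPrime (p + mPar n)) (mPar n) (cPar n ^ 6) T t j b := by
    intro i
    have hi := i.2
    rw [finF, Finset.sum_eq_zero, zero_add, Finset.sum_eq_single i]
    · refine Finset.sum_congr rfl fun j _ => ?_
      rw [skA_apply (by omega) (by omega) ht hm hb]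
      simp [hsh]
    · intro i' _ hi'
      refine Finset.sum_eq_zero fun j _ => ?_
      rw [skA_apply (by omega) (by have := i'.2; omega) ht hm hb,
        if_neg (fun h => hi' (Fin.ext h.1)), mul_zero]
    · simp
    · intro j _
      rw [skA_apply (by omega) (by omega) ht hm hb, if_neg (by omega)]
  have hFN : finF n p us T ((t * (cPar n ^ 6 + 1) + cPar n ^ 6) * mPar n + b) =
      ∑ j : Fin p, hsh (nextPrime (p + mPar n)) (mPar n) (cPar n ^ 6) T t j b := by
    rw [finF, Finset.sum_eq_zero (s := (Finset.univ : Finset (Fin n))), add_zero,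
      Finset.sum_range]
    · refine Finset.sum_congr rfl fun j _ => ?_
      rw [skA_apply (by omega) (by omega) ht hm hb]
      simp [hsh]
    · intro i' _
      have := i'.2
      refine Finset.sum_eq_zero fun j _ => ?_
      rw [skA_apply (by omega) (by omega) ht hm hb, if_neg (by omega), mul_zero]
  have hG : finG n p us i = ∑ j, streamMatrix us i j := by
    rw [finG, if_neg (by omega), zero_add, Finset.sum_eq_single i]
    · simp
    · intro i' _ h
      refine Finset.sum_eq_zero fun j _ => ?_
      rw [if_neg (fun h' => h (Fin.ext h'.symm)), mul_zero]
    · simp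
  have hGN : finG n p us (cPar n ^ 6) = p := by
    rw [finG, if_pos rfl, Finset.sum_eq_zero, add_zero]
    intro i' _
    refine Finset.sum_eq_zero fun j _ => ?_
    rw [if_neg (by have := i'.2; omega), mul_zero]
  rw [csA, hF, hFN, hG, hGN, Finset.mul_sum, ← Finset.sum_sub_distrib]
  refine Finset.sum_congr rfl fun j _ => ?_
  simp only [centered, sampleMean, Matrix.of_apply]
  ring

/-- The padding rows have a zero sketch. -/
theorem csA_eq_zero {n p : ℕ} (hS : Sizes V n p) (us : List (Update n p)) (T : ℕ → ℕ)
    {t b i : ℕ} (ht : t < LPar n) (hb : b < mPar n) (hi : n ≤ i) (hi' : i < cPar n ^ 6) :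
    csA (finF n p us T) (finG n p us) (mPar n) (cPar n ^ 6) t i b = 0 := by
  have hm := hS.one_le_mPar
  have hn := le_cPar_pow n
  have h1 : finF n p us T ((t * (cPar n ^ 6 + 1) + i) * mPar n + b) = 0 := by
    rw [finF, Finset.sum_eq_zero, zero_add]
    · refine Finset.sum_eq_zero fun i' _ => Finset.sum_eq_zero fun j _ => ?_
      have := i'.2
      rw [skA_apply (by omega) (by omega) ht hm hb, if_neg (by omega), mul_zero]
    · intro j _
      rw [skA_apply (by omega) (by omega) ht hm hb, if_neg (by omega)]
  have h2 : finG n p us i = 0 := by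
    rw [finG, if_neg (by omega), zero_add]
    refine Finset.sum_eq_zero fun i' _ => Finset.sum_eq_zero fun j _ => ?_
    rw [if_neg (by have := i'.2; omega), mul_zero]
  rw [csA, h1, h2]
  simp

end

section

open scoped BigOperators

/-! ### Averages over random tables -/

variable {q D : ℕ} [hq : Fact q.Prime]

/-- Entry `x` of a table, and `0` beyond its end. -/
def ent (ω : Fin D → ZMod q) (x : ℕ) : ZMod q := if h : x < D then ω ⟨x, h⟩ else 0

theorem tbl_eq_val_ent (ω : Fin D → ZMod q) (x : ℕ) : tbl ω x = (ent ω x).val := by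
  unfold tbl ent
  split_ifs <;> simp

theorem ent_add_smul (ω v : Fin D → ZMod q) (x : ZMod q) (y : ℕ) :
    ent (ω + x • v) y = ent ω y + x * ent v y := by
  unfold ent
  split_ifs <;> simp

/-- The average over all tables may be computed along the lines in a fixed direction. This replaces
conditioning on some of the random choices. -/
theorem expect_translate (v : Fin D → ZMod q) (f : (Fin D → ZMod q) → ℝ) :
    𝔼 ω, f ω = 𝔼 ω, 𝔼 x : ZMod q, f (ω + x • v) := by
  rw [Finset.expect_comm]
  have : ∀ x : ZMod q, 𝔼 ω, f (ω + x • v) = 𝔼 ω, f ω := fun x =>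
    Fintype.expect_equiv (Equiv.addRight (x • v)) _ _ fun ω => rfl
  simp only [this]
  exact (Fintype.expect_const _).symm

theorem expect_affine (a : ZMod q) {κ : ZMod q} (hκ : κ ≠ 0) (g : ZMod q → ℝ) :
    𝔼 x : ZMod q, g (a + x * κ) = 𝔼 y : ZMod q, g y :=
  Fintype.expect_equiv ((Equiv.mulRight₀ κ hκ).trans (Equiv.addLeft a)) _ _ fun _ => rfl

/-- The average of a function of which one factor is a function of an affine image of the random
table, shifted along a direction to which the other factor is insensitive. -/
theorem expect_mul_shift {ℓ : (Fin D → ZMod q) → ZMod q} (v : Fin D → ZMod q) {κ : ZMod q}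
    (hκ : κ ≠ 0) (hℓ : ∀ ω x, ℓ (ω + x • v) = ℓ ω + x * κ) {h : (Fin D → ZMod q) → ℝ}
    (hh : ∀ (ω : Fin D → ZMod q) (x : ZMod q), h (ω + x • v) = h ω) (g : ZMod q → ℝ) :
    𝔼 ω, h ω * g (ℓ ω) = (𝔼 ω, h ω) * 𝔼 y : ZMod q, g y := by
  rw [expect_translate v, Finset.expect_mul]
  refine Finset.expect_congr rfl fun ω _ => ?_
  simp only [hh, hℓ]
  rw [← Finset.mul_expect, expect_affine _ hκ]

/-! ### Random signs -/

/-- The sign of a residue. -/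
def sg (v : ZMod q) : ℝ := sgnN q v.val

theorem sg_zero : sg (0 : ZMod q) = 0 := by
  simp [sg, sgnN]

theorem sg_sq {v : ZMod q} (h : v ≠ 0) : sg v ^ 2 = 1 := by
  have : 1 ≤ v.val := Nat.one_le_iff_ne_zero.2 (by rwa [Ne, ZMod.val_eq_zero])
  unfold sg sgnN
  split_ifs <;> norm_num

theorem sg_sq_eq (v : ZMod q) : sg v ^ 2 = if v = 0 then 0 else 1 := by
  split_ifs with h
  · rw [h, sg_zero]; norm_num
  · exact sg_sq h

theorem abs_sg_le (v : ZMod q) : |sg v| ≤ 1 := abs_sgnN_le _ _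

theorem sg_neg (hodd : q % 2 = 1) (v : ZMod q) : sg (-v) = -sg v := by
  by_cases h : v = 0
  · rw [h, neg_zero, sg_zero, neg_zero]
  have h1 : 1 ≤ v.val := Nat.one_le_iff_ne_zero.2 (by rwa [Ne, ZMod.val_eq_zero])
  have h2 : v.val < q := ZMod.val_lt v
  have h3 : (-v).val = q - v.val := by rw [ZMod.neg_val, if_neg h]
  unfold sg sgnN
  rw [h3]
  by_cases h4 : v.val ≤ q / 2
  · rw [if_neg (by omega), if_pos h4, if_pos h1]
  · rw [if_pos (by omega), if_pos (by omega), if_neg h4]; norm_num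

theorem expect_sg (hodd : q % 2 = 1) : 𝔼 v : ZMod q, sg v = 0 := by
  have h := Fintype.expect_equiv (Equiv.neg (ZMod q)) (fun v => sg v) (fun v => -sg v) fun v => by
    simp [sg_neg hodd]
  rw [Finset.expect_neg_distrib] at h
  linarith

theorem expect_ite_zero_eq : (𝔼 v : ZMod q, if v = 0 then (1 : ℝ) else 0) = 1 / q := by
  rw [Fintype.expect_eq_sum_div_card]
  simp [ZMod.card]

/-- A residue class modulo `m ≤ q` contains at most `2 q / m` of the residues modulo `q`. -/
theorem expect_bucket_le {m : ℕ} (hm : 1 ≤ m) (hmq : m ≤ q) (b : ℕ) :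
    (𝔼 v : ZMod q, if v.val % m = b then (1 : ℝ) else 0) ≤ 2 / m := by
  have hm' : (0 : ℝ) < m := by exact_mod_cast hm
  have hq' : (0 : ℝ) < q := by exact_mod_cast hq.out.pos
  rw [Fintype.expect_eq_sum_div_card, Finset.sum_boole, ZMod.card]
  have hcard : (Finset.univ.filter fun v : ZMod q => v.val % m = b).card ≤ q / m + 1 := by
    have h1 : (Finset.univ.filter fun v : ZMod q => v.val % m = b).card ≤
        (Finset.range (q / m + 1)).card := by
      refine Finset.card_le_card_of_injOn (fun v => v.val / m) ?_ ?_
      · intro v _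
        simp only [Finset.coe_range, Set.mem_Iio]
        exact Nat.lt_succ_of_le (Nat.div_le_div_right (ZMod.val_lt v).le)
      · intro v hv w hw h
        simp only [Finset.coe_filter, Finset.mem_univ, true_and, Set.mem_ofPred_eq] at hv hw
        apply ZMod.val_injective q
        rw [← Nat.div_add_mod v.val m, ← Nat.div_add_mod w.val m, hv, hw]
        simp only at h
        rw [h]
    simpa using h1
  have h2 : ((Finset.univ.filter fun v : ZMod q => v.val % m = b).card : ℝ) ≤ q / m + 1 := by
    calc ((Finset.univ.filter fun v : ZMod q => v.val % m = b).card : ℝ)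
        ≤ ((q / m + 1 : ℕ) : ℝ) := by exact_mod_cast hcard
      _ ≤ q / m + 1 := by push_cast; have := @Nat.cast_div_le ℝ _ _ _ q m; linarith
  have h3 : (1 : ℝ) ≤ q / m := by rw [le_div_iff₀ hm']; simpa using (by exact_mod_cast hmq : (m : ℝ) ≤ q)
  rw [div_le_div_iff₀ hq' hm']
  calc _ ≤ ((q : ℝ) / m + q / m) * m := by gcongr; linarith
    _ = 2 * q := by field_simp; ring

/-! ### Polynomial hashing -/

/-- The polynomial with coefficients in entries `o, …, o + 3` of the table. -/
def pol (ω : Fin D → ZMod q) (o : ℕ) (y : ZMod q) : ZMod q :=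
  ent ω o + ent ω (o + 1) * y + ent ω (o + 2) * y ^ 2 + ent ω (o + 3) * y ^ 3

/-- The direction in which the polynomial at `o` changes by multiples of
`(X - a) (X - b) (X - c)`. -/
def cub (D o : ℕ) (a b c : ZMod q) : Fin D → ZMod q := fun y =>
  if (y : ℕ) = o then -(a * b * c) else if (y : ℕ) = o + 1 then a * b + b * c + c * a else
    if (y : ℕ) = o + 2 then -(a + b + c) else if (y : ℕ) = o + 3 then 1 else 0

theorem ent_cub {o y : ℕ} (hy : y < o ∨ o + 4 ≤ y) (a b c : ZMod q) : ent (cub D o a b c) y = 0 := by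
  unfold ent cub
  split_ifs with h h1 h2 h3 h4 <;> first | rfl | (exfalso; dsimp only at *; omega)

theorem pol_cub {o : ℕ} (ho : o + 4 ≤ D) (ω : Fin D → ZMod q) (x a b c y : ZMod q) :
    pol (ω + x • cub D o a b c) o y = pol ω o y + x * ((y - a) * (y - b) * (y - c)) := by
  have h0 : ent (cub D o a b c) o = -(a * b * c) := by
    simp [ent, cub, show o < D by omega]
  have h1 : ent (cub D o a b c) (o + 1) = a * b + b * c + c * a := by
    simp [ent, cub, show o + 1 < D by omega]
  have h2 : ent (cub D o a b c) (o + 2) = -(a + b + c) := by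
    simp [ent, cub, show o + 2 < D by omega]
  have h3 : ent (cub D o a b c) (o + 3) = 1 := by
    simp [ent, cub, show o + 3 < D by omega]
  simp only [pol, ent_add_smul, h0, h1, h2, h3]
  ring

theorem pol_cub_of_ne {o o' : ℕ} (ho : o' + 4 ≤ o ∨ o + 4 ≤ o') (ω : Fin D → ZMod q)
    (x a b c y : ZMod q) : pol (ω + x • cub D o a b c) o' y = pol ω o' y := by
  simp only [pol, ent_add_smul]
  rw [ent_cub (by omega), ent_cub (by omega), ent_cub (by omega), ent_cub (by omega)]
  ring

/-- The direction of a single table entry. -/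
def dir (D o : ℕ) : Fin D → ZMod q := fun y => if (y : ℕ) = o then 1 else 0

theorem ent_dir {o y : ℕ} (ho : o < D) : ent (dir D o : Fin D → ZMod q) y = if y = o then 1 else 0 := by
  unfold ent dir
  split_ifs <;> first | rfl | (exfalso; omega)

theorem pol_dir {o o' : ℕ} (ho : o < D) (h : o' + 4 ≤ o) (ω : Fin D → ZMod q) (x y : ZMod q) :
    pol (ω + x • dir D o) o' y = pol ω o' y := by
  simp only [pol, ent_add_smul, ent_dir ho]
  rw [if_neg (by omega), if_neg (by omega), if_neg (by omega), if_neg (by omega)]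
  ring

theorem horner_eq_val (ω : Fin D → ZMod q) (x j : ℕ) :
    horner q (tbl ω x) (tbl ω (x + 1)) (tbl ω (x + 2)) (tbl ω (x + 3)) j = (pol ω x j).val := by
  have h : ((horner q (tbl ω x) (tbl ω (x + 1)) (tbl ω (x + 2)) (tbl ω (x + 3)) j : ℕ) : ZMod q) =
      pol ω x j := by
    simp only [horner, pol, tbl_eq_val_ent]
    simp
    ring
  have hlt : horner q (tbl ω x) (tbl ω (x + 1)) (tbl ω (x + 2)) (tbl ω (x + 3)) j < q :=
    Nat.mod_lt _ hq.out.pos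
  rw [← h, ZMod.val_cast_of_lt hlt]

/-- The sign of column `j`. -/
def sH (ω : Fin D → ZMod q) (j : ℕ) : ℝ := sg (pol ω 0 j)

/-- The bucket of column `j`. -/
def bH (m : ℕ) (ω : Fin D → ZMod q) (j : ℕ) : ℕ := (pol ω 4 j).val % m

/-- The sign of row `i`. -/
def sR (ω : Fin D → ZMod q) (i : ℕ) : ℝ := sg (ent ω (8 + i))

/-- The indicator of a bucket collision. -/
def coll (m : ℕ) (ω : Fin D → ZMod q) (j l : ℕ) : ℝ := if bH m ω j = bH m ω l then 1 else 0

theorem coll_nonneg (m : ℕ) (ω : Fin D → ZMod q) (j l : ℕ) : 0 ≤ coll m ω j l := by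
  unfold coll; split_ifs <;> norm_num

theorem natCast_ne {p j l : ℕ} (hp : p ≤ q) (hj : j < p) (hl : l < p) (h : j ≠ l) :
    (j : ZMod q) ≠ l := fun e => h (by
  have := congrArg ZMod.val e
  rwa [ZMod.val_cast_of_lt (by omega), ZMod.val_cast_of_lt (by omega)] at this)

/-- Four-wise independence of the column signs, as far as it is needed. -/
theorem expect_signs_eq_zero (hodd : q % 2 = 1) (hD : 8 ≤ D) {p m j a b c : ℕ} (hp : p ≤ q)
    (hj : j < p) (ha : a < p) (hb : b < p) (hc : c < p) (hja : j ≠ a) (hjb : j ≠ b) (hjc : j ≠ c) :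
    𝔼 ω : Fin D → ZMod q, (coll m ω j a * coll m ω b c) * (sH ω a * sH ω b * sH ω c) * sH ω j = 0 := by
  have h := expect_mul_shift (ℓ := fun ω => pol ω 0 (j : ZMod q)) (cub D 0 (a : ZMod q) b c)
    (κ := (j - a) * (j - b) * (j - c)) (by
      refine mul_ne_zero (mul_ne_zero ?_ ?_) ?_ <;> rw [sub_ne_zero]
      · exact natCast_ne hp hj ha hja
      · exact natCast_ne hp hj hb hjb
      · exact natCast_ne hp hj hc hjc) (fun ω x => pol_cub (by omega) _ _ _ _ _ _)
    (h := fun ω => (coll m ω j a * coll m ω b c) * (sH ω a * sH ω b * sH ω c)) (by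
      intro ω x
      have hb : ∀ y : ℕ, bH m (ω + x • cub D 0 (a : ZMod q) b c) y = bH m ω y := fun y => by
        simp only [bH, pol_cub_of_ne (show 4 + 4 ≤ 0 ∨ 0 + 4 ≤ 4 by omega)]
      simp only [coll, hb, sH, pol_cub (show 0 + 4 ≤ D by omega), sub_self, mul_zero, zero_mul,
        add_zero]) sg
  rw [expect_sg hodd, mul_zero] at h
  exact h

theorem expect_coll_le (hD : 8 ≤ D) {p m j l : ℕ} (hm : 1 ≤ m) (hmq : m ≤ q) (hp : p ≤ q)
    (hj : j < p) (hl : l < p) (hjl : j ≠ l) : 𝔼 ω : Fin D → ZMod q, coll m ω j l ≤ 2 / m := by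
  have hκ : ((j : ZMod q) - l) * (j - l) * (j - l) ≠ 0 := by
    have : (j : ZMod q) - l ≠ 0 := sub_ne_zero.2 (natCast_ne hp hj hl hjl)
    exact mul_ne_zero (mul_ne_zero this this) this
  rw [expect_translate (cub D 4 (l : ZMod q) l l)]
  refine Finset.expect_le Finset.univ_nonempty fun ω _ => ?_
  have h1 : ∀ x : ZMod q, bH m (ω + x • cub D 4 (l : ZMod q) l l) l = bH m ω l := fun x => by
    simp [bH, pol_cub (show 4 + 4 ≤ D by omega)]
  simp only [coll, h1]
  simp only [bH, pol_cub (show 4 + 4 ≤ D by omega)]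
  rw [expect_affine _ hκ (fun v => if v.val % m = (pol ω 4 (l : ZMod q)).val % m then (1 : ℝ) else 0)]
  exact expect_bucket_le hm hmq _

theorem expect_sign_zero (hD : 8 ≤ D) (j : ℕ) :
    𝔼 ω : Fin D → ZMod q, (1 - sH ω j ^ 2) = 1 / (q : ℝ) := by
  have h := expect_mul_shift (ℓ := fun ω => pol ω 0 (j : ZMod q))
    (cub D 0 (j + 1 : ZMod q) (j + 1) (j + 1)) (κ := -1) (by simp) (fun ω x => by
      rw [pol_cub (by omega)]; ring) (h := fun _ => 1) (fun _ _ => rfl)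
      (fun v => if v = 0 then 1 else 0)
  rw [expect_ite_zero_eq, Fintype.expect_const, one_mul] at h
  rw [← h]
  refine Finset.expect_congr rfl fun ω _ => ?_
  simp only [sH, sg_sq_eq]
  split_ifs <;> norm_num

theorem expect_row_sign_zero {i : ℕ} (hi : 8 + i < D) :
    𝔼 ω : Fin D → ZMod q, (1 - sR ω i ^ 2) = 1 / (q : ℝ) := by
  have h := expect_mul_shift (q := q) (ℓ := fun ω => ent ω (8 + i)) (dir D (8 + i)) (κ := 1) one_ne_zero
    (fun ω x => by rw [ent_add_smul, ent_dir hi, if_pos rfl]) (h := fun _ => 1) (fun _ _ => rfl)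
      (fun v => if v = 0 then 1 else 0)
  rw [expect_ite_zero_eq, Fintype.expect_const, one_mul] at h
  rw [← h]
  refine Finset.expect_congr rfl fun ω _ => ?_
  simp only [sR, sg_sq_eq]
  split_ifs <;> norm_num

/-- A row sign is uncorrelated with everything that does not depend on it. -/
theorem expect_mul_row_sign (hodd : q % 2 = 1) {i : ℕ} (hi : 8 + i < D)
    {h : (Fin D → ZMod q) → ℝ} (hh : ∀ (ω : Fin D → ZMod q) (x : ZMod q), h (ω + x • dir D (8 + i)) = h ω) :
    𝔼 ω, h ω * sR ω i = 0 := by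
  have := expect_mul_shift (ℓ := fun ω => ent ω (8 + i)) (dir D (8 + i)) (κ := 1) one_ne_zero
    (fun ω x => by rw [ent_add_smul, ent_dir hi, if_pos rfl]) hh sg
  rw [expect_sg hodd, mul_zero] at this
  exact this

end

section

open scoped BigOperators

variable {q D : ℕ} [hq : Fact q.Prime]

/-! ### Inner products of sketches -/

/-- The sketch of the vector `x`: `m` buckets, each holding the signed sum of its coordinates. -/
def skV {p : ℕ} (m : ℕ) (x : Fin p → ℝ) (ω : Fin D → ZMod q) (b : ℕ) : ℝ :=
  ∑ j : Fin p, x j * if bH m ω j = b then sH ω j else 0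

/-- The inner product of two sketches. -/
def skD {p : ℕ} (m : ℕ) (x y : Fin p → ℝ) (ω : Fin D → ZMod q) : ℝ :=
  ∑ b ∈ Finset.range m, skV m x ω b * skV m y ω b

theorem skD_eq {p m : ℕ} (hm : 1 ≤ m) (x y : Fin p → ℝ) (ω : Fin D → ZMod q) :
    skD m x y ω = ∑ j : Fin p, ∑ l : Fin p, x j * y l * (coll m ω j l * sH ω j * sH ω l) := by
  unfold skD skV
  simp only [Finset.sum_mul_sum]
  rw [Finset.sum_comm]
  refine Finset.sum_congr rfl fun j _ => ?_
  rw [Finset.sum_comm]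
  refine Finset.sum_congr rfl fun l _ => ?_
  rw [Finset.sum_eq_single (bH m ω j)]
  · unfold coll
    by_cases h : bH m ω j = bH m ω l
    · simp [h]; ring
    · rw [if_neg (Ne.symm h), if_neg h]; simp
  · intro b _ hb
    rw [if_neg (Ne.symm hb)]; simp
  · intro h
    exact absurd (Finset.mem_range.2 (Nat.mod_lt _ hm)) h

/-- The signed collision indicator of a pair of distinct columns. -/
def xi {p : ℕ} (m : ℕ) (ω : Fin D → ZMod q) (e : Fin p × Fin p) : ℝ :=
  if e.1 = e.2 then 0 else coll m ω e.1 e.2 * sH ω e.1 * sH ω e.2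

theorem abs_sH_le (ω : Fin D → ZMod q) (j : ℕ) : |sH ω j| ≤ 1 := abs_sg_le _

theorem coll_le_one (m : ℕ) (ω : Fin D → ZMod q) (j l : ℕ) : coll m ω j l ≤ 1 := by
  unfold coll; split_ifs <;> norm_num

theorem coll_comm (m : ℕ) (ω : Fin D → ZMod q) (j l : ℕ) : coll m ω j l = coll m ω l j := by
  unfold coll; simp only [eq_comm]

theorem coll_self (m : ℕ) (ω : Fin D → ZMod q) (j : ℕ) : coll m ω j j = 1 := if_pos rfl

theorem abs_mul_mul_le {a b c : ℝ} (hb : |b| ≤ 1) (hc : |c| ≤ 1) : |a * b * c| ≤ |a| := by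
  rw [abs_mul, abs_mul]
  calc |a| * |b| * |c| ≤ |a| * 1 * 1 := by gcongr
    _ = |a| := by ring

theorem abs_xi_le {p m : ℕ} (ω : Fin D → ZMod q) (e : Fin p × Fin p) :
    |xi m ω e| ≤ coll m ω e.1 e.2 := by
  unfold xi
  split_ifs
  · simpa using coll_nonneg m ω _ _
  · refine (abs_mul_mul_le (abs_sH_le _ _) (abs_sH_le _ _)).trans ?_
    rw [abs_of_nonneg (coll_nonneg m ω _ _)]

/-- The signed collision indicators of different unordered pairs are uncorrelated. -/
theorem abs_expect_xi_le (hodd : q % 2 = 1) (hD : 8 ≤ D) {p m : ℕ} (hm : 1 ≤ m) (hmq : m ≤ q)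
    (hp : p ≤ q) (e f : Fin p × Fin p) :
    |𝔼 ω : Fin D → ZMod q, xi m ω e * xi m ω f| ≤
      (if f = e then (2 : ℝ) / m else 0) + if f = e.swap then (2 : ℝ) / m else 0 := by
  have h2m : (0 : ℝ) ≤ 2 / m := by positivity
  by_cases he : e.1 = e.2
  · simp only [xi, if_pos he, zero_mul, Finset.expect_const_zero, abs_zero]
    positivity
  by_cases hf : f.1 = f.2
  · simp only [xi, if_pos hf, mul_zero, Finset.expect_const_zero, abs_zero]
    positivity
  have hbound : |𝔼 ω : Fin D → ZMod q, xi m ω e * xi m ω f| ≤ 2 / m := by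
    refine (Finset.abs_expect_le _ _).trans (le_trans (Finset.expect_le_expect fun ω _ => ?_)
      (expect_coll_le hD hm hmq hp e.1.2 e.2.2 (fun h => he (Fin.ext h))))
    rw [abs_mul]
    calc |xi m ω e| * |xi m ω f| ≤ coll m ω e.1 e.2 * 1 := by
          gcongr
          · exact coll_nonneg _ _ _ _
          · exact abs_xi_le ω e
          · exact (abs_xi_le ω f).trans (coll_le_one _ _ _ _)
      _ = _ := mul_one _
  by_cases h1 : f = e
  · rw [if_pos h1]
    refine hbound.trans (le_add_of_nonneg_right ?_)
    positivity
  by_cases h2 : f = e.swap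
  · rw [if_pos h2]
    refine hbound.trans (le_add_of_nonneg_left ?_)
    positivity
  rw [if_neg h1, if_neg h2, add_zero]
  obtain ⟨j, l⟩ := e
  obtain ⟨j', l'⟩ := f
  simp only [Prod.swap_prod_mk, Prod.mk.injEq, not_and] at *
  refine le_of_eq (abs_eq_zero.2 ?_)
  have ne : ∀ {a b : Fin p}, a ≠ b → (a : ℕ) ≠ b := fun h h' => h (Fin.ext h')
  simp only [xi, if_neg he, if_neg hf]
  by_cases h3 : j' = j ∨ j' = l
  · have h4 : l' ≠ j' ∧ l' ≠ j ∧ l' ≠ l := by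
      refine ⟨Ne.symm hf, ?_, ?_⟩
      · rintro rfl
        rcases h3 with rfl | rfl
        · exact hf rfl
        · exact h2 rfl rfl
      · rintro rfl
        rcases h3 with rfl | rfl
        · exact h1 rfl rfl
        · exact hf rfl
    rw [← expect_signs_eq_zero (m := m) hodd hD hp l'.2 j'.2 j.2 l.2 (ne h4.1) (ne h4.2.1)
      (ne h4.2.2)]
    refine Finset.expect_congr rfl fun ω _ => ?_
    rw [coll_comm m ω j' l']
    ring
  · push Not at h3
    rw [← expect_signs_eq_zero (m := m) hodd hD hp j'.2 l'.2 j.2 l.2 (ne hf) (ne h3.1) (ne h3.2)]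
    refine Finset.expect_congr rfl fun ω _ => ?_
    ring

theorem sum_abs_mul_le_one {ι : Type*} [Fintype ι] {x y : ι → ℝ} (hx : ∑ j, x j ^ 2 ≤ 1)
    (hy : ∑ j, y j ^ 2 ≤ 1) : ∑ j, |x j * y j| ≤ 1 := by
  have : ∑ j, |x j * y j| ≤ ∑ j, (x j ^ 2 + y j ^ 2) / 2 := by
    refine Finset.sum_le_sum fun j _ => ?_
    rw [abs_le]
    constructor <;> nlinarith [sq_nonneg (x j - y j), sq_nonneg (x j + y j)]
  rw [← Finset.sum_div, Finset.sum_add_distrib] at this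
  linarith

/-- The off-diagonal part of the inner product of two sketches has a small second moment. -/
theorem expect_offDiag_sq_le (hodd : q % 2 = 1) (hD : 8 ≤ D) {p m : ℕ} (hm : 1 ≤ m) (hmq : m ≤ q)
    (hp : p ≤ q) {x y : Fin p → ℝ} (hx : ∑ j, x j ^ 2 ≤ 1) (hy : ∑ j, y j ^ 2 ≤ 1) :
    𝔼 ω : Fin D → ZMod q, (∑ e : Fin p × Fin p, x e.1 * y e.2 * xi m ω e) ^ 2 ≤ (4 : ℝ) / m := by
  have h2m : (0 : ℝ) ≤ 2 / m := by positivity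
  have h1 : 𝔼 ω : Fin D → ZMod q, (∑ e : Fin p × Fin p, x e.1 * y e.2 * xi m ω e) ^ 2 =
      ∑ e : Fin p × Fin p, ∑ f : Fin p × Fin p, (x e.1 * y e.2) * (x f.1 * y f.2) *
        𝔼 ω : Fin D → ZMod q, xi m ω e * xi m ω f := by
    simp only [Finset.mul_expect]
    simp only [← Finset.expect_sum_comm]
    refine Finset.expect_congr rfl fun ω _ => ?_
    rw [sq, Finset.sum_mul_sum]
    refine Finset.sum_congr rfl fun e _ => Finset.sum_congr rfl fun f _ => ?_
    ring
  rw [h1]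
  calc _ ≤ ∑ e : Fin p × Fin p, ∑ f : Fin p × Fin p, |x e.1 * y e.2| * |x f.1 * y f.2| *
        ((if f = e then (2 : ℝ) / m else 0) + if f = e.swap then (2 : ℝ) / m else 0) := by
        refine Finset.sum_le_sum fun e _ => Finset.sum_le_sum fun f _ => ?_
        refine (le_abs_self _).trans ?_
        rw [abs_mul, abs_mul]
        gcongr
        exact abs_expect_xi_le hodd hD hm hmq hp e f
    _ = ∑ e : Fin p × Fin p, ((x e.1 ^ 2 * y e.2 ^ 2) * (2 / m) +
          |x e.1 * y e.1| * |x e.2 * y e.2| * (2 / m)) := by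
        refine Finset.sum_congr rfl fun e _ => ?_
        simp only [mul_add, Finset.sum_add_distrib, mul_ite, mul_zero, Finset.sum_ite_eq',
          Finset.mem_univ, if_true]
        congr 1
        · rw [abs_mul_abs_self]; ring
        · rw [← abs_mul, ← abs_mul]
          congr 2
          simp only [Prod.fst_swap, Prod.snd_swap]
          ring
    _ = ((∑ j, x j ^ 2) * ∑ j, y j ^ 2) * (2 / m) +
        ((∑ j, |x j * y j|) * ∑ j, |x j * y j|) * (2 / m) := by
        rw [Finset.sum_add_distrib, ← Finset.sum_mul, ← Finset.sum_mul, Finset.sum_mul_sum,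
          Finset.sum_mul_sum, Fintype.sum_prod_type, Fintype.sum_prod_type]
    _ ≤ (1 * 1) * (2 / m) + (1 * 1) * (2 / m) := by
        have h3 : 0 ≤ ∑ j, x j ^ 2 := Finset.sum_nonneg fun j _ => sq_nonneg _
        have h4 : 0 ≤ ∑ j, y j ^ 2 := Finset.sum_nonneg fun j _ => sq_nonneg _
        have h5 : 0 ≤ ∑ j, |x j * y j| := Finset.sum_nonneg fun j _ => abs_nonneg _
        have h6 := sum_abs_mul_le_one hx hy
        gcongr
    _ = 4 / m := by ring

theorem expect_diag_sq_le (hD : 8 ≤ D) {p : ℕ} {x y : Fin p → ℝ}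
    (hx : ∑ j, x j ^ 2 ≤ 1) (hy : ∑ j, y j ^ 2 ≤ 1) :
    𝔼 ω : Fin D → ZMod q, (∑ j : Fin p, (1 - sH ω j ^ 2) * (x j * y j)) ^ 2 ≤ (1 : ℝ) / q := by
  have h01 : ∀ (ω : Fin D → ZMod q) (j : ℕ), 0 ≤ 1 - sH ω j ^ 2 ∧ 1 - sH ω j ^ 2 ≤ 1 := by
    intro ω j
    have h1 := (sq_le_one_iff_abs_le_one _).2 (abs_sH_le ω j)
    exact ⟨by linarith, by linarith [sq_nonneg (sH ω j)]⟩
  have hxy := sum_abs_mul_le_one hx hy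
  have h1 : ∀ ω : Fin D → ZMod q, (∑ j : Fin p, (1 - sH ω j ^ 2) * (x j * y j)) ^ 2 ≤
      ∑ j : Fin p, |x j * y j| * (1 - sH ω j ^ 2) := by
    intro ω
    set w := ∑ j : Fin p, |x j * y j| * (1 - sH ω j ^ 2) with hw
    have hw0 : 0 ≤ w := Finset.sum_nonneg fun j _ => mul_nonneg (abs_nonneg _) (h01 ω j).1
    have hw1 : w ≤ 1 := le_trans (Finset.sum_le_sum fun j _ =>
      mul_le_of_le_one_right (abs_nonneg _) (h01 ω j).2) hxy
    have habs : |∑ j : Fin p, (1 - sH ω j ^ 2) * (x j * y j)| ≤ w := by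
      refine (Finset.abs_sum_le_sum_abs _ _).trans (le_of_eq ?_)
      refine Finset.sum_congr rfl fun j _ => ?_
      rw [abs_mul, abs_of_nonneg (h01 ω j).1, mul_comm]
    calc _ ≤ w ^ 2 := sq_le_sq' (by linarith [(abs_le.1 habs).1]) (abs_le.1 habs).2
      _ ≤ w := by nlinarith
  refine (Finset.expect_le_expect fun ω _ => h1 ω).trans ?_
  rw [Finset.expect_sum_comm]
  simp only [← Finset.mul_expect, expect_sign_zero hD]
  rw [← Finset.sum_mul]
  exact mul_le_of_le_one_left (by positivity) hxy

/-- The inner product of the sketches of two vectors of norm at most 1 estimates their inner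
product, with mean squared error at most `10 / m`. -/
theorem expect_skD_sub_sq_le (hodd : q % 2 = 1) (hD : 8 ≤ D) {p m : ℕ} (hm : 1 ≤ m) (hmq : m ≤ q)
    (hp : p ≤ q) {x y : Fin p → ℝ} (hx : ∑ j, x j ^ 2 ≤ 1) (hy : ∑ j, y j ^ 2 ≤ 1) :
    𝔼 ω : Fin D → ZMod q, (skD m x y ω - ∑ j, x j * y j) ^ 2 ≤ (10 : ℝ) / m := by
  have h1 : ∀ ω : Fin D → ZMod q, skD m x y ω - ∑ j, x j * y j =
      (∑ e : Fin p × Fin p, x e.1 * y e.2 * xi m ω e) -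
        ∑ j : Fin p, (1 - sH ω j ^ 2) * (x j * y j) := by
    intro ω
    rw [skD_eq hm, Fintype.sum_prod_type, sub_eq_sub_iff_add_eq_add, ← Finset.sum_add_distrib,
      ← Finset.sum_add_distrib]
    refine Finset.sum_congr rfl fun j _ => ?_
    have h2 : ∀ l : Fin p, x j * y l * (coll m ω j l * sH ω j * sH ω l) =
        x j * y l * xi m ω (j, l) + if l = j then sH ω j ^ 2 * (x j * y j) else 0 := by
      intro l
      by_cases h : j = l
      · subst h
        simp only [xi, if_true, coll_self]; ring
      · simp [xi, h, Ne.symm h]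
    simp only [h2, Finset.sum_add_distrib, Finset.sum_ite_eq', Finset.mem_univ, if_true]
    ring
  have hmR : (0 : ℝ) < m := by exact_mod_cast hm
  have hqm : (1 : ℝ) / q ≤ 1 / m := one_div_le_one_div_of_le hmR (by exact_mod_cast hmq)
  calc _ ≤ 𝔼 ω : Fin D → ZMod q, (2 * (∑ e : Fin p × Fin p, x e.1 * y e.2 * xi m ω e) ^ 2 +
        2 * (∑ j : Fin p, (1 - sH ω j ^ 2) * (x j * y j)) ^ 2) := by
        refine Finset.expect_le_expect fun ω _ => ?_
        rw [h1]
        set a := ∑ e : Fin p × Fin p, x e.1 * y e.2 * xi m ω e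
        set b := ∑ j : Fin p, (1 - sH ω j ^ 2) * (x j * y j)
        nlinarith [sq_nonneg (a + b)]
    _ ≤ 2 * ((4 : ℝ) / m) + 2 * ((1 : ℝ) / m) := by
        rw [Finset.expect_add_distrib, ← Finset.mul_expect, ← Finset.mul_expect]
        have := expect_offDiag_sq_le (q := q) hodd hD hm hmq hp hx hy
        have := expect_diag_sq_le (q := q) hD hx hy
        linarith
    _ = (10 : ℝ) / m := by ring

/-! ### Normalized sketches -/

/-- The cosine of the angle between two sketches. -/
def cosD {p : ℕ} (m : ℕ) (x y : Fin p → ℝ) (ω : Fin D → ZMod q) : ℝ :=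
  skD m x y ω / (Real.sqrt (skD m x x ω) * Real.sqrt (skD m y y ω))

theorem skD_self_nonneg {p m : ℕ} (x : Fin p → ℝ) (ω : Fin D → ZMod q) : 0 ≤ skD m x x ω :=
  Finset.sum_nonneg fun _ _ => mul_self_nonneg _

theorem skD_sq_le {p m : ℕ} (x y : Fin p → ℝ) (ω : Fin D → ZMod q) :
    skD m x y ω ^ 2 ≤ skD m x x ω * skD m y y ω := by
  have := Finset.sum_mul_sq_le_sq_mul_sq (Finset.range m) (skV m x ω) (skV m y ω)
  simpa [skD, sq] using this

theorem cosD_sq {p m : ℕ} (x y : Fin p → ℝ) (ω : Fin D → ZMod q) :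
    cosD m x y ω ^ 2 = skD m x y ω ^ 2 / (skD m x x ω * skD m y y ω) := by
  rw [cosD, div_pow, mul_pow, Real.sq_sqrt (skD_self_nonneg _ _), Real.sq_sqrt (skD_self_nonneg _ _)]

/-- The square of a normalized inner product of sketches is large only if the inner product is large
or one of the squared norms `u`, `v` is far from 1. -/
theorem div_mul_le_of_sq_le {d u v : ℝ} (hu : 0 ≤ u) (hv : 0 ≤ v) (h : d ^ 2 ≤ u * v) :
    d ^ 2 / (u * v) ≤ 4 * d ^ 2 + 4 * (u - 1) ^ 2 + 4 * (v - 1) ^ 2 := by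
  have h1 : d ^ 2 / (u * v) ≤ 1 := div_le_one_of_le₀ h (mul_nonneg hu hv)
  have h2 := sq_nonneg (u - 1)
  have h3 := sq_nonneg (v - 1)
  have h4 := sq_nonneg d
  by_cases hu' : u < 1 / 2
  · nlinarith
  by_cases hv' : v < 1 / 2
  · nlinarith
  push Not at hu' hv'
  have h5 : 1 / 4 ≤ u * v := by nlinarith
  have : d ^ 2 / (u * v) ≤ 4 * d ^ 2 := by
    rw [div_le_iff₀ (by linarith)]
    nlinarith
  linarith

/-- Normalized sketches of nearly orthogonal unit vectors are nearly orthogonal on average. -/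
theorem expect_cosD_sq_le (hodd : q % 2 = 1) (hD : 8 ≤ D) {p m : ℕ} (hm : 1 ≤ m) (hmq : m ≤ q)
    (hp : p ≤ q) {x y : Fin p → ℝ} (hx : ∑ j, x j ^ 2 = 1) (hy : ∑ j, y j ^ 2 = 1) :
    𝔼 ω : Fin D → ZMod q, cosD m x y ω ^ 2 ≤ 8 * (∑ j, x j * y j) ^ 2 + 160 / m := by
  have hxx : ∑ j, x j * x j = 1 := by simpa [sq] using hx
  have hyy : ∑ j, y j * y j = 1 := by simpa [sq] using hy
  have h1 := expect_skD_sub_sq_le (q := q) hodd hD hm hmq hp hx.le hy.le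
  have h2 := expect_skD_sub_sq_le (q := q) hodd hD hm hmq hp hx.le hx.le
  have h3 := expect_skD_sub_sq_le (q := q) hodd hD hm hmq hp hy.le hy.le
  rw [hxx] at h2
  rw [hyy] at h3
  calc _ ≤ 𝔼 ω : Fin D → ZMod q, (8 * (skD m x y ω - ∑ j, x j * y j) ^ 2 +
        8 * (∑ j, x j * y j) ^ 2 + 4 * (skD m x x ω - 1) ^ 2 + 4 * (skD m y y ω - 1) ^ 2) := by
        refine Finset.expect_le_expect fun ω _ => ?_
        rw [cosD_sq]
        refine (div_mul_le_of_sq_le (skD_self_nonneg _ _) (skD_self_nonneg _ _)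
          (skD_sq_le _ _ _)).trans ?_
        set d := skD m x y ω
        set C := ∑ j, x j * y j
        nlinarith [sq_nonneg (d - 2 * C)]
    _ ≤ _ := by
        rw [Finset.expect_add_distrib, Finset.expect_add_distrib, Finset.expect_add_distrib,
          ← Finset.mul_expect, ← Finset.mul_expect, ← Finset.mul_expect, ← Finset.mul_expect,
          Fintype.expect_const]
        have : (160 : ℝ) / m = 16 * (10 / m) := by ring
        linarith

theorem le_abs_div_sqrt {d u v C φ : ℝ} (hφ : 0 < φ) (hC : φ ≤ |C|) (hd : |d - C| ≤ φ / 16)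
    (hu : |u - 1| ≤ 1 / 16) (hv : |v - 1| ≤ 1 / 16) :
    3 * φ / 4 ≤ |d / (Real.sqrt u * Real.sqrt v)| := by
  have hu' := abs_le.1 hu
  have hv' := abs_le.1 hv
  have h1 : 15 / 16 * φ ≤ |d| := by
    have := abs_sub_abs_le_abs_sub C d
    rw [abs_sub_comm] at this
    linarith
  have hsu := Real.sqrt_pos.2 (show 0 < u by linarith)
  have hsv := Real.sqrt_pos.2 (show 0 < v by linarith)
  have h2 : Real.sqrt u * Real.sqrt v ≤ 17 / 16 := by
    have := Real.sq_sqrt (show 0 ≤ u by linarith)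
    have := Real.sq_sqrt (show 0 ≤ v by linarith)
    nlinarith [sq_nonneg (Real.sqrt u - Real.sqrt v)]
  rw [abs_div, abs_of_pos (mul_pos hsu hsv), le_div_iff₀ (mul_pos hsu hsv)]
  nlinarith [mul_pos hsu hsv]

open Classical in
/-- The normalized sketches of two highly correlated vectors keep three quarters of the threshold
with probability at least `241 / 256`. -/
theorem expect_cosD_small_le (hodd : q % 2 = 1) (hD : 8 ≤ D) {p m : ℕ} (hm : 1 ≤ m) (hmq : m ≤ q)
    (hp : p ≤ q) {x y : Fin p → ℝ} (hx : ∑ j, x j ^ 2 = 1) (hy : ∑ j, y j ^ 2 = 1) {φ : ℝ}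
    (hφ : 0 < φ) (hφ1 : φ ≤ 1) (hC : φ ≤ |∑ j, x j * y j|) (hmφ : 131072 ≤ m * φ ^ 2) :
    (𝔼 ω : Fin D → ZMod q, if |cosD m x y ω| < 3 * φ / 4 then (1 : ℝ) else 0) ≤ 15 / 256 := by
  have hmR : (0 : ℝ) < m := by exact_mod_cast hm
  have hxx : ∑ j, x j * x j = 1 := by simpa [sq] using hx
  have hyy : ∑ j, y j * y j = 1 := by simpa [sq] using hy
  have h1 := expect_skD_sub_sq_le (q := q) hodd hD hm hmq hp hx.le hy.le
  have h2 := expect_skD_sub_sq_le (q := q) hodd hD hm hmq hp hx.le hx.le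
  have h3 := expect_skD_sub_sq_le (q := q) hodd hD hm hmq hp hy.le hy.le
  rw [hxx] at h2
  rw [hyy] at h3
  set C := ∑ j, x j * y j with hCdef
  have hφ2 : 0 < φ ^ 2 := by positivity
  calc _ ≤ 𝔼 ω : Fin D → ZMod q, (256 / φ ^ 2 * (skD m x y ω - C) ^ 2 +
        256 / φ ^ 2 * (skD m x x ω - 1) ^ 2 + 256 / φ ^ 2 * (skD m y y ω - 1) ^ 2) := by
        refine Finset.expect_le_expect fun ω _ => ?_
        have big : ∀ z δ : ℝ, 0 ≤ δ → φ / 16 ≤ δ → ¬ |z| ≤ δ → 1 ≤ 256 / φ ^ 2 * z ^ 2 := by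
          intro z δ hδ hδ' hz
          push Not at hz
          have : (φ / 16) ^ 2 ≤ z ^ 2 := by
            rw [← sq_abs z]
            exact pow_le_pow_left₀ (by positivity) (by linarith) 2
          rw [div_mul_eq_mul_div, le_div_iff₀ hφ2]
          nlinarith
        have n1 : 0 ≤ 256 / φ ^ 2 * (skD m x y ω - C) ^ 2 := by positivity
        have n2 : 0 ≤ 256 / φ ^ 2 * (skD m x x ω - 1) ^ 2 := by positivity
        have n3 : 0 ≤ 256 / φ ^ 2 * (skD m y y ω - 1) ^ 2 := by positivity
        split_ifs with h
        · by_cases c1 : |skD m x y ω - C| ≤ φ / 16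
          · by_cases c2 : |skD m x x ω - 1| ≤ 1 / 16
            · by_cases c3 : |skD m y y ω - 1| ≤ 1 / 16
              · exact absurd (le_abs_div_sqrt hφ hC c1 c2 c3) (not_le.2 h)
              · have := big _ _ (by norm_num) (by linarith) c3
                linarith
            · have := big _ _ (by norm_num) (by linarith) c2
              linarith
          · have := big _ _ (by positivity) le_rfl c1
            linarith
        · positivity
    _ ≤ 256 / φ ^ 2 * (30 / m) := by
        rw [Finset.expect_add_distrib, Finset.expect_add_distrib,
          ← Finset.mul_expect, ← Finset.mul_expect, ← Finset.mul_expect]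
        have h0 : 0 ≤ 256 / φ ^ 2 := by positivity
        have e : (30 : ℝ) / m = 10 / m + 10 / m + 10 / m := by ring
        rw [e, mul_add, mul_add]
        gcongr
    _ = 7680 / (m * φ ^ 2) := by field_simp; norm_num
    _ ≤ 7680 / 131072 := by gcongr
    _ = 15 / 256 := by norm_num

end

section

open scoped BigOperators

variable {q D : ℕ} [hq : Fact q.Prime]

/-! ### Sums over groups of rows -/

/-- The normalized sketch of row `i`. -/
def skN {p : ℕ} (m : ℕ) (X : ℕ → Fin p → ℝ) (i : ℕ) (ω : Fin D → ZMod q) (b : ℕ) : ℝ :=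
  skV m (X i) ω b / Real.sqrt (skD m (X i) (X i) ω)

/-- The signed sum of the normalized sketches of the `c` rows of group `a`. -/
def grp {p : ℕ} (m c : ℕ) (X : ℕ → Fin p → ℝ) (a : ℕ) (ω : Fin D → ZMod q) (b : ℕ) : ℝ :=
  ∑ u ∈ Finset.range c, sR ω (a * c + u) * skN m X (a * c + u) ω b

/-- The inner product of two group sums. -/
def grpD {p : ℕ} (m c : ℕ) (X : ℕ → Fin p → ℝ) (a a' : ℕ) (ω : Fin D → ZMod q) : ℝ :=
  ∑ b ∈ Finset.range m, grp m c X a ω b * grp m c X a' ω b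

theorem cosD_eq {p m : ℕ} (X : ℕ → Fin p → ℝ) (i j : ℕ) (ω : Fin D → ZMod q) :
    cosD m (X i) (X j) ω = ∑ b ∈ Finset.range m, skN m X i ω b * skN m X j ω b := by
  unfold cosD skN
  conv_lhs => rw [skD]
  rw [Finset.sum_div]
  refine Finset.sum_congr rfl fun b _ => ?_
  rw [div_mul_div_comm]

theorem grpD_eq {p m c : ℕ} (X : ℕ → Fin p → ℝ) (a a' : ℕ) (ω : Fin D → ZMod q) :
    grpD m c X a a' ω = ∑ e ∈ Finset.range c ×ˢ Finset.range c,
      cosD m (X (a * c + e.1)) (X (a' * c + e.2)) ω *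
        (sR ω (a * c + e.1) * sR ω (a' * c + e.2)) := by
  unfold grpD grp
  simp only [Finset.sum_mul_sum, cosD_eq]
  rw [Finset.sum_comm, Finset.sum_product]
  refine Finset.sum_congr rfl fun u _ => ?_
  rw [Finset.sum_comm]
  refine Finset.sum_congr rfl fun u' _ => ?_
  rw [Finset.sum_mul]
  refine Finset.sum_congr rfl fun b _ => ?_
  ring

theorem expect_sum_sq_of_orthogonal {ι Ω : Type*} [Fintype Ω] (s : Finset ι) (ζ : ι → Ω → ℝ)
    (h : ∀ e ∈ s, ∀ f ∈ s, e ≠ f → 𝔼 ω, ζ e ω * ζ f ω = 0) :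
    𝔼 ω, (∑ e ∈ s, ζ e ω) ^ 2 = ∑ e ∈ s, 𝔼 ω, ζ e ω ^ 2 := by
  simp only [sq, Finset.sum_mul_sum]
  rw [Finset.expect_sum_comm]
  refine Finset.sum_congr rfl fun e he => ?_
  rw [Finset.expect_sum_comm, Finset.sum_eq_single e]
  · intro f hf hfe
    exact h e he f hf hfe.symm
  · intro h'; exact absurd he h'

theorem bH_dir {m o : ℕ} (ho : o < D) (h : 8 ≤ o) (ω : Fin D → ZMod q) (x : ZMod q) (j : ℕ) :
    bH m (ω + x • dir D o) j = bH m ω j := by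
  simp only [bH, pol_dir ho (show 4 + 4 ≤ o by omega)]

theorem sH_dir {o : ℕ} (ho : o < D) (h : 8 ≤ o) (ω : Fin D → ZMod q) (x : ZMod q) (j : ℕ) :
    sH (ω + x • dir D o) j = sH ω j := by
  simp only [sH, pol_dir ho (show 0 + 4 ≤ o by omega)]

theorem cosD_dir {p m o : ℕ} (ho : o < D) (h : 8 ≤ o) (ω : Fin D → ZMod q) (x : ZMod q)
    (y z : Fin p → ℝ) : cosD m y z (ω + x • dir D o) = cosD m y z ω := by
  simp only [cosD, skD, skV, bH_dir ho h, sH_dir ho h]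

theorem sR_dir_of_ne {o i : ℕ} (ho : o < D) (h : 8 + i ≠ o) (ω : Fin D → ZMod q) (x : ZMod q) :
    sR (ω + x • dir D o) i = sR ω i := by
  simp only [sR, ent_add_smul, ent_dir ho, if_neg h, mul_zero, add_zero]

theorem mul_add_ne {a a' c u u' : ℕ} (haa : a ≠ a') (hu : u < c) (hu' : u' < c) :
    a * c + u ≠ a' * c + u' := by
  intro h
  have h1 := congrArg (· / c) h
  have hc : 0 < c := by omega
  simp only [mul_comm _ c, Nat.mul_add_div hc, Nat.div_eq_of_lt hu, Nat.div_eq_of_lt hu'] at h1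
  omega

/-- The row signs cancel the mixed terms in the mean square of the inner product of two group
sums. -/
theorem expect_grpD_sq_le (hodd : q % 2 = 1) {p m c N a a' : ℕ} (hD : D = N + 8)
    (X : ℕ → Fin p → ℝ) (haa : a ≠ a') (ha : (a + 1) * c ≤ N) (ha' : (a' + 1) * c ≤ N) :
    𝔼 ω : Fin D → ZMod q, grpD m c X a a' ω ^ 2 ≤
      ∑ e ∈ Finset.range c ×ˢ Finset.range c,
        𝔼 ω : Fin D → ZMod q, cosD m (X (a * c + e.1)) (X (a' * c + e.2)) ω ^ 2 := by
  simp only [grpD_eq]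
  rw [expect_sum_sq_of_orthogonal]
  · refine Finset.sum_le_sum fun e _ => Finset.expect_le_expect fun ω _ => ?_
    rw [mul_pow]
    refine mul_le_of_le_one_right (sq_nonneg _) ?_
    rw [mul_pow]
    have h1 := (sq_le_one_iff_abs_le_one _).2 (abs_sg_le (ent ω (8 + (a * c + e.1))))
    have h2 := (sq_le_one_iff_abs_le_one _).2 (abs_sg_le (ent ω (8 + (a' * c + e.2))))
    exact mul_le_one₀ h1 (sq_nonneg _) h2
  · rintro ⟨u, u'⟩ he ⟨v, v'⟩ hf hef
    simp only [Finset.mem_product, Finset.mem_range] at he hf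
    have e1 : ∀ a u, (a + 1) * c ≤ N → u < c → a * c + u < N := fun a u h h' => by
      rw [add_mul] at h; omega
    by_cases h : u = v
    · subst h
      have hne : u' ≠ v' := fun h => hef (by rw [h])
      have hi : 8 + (a' * c + u') < D := by have := e1 a' u' ha' he.2; omega
      rw [← expect_mul_row_sign (q := q) hodd hi (h := fun ω =>
        (cosD m (X (a * c + u)) (X (a' * c + u')) ω * cosD m (X (a * c + u)) (X (a' * c + v')) ω) *
        (sR ω (a * c + u) * sR ω (a * c + u) * sR ω (a' * c + v')))]
      · refine Finset.expect_congr rfl fun ω _ => ?_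
        ring
      · intro ω x
        have n1 := mul_add_ne haa he.1 he.2
        simp only [cosD_dir hi (show 8 ≤ 8 + (a' * c + u') by omega),
          sR_dir_of_ne hi (show 8 + (a * c + u) ≠ 8 + (a' * c + u') by omega),
          sR_dir_of_ne hi (show 8 + (a' * c + v') ≠ 8 + (a' * c + u') by omega)]
    · have hi : 8 + (a * c + u) < D := by have := e1 a u ha he.1; omega
      rw [← expect_mul_row_sign (q := q) hodd hi (h := fun ω =>
        (cosD m (X (a * c + u)) (X (a' * c + u')) ω * cosD m (X (a * c + v)) (X (a' * c + v')) ω) *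
        (sR ω (a' * c + u') * sR ω (a * c + v) * sR ω (a' * c + v')))]
      · refine Finset.expect_congr rfl fun ω _ => ?_
        ring
      · intro ω x
        have n1 := mul_add_ne haa he.1 he.2
        have n2 := mul_add_ne haa he.1 hf.2
        simp only [cosD_dir hi (show 8 ≤ 8 + (a * c + u) by omega),
          sR_dir_of_ne hi (show 8 + (a' * c + u') ≠ 8 + (a * c + u) by omega),
          sR_dir_of_ne hi (show 8 + (a * c + v) ≠ 8 + (a * c + u) by omega),
          sR_dir_of_ne hi (show 8 + (a' * c + v') ≠ 8 + (a * c + u) by omega)]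

/-- The mean square of the inner products of all pairs of different group sums. -/
theorem expect_sum_grpD_sq_le (hodd : q % 2 = 1) {p m c g N n : ℕ} (hD : D = N + 8)
    (hN : g * c = N) (hm : 1 ≤ m) (hmq : m ≤ q) (hp : p ≤ q) {X : ℕ → Fin p → ℝ}
    (hX : ∀ i < n, ∑ j, X i j ^ 2 = 1) (hX0 : ∀ i, n ≤ i → X i = 0) {K₀ : ℝ}
    (hK : ∑ i ∈ Finset.range N, ∑ j ∈ Finset.range N,
      (if i = j then 0 else (∑ l, X i l * X j l) ^ 2) ≤ K₀) :
    𝔼 ω : Fin D → ZMod q, ∑ a ∈ Finset.range g, ∑ a' ∈ Finset.range g,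
      (if a = a' then 0 else grpD m c X a a' ω ^ 2) ≤ 8 * K₀ + 160 * (N : ℝ) ^ 2 / m := by
  classical
  set f : ℕ → ℕ → ℝ := fun i j =>
    if i = j then 0 else 𝔼 ω : Fin D → ZMod q, cosD m (X i) (X j) ω ^ 2 with hf
  have hf0 : ∀ i j, 0 ≤ f i j := fun i j => by
    simp only [hf]
    split_ifs
    · exact le_rfl
    · exact Finset.expect_nonneg fun ω _ => sq_nonneg _
  have hsum : ∀ h : ℕ → ℝ, ∑ i ∈ Finset.range N, h i =
      ∑ a ∈ Finset.range g, ∑ u ∈ Finset.range c, h (a * c + u) := by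
    intro h
    rw [← hN, ← sum_range_mul_digits c g (fun u a => h (a * c + u))]
    · rw [mul_comm]
      refine Finset.sum_congr rfl fun i _ => ?_
      rw [mul_comm, Nat.div_add_mod]
  have hle : ∀ a < g, (a + 1) * c ≤ N := fun a ha => hN ▸ Nat.mul_le_mul_right c ha
  calc _ = ∑ a ∈ Finset.range g, ∑ a' ∈ Finset.range g,
        𝔼 ω : Fin D → ZMod q, (if a = a' then 0 else grpD m c X a a' ω ^ 2) := by
        rw [Finset.expect_sum_comm]
        refine Finset.sum_congr rfl fun a _ => Finset.expect_sum_comm _ _ _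
    _ ≤ ∑ a ∈ Finset.range g, ∑ a' ∈ Finset.range g, ∑ u ∈ Finset.range c,
        ∑ u' ∈ Finset.range c, f (a * c + u) (a' * c + u') := by
        refine Finset.sum_le_sum fun a ha => Finset.sum_le_sum fun a' ha' => ?_
        by_cases h : a = a'
        · simp only [if_pos h, Finset.expect_const_zero]
          exact Finset.sum_nonneg fun u _ => Finset.sum_nonneg fun u' _ => hf0 _ _
        · simp only [if_neg h]
          refine (expect_grpD_sq_le hodd hD X h (hle a (Finset.mem_range.1 ha))
            (hle a' (Finset.mem_range.1 ha'))).trans (le_of_eq ?_)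
          rw [Finset.sum_product]
          refine Finset.sum_congr rfl fun u hu => Finset.sum_congr rfl fun u' hu' => ?_
          simp only [hf]
          rw [if_neg (mul_add_ne h (Finset.mem_range.1 hu) (Finset.mem_range.1 hu'))]
    _ = ∑ i ∈ Finset.range N, ∑ j ∈ Finset.range N, f i j := by
        rw [hsum]
        refine Finset.sum_congr rfl fun a _ => ?_
        rw [Finset.sum_comm]
        refine Finset.sum_congr rfl fun u _ => ?_
        rw [hsum]
    _ ≤ ∑ i ∈ Finset.range N, ∑ j ∈ Finset.range N,
        (8 * (if i = j then 0 else (∑ l, X i l * X j l) ^ 2) + 160 / m) := by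
        refine Finset.sum_le_sum fun i _ => Finset.sum_le_sum fun j _ => ?_
        have hm0 : (0 : ℝ) ≤ 160 / m := by positivity
        simp only [hf]
        split_ifs with h
        · linarith
        · by_cases hi : i < n
          · by_cases hj : j < n
            · exact expect_cosD_sq_le hodd (by omega) hm hmq hp (hX i hi) (hX j hj)
            · have : ∀ ω : Fin D → ZMod q, cosD m (X i) (X j) ω = 0 := fun ω => by
                simp [cosD, skD, skV, hX0 j (by omega)]
              simp only [this]
              norm_num
              positivity
          · have : ∀ ω : Fin D → ZMod q, cosD m (X i) (X j) ω = 0 := fun ω => by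
              simp [cosD, skD, skV, hX0 i (by omega)]
            simp only [this]
            norm_num
            positivity
    _ ≤ 8 * K₀ + 160 * (N : ℝ) ^ 2 / m := by
        simp only [Finset.sum_add_distrib, ← Finset.mul_sum, Finset.sum_const, Finset.card_range,
          nsmul_eq_mul]
        have : (N : ℝ) * (N * (160 / m)) = 160 * (N : ℝ) ^ 2 / m := by ring
        rw [this]
        linarith

/-! ### Flipping row signs -/

/-- Negates entry `o` of a table. -/
def flipAt (o : ℕ) (ω : Fin D → ZMod q) : Fin D → ZMod q := fun y => if (y : ℕ) = o then -ω y else ω y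

theorem ent_flipAt (o : ℕ) (ω : Fin D → ZMod q) (y : ℕ) :
    ent (flipAt o ω) y = if y = o then -ent ω y else ent ω y := by
  unfold ent flipAt
  split_ifs <;> simp

theorem flipAt_flipAt (o : ℕ) (ω : Fin D → ZMod q) : flipAt o (flipAt o ω) = ω := by
  funext y
  unfold flipAt
  split_ifs <;> simp

theorem expect_flipAt (o : ℕ) (f : (Fin D → ZMod q) → ℝ) : 𝔼 ω, f (flipAt o ω) = 𝔼 ω, f ω :=
  Fintype.expect_equiv ⟨flipAt o, flipAt o, flipAt_flipAt o, flipAt_flipAt o⟩ _ _ fun _ => rfl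

theorem pol_flipAt {o o' : ℕ} (h : o' + 4 ≤ o) (ω : Fin D → ZMod q) (y : ZMod q) :
    pol (flipAt o ω) o' y = pol ω o' y := by
  simp only [pol, ent_flipAt]
  rw [if_neg (by omega), if_neg (by omega), if_neg (by omega), if_neg (by omega)]

theorem skN_flipAt {p m : ℕ} (X : ℕ → Fin p → ℝ) (i i' : ℕ) (ω : Fin D → ZMod q) (b : ℕ) :
    skN m X i (flipAt (8 + i') ω) b = skN m X i ω b := by
  have h1 : ∀ j : ℕ, bH m (flipAt (8 + i') ω) j = bH m ω j := fun j => by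
    simp only [bH, pol_flipAt (show 4 + 4 ≤ 8 + i' by omega)]
  have h2 : ∀ j : ℕ, sH (flipAt (8 + i') ω) j = sH ω j := fun j => by
    simp only [sH, pol_flipAt (show 0 + 4 ≤ 8 + i' by omega)]
  simp only [skN, skD, skV, h1, h2]

theorem sR_flipAt (hodd : q % 2 = 1) (i i' : ℕ) (ω : Fin D → ZMod q) :
    sR (flipAt (8 + i') ω) i = if i = i' then -sR ω i else sR ω i := by
  simp only [sR, ent_flipAt, add_right_inj]
  split_ifs
  · exact sg_neg hodd _
  · rfl

theorem grp_sub_flipAt (hodd : q % 2 = 1) {p m c : ℕ} (X : ℕ → Fin p → ℝ) (a : ℕ) {u : ℕ} (hu : u < c)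
    (ω : Fin D → ZMod q) (b : ℕ) :
    grp m c X a ω b - grp m c X a (flipAt (8 + (a * c + u)) ω) b =
      2 * sR ω (a * c + u) * skN m X (a * c + u) ω b := by
  unfold grp
  rw [← Finset.sum_sub_distrib, Finset.sum_eq_single u]
  · rw [skN_flipAt, sR_flipAt hodd, if_pos rfl]; ring
  · intro v _ hv
    rw [skN_flipAt, sR_flipAt hodd, if_neg (by omega)]; ring
  · intro h; exact absurd (Finset.mem_range.2 hu) h

theorem grp_flipAt_of_ne (hodd : q % 2 = 1) {p m c : ℕ} (X : ℕ → Fin p → ℝ) {a a' : ℕ} (h : a ≠ a')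
    {u : ℕ} (hu : u < c) (ω : Fin D → ZMod q) (b : ℕ) :
    grp m c X a' (flipAt (8 + (a * c + u)) ω) b = grp m c X a' ω b := by
  unfold grp
  refine Finset.sum_congr rfl fun v hv => ?_
  rw [skN_flipAt, sR_flipAt hodd, if_neg (mul_add_ne h.symm (Finset.mem_range.1 hv) hu)]

/-- Among the four ways to choose the signs of the rows `i` and `j`, at least one lets the inner
product of their group sums be at least as large as that of their own normalized sketches. -/
theorem four_mul_cosD_le (hodd : q % 2 = 1) {p m c : ℕ} (X : ℕ → Fin p → ℝ) {a a' u u' : ℕ}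
    (haa : a ≠ a') (hu : u < c) (hu' : u' < c) (ω : Fin D → ZMod q)
    (hi : sR ω (a * c + u) ^ 2 = 1) (hj : sR ω (a' * c + u') ^ 2 = 1) :
    4 * |cosD m (X (a * c + u)) (X (a' * c + u')) ω| ≤ |grpD m c X a a' ω| +
      |grpD m c X a a' (flipAt (8 + (a * c + u)) ω)| +
      |grpD m c X a a' (flipAt (8 + (a' * c + u')) ω)| +
      |grpD m c X a a' (flipAt (8 + (a * c + u)) (flipAt (8 + (a' * c + u')) ω))| := by
  set i := a * c + u with hi'
  set j := a' * c + u' with hj'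
  have h1 : grpD m c X a a' ω - grpD m c X a a' (flipAt (8 + i) ω) -
      grpD m c X a a' (flipAt (8 + j) ω) + grpD m c X a a' (flipAt (8 + i) (flipAt (8 + j) ω)) =
      4 * (sR ω i * sR ω j) * cosD m (X i) (X j) ω := by
    rw [cosD_eq, Finset.mul_sum]
    unfold grpD
    rw [← Finset.sum_sub_distrib, ← Finset.sum_sub_distrib, ← Finset.sum_add_distrib]
    refine Finset.sum_congr rfl fun b _ => ?_
    have e1 := grp_sub_flipAt hodd X (m := m) a hu ω b
    have e2 := grp_sub_flipAt hodd X (m := m) a' hu' ω b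
    have e3 := grp_sub_flipAt hodd X (m := m) a hu (flipAt (8 + j) ω) b
    have e4 := grp_flipAt_of_ne hodd X (m := m) haa hu ω b
    have e5 := grp_flipAt_of_ne hodd X (m := m) haa.symm hu' ω b
    have e6 := grp_flipAt_of_ne hodd X (m := m) haa hu (flipAt (8 + j) ω) b
    rw [← hi'] at e1 e3 e4 e6
    rw [← hj'] at e2 e5
    rw [skN_flipAt, sR_flipAt hodd, if_neg (mul_add_ne haa hu hu')] at e3
    rw [e4, e5, e6]
    rw [e5] at e3
    have e7 : grp m c X a (flipAt (8 + i) ω) b = grp m c X a ω b - 2 * sR ω i * skN m X i ω b := by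
      linarith
    have e8 : grp m c X a (flipAt (8 + i) (flipAt (8 + j) ω)) b =
        grp m c X a ω b - 2 * sR ω i * skN m X i ω b := by linarith
    have e9 : grp m c X a' (flipAt (8 + j) ω) b = grp m c X a' ω b - 2 * sR ω j * skN m X j ω b := by
      linarith
    rw [e7, e8, e9]
    ring
  have h2 : |sR ω i * sR ω j| = 1 := by
    rw [abs_mul, ← Real.sqrt_sq_eq_abs, ← Real.sqrt_sq_eq_abs, hi, hj]; simp
  have h3 : |4 * (sR ω i * sR ω j) * cosD m (X i) (X j) ω| = 4 * |cosD m (X i) (X j) ω| := by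
    rw [abs_mul, abs_mul, h2]; norm_num
  rw [← h3, ← h1]
  refine (abs_add_le _ _).trans ?_
  have := abs_sub (grpD m c X a a' ω - grpD m c X a a' (flipAt (8 + i) ω)) (grpD m c X a a' (flipAt (8 + j) ω))
  have := abs_sub (grpD m c X a a' ω) (grpD m c X a a' (flipAt (8 + i) ω))
  linarith

open Classical in
/-- By `four_mul_cosD_le`, flipping the signs of the two rows spoils at most three of the four
cases. A row sign is `0` with probability `1 / q`, which accounts for the small excess. -/
theorem expect_grpD_lt_le (hodd : q % 2 = 1) {p m c N : ℕ} (hD : D = N + 8) (X : ℕ → Fin p → ℝ)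
    {a a' u u' : ℕ} (haa : a ≠ a') (hu : u < c) (hu' : u' < c) (ha : (a + 1) * c ≤ N)
    (ha' : (a' + 1) * c ≤ N) :
    (𝔼 ω : Fin D → ZMod q, if |grpD m c X a a' ω| < |cosD m (X (a * c + u)) (X (a' * c + u')) ω|
      then (1 : ℝ) else 0) ≤ 3 / 4 + 1 / (2 * q) := by
  have e1 : ∀ a u, (a + 1) * c ≤ N → u < c → 8 + (a * c + u) < D := fun a u h h' => by
    rw [add_mul] at h; omega
  set i := a * c + u with hi'
  set j := a' * c + u' with hj'
  set B : (Fin D → ZMod q) → ℝ := fun ω =>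
    if |grpD m c X a a' ω| < |cosD m (X i) (X j) ω| then (1 : ℝ) else 0 with hB
  have hcos : ∀ k (ω : Fin D → ZMod q), cosD m (X i) (X j) (flipAt (8 + k) ω) = cosD m (X i) (X j) ω := by
    intro k ω
    simp only [cosD_eq, skN_flipAt]
  have hB1 : ∀ ω, B ω ≤ 1 := fun ω => by simp only [hB]; split_ifs <;> norm_num
  -- of the four sign choices, at most three are bad, unless one of the signs is zero
  have key : ∀ ω : Fin D → ZMod q, B ω + B (flipAt (8 + i) ω) + B (flipAt (8 + j) ω) +
      B (flipAt (8 + i) (flipAt (8 + j) ω)) ≤ 3 + ((1 - sR ω i ^ 2) + (1 - sR ω j ^ 2)) := by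
    intro ω
    by_cases hz : ent ω (8 + i) = 0
    · have h1 : sR ω i = 0 := by simp [sR, hz, sg_zero]
      have h2 := (sq_le_one_iff_abs_le_one _).2 (abs_sg_le (ent ω (8 + j)))
      have h3 : sR ω j ^ 2 ≤ 1 := h2
      rw [h1]
      linarith [hB1 ω, hB1 (flipAt (8 + i) ω), hB1 (flipAt (8 + j) ω), hB1 (flipAt (8 + i) (flipAt (8 + j) ω))]
    by_cases hz' : ent ω (8 + j) = 0
    · have h1 : sR ω j = 0 := by simp [sR, hz', sg_zero]
      have h2 := (sq_le_one_iff_abs_le_one _).2 (abs_sg_le (ent ω (8 + i)))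
      have h3 : sR ω i ^ 2 ≤ 1 := h2
      rw [h1]
      linarith [hB1 ω, hB1 (flipAt (8 + i) ω), hB1 (flipAt (8 + j) ω), hB1 (flipAt (8 + i) (flipAt (8 + j) ω))]
    have h1 : sR ω i ^ 2 = 1 := sg_sq hz
    have h2 : sR ω j ^ 2 = 1 := sg_sq hz'
    have h3 := four_mul_cosD_le hodd X (m := m) haa hu hu' ω h1 h2
    rw [h1, h2]
    simp only [hB, hcos]
    rw [← hi', ← hj'] at h3
    split_ifs <;> linarith
  have h4 : 4 * 𝔼 ω, B ω ≤ 3 + (1 / (q : ℝ) + 1 / q) := by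
    have := Finset.expect_le_expect (s := Finset.univ) fun ω _ => key ω
    rw [Finset.expect_add_distrib, Finset.expect_add_distrib, Finset.expect_add_distrib,
      Finset.expect_add_distrib, Finset.expect_add_distrib, Fintype.expect_const,
      expect_row_sign_zero (e1 a u ha hu), expect_row_sign_zero (e1 a' u' ha' hu'),
      expect_flipAt (8 + i), expect_flipAt (8 + j),
      expect_flipAt (8 + j) (fun ω => B (flipAt (8 + i) ω)), expect_flipAt (8 + i)] at this
    linarith
  have h5 : (1 : ℝ) / (2 * q) = (1 / (q : ℝ) + 1 / q) / 4 := by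
    have : (q : ℝ) ≠ 0 := by exact_mod_cast hq.out.ne_zero
    field_simp; norm_num
  rw [h5]
  linarith

end

section

open scoped BigOperators

variable {q D : ℕ} [hq : Fact q.Prime]

/-! ### Rounding, and the success of a trial -/

/-- Inner product number `e` of the rounded group sums. -/
def grpE {p : ℕ} (m c : ℕ) (X : ℕ → Fin p → ℝ) (ω : Fin D → ZMod q) (e : ℕ) : ℝ :=
  ∑ b ∈ Finset.range m, rnd m (grp m c X (e % c ^ 5) ω b) * rnd m (grp m c X (e / c ^ 5) ω b)

theorem abs_skN_le {p m : ℕ} (X : ℕ → Fin p → ℝ) (i : ℕ) (ω : Fin D → ZMod q) {b : ℕ} (hb : b < m) :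
    |skN m X i ω b| ≤ 1 := by
  unfold skN
  rw [abs_div, abs_of_nonneg (Real.sqrt_nonneg _)]
  refine div_le_one_of_le₀ (Real.abs_le_sqrt ?_) (Real.sqrt_nonneg _)
  rw [sq]
  exact Finset.single_le_sum (f := fun b => skV m (X i) ω b * skV m (X i) ω b)
    (fun b _ => mul_self_nonneg _) (Finset.mem_range.2 hb)

theorem abs_grp_le {p m c : ℕ} (X : ℕ → Fin p → ℝ) (a : ℕ) (ω : Fin D → ZMod q) {b : ℕ}
    (hb : b < m) : |grp m c X a ω b| ≤ c := by
  unfold grp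
  refine (Finset.abs_sum_le_sum_abs _ _).trans ?_
  calc _ ≤ ∑ u ∈ Finset.range c, (1 : ℝ) := by
        refine Finset.sum_le_sum fun u _ => ?_
        rw [abs_mul]
        exact mul_le_one₀ (abs_sg_le _) (abs_nonneg _) (abs_skN_le _ _ _ hb)
    _ = c := by simp

/-- The rounding error of a product of two coordinates. -/
theorem abs_mul_sub_mul_le {m c : ℕ} (hm : 1 ≤ m) (hc : 1 ≤ c) (hcm : c ≤ m) {z z' : ℝ}
    (hz : |z| ≤ c) (hz' : |z'| ≤ c) :
    |rnd m z * rnd m z' - (m : ℝ) ^ 4 * (z * z')| ≤ 3 * ((m : ℝ) ^ 2 * c) := by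
  have hcm' : (c : ℝ) ≤ m := by exact_mod_cast hcm
  have hm' : (1 : ℝ) ≤ m := by exact_mod_cast hm
  have hc' : (1 : ℝ) ≤ c := by exact_mod_cast hc
  obtain ⟨h1, h2⟩ := rnd_le hm (hz.trans hcm')
  obtain ⟨h3, h4⟩ := rnd_le hm (hz'.trans hcm')
  set δ := rnd m z - (m : ℝ) ^ 2 * z with hδ
  set δ' := rnd m z' - (m : ℝ) ^ 2 * z' with hδ'
  have e1 : rnd m z = (m : ℝ) ^ 2 * z + δ := by rw [hδ]; ring
  have e2 : rnd m z' = (m : ℝ) ^ 2 * z' + δ' := by rw [hδ']; ring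
  have d1 : |δ| ≤ 1 := abs_le.2 ⟨by linarith, by linarith⟩
  have d2 : |δ'| ≤ 1 := abs_le.2 ⟨by linarith, by linarith⟩
  have e3 : rnd m z * rnd m z' - (m : ℝ) ^ 4 * (z * z') =
      (m : ℝ) ^ 2 * (z * δ') + (m : ℝ) ^ 2 * (z' * δ) + δ * δ' := by
    rw [e1, e2]; ring
  rw [e3]
  have hm2 : (0 : ℝ) ≤ (m : ℝ) ^ 2 := by positivity
  have a1 : |(m : ℝ) ^ 2 * (z * δ')| ≤ (m : ℝ) ^ 2 * c := by
    rw [abs_mul, abs_of_nonneg hm2, abs_mul]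
    gcongr
    calc |z| * |δ'| ≤ c * 1 := by gcongr
      _ = c := mul_one _
  have a2 : |(m : ℝ) ^ 2 * (z' * δ)| ≤ (m : ℝ) ^ 2 * c := by
    rw [abs_mul, abs_of_nonneg hm2, abs_mul]
    gcongr
    calc |z'| * |δ| ≤ c * 1 := by gcongr
      _ = c := mul_one _
  have a3 : |δ * δ'| ≤ (m : ℝ) ^ 2 * c := by
    rw [abs_mul]
    calc |δ| * |δ'| ≤ 1 * 1 := by gcongr
      _ ≤ (m : ℝ) ^ 2 * c := by
        have : (1 : ℝ) ≤ (m : ℝ) ^ 2 := one_le_pow₀ hm'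
        exact mul_le_mul this hc' (by norm_num) hm2
  have := abs_add_le ((m : ℝ) ^ 2 * (z * δ') + (m : ℝ) ^ 2 * (z' * δ)) (δ * δ')
  have := abs_add_le ((m : ℝ) ^ 2 * (z * δ')) ((m : ℝ) ^ 2 * (z' * δ))
  linarith

theorem abs_grpE_sub_le {p m c : ℕ} (hm : 1 ≤ m) (hc : 1 ≤ c) (hcm : c ≤ m) {φ : ℝ}
    (hmφ : 24 * (c : ℝ) ≤ m * φ) (X : ℕ → Fin p → ℝ) (ω : Fin D → ZMod q) (e : ℕ) :
    |grpE m c X ω e - (m : ℝ) ^ 4 * grpD m c X (e % c ^ 5) (e / c ^ 5) ω| ≤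
      (m : ℝ) ^ 4 * (φ / 8) := by
  unfold grpE grpD
  rw [Finset.mul_sum, ← Finset.sum_sub_distrib]
  refine (Finset.abs_sum_le_sum_abs _ _).trans ?_
  calc _ ≤ ∑ b ∈ Finset.range m, 3 * ((m : ℝ) ^ 2 * c) := by
        refine Finset.sum_le_sum fun b hb => ?_
        have hb' := Finset.mem_range.1 hb
        exact abs_mul_sub_mul_le hm hc hcm (abs_grp_le X _ ω hb') (abs_grp_le X _ ω hb')
    _ = (m : ℝ) ^ 3 * (24 * c) / 8 := by
        rw [Finset.sum_const, Finset.card_range, nsmul_eq_mul]; ring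
    _ ≤ (m : ℝ) ^ 3 * (m * φ) / 8 := by gcongr
    _ = (m : ℝ) ^ 4 * (φ / 8) := by ring

/-- Inner products of group sums that pass the threshold are large. -/
theorem le_abs_grpD_of_thr_le {p m c : ℕ} (hm : 1 ≤ m) (hc : 1 ≤ c) (hcm : c ≤ m) {φ : ℝ} (hφ : 0 < φ)
    (hmφ : 24 * (c : ℝ) ≤ m * φ) (X : ℕ → Fin p → ℝ) (ω : Fin D → ZMod q) {e : ℕ}
    (h : thr φ m ≤ grpE m c X ω e * grpE m c X ω e) :
    3 * φ / 8 ≤ |grpD m c X (e % c ^ 5) (e / c ^ 5) ω| := by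
  have hm4 : (0 : ℝ) < (m : ℝ) ^ 4 := by
    have : (0 : ℝ) < m := by exact_mod_cast hm
    positivity
  have h1 : φ / 2 * (m : ℝ) ^ 4 ≤ |grpE m c X ω e| := by
    have h2 : |φ / 2 * (m : ℝ) ^ 4| ≤ |grpE m c X ω e| := sq_le_sq.1 (by
      unfold thr at h; nlinarith)
    rwa [abs_of_pos (by positivity)] at h2
  have h3 := abs_grpE_sub_le hm hc hcm hmφ X ω e
  have h4 := abs_sub_abs_le_abs_sub (grpE m c X ω e)
    ((m : ℝ) ^ 4 * grpD m c X (e % c ^ 5) (e / c ^ 5) ω)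
  rw [abs_mul, abs_of_pos hm4] at h4
  have h5 : (m : ℝ) ^ 4 * (3 * φ / 8) ≤ (m : ℝ) ^ 4 * |grpD m c X (e % c ^ 5) (e / c ^ 5) ω| := by
    linarith
  exact le_of_mul_le_mul_left h5 hm4

theorem thr_le_of_le_abs_grpD {p m c : ℕ} (hm : 1 ≤ m) (hc : 1 ≤ c) (hcm : c ≤ m) {φ : ℝ} (hφ : 0 < φ)
    (hmφ : 24 * (c : ℝ) ≤ m * φ) (X : ℕ → Fin p → ℝ) (ω : Fin D → ZMod q) {e : ℕ}
    (h : 3 * φ / 4 ≤ |grpD m c X (e % c ^ 5) (e / c ^ 5) ω|) :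
    thr φ m ≤ grpE m c X ω e * grpE m c X ω e := by
  have hm4 : (0 : ℝ) < (m : ℝ) ^ 4 := by
    have : (0 : ℝ) < m := by exact_mod_cast hm
    positivity
  have h3 := abs_grpE_sub_le hm hc hcm hmφ X ω e
  have h4 := abs_sub_abs_le_abs_sub ((m : ℝ) ^ 4 * grpD m c X (e % c ^ 5) (e / c ^ 5) ω)
    (grpE m c X ω e)
  rw [abs_mul, abs_of_pos hm4, abs_sub_comm] at h4
  have h5 : (m : ℝ) ^ 4 * (3 * φ / 4) ≤ (m : ℝ) ^ 4 * |grpD m c X (e % c ^ 5) (e / c ^ 5) ω| := by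
    gcongr
  have h6 : φ / 2 * (m : ℝ) ^ 4 ≤ |grpE m c X ω e| := by nlinarith
  unfold thr
  rw [← abs_mul_abs_self (grpE m c X ω e)]
  exact mul_self_le_mul_self (by positivity) h6

/-- The number of inner products that pass the threshold. -/
theorem bigCount_le {p m c : ℕ} (hm : 1 ≤ m) (hc : 1 ≤ c) (hcm : c ≤ m) {φ : ℝ} (hφ : 0 < φ)
    (hmφ : 24 * (c : ℝ) ≤ m * φ) (X : ℕ → Fin p → ℝ) (ω : Fin D → ZMod q) :
    (bigCount (grpE m c X ω) (thr φ m) (Finset.range (c ^ 5 * c ^ 5)) : ℝ) ≤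
      (c : ℝ) ^ 5 + 8 / φ ^ 2 * ∑ a ∈ Finset.range (c ^ 5), ∑ a' ∈ Finset.range (c ^ 5),
        (if a = a' then 0 else grpD m c X a a' ω ^ 2) := by
  classical
  have h1 : (bigCount (grpE m c X ω) (thr φ m) (Finset.range (c ^ 5 * c ^ 5)) : ℝ) =
      ∑ e ∈ Finset.range (c ^ 5 * c ^ 5),
        if thr φ m ≤ grpE m c X ω e * grpE m c X ω e then (1 : ℝ) else 0 := by
    rw [Finset.sum_boole]
    unfold bigCount
    congr!
  rw [h1]
  calc _ ≤ ∑ e ∈ Finset.range (c ^ 5 * c ^ 5), ((if e % c ^ 5 = e / c ^ 5 then (1 : ℝ) else 0) +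
        8 / φ ^ 2 * if e % c ^ 5 = e / c ^ 5 then 0 else grpD m c X (e % c ^ 5) (e / c ^ 5) ω ^ 2) := by
        refine Finset.sum_le_sum fun e _ => ?_
        have h0 : 0 ≤ 8 / φ ^ 2 * grpD m c X (e % c ^ 5) (e / c ^ 5) ω ^ 2 := by positivity
        split_ifs with h2 h3 h3
        · linarith
        · have h4 := le_abs_grpD_of_thr_le hm hc hcm hφ hmφ X ω h2
          have h5 : (3 * φ / 8) ^ 2 ≤ grpD m c X (e % c ^ 5) (e / c ^ 5) ω ^ 2 := by
            rw [← sq_abs (grpD _ _ _ _ _ _)]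
            exact pow_le_pow_left₀ (by positivity) h4 2
          have h6 : 8 / φ ^ 2 * (3 * φ / 8) ^ 2 = 9 / 8 := by field_simp; norm_num
          have h7 : 8 / φ ^ 2 * (3 * φ / 8) ^ 2 ≤
            8 / φ ^ 2 * grpD m c X (e % c ^ 5) (e / c ^ 5) ω ^ 2 := by gcongr
          linarith
        · norm_num
        · linarith
    _ = _ := by
        rw [sum_range_mul_digits (c ^ 5) (c ^ 5) (fun a a' => (if a = a' then (1 : ℝ) else 0) +
          8 / φ ^ 2 * if a = a' then 0 else grpD m c X a a' ω ^ 2), Finset.sum_comm]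
        simp only [Finset.sum_add_distrib, Finset.mul_sum]
        congr 1
        rw [Finset.sum_congr rfl (fun a ha => by rw [Finset.sum_ite_eq, if_pos ha])]
        simp

open Classical in
/-- A trial fails to list a given pair of groups that contains a highly correlated pair of rows
with probability at most `7 / 8`. -/
theorem expect_fail_le (hodd : q % 2 = 1) {p m c N n : ℕ} (hD : D = N + 8) (hN : c ^ 5 * c = N)
    (hc : 1 ≤ c) (hcm : c ≤ m) (hmq : m ≤ q) (hp : p ≤ q) (hq512 : 256 ≤ q) {X : ℕ → Fin p → ℝ}
    (hX : ∀ i < n, ∑ j, X i j ^ 2 = 1) (hX0 : ∀ i, n ≤ i → X i = 0) {K₀ φ cap : ℝ}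
    (hK : ∑ i ∈ Finset.range N, ∑ j ∈ Finset.range N,
      (if i = j then 0 else (∑ l, X i l * X j l) ^ 2) ≤ K₀) (hφ : 0 < φ) (hφ1 : φ ≤ 1)
    (hmφ : 24 * (c : ℝ) ≤ m * φ) (hmφ2 : 131072 ≤ m * φ ^ 2)
    (hcap : (c : ℝ) ^ 5 + 128 / φ ^ 2 * (8 * K₀ + 160 * (N : ℝ) ^ 2 / m) ≤ cap)
    {a a' u u' : ℕ} (ha : a < c ^ 5) (ha' : a' < c ^ 5) (hu : u < c) (hu' : u' < c) (haa : a ≠ a')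
    (hi : a * c + u < n) (hj : a' * c + u' < n)
    (hC : φ ≤ |∑ l, X (a * c + u) l * X (a' * c + u') l|) :
    (𝔼 ω : Fin D → ZMod q, if (bigCount (grpE m c X ω) (thr φ m) (Finset.range (c ^ 5 * c ^ 5)) : ℝ)
        ≤ cap ∧ thr φ m ≤ grpE m c X ω (a + c ^ 5 * a') * grpE m c X ω (a + c ^ 5 * a')
      then (0 : ℝ) else 1) ≤ 7 / 8 := by
  have hm : 1 ≤ m := hc.trans hcm
  have e1 : (a + c ^ 5 * a') % c ^ 5 = a := by
    rw [Nat.add_mul_mod_self_left, Nat.mod_eq_of_lt ha]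
  have e2 : (a + c ^ 5 * a') / c ^ 5 = a' := by
    rw [Nat.add_mul_div_left _ _ (by positivity), Nat.div_eq_of_lt ha, zero_add]
  have hle : ∀ a < c ^ 5, (a + 1) * c ≤ N := fun a ha => hN ▸ Nat.mul_le_mul_right c ha
  -- the three ways to fail have probabilities at most `15 / 256`, `3 / 4 + 1 / 512` and `1 / 16`,
  -- which add up to less than `7 / 8`
  have p1 := expect_cosD_small_le (q := q) (D := D) hodd (by omega) hm hmq hp (hX _ hi) (hX _ hj) hφ
    hφ1 hC hmφ2
  have p2 := expect_grpD_lt_le (q := q) (D := D) (m := m) hodd hD X haa hu hu' (hle a ha) (hle a' ha')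
  have p3 := expect_sum_grpD_sq_le (q := q) hodd hD hN hm hmq hp hX hX0 hK
  set E : ℝ := 8 * K₀ + 160 * (N : ℝ) ^ 2 / m with hE
  set S : (Fin D → ZMod q) → ℝ := fun ω => ∑ a ∈ Finset.range (c ^ 5), ∑ a' ∈ Finset.range (c ^ 5),
      (if a = a' then 0 else grpD m c X a a' ω ^ 2) with hS
  have hS0 : ∀ ω, 0 ≤ S ω := fun ω => Finset.sum_nonneg fun a _ => Finset.sum_nonneg fun a' _ => by
    split_ifs
    · exact le_rfl
    · positivity
  have hφ2 : 0 < φ ^ 2 := by positivity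
  have hE0 : 0 ≤ E := (Finset.expect_nonneg fun ω _ => hS0 ω).trans p3
  have p4 : (𝔼 ω : Fin D → ZMod q,
      if (bigCount (grpE m c X ω) (thr φ m) (Finset.range (c ^ 5 * c ^ 5)) : ℝ) ≤ cap then (0 : ℝ)
        else 1) ≤ 1 / 16 := by
    rcases hE0.eq_or_lt with hE1 | hE1
    · -- in this degenerate case no inner product of different group sums is ever nonzero
      have hz : 𝔼 ω, S ω = 0 := le_antisymm (by rw [hE1]; exact p3)
        (Finset.expect_nonneg fun ω _ => hS0 ω)
      have hz' : ∀ ω, S ω = 0 := by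
        intro ω
        rw [Fintype.expect_eq_sum_div_card, div_eq_zero_iff] at hz
        rcases hz with hz | hz
        · exact (Finset.sum_eq_zero_iff_of_nonneg fun ω _ => hS0 ω).1 hz ω (Finset.mem_univ _)
        · exact absurd hz (by exact_mod_cast Fintype.card_ne_zero)
      have hle : ∀ ω : Fin D → ZMod q,
          (bigCount (grpE m c X ω) (thr φ m) (Finset.range (c ^ 5 * c ^ 5)) : ℝ) ≤ cap := by
        intro ω
        have h1 := bigCount_le hm hc hcm hφ hmφ X ω
        have h2 : S ω = 0 := hz' ω
        simp only [hS] at h2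
        rw [h2, mul_zero] at h1
        rw [← hE1, mul_zero] at hcap
        linarith
      simp only [hle, if_true, Finset.expect_const_zero]
      norm_num
    · calc _ ≤ 𝔼 ω : Fin D → ZMod q, 1 / (16 * E) * S ω := by
            refine Finset.expect_le_expect fun ω _ => ?_
            split_ifs with h
            · have := hS0 ω; positivity
            · have h1 := bigCount_le hm hc hcm hφ hmφ X ω
              have h2 : 128 / φ ^ 2 * E ≤ 8 / φ ^ 2 * S ω := by
                simp only [hS]
                push Not at h
                linarith
              have h3 : 16 * E ≤ S ω := by
                have h4 : 8 / φ ^ 2 * (16 * E) ≤ 8 / φ ^ 2 * S ω := by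
                  refine le_trans (le_of_eq ?_) h2; ring
                exact le_of_mul_le_mul_left h4 (by positivity)
              rw [one_div_mul_eq_div, le_div_iff₀ (by positivity)]
              linarith
        _ ≤ 1 / (16 * E) * E := by
            rw [← Finset.mul_expect]
            gcongr
        _ = 1 / 16 := by field_simp
  have hq' : (1 : ℝ) / (2 * q) ≤ 1 / 512 := by
    have : (256 : ℝ) ≤ q := by exact_mod_cast hq512
    exact one_div_le_one_div_of_le (by norm_num) (by linarith)
  calc _ ≤ 𝔼 ω : Fin D → ZMod q,
        ((if |cosD m (X (a * c + u)) (X (a' * c + u')) ω| < 3 * φ / 4 then (1 : ℝ) else 0) +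
        (if |grpD m c X a a' ω| < |cosD m (X (a * c + u)) (X (a' * c + u')) ω| then (1 : ℝ) else 0) +
        if (bigCount (grpE m c X ω) (thr φ m) (Finset.range (c ^ 5 * c ^ 5)) : ℝ) ≤ cap then (0 : ℝ)
          else 1) := by
        refine Finset.expect_le_expect fun ω _ => ?_
        have key : ¬ |cosD m (X (a * c + u)) (X (a' * c + u')) ω| < 3 * φ / 4 →
            ¬ |grpD m c X a a' ω| < |cosD m (X (a * c + u)) (X (a' * c + u')) ω| →
            thr φ m ≤ grpE m c X ω (a + c ^ 5 * a') * grpE m c X ω (a + c ^ 5 * a') := by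
          intro h1 h2
          push Not at h1 h2
          refine thr_le_of_le_abs_grpD hm hc hcm hφ hmφ X ω ?_
          rw [e1, e2]
          exact h1.trans h2
        by_cases h1 : |cosD m (X (a * c + u)) (X (a' * c + u')) ω| < 3 * φ / 4
        · rw [if_pos h1]
          split_ifs <;> norm_num
        by_cases h2 : |grpD m c X a a' ω| < |cosD m (X (a * c + u)) (X (a' * c + u')) ω|
        · rw [if_neg h1, if_pos h2]
          split_ifs <;> norm_num
        have h3 := key h1 h2
        rw [if_neg h1, if_neg h2]
        by_cases h4 : (bigCount (grpE m c X ω) (thr φ m) (Finset.range (c ^ 5 * c ^ 5)) : ℝ) ≤ cap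
        · rw [if_pos ⟨h4, h3⟩, if_pos h4]; norm_num
        · rw [if_neg (fun h => h4 h.1), if_neg h4]; norm_num
    _ ≤ 15 / 256 + (3 / 4 + 1 / 512) + 1 / 16 := by
        rw [Finset.expect_add_distrib, Finset.expect_add_distrib]
        linarith
    _ ≤ 7 / 8 := by norm_num

end

section

open scoped BigOperators

/-! ### Independent trials -/

/-- The part of the random table that belongs to trial `t`. -/
def blk {q L D : ℕ} [Fact q.Prime] (t : ℕ) (ω : Fin (L * D) → ZMod q) : Fin D → ZMod q := fun x =>
  ent ω (t * D + x)

/-- The parts of the random table that belong to different trials are independent. -/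
theorem expect_prod_blk {q L D : ℕ} [Fact q.Prime] (f : (Fin D → ZMod q) → ℝ) :
    𝔼 ω : Fin (L * D) → ZMod q, ∏ t ∈ Finset.range L, f (blk t ω) = (𝔼 ω, f ω) ^ L := by
  rw [Finset.expect_pow, Fintype.piFinset_univ]
  refine Fintype.expect_equiv
    ((Equiv.arrowCongr finProdFinEquiv.symm (Equiv.refl _)).trans (Equiv.curry _ _ _)) _ _ ?_
  intro ω
  rw [Finset.prod_range]
  refine Finset.prod_congr rfl fun t _ => ?_
  congr 1
  funext x
  have h : (t : ℕ) * D + x < L * D := by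
    have h1 : ((t : ℕ) + 1) * D ≤ L * D := Nat.mul_le_mul_right _ t.2
    have := x.2
    rw [add_mul] at h1
    omega
  simp only [blk, ent, dif_pos h]
  simp only [Equiv.trans_apply, Equiv.curry_apply, Function.curry, Equiv.arrowCongr_apply,
    Equiv.symm_symm, Function.comp, Equiv.refl_apply]
  congr 1
  rw [Fin.ext_iff]
  simp [finProdFinEquiv]
  ring

/-- Markov's inequality: `f` is at least 1 off the event `G` and has a small mean. -/
theorem toOuterMeasure_uniform_ge {Ω : Type*} [Fintype Ω] [Nonempty Ω] (G : Set Ω) {δ : ℝ}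
    (f : Ω → ℝ) (hf : ∀ ω, 0 ≤ f ω) (hfG : ∀ ω, ω ∉ G → 1 ≤ f ω) (h : 𝔼 ω, f ω ≤ δ) :
    (PMF.uniformOfFintype Ω).toOuterMeasure G ≥ ENNReal.ofReal (1 - δ) := by
  classical
  have hc : (0 : ℝ) < Fintype.card Ω := by exact_mod_cast Fintype.card_pos
  rw [PMF.toOuterMeasure_uniformOfFintype_apply, ge_iff_le]
  have h1 : (1 - δ) ≤ (Fintype.card G : ℝ) / Fintype.card Ω := by
    have h2 : 𝔼 ω : Ω, (1 - f ω) ≤ 𝔼 ω : Ω, if ω ∈ G then (1 : ℝ) else 0 := by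
      refine Finset.expect_le_expect fun ω _ => ?_
      split_ifs with hω
      · linarith [hf ω]
      · linarith [hfG ω hω]
    rw [Finset.expect_sub_distrib, Fintype.expect_const, Fintype.expect_eq_sum_div_card
      (fun ω => if ω ∈ G then (1 : ℝ) else 0), Finset.sum_boole] at h2
    have h3 : (Fintype.card G : ℝ) = (Finset.univ.filter fun ω => ω ∈ G).card := by
      rw [Fintype.card_subtype]
    rw [h3]
    linarith
  calc ENNReal.ofReal (1 - δ) ≤ ENNReal.ofReal ((Fintype.card G : ℝ) / Fintype.card Ω) :=
        ENNReal.ofReal_le_ofReal h1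
    _ = _ := by
        rw [ENNReal.ofReal_div_of_pos hc, ENNReal.ofReal_natCast, ENNReal.ofReal_natCast]

/-! ### The sketch of a trial -/

theorem ent_blk {q L D : ℕ} [Fact q.Prime] (t : ℕ) (ω : Fin (L * D) → ZMod q) {y : ℕ} (hy : y < D) :
    ent (blk t ω) y = ent ω (t * D + y) := by
  rw [ent, dif_pos hy]; rfl

theorem pol_blk {q L D : ℕ} [Fact q.Prime] (t : ℕ) (ω : Fin (L * D) → ZMod q) {o : ℕ}
    (ho : o + 4 ≤ D) (y : ZMod q) : pol (blk t ω) o y = pol ω (t * D + o) y := by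
  simp only [pol, ent_blk t ω (show o < D by omega), ent_blk t ω (show o + 1 < D by omega),
    ent_blk t ω (show o + 2 < D by omega), ent_blk t ω (show o + 3 < D by omega), ← add_assoc]

theorem hsh_eq {q L N m : ℕ} [Fact q.Prime] (t : ℕ) (ω : Fin (L * (N + 8)) → ZMod q) (j b : ℕ) :
    hsh q m N (tbl ω) t j b = if bH m (blk t ω) j = b then sH (blk t ω) j else 0 := by
  have h1 : bktH q m (tbl ω) (t * (N + 8)) j = bH m (blk t ω) j := by
    have := horner_eq_val ω (t * (N + 8) + 4) j
    rw [bH, pol_blk t ω (by omega), ← this]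
    rfl
  have h2 : sgnH q (tbl ω) (t * (N + 8)) j = sH (blk t ω) j := by
    have := horner_eq_val ω (t * (N + 8)) j
    rw [sH, pol_blk t ω (by omega), add_zero, sg, ← this]
    rfl
  rw [hsh, h1, h2]

theorem rsgn_eq {q L N : ℕ} [Fact q.Prime] (t : ℕ) (ω : Fin (L * (N + 8)) → ZMod q) {i : ℕ}
    (hi : i < N) : rsgn q (tbl ω) N t i = sR (blk t ω) i := by
  rw [rsgn, sR, ent_blk t ω (by omega), tbl_eq_val_ent, sg]

/-- The Euclidean norm of a centered row. -/
def rowN {n p : ℕ} (M : Matrix (Fin n) (Fin p) ℝ) (i : Fin n) : ℝ :=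
  Real.sqrt (∑ l, centered M i l ^ 2)

/-- The normalized centered rows; rows beyond `n` are zero. -/
def rowX {n p : ℕ} (M : Matrix (Fin n) (Fin p) ℝ) (i : ℕ) (l : Fin p) : ℝ :=
  if h : i < n then centered M ⟨i, h⟩ l / rowN M ⟨i, h⟩ else 0

theorem rowX_of_le {n p : ℕ} (M : Matrix (Fin n) (Fin p) ℝ) {i : ℕ} (h : n ≤ i) : rowX M i = 0 := by
  funext l
  rw [rowX, dif_neg (by omega)]; rfl

variable {V : ℕ} [hV : Fact (1048576 ≤ V)]

section

variable {n p : ℕ} [hq : Fact (nextPrime (p + mPar n)).Prime]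

theorem csA_eq_skV (hS : Sizes V n p) (us : List (Update n p))
    (ω : Fin (tlen n) → ZMod (nextPrime (p + mPar n))) {t b : ℕ} (ht : t < LPar n) (hb : b < mPar n)
    (i : Fin n) (hi : 0 < rowN (streamMatrix us) i) :
    csA (finF n p us (tbl ω)) (finG n p us) (mPar n) (cPar n ^ 6) t i b =
      rowN (streamMatrix us) i * skV (mPar n) (rowX (streamMatrix us) i)
        (blk (L := LPar n) (D := cPar n ^ 6 + 8) t ω) b := by
  rw [csA_eq hS us (tbl ω) ht hb i, skV, Finset.mul_sum]
  refine Finset.sum_congr rfl fun j _ => ?_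
  rw [hsh_eq (L := LPar n) (N := cPar n ^ 6) t ω, rowX, dif_pos i.2]
  field_simp

theorem csA_div_nrmA (hS : Sizes V n p) (us : List (Update n p))
    (ω : Fin (tlen n) → ZMod (nextPrime (p + mPar n))) {t b i : ℕ} (ht : t < LPar n)
    (hb : b < mPar n) (hiN : i < cPar n ^ 6) (hi : ∀ i, 0 < rowN (streamMatrix us) i) :
    csA (finF n p us (tbl ω)) (finG n p us) (mPar n) (cPar n ^ 6) t i b /
      nrmA (finF n p us (tbl ω)) (finG n p us) (mPar n) (cPar n ^ 6) t i =
      skN (mPar n) (rowX (streamMatrix us)) i (blk (L := LPar n) (D := cPar n ^ 6 + 8) t ω) b := by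
  by_cases h : i < n
  · have h1 : nrmA (finF n p us (tbl ω)) (finG n p us) (mPar n) (cPar n ^ 6) t i =
        rowN (streamMatrix us) ⟨i, h⟩ * Real.sqrt (skD (mPar n) (rowX (streamMatrix us) i)
          (rowX (streamMatrix us) i) (blk (L := LPar n) (D := cPar n ^ 6 + 8) t ω)) := by
      unfold nrmA
      rw [show (∑ b ∈ Finset.range (mPar n),
          csA (finF n p us (tbl ω)) (finG n p us) (mPar n) (cPar n ^ 6) t i b *
          csA (finF n p us (tbl ω)) (finG n p us) (mPar n) (cPar n ^ 6) t i b) =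
          rowN (streamMatrix us) ⟨i, h⟩ ^ 2 * skD (mPar n) (rowX (streamMatrix us) i)
          (rowX (streamMatrix us) i) (blk (L := LPar n) (D := cPar n ^ 6 + 8) t ω) from ?_]
      · rw [Real.sqrt_mul (sq_nonneg _), Real.sqrt_sq (hi _).le]
      · rw [skD, Finset.mul_sum]
        refine Finset.sum_congr rfl fun b hb => ?_
        have := csA_eq_skV hS us ω ht (Finset.mem_range.1 hb) ⟨i, h⟩ (hi _)
        simp only at this
        rw [this]
        ring
    have h2 := csA_eq_skV hS us ω ht hb ⟨i, h⟩ (hi _)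
    simp only at h2
    rw [h1, h2, skN, mul_div_mul_left _ _ (hi _).ne']
  · rw [csA_eq_zero hS us (tbl ω) ht hb (by omega) hiN, skN, skV]
    simp [rowX_of_le (streamMatrix us) (show n ≤ i by omega)]

theorem dA_eq_grpE (hS : Sizes V n p) (us : List (Update n p))
    (ω : Fin (tlen n) → ZMod (nextPrime (p + mPar n))) {t e : ℕ} (ht : t < LPar n)
    (he : e < cPar n ^ 5 * cPar n ^ 5) (hi : ∀ i, 0 < rowN (streamMatrix us) i) :
    dA (finF n p us (tbl ω)) (finG n p us) (tbl ω) (nextPrime (p + mPar n)) (cPar n) (mPar n)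
      (cPar n ^ 6) t e =
      grpE (mPar n) (cPar n) (rowX (streamMatrix us))
        (blk (L := LPar n) (D := cPar n ^ 6 + 8) t ω) e := by
  have hz : ∀ a < cPar n ^ 5, ∀ b < mPar n,
      zA (finF n p us (tbl ω)) (finG n p us) (tbl ω) (nextPrime (p + mPar n)) (cPar n) (mPar n)
        (cPar n ^ 6) t a b = grp (mPar n) (cPar n) (rowX (streamMatrix us)) a
        (blk (L := LPar n) (D := cPar n ^ 6 + 8) t ω) b := by
    intro a ha b hb
    unfold zA grp
    refine Finset.sum_congr rfl fun u hu => ?_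
    have hu' := Finset.mem_range.1 hu
    have hiN : a * cPar n + u < cPar n ^ 6 := by
      have : (a + 1) * cPar n ≤ cPar n ^ 5 * cPar n := Nat.mul_le_mul_right _ ha
      rw [show cPar n ^ 5 * cPar n = cPar n ^ 6 by ring, add_mul] at this
      omega
    rw [mul_div_assoc, csA_div_nrmA hS us ω ht hb hiN hi,
      rsgn_eq (L := LPar n) (N := cPar n ^ 6) t ω hiN]
  have hc : 0 < cPar n ^ 5 := pow_pos hS.root 5
  unfold dA grpE wA
  refine Finset.sum_congr rfl fun b hb => ?_
  have hb' := Finset.mem_range.1 hb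
  rw [hz _ (Nat.mod_lt _ hc) b hb', hz _ (Nat.div_lt_of_lt_mul he) b hb']

end

/-! ### Correlations -/

section

variable {n p : ℕ} (M : Matrix (Fin n) (Fin p) ℝ)

theorem sampleCov_apply (i j : Fin n) :
    sampleCov M i j = (1 / ((p : ℝ) - 1)) * ∑ l, centered M i l * centered M j l := by
  simp [sampleCov, Matrix.mul_apply]

variable {M}

theorem rowN_pos (hp : 2 ≤ p) (i : Fin n) (h : 0 < sampleCov M i i) : 0 < rowN M i := by
  refine Real.sqrt_pos.2 ?_
  have hp' : (0 : ℝ) < 1 / ((p : ℝ) - 1) := by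
    have : (2 : ℝ) ≤ p := by exact_mod_cast hp
    exact one_div_pos.2 (by linarith)
  rw [sampleCov_apply] at h
  have := (mul_pos_iff_of_pos_left hp').1 h
  simpa [sq] using this

theorem sum_rowX_sq (i : Fin n) (h : 0 < rowN M i) : ∑ l, rowX M i l ^ 2 = 1 := by
  simp only [rowX, dif_pos i.2, Fin.eta, div_pow, ← Finset.sum_div]
  rw [div_eq_one_iff_eq (by positivity), rowN, Real.sq_sqrt (Finset.sum_nonneg fun _ _ => sq_nonneg _)]

theorem sampleCorr_eq (hp : 2 ≤ p) (hpos : ∀ i, 0 < sampleCov M i i) (i j : Fin n) :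
    sampleCorr M i j = ∑ l, rowX M i l * rowX M j l := by
  have hp' : (0 : ℝ) < (p : ℝ) - 1 := by
    have : (2 : ℝ) ≤ p := by exact_mod_cast hp
    linarith
  have hr : ∀ i, sampleCov M i i ^ (-(1 / 2) : ℝ) = Real.sqrt ((p : ℝ) - 1) / rowN M i := by
    intro i
    rw [Real.rpow_neg (hpos i).le, ← Real.sqrt_eq_rpow, sampleCov_apply]
    rw [show (1 / ((p : ℝ) - 1)) * ∑ l, centered M i l * centered M i l =
      (∑ l, centered M i l ^ 2) / ((p : ℝ) - 1) by simp only [sq]; ring]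
    rw [Real.sqrt_div' _ hp'.le, inv_div, rowN]
  have hs := Real.mul_self_sqrt hp'.le
  have hi := rowN_pos hp i (hpos i)
  have hj := rowN_pos hp j (hpos j)
  rw [sampleCorr, Matrix.mul_diagonal, Matrix.diagonal_mul, hr, hr, sampleCov_apply]
  simp only [rowX, dif_pos i.2, dif_pos j.2, Fin.eta, div_mul_div_comm, ← Finset.sum_div]
  rw [show Real.sqrt ((p : ℝ) - 1) / rowN M i * (1 / ((p : ℝ) - 1) *
      ∑ l, centered M i l * centered M j l) * (Real.sqrt ((p : ℝ) - 1) / rowN M j) =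
      (Real.sqrt ((p : ℝ) - 1) * Real.sqrt ((p : ℝ) - 1)) * (1 / ((p : ℝ) - 1)) *
      ((∑ l, centered M i l * centered M j l) / (rowN M i * rowN M j)) by field_simp, hs]
  field_simp

theorem abs_sampleCorr_le (hp : 2 ≤ p) (hpos : ∀ i, 0 < sampleCov M i i) (i j : Fin n) :
    |sampleCorr M i j| ≤ 1 := by
  rw [sampleCorr_eq hp hpos]
  exact (Finset.abs_sum_le_sum_abs _ _).trans (sum_abs_mul_le_one
    (sum_rowX_sq i (rowN_pos hp i (hpos i))).le (sum_rowX_sq j (rowN_pos hp j (hpos j))).le)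

/-- The off-diagonal correlations have a small sum of squares. -/
theorem sum_corr_sq_le (hp : 2 ≤ p) (hpos : ∀ i, 0 < sampleCov M i i) {k : ℕ} {R : ℝ} (hR : 0 ≤ R)
    {B : Matrix (Fin n) (Fin n) ℝ} (hB : IsResidual (sampleCorr M) k B) (hBR : frobNorm B ≤ R)
    {N : ℕ} (hN : n ≤ N) :
    ∑ i ∈ Finset.range N, ∑ j ∈ Finset.range N,
      (if i = j then 0 else (∑ l, rowX M i l * rowX M j l) ^ 2) ≤ k + R * R := by
  classical
  obtain ⟨S, hS, rfl⟩ := hB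
  set B := Matrix.of fun i j => if i = j ∨ (i, j) ∈ S then 0 else sampleCorr M i j with hBdef
  have hcard : (S.card : ℝ) ≤ k := by
    have := hS.2.1
    exact_mod_cast this.le.trans (min_le_left _ _)
  have hF : ∑ i, ∑ j, B i j ^ 2 ≤ R * R := by
    rw [← sq]
    exact (Real.sqrt_le_left hR).1 hBR
  have hsub : Finset.range n ⊆ Finset.range N := Finset.range_subset_range.2 hN
  have h1 : ∑ i ∈ Finset.range N, ∑ j ∈ Finset.range N,
      (if i = j then 0 else (∑ l, rowX M i l * rowX M j l) ^ 2) =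
      ∑ i : Fin n, ∑ j : Fin n, if i = j then 0 else sampleCorr M i j ^ 2 := by
    rw [← Finset.sum_subset hsub]
    · rw [Finset.sum_range]
      refine Finset.sum_congr rfl fun i _ => ?_
      rw [← Finset.sum_subset hsub]
      · rw [Finset.sum_range]
        refine Finset.sum_congr rfl fun j _ => ?_
        rw [sampleCorr_eq hp hpos]
        simp only [Fin.ext_iff]
      · intro j _ hj
        have : n ≤ j := by simpa using hj
        simp [rowX_of_le M this]
    · intro i _ hi
      have : n ≤ i := by simpa using hi
      simp [rowX_of_le M this]
  rw [h1]
  calc _ ≤ ∑ i : Fin n, ∑ j : Fin n, ((if (i, j) ∈ S then (1 : ℝ) else 0) + B i j ^ 2) := by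
        refine Finset.sum_le_sum fun i _ => Finset.sum_le_sum fun j _ => ?_
        have h2 := (sq_le_one_iff_abs_le_one _).2 (abs_sampleCorr_le hp hpos i j)
        by_cases h3 : i = j
        · rw [if_pos h3]; split_ifs <;> positivity
        · by_cases h4 : (i, j) ∈ S
          · rw [if_neg h3, if_pos h4]
            linarith [sq_nonneg (B i j)]
          · simp [hBdef, h3, h4]
    _ = S.card + ∑ i, ∑ j, B i j ^ 2 := by
        simp only [Finset.sum_add_distrib]
        congr 1
        rw [← Fintype.sum_prod_type' (f := fun i j => if (i, j) ∈ S then (1 : ℝ) else 0)]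
        simp
    _ ≤ k + R * R := add_le_add hcard hF

end

end

section

open scoped BigOperators

variable {V : ℕ} [hV : Fact (1048576 ≤ V)]

/-! ### Success probability -/

theorem one_lt_cPar_mul {n : ℕ} {φ : ℝ} (hφ : 0 < φ) (h : ¬ n * φ ^ 6 ≤ 1) : 1 < cPar n * φ := by
  push Not at h
  have h1 : (n : ℝ) ≤ (cPar n : ℝ) ^ 6 := by exact_mod_cast le_cPar_pow n
  have h2 : 1 < (cPar n * φ) ^ 6 := by
    rw [mul_pow]
    exact h.trans_le (by gcongr)
  by_contra hc
  push Not at hc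
  exact absurd (pow_le_one₀ (by positivity) hc (n := 6)) (not_le.2 h2)

/-- Six trials halve the probability of failure, as `(7 / 8) ^ 6 ≤ 1 / 2`. -/
theorem pow_LPar_le {n : ℕ} (hn : 1 ≤ n) : (7 / 8 : ℝ) ^ LPar n ≤ 1 / (n : ℝ) ^ 5 := by
  have hn' : (0 : ℝ) < n := by exact_mod_cast hn
  have h1 : (n : ℝ) ≤ 2 ^ Nat.clog 2 n := by
    exact_mod_cast Nat.le_pow_clog (by norm_num) n
  calc (7 / 8 : ℝ) ^ LPar n = ((7 / 8 : ℝ) ^ 6) ^ (5 * Nat.clog 2 n) := by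
        rw [← pow_mul, LPar]; congr 1; ring
    _ ≤ (1 / 2 : ℝ) ^ (5 * Nat.clog 2 n) := by
        refine pow_le_pow_left₀ (by positivity) (by norm_num) _
    _ = 1 / (2 ^ Nat.clog 2 n) ^ 5 := by
        rw [one_div, inv_pow, ← pow_mul, one_div, mul_comm]
    _ ≤ 1 / (n : ℝ) ^ 5 := by gcongr

theorem capR_ge {n k : ℕ} {R φ : ℝ} (hφ : 0 < φ) (hφ1 : φ ≤ 1) (hc : 1 ≤ cPar n) :
    (cPar n : ℝ) ^ 5 + 128 / φ ^ 2 * (8 * (k + R * R) + 160 * ((cPar n ^ 6 : ℕ) : ℝ) ^ 2 / mPar n) ≤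
      capR k R φ (cPar n) := by
  have hc' : (1 : ℝ) ≤ cPar n := by exact_mod_cast hc
  set c : ℝ := (cPar n : ℝ) with hcdef
  have hφ2 : 0 < φ ^ 2 := by positivity
  have hK : 0 ≤ (k : ℝ) + R * R := add_nonneg (Nat.cast_nonneg _) (mul_self_nonneg R)
  have h8 : 1 ≤ c ^ 8 := one_le_pow₀ hc'
  have h58 : c ^ 5 ≤ c ^ 8 := pow_le_pow_right₀ hc' (by norm_num)
  have e1 : 160 * ((cPar n ^ 6 : ℕ) : ℝ) ^ 2 / mPar n = 160 / 131072 * c ^ 8 := by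
    have : c ≠ 0 := by linarith
    simp only [mPar, hcdef]
    push_cast
    field_simp
  have e2 : capR k R φ (cPar n) = 2048 * (1 + (k + R * R)) * c ^ 8 / φ ^ 2 := by
    simp only [capR, hcdef]
    push_cast
    ring
  rw [e1, e2, le_div_iff₀ hφ2, add_mul, mul_comm (128 / φ ^ 2), mul_assoc, div_mul_cancel₀ _ hφ2.ne']
  have h1 : c ^ 5 * φ ^ 2 ≤ c ^ 8 := by
    calc c ^ 5 * φ ^ 2 ≤ c ^ 8 * 1 := by
          gcongr
          exact pow_le_one₀ hφ.le hφ1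
      _ = c ^ 8 := mul_one _
  nlinarith

/-- The union bound over the pairs of highly correlated rows and the independence of the trials. -/
theorem success_prob {n p k : ℕ} {φ R : ℝ} (hS : Sizes V n p) (hp : 2 ≤ p) (hφ : 0 < φ)
    (hφ1 : φ ≤ 1) (hR : 0 ≤ R) [hq : Fact (nextPrime (p + mPar n)).Prime] (us : List (Update n p))
    (hpos : ∀ i, 0 < sampleCov (streamMatrix us) i i) {B : Matrix (Fin n) (Fin n) ℝ}
    (hB : IsResidual (sampleCorr (streamMatrix us)) k B) (hBR : frobNorm B ≤ R)
    (F : (Fin (tlen n) → ZMod (nextPrime (p + mPar n))) → State)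
    (hF : ∀ ω, QueryOut (finF n p us (tbl ω)) (finG n p us) (tbl ω) (nextPrime (p + mPar n)) (cPar n)
        (mPar n) (cPar n ^ 6) (LPar n) n k R φ (F ω).out) :
    ((PMF.uniformOfFintype _).map F).toOuterMeasure
      {s | ∀ e ∈ largePairs φ (sampleCorr (streamMatrix us)), ((e.1 : ℕ), (e.2 : ℕ)) ∈ s.out}
      ≥ ENNReal.ofReal (1 - 1 / (n : ℝ) ^ 3) := by
  classical
  have hn := hS.one_le
  have hc := hS.root
  have hm := hS.one_le_mPar
  have hn' : (0 : ℝ) < n := by exact_mod_cast hn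
  set C := sampleCorr (streamMatrix us) with hC
  set c := cPar n with hcdef
  have hnc : n ≤ c ^ 5 * c := by
    have := le_cPar_pow n
    rwa [show c ^ 5 * c = c ^ 6 by ring]
  rw [PMF.toOuterMeasure_map_apply]
  by_cases hreg : n * φ ^ 6 ≤ 1
  · refine toOuterMeasure_uniform_ge _ (fun _ => 0) (fun _ => le_rfl) (fun ω hω => ?_)
      (by rw [Finset.expect_const_zero]; positivity)
    refine absurd ?_ hω
    intro e _
    exact (hF ω).1 hreg _ e.1.2 _ e.2.2
  have hcφ := one_lt_cPar_mul hφ hreg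
  obtain ⟨hq1, hq2⟩ := nextPrime_spec (p + mPar n)
  have hc' : (1 : ℝ) ≤ c := by exact_mod_cast hc
  have hm17 : 131072 ≤ mPar n := by
    have : 1 ≤ c ^ 4 := Nat.one_le_pow _ _ hc
    unfold mPar; rw [← hcdef]; omega
  have hodd : nextPrime (p + mPar n) % 2 = 1 :=
    (hq2.eq_two_or_odd).resolve_left (by omega)
  have hcm : c ≤ mPar n := by
    have : c ≤ c ^ 4 := Nat.le_self_pow (by norm_num) _
    unfold mPar; rw [← hcdef]; omega
  have hmR : (mPar n : ℝ) = 131072 * (c : ℝ) ^ 4 := by simp [mPar, hcdef]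
  have hc3 : (1 : ℝ) ≤ (c : ℝ) ^ 3 := one_le_pow₀ hc'
  have hmφ : 24 * (c : ℝ) ≤ mPar n * φ := by
    rw [hmR]
    have h1 : (c : ℝ) ≤ (c : ℝ) ^ 3 := le_self_pow₀ hc' (by norm_num)
    have h2 : (c : ℝ) ^ 3 * 1 ≤ (c : ℝ) ^ 3 * (c * φ) := by gcongr
    nlinarith
  have hmφ2 : 131072 ≤ mPar n * φ ^ 2 := by
    rw [hmR]
    have h1 : 1 ≤ (c * φ) ^ 2 := one_le_pow₀ hcφ.le
    have h2 : (1 : ℝ) ≤ (c : ℝ) ^ 2 := one_le_pow₀ hc'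
    have h3 : 1 * 1 ≤ (c : ℝ) ^ 2 * (c * φ) ^ 2 := mul_le_mul h2 h1 (by norm_num) (by positivity)
    nlinarith
  have hX : ∀ i < n, ∑ j, rowX (streamMatrix us) i j ^ 2 = 1 := fun i hi =>
    sum_rowX_sq ⟨i, hi⟩ (rowN_pos hp _ (hpos _))
  have hK := sum_corr_sq_le hp hpos hR hB hBR (le_cPar_pow n)
  have hrow : ∀ i, 0 < rowN (streamMatrix us) i := fun i => rowN_pos hp i (hpos i)
  -- failure of a trial to list the groups of a given pair of rows
  set bad : Fin n × Fin n → (Fin (c ^ 6 + 8) → ZMod (nextPrime (p + mPar n))) → ℝ := fun e ω =>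
    if (bigCount (grpE (mPar n) c (rowX (streamMatrix us)) ω) (thr φ (mPar n))
        (Finset.range (c ^ 5 * c ^ 5)) : ℝ) ≤ capR k R φ c ∧
      thr φ (mPar n) ≤ grpE (mPar n) c (rowX (streamMatrix us)) ω (e.1 / c + c ^ 5 * (e.2 / c)) *
        grpE (mPar n) c (rowX (streamMatrix us)) ω (e.1 / c + c ^ 5 * (e.2 / c))
    then (0 : ℝ) else 1 with hbad
  set Lg := (largePairs φ C).filter fun e => (e.1 : ℕ) / c ≠ (e.2 : ℕ) / c with hLg
  have hbad0 : ∀ e ω, 0 ≤ bad e ω := fun e ω => by simp only [hbad]; split_ifs <;> norm_num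
  have hdiv : ∀ i < n, i / c < c ^ 5 := fun i hi => Nat.div_lt_of_lt_mul (by
    rw [mul_comm]; omega)
  have hsplit : ∀ i, i / c * c + i % c = i := fun i => by rw [mul_comm]; exact Nat.div_add_mod _ _
  refine toOuterMeasure_uniform_ge _ (fun ω => ∑ e ∈ Lg, ∏ t ∈ Finset.range (LPar n),
    bad e (blk (L := LPar n) (D := c ^ 6 + 8) t ω)) ?_ ?_ ?_
  · exact fun ω => Finset.sum_nonneg fun e _ => Finset.prod_nonneg fun t _ => hbad0 _ _
  · intro ω hω
    simp only [Set.mem_preimage, Set.mem_ofPred_eq, not_forall] at hω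
    obtain ⟨e, he, hout⟩ := hω
    obtain ⟨hq1, hq2⟩ := (hF ω).2 hreg
    have h1 := hsplit e.1
    have h2 := hsplit e.2
    have heL : e ∈ Lg := by
      refine Finset.mem_filter.2 ⟨he, fun h => hout ?_⟩
      have := hq1 _ (hdiv e.1 e.1.2) (e.1 % c) (Nat.mod_lt _ hc) (e.2 % c) (Nat.mod_lt _ hc)
      rw [h1, h, h2] at this
      exact this
    have hprod : ∏ t ∈ Finset.range (LPar n), bad e (blk (L := LPar n) (D := c ^ 6 + 8) t ω) = 1 := by
      refine Finset.prod_eq_one fun t ht => ?_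
      have ht' := Finset.mem_range.1 ht
      refine if_neg fun hgood => hout ?_
      have ha := hdiv e.1 e.1.2
      have ha' := hdiv e.2 e.2.2
      have e1 : ((e.1 : ℕ) / c + c ^ 5 * (e.2 / c)) % c ^ 5 = e.1 / c := by
        rw [Nat.add_mul_mod_self_left, Nat.mod_eq_of_lt ha]
      have e2 : ((e.1 : ℕ) / c + c ^ 5 * (e.2 / c)) / c ^ 5 = e.2 / c := by
        rw [Nat.add_mul_div_left _ _ (by positivity), Nat.div_eq_of_lt ha, zero_add]
      have hlt : (e.1 : ℕ) / c + c ^ 5 * (e.2 / c) < c ^ 5 * c ^ 5 := by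
        have : c ^ 5 * ((e.2 : ℕ) / c + 1) ≤ c ^ 5 * c ^ 5 := Nat.mul_le_mul_left _ ha'
        rw [mul_add] at this
        omega
      have hdA := fun x (hx : x < c ^ 5 * c ^ 5) => dA_eq_grpE hS us ω ht' hx hrow
      have hcount : (bigCount (dA (finF n p us (tbl ω)) (finG n p us) (tbl ω)
          (nextPrime (p + mPar n)) c (mPar n) (c ^ 6) t) (thr φ (mPar n))
          (Finset.range (c ^ 5 * c ^ 5)) : ℝ) ≤ capR k R φ c := by
        refine le_trans (le_of_eq ?_) hgood.1
        unfold bigCount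
        congr 2
        refine Finset.filter_congr fun x hx => ?_
        rw [hdA x (Finset.mem_range.1 hx)]
      have := hq2 t ht' hcount _ hlt (by rw [hdA _ hlt]; exact hgood.2) (e.1 % c)
        (Nat.mod_lt _ hc) (e.2 % c) (Nat.mod_lt _ hc)
      rw [e1, e2, h1, h2] at this
      exact this
    rw [← hprod]
    exact Finset.single_le_sum (f := fun e => ∏ t ∈ Finset.range (LPar n),
      bad e (blk (L := LPar n) (D := c ^ 6 + 8) t ω))
      (fun e _ => Finset.prod_nonneg fun t _ => hbad0 _ _) heL
  · rw [Finset.expect_sum_comm]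
    have hone : ∀ e ∈ Lg, 𝔼 ω : Fin (tlen n) → ZMod (nextPrime (p + mPar n)),
        ∏ t ∈ Finset.range (LPar n), bad e (blk (L := LPar n) (D := c ^ 6 + 8) t ω) ≤
        1 / (n : ℝ) ^ 5 := by
      intro e he
      obtain ⟨he1, he2⟩ := Finset.mem_filter.1 he
      have he3 := (Finset.mem_filter.1 he1).2
      have h1 := hsplit e.1
      have h2 := hsplit e.2
      have hfail : 𝔼 ω, bad e ω ≤ 7 / 8 := by
        refine expect_fail_le hodd rfl (by ring) hc hcm (by omega) (by omega) (by omega) hX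
          (fun i hi => rowX_of_le _ hi) hK hφ hφ1 hmφ hmφ2 (capR_ge hφ hφ1 hc)
          (hdiv _ e.1.2) (hdiv _ e.2.2) (Nat.mod_lt e.1 hc) (Nat.mod_lt e.2 hc) he2
          (by rw [h1]; exact e.1.2) (by rw [h2]; exact e.2.2) ?_
        rw [h1, h2, ← sampleCorr_eq hp hpos]
        exact he3.2
      rw [expect_prod_blk]
      exact (pow_le_pow_left₀ (Finset.expect_nonneg fun ω _ => hbad0 e ω) hfail _).trans
        (pow_LPar_le hn)
    have hcard : (Lg.card : ℝ) ≤ (n : ℝ) ^ 2 := by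
      have : Lg.card ≤ n ^ 2 := by
        calc Lg.card ≤ Fintype.card (Fin n × Fin n) := Finset.card_le_univ _
          _ = n ^ 2 := by simp [sq]
      exact_mod_cast this
    calc _ ≤ ∑ e ∈ Lg, 1 / (n : ℝ) ^ 5 := Finset.sum_le_sum hone
      _ = Lg.card * (1 / (n : ℝ) ^ 5) := by rw [Finset.sum_const, nsmul_eq_mul]
      _ ≤ (n : ℝ) ^ 2 * (1 / (n : ℝ) ^ 5) := by gcongr
      _ = 1 / (n : ℝ) ^ 3 := by field_simp

end

/-! ### Bounds for the size and the running times -/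

theorem one_le_cPar {n : ℕ} (hn : 1 ≤ n) : 1 ≤ cPar n := by
  by_contra h
  have h0 : cPar n = 0 := by omega
  have := le_cPar_pow n
  rw [h0] at this
  simp at this
  omega

theorem cPar_le (n : ℕ) : cPar n ≤ n := by
  classical exact Nat.find_min' (exists_sixth_root n) (Nat.le_self_pow (by norm_num) n)

theorem cPar_le_rpow {n : ℕ} (hn : 1 ≤ n) : (cPar n : ℝ) ≤ 2 * (n : ℝ) ^ (1 / 6 : ℝ) := by
  have hn' : (1 : ℝ) ≤ n := by exact_mod_cast hn
  have hc := one_le_cPar hn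
  have hx : 1 ≤ (n : ℝ) ^ (1 / 6 : ℝ) := Real.one_le_rpow hn' (by norm_num)
  have h1 : (cPar n - 1) ^ 6 < n := pow_lt_of_lt_cPar (by omega)
  have h2 : ((cPar n - 1 : ℕ) : ℝ) ^ 6 ≤ ((n : ℝ) ^ (1 / 6 : ℝ)) ^ 6 := by
    rw [← Real.rpow_natCast ((n : ℝ) ^ (1 / 6 : ℝ)), ← Real.rpow_mul (by positivity)]
    norm_num
    exact_mod_cast h1.le
  have h3 := le_of_pow_le_pow_left₀ (by norm_num) (by positivity) h2
  rw [Nat.cast_sub hc] at h3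
  push_cast at h3
  linarith

theorem cPar_pow_ten_le {n : ℕ} (hn : 1 ≤ n) :
    (cPar n : ℝ) ^ 10 ≤ 1024 * (n : ℝ) ^ (5 / 3 : ℝ) := by
  calc (cPar n : ℝ) ^ 10 ≤ (2 * (n : ℝ) ^ (1 / 6 : ℝ)) ^ 10 := by
        gcongr
        exact cPar_le_rpow hn
    _ = 1024 * (n : ℝ) ^ (5 / 3 : ℝ) := by
        rw [mul_pow, ← Real.rpow_natCast ((n : ℝ) ^ (1 / 6 : ℝ)), ← Real.rpow_mul (by positivity)]
        norm_num

theorem clog_le_log {n : ℕ} (hn : 1 ≤ n) : (Nat.clog 2 n : ℝ) ≤ 2 * (1 + Real.log n) := by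
  have hn' : (1 : ℝ) ≤ n := by exact_mod_cast hn
  have hlog := Real.log_nonneg hn'
  rcases Nat.eq_zero_or_pos (Nat.clog 2 n) with h | h
  · rw [h]; push_cast; linarith
  have h1 : 2 ^ (Nat.clog 2 n - 1) < n :=
    (Nat.lt_clog_iff_pow_lt (by norm_num)).1 (by omega)
  have h2 : ((Nat.clog 2 n - 1 : ℕ) : ℝ) * Real.log 2 ≤ Real.log n := by
    rw [← Real.log_pow]
    exact Real.log_le_log (by positivity) (by exact_mod_cast h1.le)
  rw [Nat.cast_sub h] at h2
  push_cast at h2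
  have h3 := Real.log_two_gt_d9
  have h4 : (1 : ℝ) ≤ Nat.clog 2 n := by exact_mod_cast h
  nlinarith

theorem baseLog_le {n : ℕ} (hn : 1 ≤ n) : (baseLog (mPar n) : ℝ) ≤ 203 * (1 + Real.log n) := by
  have hn' : (1 : ℝ) ≤ n := by exact_mod_cast hn
  have hlog := Real.log_nonneg hn'
  have h1 : 4 * mPar n ^ 8 ≤ 2 ^ (138 + 32 * Nat.clog 2 n) := by
    have h2 : cPar n ≤ 2 ^ Nat.clog 2 n := (cPar_le n).trans (Nat.le_pow_clog (by norm_num) n)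
    calc 4 * mPar n ^ 8 = 2 ^ 138 * cPar n ^ 32 := by unfold mPar; ring
      _ ≤ 2 ^ 138 * (2 ^ Nat.clog 2 n) ^ 32 := by gcongr
      _ = 2 ^ (138 + 32 * Nat.clog 2 n) := by rw [pow_add, ← pow_mul, mul_comm 32]
  have h3 : baseLog (mPar n) ≤ 139 + 32 * Nat.clog 2 n := by
    have := Nat.log_mono_right (b := 2) h1
    rw [Nat.log_pow (by norm_num)] at this
    unfold baseLog
    omega
  have h4 : (baseLog (mPar n) : ℝ) ≤ 139 + 32 * Nat.clog 2 n := by exact_mod_cast h3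
  have := clog_le_log hn
  linarith

theorem LPar_le {n : ℕ} (hn : 1 ≤ n) : (LPar n : ℝ) ≤ 60 * (1 + Real.log n) := by
  have := clog_le_log hn
  unfold LPar
  push_cast
  linarith

theorem sizeT_le {n : ℕ} (hn : 1 ≤ n) :
    (sizeT n : ℝ) ≤ 600000000 * ((1 + Real.log n) * (cPar n : ℝ) ^ 10) := by
  have hn' : (1 : ℝ) ≤ n := by exact_mod_cast hn
  have hlog := Real.log_nonneg hn'
  have hc : (1 : ℝ) ≤ cPar n := by exact_mod_cast one_le_cPar hn
  have hL := LPar_le hn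
  have hL0 : (0 : ℝ) ≤ LPar n := Nat.cast_nonneg _
  unfold sizeT
  simp only [mPar]
  push_cast
  set c : ℝ := (cPar n : ℝ) with hcdef
  set L : ℝ := (LPar n : ℝ) with hLdef
  set l : ℝ := 1 + Real.log n with hl
  have hl1 : 1 ≤ l := by linarith
  have h6 : c ^ 6 ≤ c ^ 10 := pow_le_pow_right₀ hc (by norm_num)
  have h4 : c ^ 4 ≤ c ^ 10 := pow_le_pow_right₀ hc (by norm_num)
  have h0 : 1 ≤ c ^ 10 := one_le_pow₀ hc
  have h7 : L * c ^ 10 ≤ 60 * l * c ^ 10 := by gcongr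
  have h8 : 1 * c ^ 10 ≤ l * c ^ 10 := by gcongr
  have a1 : L * (c ^ 6 + 8) ≤ L * (9 * c ^ 10) := by gcongr; linarith
  have a2 : L * (c ^ 6 + 1) * (131072 * c ^ 4) ≤ 262144 * (L * c ^ 10) := by
    have : L * (c ^ 6 + 1) * (131072 * c ^ 4) = 131072 * (L * c ^ 10) + 131072 * (L * c ^ 4) := by ring
    rw [this]
    have : L * c ^ 4 ≤ L * c ^ 10 := by gcongr
    linarith
  nlinarith

theorem trialTime_le {n k : ℕ} {R φ : ℝ} (hn : 1 ≤ n) (hφ : 0 < φ) (hφ1 : φ ≤ 1) :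
    (trialTime (cPar n) (mPar n) (baseLog (mPar n)) ⌈max (capR k R φ (cPar n)) 0⌉₊ : ℝ) ≤
      2000000000 * ((1 + (k + R * R)) * (1 / φ ^ 2) * (1 + Real.log n) * (cPar n : ℝ) ^ 10) := by
  have hn' : (1 : ℝ) ≤ n := by exact_mod_cast hn
  have hlog := Real.log_nonneg hn'
  have hc : (1 : ℝ) ≤ cPar n := by exact_mod_cast one_le_cPar hn
  have hB := baseLog_le hn
  have hB0 : (0 : ℝ) ≤ baseLog (mPar n) := Nat.cast_nonneg _
  have hm : (mPar n : ℝ) = 131072 * (cPar n : ℝ) ^ 4 := by simp [mPar]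
  have hκ : (1 : ℝ) ≤ 1 + (k + R * R) := by
    have : 0 ≤ (k : ℝ) + R * R := add_nonneg (Nat.cast_nonneg _) (mul_self_nonneg R)
    linarith
  have hΦ : (1 : ℝ) ≤ 1 / φ ^ 2 := by
    rw [le_div_iff₀ (by positivity), one_mul]
    exact pow_le_one₀ hφ.le hφ1
  have hcap : capR k R φ (cPar n) = 2048 * ((1 + (k + R * R)) * (1 / φ ^ 2) * (cPar n : ℝ) ^ 8) := by
    unfold capR
    push_cast
    field_simp
  have hcap0 : 1 ≤ (1 + (k + R * R)) * (1 / φ ^ 2) * (cPar n : ℝ) ^ 8 :=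
    one_le_mul_of_one_le_of_one_le (one_le_mul_of_one_le_of_one_le hκ hΦ) (one_le_pow₀ hc)
  have hK : (⌈max (capR k R φ (cPar n)) 0⌉₊ : ℝ) ≤
      2049 * ((1 + (k + R * R)) * (1 / φ ^ 2) * (cPar n : ℝ) ^ 8) := by
    rw [max_eq_left (by rw [hcap]; linarith)]
    have := Nat.ceil_lt_add_one (show 0 ≤ capR k R φ (cPar n) by rw [hcap]; linarith)
    rw [hcap] at this
    rw [hcap]
    linarith
  unfold trialTime
  push_cast
  rw [hm]
  set K : ℝ := (⌈max (capR k R φ (cPar n)) 0⌉₊ : ℝ) with hKdef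
  set B : ℝ := (baseLog (mPar n) : ℝ) with hBdef
  set c : ℝ := (cPar n : ℝ) with hcdef
  set l : ℝ := 1 + Real.log n with hl
  set w : ℝ := (1 + (k + R * R)) * (1 / φ ^ 2) with hw
  have hw1 : 1 ≤ w := one_le_mul_of_one_le_of_one_le hκ hΦ
  have hl1 : 1 ≤ l := by linarith
  have p0 : 1 ≤ c ^ 10 := one_le_pow₀ hc
  have pw : ∀ i ≤ 10, c ^ i ≤ c ^ 10 := fun i hi => pow_le_pow_right₀ hc hi
  have q9 : c ^ 9 * B ≤ c ^ 10 * B := by have := pw 9 (by norm_num); gcongr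
  have qB : c ^ 10 * B ≤ c ^ 10 * (203 * l) := by gcongr
  have ql : 1 * (l * c ^ 10) ≤ w * (l * c ^ 10) := by gcongr
  have q1 : 1 * c ^ 10 ≤ l * c ^ 10 := by gcongr
  have qw : w * c ^ 10 * 1 ≤ w * c ^ 10 * l := by gcongr
  have t1 : c ^ 5 * (c * (131072 * c ^ 4 * 226 + 213) + 131072 * c ^ 4 * (B * 40 + 218) + 63) =
      29622272 * c ^ 10 + 213 * c ^ 6 + 5242880 * (c ^ 9 * B) + 28573696 * c ^ 9 + 63 * c ^ 5 := by
    ring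
  have t2 : c ^ 5 * c ^ 5 * (B * 40 + 233) = 40 * (c ^ 10 * B) + 233 * c ^ 10 := by ring
  have t3 : K * (c * (c * 24 + 23) + 63) ≤ 225390 * (w * c ^ 10) := by
    have h1 : c * (c * 24 + 23) + 63 ≤ 110 * c ^ 2 := by nlinarith
    calc K * (c * (c * 24 + 23) + 63) ≤ (2049 * (w * c ^ 8)) * (110 * c ^ 2) := by gcongr
      _ = 225390 * (w * c ^ 10) := by ring
  have e6 := pw 6 (by norm_num)
  have e9 := pw 9 (by norm_num)
  have e5 := pw 5 (by norm_num)
  have e4 := pw 4 (by norm_num)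
  have f1 : w * l * c ^ 10 = w * (l * c ^ 10) := by ring
  have f2 : c ^ 10 * (203 * l) = 203 * (l * c ^ 10) := by ring
  have f3 : w * c ^ 10 * l = w * (l * c ^ 10) := by ring
  rw [t1, t2, f1]
  rw [f2] at qB
  rw [f3] at qw
  linarith

theorem mainTime_le {n k : ℕ} {R φ : ℝ} (hn : 1 ≤ n) (hφ : 0 < φ) (hφ1 : φ ≤ 1) :
    (mainTime k R φ (cPar n) (mPar n) (LPar n) : ℝ) ≤
      200000000000 * ((1 + (k + R * R)) * (1 / φ ^ 2) * (1 + Real.log n) ^ 2 *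
        (cPar n : ℝ) ^ 10) := by
  have hn' : (1 : ℝ) ≤ n := by exact_mod_cast hn
  have hlog := Real.log_nonneg hn'
  have hc : (1 : ℝ) ≤ cPar n := by exact_mod_cast one_le_cPar hn
  have hB := baseLog_le hn
  have hL := LPar_le hn
  have hT := trialTime_le (k := k) (R := R) hn hφ hφ1
  have hκ : (1 : ℝ) ≤ 1 + (k + R * R) := by
    have : 0 ≤ (k : ℝ) + R * R := add_nonneg (Nat.cast_nonneg _) (mul_self_nonneg R)
    linarith
  have hΦ : (1 : ℝ) ≤ 1 / φ ^ 2 := by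
    rw [le_div_iff₀ (by positivity), one_mul]
    exact pow_le_one₀ hφ.le hφ1
  unfold mainTime
  push_cast
  set T : ℝ := (trialTime (cPar n) (mPar n) (baseLog (mPar n))
    ⌈max (capR k R φ (cPar n)) 0⌉₊ : ℝ) with hTdef
  set B : ℝ := (baseLog (mPar n) : ℝ) with hBdef
  set c : ℝ := (cPar n : ℝ) with hcdef
  set L : ℝ := (LPar n : ℝ) with hLdef
  set l : ℝ := 1 + Real.log n with hl
  set w : ℝ := (1 + (k + R * R)) * (1 / φ ^ 2) with hw
  have hw1 : 1 ≤ w := one_le_mul_of_one_le_of_one_le hκ hΦ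
  have hl1 : 1 ≤ l := by linarith
  have p0 : 1 ≤ c ^ 10 := one_le_pow₀ hc
  have pw : ∀ i ≤ 10, c ^ i ≤ c ^ 10 := fun i hi => pow_le_pow_right₀ hc hi
  have hwc : 1 ≤ w * c ^ 10 := one_le_mul_of_one_le_of_one_le hw1 p0
  have hL0 : 0 ≤ L := Nat.cast_nonneg _
  have y1 : l ≤ w * l ^ 2 * c ^ 10 := by
    calc l = 1 * (l * 1) := by ring
      _ ≤ (w * c ^ 10) * (l * l) := by gcongr
      _ = w * l ^ 2 * c ^ 10 := by ring
  have y2 : c ^ 10 ≤ w * l ^ 2 * c ^ 10 := by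
    have : 1 ≤ w * l ^ 2 := one_le_mul_of_one_le_of_one_le hw1 (one_le_pow₀ hl1)
    nlinarith
  have y3 : L * (T + 13) ≤ 60 * 2000000013 * (w * l ^ 2 * c ^ 10) := by
    have h1 : 1 ≤ w * l * c ^ 10 := by
      calc (1 : ℝ) = 1 * 1 := by ring
        _ ≤ (w * c ^ 10) * l := by gcongr
        _ = w * l * c ^ 10 := by ring
    calc L * (T + 13) ≤ (60 * l) * (2000000013 * (w * l * c ^ 10)) := by
          gcongr
          linarith
      _ = 60 * 2000000013 * (w * l ^ 2 * c ^ 10) := by ring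
  have t1 : c ^ 5 * (c * (c * 24 + 23) + 43) = 24 * c ^ 7 + 23 * c ^ 6 + 43 * c ^ 5 := by ring
  have e7 := pw 7 (by norm_num)
  have e6 := pw 6 (by norm_num)
  have e5 := pw 5 (by norm_num)
  rw [t1]
  linarith

/-- In both cases of the query the running time is `Õ(φ⁻² n ^ (5 / 3))`: for `n φ ^ 6 ≤ 1` because
then `n ^ 2` is at most `φ⁻² n ^ (5 / 3)`. -/
theorem queryTimeT_le {n k : ℕ} {R φ : ℝ} (hn : 1 ≤ n) (hφ : 0 < φ) (hφ1 : φ ≤ 1) :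
    (queryTimeT n k R φ : ℝ) ≤ 1000000000000000 * (1 + (k + R * R)) * (1 + Real.log n) ^ 2 *
      (φ ^ (-2 : ℝ) * (n : ℝ) ^ (5 / 3 : ℝ)) := by
  have hn' : (1 : ℝ) ≤ n := by exact_mod_cast hn
  have hlog := Real.log_nonneg hn'
  have hκ : (1 : ℝ) ≤ 1 + (k + R * R) := by
    have : 0 ≤ (k : ℝ) + R * R := add_nonneg (Nat.cast_nonneg _) (mul_self_nonneg R)
    linarith
  have hΦ : (1 : ℝ) ≤ 1 / φ ^ 2 := by
    rw [le_div_iff₀ (by positivity), one_mul]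
    exact pow_le_one₀ hφ.le hφ1
  have hφ' : φ ^ (-2 : ℝ) = 1 / φ ^ 2 := by
    rw [Real.rpow_neg hφ.le, one_div]; norm_num
  have hx : 1 ≤ (n : ℝ) ^ (5 / 3 : ℝ) := Real.one_le_rpow hn' (by norm_num)
  have hl2 : 1 ≤ (1 + Real.log n) ^ 2 := one_le_pow₀ (by linarith)
  rw [hφ']
  have hY : 1 / φ ^ 2 * (n : ℝ) ^ (5 / 3 : ℝ) ≤ (1 + (k + R * R)) * (1 + Real.log n) ^ 2 *
      (1 / φ ^ 2 * (n : ℝ) ^ (5 / 3 : ℝ)) :=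
    le_mul_of_one_le_left (by positivity) (one_le_mul_of_one_le_of_one_le hκ hl2)
  have hY1 : 1 ≤ 1 / φ ^ 2 * (n : ℝ) ^ (5 / 3 : ℝ) := one_le_mul_of_one_le_of_one_le hΦ hx
  unfold queryTimeT
  split_ifs with h
  · -- here the number of pairs of rows is at most the bound
    push_cast
    have h1 : (n : ℝ) ^ 2 ≤ 1 / φ ^ 2 * (n : ℝ) ^ (5 / 3 : ℝ) := by
      set x := (n : ℝ) ^ (1 / 6 : ℝ) with hxdef
      have hx0 : 0 < x := by positivity
      have e6 : x ^ 6 = n := by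
        rw [hxdef, ← Real.rpow_natCast, ← Real.rpow_mul (by positivity)]; norm_num
      have e10 : (n : ℝ) ^ (5 / 3 : ℝ) = x ^ 10 := by
        rw [hxdef, ← Real.rpow_natCast, ← Real.rpow_mul (by positivity)]; norm_num
      have h2 : x * φ ≤ 1 := by
        by_contra hlt
        push Not at hlt
        have := one_lt_pow₀ hlt (n := 6) (by norm_num)
        rw [mul_pow, e6] at this
        linarith
      have h3 : x ^ 2 * φ ^ 2 ≤ 1 := by
        rw [← mul_pow]; exact pow_le_one₀ (by positivity) h2
      rw [e10, ← e6, one_div_mul_eq_div, le_div_iff₀ (by positivity)]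
      calc (x ^ 6) ^ 2 * φ ^ 2 = x ^ 10 * (x ^ 2 * φ ^ 2) := by ring
        _ ≤ x ^ 10 * 1 := by gcongr
        _ = x ^ 10 := mul_one _
    nlinarith
  · push_cast
    have h1 := mainTime_le (k := k) (R := R) hn hφ hφ1
    have h2 := cPar_pow_ten_le hn
    have h3 : (1 + (k + R * R)) * (1 / φ ^ 2) * (1 + Real.log n) ^ 2 * (cPar n : ℝ) ^ 10 ≤
        (1 + (k + R * R)) * (1 / φ ^ 2) * (1 + Real.log n) ^ 2 * (1024 * (n : ℝ) ^ (5 / 3 : ℝ)) := by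
      gcongr
    have h4 : (1 + (k + R * R)) * (1 / φ ^ 2) * (1 + Real.log n) ^ 2 *
        (1024 * (n : ℝ) ^ (5 / 3 : ℝ)) = 1024 * ((1 + (k + R * R)) * (1 + Real.log n) ^ 2 *
      (1 / φ ^ 2 * (n : ℝ) ^ (5 / 3 : ℝ))) := by ring
    rw [h4] at h3
    linarith

/-! ### Absence of overflow -/

/-- A fixed power of any bound for `n` and `p` is at least as large as everything that the programs
store in words, so that word cells of logarithmic length suffice. -/
theorem sizes_of_le {n p b κ : ℕ} (hn : 1 ≤ n) (hb6 : 6 ≤ b) (hnb : n ≤ b) (hpb : p ≤ b)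
    (hκ : 40 ≤ κ) : Sizes (b ^ κ) n p := by
  have hb1 : 1 ≤ b := by omega
  have hc := one_le_cPar hn
  have hcb : cPar n ≤ b := (cPar_le n).trans hnb
  have up : ∀ i ≤ 40, b ^ i ≤ b ^ κ := fun i hi => Nat.pow_le_pow_right hb1 (hi.trans hκ)
  have h6 : ∀ i, 6 ^ i ≤ b ^ i := fun i => Nat.pow_le_pow_left hb6 i
  have hm : mPar n ≤ b ^ 12 := by
    unfold mPar
    calc 131072 * cPar n ^ 4 ≤ b ^ 8 * b ^ 4 :=
          Nat.mul_le_mul (le_trans (by norm_num) (h6 8)) (Nat.pow_le_pow_left hcb 4)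
      _ = b ^ 12 := by ring
  have hL : LPar n ≤ b ^ 3 := by
    have h1 : Nat.clog 2 n ≤ n := by
      refine Nat.clog_le_of_le_pow (b := 2) Nat.lt_two_pow_self.le
    unfold LPar
    calc 30 * Nat.clog 2 n ≤ b ^ 2 * b := Nat.mul_le_mul (le_trans (by norm_num) (h6 2)) (h1.trans hnb)
      _ = b ^ 3 := by ring
  have hc6 : cPar n ^ 6 ≤ b ^ 6 := Nat.pow_le_pow_left hcb 6
  have hb2 : 36 ≤ b ^ 2 := h6 2
  have hb26 : b ^ 2 ≤ b ^ 6 := Nat.pow_le_pow_right hb1 (by norm_num)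
  have hb7 : 6 * b ^ 6 ≤ b ^ 7 := by
    rw [pow_succ b 6, mul_comm]; exact Nat.mul_le_mul_left _ hb6
  have hb112 : b ≤ b ^ 12 := Nat.le_self_pow (by norm_num) b
  have hb14 : 36 * b ^ 12 ≤ b ^ 14 := by
    rw [show b ^ 14 = b ^ 2 * b ^ 12 by ring]; exact Nat.mul_le_mul_right _ hb2
  have hb22 : b * 6 ≤ b ^ 2 := by rw [sq]; exact Nat.mul_le_mul_left _ hb6
  refine ⟨hn, hc, ?_, ?_, ?_, ?_, ?_, ?_, ?_, ?_⟩
  · have := up 2 (by norm_num); omega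
  · have := up 14 (by norm_num); omega
  · calc LPar n * (cPar n ^ 6 + 8) ≤ b ^ 3 * b ^ 7 := Nat.mul_le_mul hL (by omega)
      _ = b ^ 10 := by ring
      _ ≤ _ := up 10 (by norm_num)
  · calc LPar n * (cPar n ^ 6 + 1) * mPar n ≤ b ^ 3 * b ^ 7 * b ^ 12 :=
          Nat.mul_le_mul (Nat.mul_le_mul hL (by omega)) hm
      _ = b ^ 22 := by ring
      _ ≤ _ := up 22 (by norm_num)
  · calc cPar n ^ 5 * cPar n ^ 5 = cPar n ^ 10 := by ring
      _ ≤ b ^ 10 := Nat.pow_le_pow_left hcb 10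
      _ ≤ _ := up 10 (by norm_num)
  · exact hc6.trans (up 6 (by norm_num))
  · exact hcb.trans (by simpa using up 1 (by norm_num))
  · exact hL.trans (up 3 (by norm_num))

end

end CorrelationSketch

theorem mainTheorem2 :
    ∃ A : CorrelationSketch.SketchAlgorithm,
    ∀ (k : ℕ) (R : ℝ), 0 ≤ R →
    ∃ (K : ℝ) (c κ : ℕ),
    ∀ (n p : ℕ) (φ : ℝ), 1 ≤ n → 2 ≤ p → 0 < φ → φ ≤ 1 →
    ∃ size updateTime queryTime : ℕ,
      (size : ℝ) ≤ K * (1 + Real.log n) ^ c * (φ ^ (-2 : ℝ) * (n : ℝ) ^ (5 / 3 : ℝ)) ∧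
      (updateTime : ℝ) ≤ K * (1 + Real.log n) ^ c ∧
      (queryTime : ℝ) ≤ K * (1 + Real.log n) ^ c * (φ ^ (-2 : ℝ) * (n : ℝ) ^ (5 / 3 : ℝ)) ∧
      ∀ us : List (CorrelationSketch.Update n p),
      ∃ (μ : PMF CorrelationSketch.State)
        (ν : CorrelationSketch.State → PMF CorrelationSketch.State),
        A.Sketches (CorrelationSketch.wordBound κ n p φ) k φ R updateTime us μ ∧
        (∀ s ∈ μ.support, s.FitsIn size) ∧
        (∀ s ∈ μ.support, CorrelationSketch.Exec (CorrelationSketch.wordBound κ n p φ)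
          A.query s.clearOut queryTime (ν s)) ∧
        ((∀ i, 0 < CorrelationSketch.sampleCov (CorrelationSketch.streamMatrix us) i i) →
          (CorrelationSketch.largePairs φ (CorrelationSketch.sampleCorr
            (CorrelationSketch.streamMatrix us))).card ≤ k →
          ∀ B, CorrelationSketch.IsResidual (CorrelationSketch.sampleCorr
            (CorrelationSketch.streamMatrix us)) k B →
          CorrelationSketch.frobNorm B ≤ R →
          (μ.bind ν).toOuterMeasure
            {s | ∀ e ∈ CorrelationSketch.largePairs φ (CorrelationSketch.sampleCorr
                (CorrelationSketch.streamMatrix us)), ((e.1 : ℕ), (e.2 : ℕ)) ∈ s.out}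
            ≥ ENNReal.ofReal (1 - 1 / (n : ℝ) ^ 3)) := by
  open CorrelationSketch in
  refine ⟨⟨initProg, updProg, queryProg⟩, fun k R hR =>
    ⟨1000000000000000 * (1 + (k + R * R)), 2, (40 + k) * 31, fun n p φ hn hp hφ hφ1 =>
    ⟨sizeT n, LPar n * 400 + 50, queryTimeT n k R φ, ?_, ?_, queryTimeT_le hn hφ hφ1, ?_⟩⟩⟩
  · have hn' : (1 : ℝ) ≤ n := by exact_mod_cast hn
    have hlog := Real.log_nonneg hn'
    have hκ : (0 : ℝ) ≤ k + R * R := add_nonneg (Nat.cast_nonneg _) (mul_self_nonneg R)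
    have hφ' : φ ^ (-2 : ℝ) = 1 / φ ^ 2 := by
      rw [Real.rpow_neg hφ.le, one_div]; norm_num
    have hΦ : (1 : ℝ) ≤ 1 / φ ^ 2 := by
      rw [le_div_iff₀ (by positivity), one_mul]
      exact pow_le_one₀ hφ.le hφ1
    have h1 := sizeT_le hn
    have h2 := cPar_pow_ten_le hn
    rw [hφ']
    set l := 1 + Real.log (n : ℝ) with hl
    have hl1 : 1 ≤ l := by linarith
    calc (sizeT n : ℝ) ≤ 600000000 * (l * (1024 * (n : ℝ) ^ (5 / 3 : ℝ))) := h1.trans (by gcongr)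
      _ = 614400000000 * 1 * l * (1 * (n : ℝ) ^ (5 / 3 : ℝ)) := by ring
      _ ≤ 1000000000000000 * (1 + (k + R * R)) * l ^ 2 *
          (1 / φ ^ 2 * (n : ℝ) ^ (5 / 3 : ℝ)) := by
        gcongr
        · norm_num
        · linarith
        · exact le_self_pow₀ hl1 (by norm_num)
  · have hn' : (1 : ℝ) ≤ n := by exact_mod_cast hn
    have hlog := Real.log_nonneg hn'
    have hκ : (0 : ℝ) ≤ k + R * R := add_nonneg (Nat.cast_nonneg _) (mul_self_nonneg R)
    have h1 := LPar_le hn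
    push_cast
    set l := 1 + Real.log (n : ℝ) with hl
    have hl1 : 1 ≤ l := by linarith
    calc (LPar n : ℝ) * 400 + 50 ≤ 24050 * 1 * l := by linarith
      _ ≤ 1000000000000000 * (1 + (k + R * R)) * l ^ 2 := by
        gcongr
        · norm_num
        · linarith
        · exact le_self_pow₀ hl1 (by norm_num)
  · intro us
    have hφ'' : 1 ≤ ⌈1 / φ⌉₊ := Nat.one_le_ceil_iff.2 (by positivity)
    set b := n + p + ⌈1 / φ⌉₊ + 2 with hb
    have hb6 : 6 ≤ b := by omega
    have hW : wordBound ((40 + k) * 31) n p φ = (b ^ (40 + k)) ^ 31 := by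
      rw [wordBound, pow_mul]
    have hV : Fact (1048576 ≤ b ^ (40 + k)) := ⟨by
      calc 1048576 ≤ 6 ^ 40 := by norm_num
        _ ≤ b ^ 40 := Nat.pow_le_pow_left hb6 40
        _ ≤ b ^ (40 + k) := Nat.pow_le_pow_right (by omega) (by omega)⟩
    have hS : Sizes (b ^ (40 + k)) n p := sizes_of_le hn hb6 (by omega) (by omega) (by omega)
    have hk : k ≤ b ^ (40 + k) := by
      calc k ≤ 2 ^ k := Nat.lt_two_pow_self.le
        _ ≤ b ^ k := Nat.pow_le_pow_left (by omega) k
        _ ≤ b ^ (40 + k) := Nat.pow_le_pow_right (by omega) (by omega)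
    have hq : Fact (nextPrime (p + mPar n)).Prime := ⟨(nextPrime_spec _).2⟩
    obtain ⟨μ, ν, F, h1, h2, h3, h4, h5⟩ := run_spec (k := k) (φ := φ) (R := R) hS hk us
    refine ⟨μ, ν, by rw [hW]; exact h1, h2, by rw [hW]; exact h3, ?_⟩
    intro hpos _ B hB hBR
    rw [h4]
    exact success_prob hS hp hφ hφ1 hR us hpos hB hBR F h5
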